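/- Conventions. On a Riemannian 4-manifold $(M,g)$, for symmetric 2-tensors $h$, let $\Delta_{L,g}h=\Delta_g h+2\,\mathrm{Rm}(h)-\mathrm{Ric}\circ h-h\circ\mathrm{Ric}$ be the Lichnerowicz Laplacian, where $\Delta_g$ is the rough Laplacian, $\mathrm{Rm}(h)_{jk}=R_{ijkl}h^{il}$, and $R_{ijkl}=g_{il}g_{jk}-g_{ik}g_{jl}$ on the unit sphere. A Riemannian 4-orbifold $(M_o,g_o)$ with isolated singularities is a space which, away from finitely many singular points, is a smooth Riemannian 4-manifold, and which near each singular point is modelled on a ball of $\mathbb{R}^4/\Gamma$, with $\Gamma\subset SO(4)$ a finite group acting freely on $\mathbb{S}^3$, the lift of $g_o$ to the ball of $\mathbb{R}^4$ being a smooth metric. Let $r_o$ denote the distance to the singular points near them (the Euclidean distance to $0$ in the orbifold charts), extended to a smooth positive function smaller than $1$ on the regular part. Solutions are smooth and are defined on the regular part of $M_o$. Let $\sigma\in(0,1)$ and let $C$ be a constant. (1) Let $\Gamma\subset SO(4)$ be a finite group, $\Gamma\neq\{\mathrm{Id}\}$, acting freely on $\mathbb{S}^3$, and let $(M_o,g_o)$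 be the spherical suspension over $\mathbb{S}^3/\Gamma$, that is, $g_o=d\theta^2+\sin^2\theta\,g_{\mathbb{S}^3/\Gamma}$ with $\theta\in(0,\pi)$ on its regular part; it has constant sectional curvature $1$ and $\mathrm{Ric}(g_o)=\Lambda g_o$ with $\Lambda=3$. Let $v_o=\cos\theta$. Let $(h(t))_{t<0}$ be a solution to $\partial_t h=(\Delta_{L,g_o}+2\Lambda)h$ on the regular part of $M_o$ such that $|h(t)|_{g_o}\le C r_o^{-\sigma}$ for all $t<0$. If, for all $t<0$, $$\int_{M_o}\langle h(t),g_o\rangle_{g_o}\,d\mu_{g_o}=0\quad\text{and}\quad\int_{M_o}\langle h(t),\mathcal{L}_{\nabla^{g_o}v_o}g_o\rangle_{g_o}\,d\mu_{g_o}=0,$$ then $h(t)=0$ for all $t<0$. (2) Let $(M_o,g_o)$ be a compact oriented Einstein 4-orbifold with isolated singularities, $\mathrm{Ric}(g_o)=\Lambda g_o$ with $\Lambda<0$. Assume that at every point of $M_o$ (singular points included) the selfdual part $\mathbf{R}^+$ of the curvature operator is negative definite as a bilinear form on the selfdual 2-forms $\Lambda^+$. Let $(h(t))_{t\le 0}$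 be a solution to $\partial_t h=(\Delta_{L,g_o}+2\Lambda)h$ on the regular part of $M_o$, for $t\in(-\infty,0]$, such that $|h(t)|_{g_o}\le C r_o^{-\sigma}$ for all $t\le 0$. Then $h(t)=0$ for all $t\le 0$. -/

import Mathlib

open Set Filter Topology MeasureTheory
open scoped Manifold ContDiff

noncomputable section

namespace OrbifoldLiouville

/-- Four-dimensional Euclidean space, the model space of all the manifolds below. -/
abbrev E4 : Type := EuclideanSpace ℝ (Fin 4)

/-- A `4 × 4` real matrix: the components of a covariant 2-tensor at a point. -/
abbrev Mat4 : Type := Matrix (Fin 4) (Fin 4) ℝ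

/-- The standard basis vector `e_i` of `ℝ⁴`. -/
def stdVec (i : Fin 4) : E4 := EuclideanSpace.single i (1 : ℝ)

/-- The partial derivative `∂_i f` at `y`. -/
def partialDeriv (i : Fin 4) (f : E4 → ℝ) (y : E4) : ℝ := fderiv ℝ f y (stdVec i)

/-! ### Pointwise tensor algebra with respect to a Gram matrix -/

/-- `⟨A, B⟩_G = G^{ik} G^{jl} A_{ij} B_{kl}`. -/
def tensorInner (G A B : Mat4) : ℝ :=
  ∑ i, ∑ j, ∑ k, ∑ l, G⁻¹ i k * G⁻¹ j l * A i j * B k l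

/-- `|A|_G`. -/
def tensorNorm (G A : Mat4) : ℝ := Real.sqrt (tensorInner G A A)

/-- The Levi-Civita symbol. -/
def leviCivita (i j k l : Fin 4) : ℝ :=
  Matrix.det (Matrix.of fun a b : Fin 4 => if ![i, j, k, l] a = b then (1 : ℝ) else 0)

/-- The Hodge star on 2-forms for the metric `G` and the standard orientation of `ℝ⁴`:
`(⋆w)_{ij} = 1/2 √(det G) ε_{ijkl} G^{kp} G^{lq} w_{pq}`. -/
def hodgeStar (G w : Mat4) : Mat4 :=
  Matrix.of fun i j => (1 / 2 : ℝ) * Real.sqrt G.det *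
    ∑ k, ∑ l, ∑ p, ∑ q, leviCivita i j k l * G⁻¹ k p * G⁻¹ l q * w p q

/-- `w` is a selfdual 2-form: an element of `Λ⁺` for the metric `G` and the standard orientation. -/
def IsSelfDual (G w : Mat4) : Prop := w.transpose = -w ∧ hodgeStar G w = w

/-! ### Riemannian geometry in coordinates

`G : ℝ⁴ → Mat4` is the matrix of a metric in a coordinate system, `H` that of a 2-tensor. -/

/-- Christoffel symbols `Γ^k_{ij}`. -/
def christoffel (G : E4 → Mat4) (k i j : Fin 4) (y : E4) : ℝ :=
  (1 / 2 : ℝ) * ∑ l, (G y)⁻¹ k l *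
    (partialDeriv i (fun z => G z j l) y + partialDeriv j (fun z => G z i l) y
      - partialDeriv l (fun z => G z i j) y)

/-- First covariant derivative `(∇_i H)_{jk}`. -/
def covDeriv (G H : E4 → Mat4) (i j k : Fin 4) (y : E4) : ℝ :=
  partialDeriv i (fun z => H z j k) y
    - ∑ l, christoffel G l i j y * H y l k - ∑ l, christoffel G l i k y * H y j l

/-- Second covariant derivative `(∇²_{a,i} H)_{jk}`, where `a` is the index added last. -/
def covDeriv2 (G H : E4 → Mat4) (a i j k : Fin 4) (y : E4) : ℝ :=
  partialDeriv a (fun z => covDeriv G H i j k z) y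
    - ∑ l, christoffel G l a i y * covDeriv G H l j k y
    - ∑ l, christoffel G l a j y * covDeriv G H i l k y
    - ∑ l, christoffel G l a k y * covDeriv G H i j l y

/-- The rough Laplacian `(Δ H)_{jk} = G^{ai} (∇²_{a,i} H)_{jk}`. -/
def roughLaplacian (G H : E4 → Mat4) (y : E4) : Mat4 :=
  Matrix.of fun j k => ∑ a, ∑ i, (G y)⁻¹ a i * covDeriv2 G H a i j k y

/-- The (1,3) curvature: `R(∂_i, ∂_j) ∂_k = R_{ijk}^l ∂_l`, where
`R(X, Y) Z = ∇_X ∇_Y Z - ∇_Y ∇_X Z - ∇_{[X, Y]} Z`. -/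
def riemannUp (G : E4 → Mat4) (i j k l : Fin 4) (y : E4) : ℝ :=
  partialDeriv i (fun z => christoffel G l j k z) y
    - partialDeriv j (fun z => christoffel G l i k z) y
    + ∑ m, (christoffel G m j k y * christoffel G l i m y
        - christoffel G m i k y * christoffel G l j m y)

/-- The (0,4) curvature `R_{ijkl} = ⟨R(∂_i, ∂_j) ∂_k, ∂_l⟩`; on the unit sphere
it is `G_{il} G_{jk} - G_{ik} G_{jl}`. -/
def riemann (G : E4 → Mat4) (i j k l : Fin 4) (y : E4) : ℝ :=
  ∑ m, riemannUp G i j k m y * G y m l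

/-- The Ricci tensor, `Ric_{jk} = R_{ijk}^i`. -/
def ricci (G : E4 → Mat4) (y : E4) : Mat4 :=
  Matrix.of fun j k => ∑ i, riemannUp G i j k i y

/-- The action of the curvature on 2-tensors, `Rm(H)_{jk} = R_{ijkl} H^{il}`. -/
def curvAction (G H : E4 → Mat4) (y : E4) : Mat4 :=
  Matrix.of fun j k => ∑ i, ∑ l, ∑ p, ∑ q,
    riemann G i j k l y * (G y)⁻¹ i p * (G y)⁻¹ l q * H y p q

/-- The Lichnerowicz Laplacian `Δ_L H = Δ H + 2 Rm(H) - Ric ∘ H - H ∘ Ric`. -/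
def lichnerowicz (G H : E4 → Mat4) (y : E4) : Mat4 :=
  roughLaplacian G H y + (2 : ℝ) • curvAction G H y
    - ricci G y * (G y)⁻¹ * H y - H y * (G y)⁻¹ * ricci G y

/-- The curvature operator as a quadratic form on 2-forms, `1/4 R_{ijkl} w^{ij} w^{lk}`;
on the unit sphere it is the squared norm for which `e_i ∧ e_j`, `i < j`, is orthonormal. -/
def curvForm (G : E4 → Mat4) (y : E4) (w : Mat4) : ℝ :=
  (1 / 4 : ℝ) * ∑ i, ∑ j, ∑ k, ∑ l,
    riemann G i j k l y * ((G y)⁻¹ * w * (G y)⁻¹) i j * ((G y)⁻¹ * w * (G y)⁻¹) l k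

/-- `R⁺ < 0` at `y`: the curvature operator restricted to selfdual 2-forms is
negative definite there. -/
def RPlusNeg (G : E4 → Mat4) (y : E4) : Prop :=
  ∀ w : Mat4, IsSelfDual (G y) w → w ≠ 0 → curvForm G y w < 0

/-- The gradient of a function, `(∇v)^k = G^{kl} ∂_l v`. -/
def gradient (G : E4 → Mat4) (v : E4 → ℝ) (k : Fin 4) (y : E4) : ℝ :=
  ∑ l, (G y)⁻¹ k l * partialDeriv l v y

/-- The Lie derivative of `G` along the vector field with components `X k`:
`(ℒ_X G)_{ij} = X^k ∂_k G_{ij} + G_{kj} ∂_i X^k + G_{ik} ∂_j X^k`. -/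
def lieDeriv (X : Fin 4 → E4 → ℝ) (G : E4 → Mat4) (y : E4) : Mat4 :=
  Matrix.of fun i j => ∑ k, (X k y * partialDeriv k (fun z => G z i j) y
    + G y k j * partialDeriv i (X k) y + G y i k * partialDeriv j (X k) y)

/-! ### Tensor fields on a smooth 4-manifold -/

section Manifold

variable {M : Type*} [TopologicalSpace M] [ChartedSpace E4 M]

/-- A field of bilinear forms on the tangent spaces of `M` (a covariant 2-tensor field). -/
abbrev TensorField (M : Type*) [TopologicalSpace M] [ChartedSpace E4 M] : Type _ :=
  ∀ x : M, TangentSpace (𝓡 4) x →L[ℝ] TangentSpace (𝓡 4) x →L[ℝ] ℝ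

/-- A smooth Riemannian metric on `M`. -/
abbrev RMetric (M : Type*) [TopologicalSpace M] [ChartedSpace E4 M] [IsManifold (𝓡 4) ∞ M] :
    Type _ :=
  Bundle.ContMDiffRiemannianMetric (𝓡 4) ∞ E4 (TangentSpace (𝓡 4) : M → Type _)

/-- The pull-back of a 2-tensor field `T` under `Φ : ℝ⁴ → M`, as a bilinear expression. -/
def pullback (Φ : E4 → M) (T : TensorField M) (y u v : E4) : ℝ :=
  T (Φ y) (mfderiv (𝓡 4) (𝓡 4) Φ y u) (mfderiv (𝓡 4) (𝓡 4) Φ y v)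

/-- The components of the pull-back of `T` under `Φ : ℝ⁴ → M`. When `Φ` is the inverse of
a chart these are the components of `T` in that chart. -/
def coords (Φ : E4 → M) (T : TensorField M) (y : E4) : Mat4 :=
  Matrix.of fun i j => pullback Φ T y (stdVec i) (stdVec j)

/-- The components of `T` at the point `x`, in the preferred chart at `x`. -/
def atPt (T : TensorField M) (x : M) : Mat4 :=
  coords (chartAt E4 x).symm T (chartAt E4 x x)

variable [IsManifold (𝓡 4) ∞ M]

/-- `|T|_g` at the point `x`. -/
def normAt (g : RMetric M) (T : TensorField M) (x : M) : ℝ :=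
  tensorNorm (atPt g.inner x) (atPt T x)

/-- The components at `x`, in the preferred chart at `x`, of `ℒ_{∇v} g`. -/
def lieGrad (g : RMetric M) (v : M → ℝ) (x : M) : Mat4 :=
  lieDeriv
    (gradient (coords (chartAt E4 x).symm g.inner) (fun y => v ((chartAt E4 x).symm y)))
    (coords (chartAt E4 x).symm g.inner) (chartAt E4 x x)

/-- `Ric(g) = Λ g`. -/
def IsEinstein (g : RMetric M) (Λ : ℝ) : Prop :=
  ∀ e ∈ atlas E4 M, ∀ y ∈ e.target,
    ricci (coords e.symm g.inner) y = Λ • coords e.symm g.inner y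

/-- `(h t)` for `t ∈ I` is a smooth solution on `M × I` of `∂_t h = (Δ_L + 2Λ) h` among symmetric
2-tensors: it is symmetric, jointly smooth in space and time (up to the endpoints of `I` that
belong to `I`, where the time derivative is one-sided) and satisfies the equation. -/
structure IsHeatSolution (g : RMetric M) (Λ : ℝ) (I : Set ℝ) (h : ℝ → TensorField M) : Prop where
  symm : ∀ t ∈ I, ∀ (x : M) (u v : TangentSpace (𝓡 4) x), h t x u v = h t x v u
  smooth : ∀ e ∈ atlas E4 M, ∀ i j : Fin 4,
    ContDiffOn ℝ ∞ (fun p : ℝ × E4 => coords e.symm (h p.1) p.2 i j) (I ×ˢ e.target)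
  equation : ∀ e ∈ atlas E4 M, ∀ y ∈ e.target, ∀ t ∈ I, ∀ i j : Fin 4,
    HasDerivWithinAt (fun s : ℝ => coords e.symm (h s) y i j)
      ((lichnerowicz (coords e.symm g.inner) (coords e.symm (h t)) y
        + (2 * Λ) • coords e.symm (h t) y) i j) I t

/-- `μ` is the Riemannian measure of `g`: in every chart it is `√(det g) dy`. -/
def IsRiemannianMeasure [MeasurableSpace M] (g : RMetric M) (μ : Measure M) : Prop :=
  ∀ e ∈ atlas E4 M, ∀ A : Set M, MeasurableSet A → A ⊆ e.source →
    μ A = ∫⁻ y in e '' A, ENNReal.ofReal (Real.sqrt (coords e.symm g.inner y).det)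

end Manifold

/-- A finite group of `SO(4)` acting freely on the unit sphere `𝕊³`. -/
structure IsSphericalGroup (Γ : Subgroup (E4 ≃ₗᵢ[ℝ] E4)) : Prop where
  finite : Finite Γ
  det_eq_one : ∀ γ ∈ Γ, LinearMap.det (γ.toLinearEquiv : E4 →ₗ[ℝ] E4) = 1
  free : ∀ γ ∈ Γ, γ ≠ 1 → ∀ x : E4, ‖x‖ = 1 → γ x ≠ x

/-- The punctured ball of radius `δ` about the origin of `ℝ⁴`. -/
def puncturedBall (δ : ℝ) : Set E4 := {x | 0 < ‖x‖ ∧ ‖x‖ < δ}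

/-! ### Spherical suspensions -/

section Suspension

variable {M : Type*} [TopologicalSpace M] [ChartedSpace E4 M] [IsManifold (𝓡 4) ∞ M]

/-- `(M, g)` is the regular part `(0, π) × 𝕊³/Γ` of the spherical suspension over `𝕊³/Γ`, with
the metric `dθ² + sin²θ g_{𝕊³/Γ}` of constant curvature 1. Here `(θ, ω) ∈ (0, π) × 𝕊³` is written
as the point `x = θ ω` of the punctured ball of radius `π`, so that `θ = ‖x‖`, and `M` is the
quotient of this punctured ball by `Γ`, with quotient map `par`. The two singular points are
the limits `θ → 0` and `θ → π`. -/
structure SphericalSuspension (Γ : Subgroup (E4 ≃ₗᵢ[ℝ] E4)) (g : RMetric M) where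
  par : E4 → M
  localDiffeo : IsLocalDiffeomorphOn (𝓡 4) (𝓡 4) ∞ par (puncturedBall Real.pi)
  surj : par '' puncturedBall Real.pi = univ
  fibre : ∀ x ∈ puncturedBall Real.pi, ∀ y ∈ puncturedBall Real.pi,
    (par x = par y ↔ ∃ γ ∈ Γ, γ x = y)
  metric : ∀ x ∈ puncturedBall Real.pi, ∀ u v : E4,
    pullback par g.inner x u v =
      (inner ℝ x u * inner ℝ x v) / ‖x‖ ^ 2
        + Real.sin ‖x‖ ^ 2 *
          ((inner ℝ u v - (inner ℝ x u * inner ℝ x v) / ‖x‖ ^ 2) / ‖x‖ ^ 2)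

/-- `r` is a radius function of the suspension: the distance to the singular points near them,
extended as a smooth positive function smaller than 1. -/
structure SphericalSuspension.IsRadius {Γ : Subgroup (E4 ≃ₗᵢ[ℝ] E4)} {g : RMetric M}
    (S : SphericalSuspension Γ g) (r : M → ℝ) : Prop where
  smooth : ContMDiff (𝓡 4) 𝓘(ℝ, ℝ) ∞ r
  pos : ∀ x, 0 < r x
  lt_one : ∀ x, r x < 1
  near : ∃ ε > 0, ∀ x ∈ puncturedBall Real.pi,
    (‖x‖ < ε → r (S.par x) = ‖x‖) ∧ (Real.pi - ‖x‖ < ε → r (S.par x) = Real.pi - ‖x‖)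

end Suspension

/-! ### Orbifolds with isolated singularities -/

section Orbifold

variable {M : Type*} [TopologicalSpace M] [ChartedSpace E4 M] [IsManifold (𝓡 4) ∞ M]
  {X : Type*} [TopologicalSpace X]

/-- An orbifold chart at a singular point `p` of `X`, where `incl : M → X` is the inclusion of the
regular part: the map `0 ↦ p`, `x ↦ par x` induces a homeomorphism from `B(0, δ) / Γ` onto a
neighbourhood of `p`, it is a local diffeomorphism away from the origin, and the pull-back of
the metric `g` extends to a smooth Riemannian metric `lift` on the whole ball `B(0, δ)`. -/
structure OrbifoldChart (incl : M → X) (g : RMetric M) (p : X) where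
  Γ : Subgroup (E4 ≃ₗᵢ[ℝ] E4)
  spherical : IsSphericalGroup Γ
  δ : ℝ
  δ_pos : 0 < δ
  par : E4 → M
  localDiffeo : IsLocalDiffeomorphOn (𝓡 4) (𝓡 4) ∞ par (puncturedBall δ)
  fibre : ∀ x ∈ puncturedBall δ, ∀ y ∈ puncturedBall δ, (par x = par y ↔ ∃ γ ∈ Γ, γ x = y)
  continuousOn : ContinuousOn (fun x => open Classical in if x = 0 then p else incl (par x))
    (Metric.ball 0 δ)
  isOpen_image : ∀ U ⊆ Metric.ball (0 : E4) δ, IsOpen U →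
    IsOpen ((fun x => open Classical in if x = 0 then p else incl (par x)) '' U)
  lift : E4 → Mat4
  lift_smooth : ∀ i j : Fin 4, ContDiffOn ℝ ∞ (fun y => lift y i j) (Metric.ball 0 δ)
  lift_eq : ∀ y ∈ puncturedBall δ, lift y = coords par g.inner y
  lift_posDef : (lift 0).PosDef

/-- A Riemannian 4-orbifold `X` with isolated singularities: the complement of the finite set
`sing` of singular points is the Riemannian manifold `(M, g)`, and there is an orbifold chart at
each singular point. -/
structure RiemannianOrbifold (g : RMetric M) (X : Type*) [TopologicalSpace X] where
  incl : M → X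
  isOpenEmbedding : IsOpenEmbedding incl
  sing : Finset X
  mem_sing : ∀ p : X, p ∈ sing ↔ p ∉ range incl
  chart : ∀ p ∈ sing, OrbifoldChart incl g p

/-- `r` is a radius function of the orbifold: the Euclidean distance to the origin in the orbifold
charts near the singular points, extended as a smooth positive function smaller than 1. -/
structure RiemannianOrbifold.IsRadius {g : RMetric M} (O : RiemannianOrbifold g X) (r : M → ℝ) :
    Prop where
  smooth : ContMDiff (𝓡 4) 𝓘(ℝ, ℝ) ∞ r
  pos : ∀ x, 0 < r x
  lt_one : ∀ x, r x < 1
  near : ∀ (p : X) (hp : p ∈ O.sing), ∃ ε > 0, ∀ x ∈ puncturedBall (O.chart p hp).δ,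
    ‖x‖ < ε → r ((O.chart p hp).par x) = ‖x‖

/-- The orbifold is oriented: the atlas of its regular part is oriented (the orientation being the
one for which all charts in the atlas preserve it) and the orbifold charts preserve
the orientation. -/
structure RiemannianOrbifold.IsOriented {g : RMetric M} (O : RiemannianOrbifold g X) : Prop where
  atlas_pos : ∀ e ∈ atlas E4 M, ∀ e' ∈ atlas E4 M, ∀ y ∈ e.target, e.symm y ∈ e'.source →
    0 < (fderiv ℝ (fun z => e' (e.symm z)) y).det
  chart_pos : ∀ (p : X) (hp : p ∈ O.sing), ∀ e ∈ atlas E4 M,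
    ∀ x ∈ puncturedBall (O.chart p hp).δ, (O.chart p hp).par x ∈ e.source →
      0 < (fderiv ℝ (fun z => e ((O.chart p hp).par z)) x).det

/-- `R⁺ < 0` at every point of the oriented orbifold, regular or singular. -/
structure RiemannianOrbifold.RPlusNegative {g : RMetric M} (O : RiemannianOrbifold g X) :
    Prop where
  regular : ∀ e ∈ atlas E4 M, ∀ y ∈ e.target, RPlusNeg (coords e.symm g.inner) y
  singular : ∀ (p : X) (hp : p ∈ O.sing), RPlusNeg (O.chart p hp).lift 0

end Orbifold

end OrbifoldLiouville

end

noncomputable section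

namespace OrbifoldLiouville

open Finset (mul_sum sum_add_distrib sum_comm sum_congr sum_eq_zero sum_mul sum_neg_distrib
  sum_nonneg sum_sub_distrib smul_sum)
open Matrix (mul_apply of_apply transpose_apply transpose_mul transpose_smul transpose_transpose
  nonsing_inv_mul mul_nonsing_inv det_mul det_transpose trace_mul_comm)
open scoped Real Matrix

section

lemma sum₂_congr {ι κ R : Type*} [Fintype ι] [Fintype κ] [AddCommMonoid R] {f g : ι → κ → R}
    (h : ∀ i j, f i j = g i j) : ∑ i, ∑ j, f i j = ∑ i, ∑ j, g i j :=
  sum_congr rfl fun i _ => sum_congr rfl fun j _ => h i j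

/-! ### Calculus of partial derivatives -/

lemma stdVec_apply (i j : Fin 4) : stdVec i j = if j = i then 1 else 0 := by
  simp [stdVec]

lemma eq_sum_stdVec (v : E4) : v = ∑ i, v i • stdVec i := by
  ext j
  simp [stdVec_apply]

lemma fderiv_eq_sum_partialDeriv (f : E4 → ℝ) (y v : E4) :
    fderiv ℝ f y v = ∑ i, v i * partialDeriv i f y := by
  conv_lhs => rw [eq_sum_stdVec v]
  simp [partialDeriv]

lemma differentiableAt_of_contDiffOn {f : E4 → ℝ} {U : Set E4} (hf : ContDiffOn ℝ ∞ f U)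
    (hU : IsOpen U) {y : E4} (hy : y ∈ U) : DifferentiableAt ℝ f y :=
  (hf.contDiffAt (hU.mem_nhds hy)).differentiableAt (by simp)

lemma partialDeriv_congr {f g : E4 → ℝ} {y : E4} (i : Fin 4) (h : f =ᶠ[𝓝 y] g) :
    partialDeriv i f y = partialDeriv i g y := by
  simp [partialDeriv, h.fderiv_eq]

lemma partialDeriv_congr_on {f g : E4 → ℝ} {U : Set E4} (hU : IsOpen U) {y : E4} (hy : y ∈ U)
    (i : Fin 4) (h : ∀ z ∈ U, f z = g z) : partialDeriv i f y = partialDeriv i g y :=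
  partialDeriv_congr i (by filter_upwards [hU.mem_nhds hy] with z hz using h z hz)

lemma partialDeriv_const (i : Fin 4) (c : ℝ) (y : E4) : partialDeriv i (fun _ => c) y = 0 := by
  simp [partialDeriv]

lemma partialDeriv_add {f g : E4 → ℝ} {y : E4} (i : Fin 4) (hf : DifferentiableAt ℝ f y)
    (hg : DifferentiableAt ℝ g y) :
    partialDeriv i (fun z => f z + g z) y = partialDeriv i f y + partialDeriv i g y := by
  simp [partialDeriv, fderiv_fun_add hf hg]

lemma partialDeriv_neg {f : E4 → ℝ} {y : E4} (i : Fin 4) :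
    partialDeriv i (fun z => - f z) y = - partialDeriv i f y := by
  simp [partialDeriv, fderiv_fun_neg]

lemma partialDeriv_sub {f g : E4 → ℝ} {y : E4} (i : Fin 4) (hf : DifferentiableAt ℝ f y)
    (hg : DifferentiableAt ℝ g y) :
    partialDeriv i (fun z => f z - g z) y = partialDeriv i f y - partialDeriv i g y := by
  simp [partialDeriv, fderiv_fun_sub hf hg]

lemma partialDeriv_mul {f g : E4 → ℝ} {y : E4} (i : Fin 4) (hf : DifferentiableAt ℝ f y)
    (hg : DifferentiableAt ℝ g y) :
    partialDeriv i (fun z => f z * g z) y = partialDeriv i f y * g y + f y * partialDeriv i g y := by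
  simp [partialDeriv, fderiv_fun_mul hf hg]; ring

lemma partialDeriv_const_mul {f : E4 → ℝ} {y : E4} (i : Fin 4) (c : ℝ)
    (hf : DifferentiableAt ℝ f y) :
    partialDeriv i (fun z => c * f z) y = c * partialDeriv i f y := by
  simp [partialDeriv, fderiv_const_mul hf]

lemma partialDeriv_sum {ι : Type*} (s : Finset ι) {f : ι → E4 → ℝ} {y : E4} (i : Fin 4)
    (hf : ∀ j ∈ s, DifferentiableAt ℝ (f j) y) :
    partialDeriv i (fun z => ∑ j ∈ s, f j z) y = ∑ j ∈ s, partialDeriv i (f j) y := by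
  simp [partialDeriv, fderiv_fun_sum hf]

lemma partialDeriv_comp_real {f : E4 → ℝ} {φ : ℝ → ℝ} {y : E4} (i : Fin 4)
    (hφ : DifferentiableAt ℝ φ (f y)) (hf : DifferentiableAt ℝ f y) :
    partialDeriv i (fun z => φ (f z)) y = deriv φ (f y) * partialDeriv i f y := by
  have := (hφ.hasDerivAt.comp_hasFDerivAt y hf.hasFDerivAt).fderiv
  simp only [Function.comp_def] at this
  simp [partialDeriv, this]

lemma contDiffOn_partialDeriv {f : E4 → ℝ} {U : Set E4} (hf : ContDiffOn ℝ ∞ f U)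
    (hU : IsOpen U) (i : Fin 4) : ContDiffOn ℝ ∞ (partialDeriv i f) U :=
  (hf.fderiv_of_isOpen hU (by simp)).clm_apply contDiffOn_const

lemma partialDeriv_comm {f : E4 → ℝ} {U : Set E4} (hf : ContDiffOn ℝ ∞ f U)
    (hU : IsOpen U) {y : E4} (hy : y ∈ U) (i j : Fin 4) :
    partialDeriv i (partialDeriv j f) y = partialDeriv j (partialDeriv i f) y := by
  have h1 : ContDiffAt ℝ ∞ f y := hf.contDiffAt (hU.mem_nhds hy)
  have h2 : DifferentiableAt ℝ (fderiv ℝ f) y :=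
    (h1.fderiv_right (m := ∞) (by simp)).differentiableAt (by simp)
  have h3 : ∀ k l : Fin 4, partialDeriv k (partialDeriv l f) y
      = fderiv ℝ (fderiv ℝ f) y (stdVec k) (stdVec l) := by
    intro k l
    unfold OrbifoldLiouville.partialDeriv
    rw [fderiv_clm_apply h2 (differentiableAt_const _)]
    simp
  rw [h3, h3]
  exact (h1.isSymmSndFDerivAt (by
    rw [minSmoothness_of_isRCLikeNormedField]
    exact WithTop.coe_le_coe.2 (le_top (a := (2 : ℕ∞))))) _ _

/-- The Jacobian matrix of a map. -/
def jac (Φ : E4 → E4) (y : E4) : Mat4 := Matrix.of fun m i => partialDeriv i (fun z => Φ z m) y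

lemma contDiffOn_apply {Φ : E4 → E4} {U : Set E4} (h : ContDiffOn ℝ ∞ Φ U)
    (m : Fin 4) : ContDiffOn ℝ ∞ (fun z => Φ z m) U := by fun_prop

lemma fderiv_apply_eq_jac {Φ : E4 → E4} {y : E4} (h : DifferentiableAt ℝ Φ y) (v : E4)
    (m : Fin 4) : fderiv ℝ Φ y v m = ∑ i, jac Φ y m i * v i := by
  have : fderiv ℝ (fun z => Φ z m) y v = fderiv ℝ Φ y v m := by
    have h1 := ((EuclideanSpace.proj (𝕜 := ℝ) m).hasFDerivAt.comp y h.hasFDerivAt).fderiv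
    have h2 : (fun z => Φ z m) = (EuclideanSpace.proj (𝕜 := ℝ) m) ∘ Φ := by
      ext z; simp
    rw [h2, h1]; simp
  rw [← this, fderiv_eq_sum_partialDeriv]
  exact sum_congr rfl fun i _ => by simp [jac, mul_comm]

lemma fderiv_stdVec_eq_sum_jac {Φ : E4 → E4} {y : E4} (h : DifferentiableAt ℝ Φ y)
    (i : Fin 4) : fderiv ℝ Φ y (stdVec i) = ∑ m, jac Φ y m i • stdVec m := by
  rw [eq_sum_stdVec (fderiv ℝ Φ y (stdVec i))]
  refine sum_congr rfl fun m _ => ?_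
  rw [fderiv_apply_eq_jac h]
  simp [stdVec_apply]

lemma partialDeriv_comp {f : E4 → ℝ} {Φ : E4 → E4} {y : E4} (hf : DifferentiableAt ℝ f (Φ y))
    (hΦ : DifferentiableAt ℝ Φ y) (i : Fin 4) :
    partialDeriv i (fun z => f (Φ z)) y = ∑ a, jac Φ y a i * partialDeriv a f (Φ y) := by
  have h1 := (hf.hasFDerivAt.comp y hΦ.hasFDerivAt).fderiv
  have h2 : partialDeriv i (fun z => f (Φ z)) y = fderiv ℝ f (Φ y) (fderiv ℝ Φ y (stdVec i)) := by
    unfold partialDeriv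
    rw [show (fun z => f (Φ z)) = f ∘ Φ from rfl, h1]; rfl
  rw [h2, fderiv_eq_sum_partialDeriv]
  refine sum_congr rfl fun a _ => ?_
  rw [fderiv_apply_eq_jac hΦ]
  simp [stdVec_apply]

lemma toMatrix_fderiv_eq_jac {Φ : E4 → E4} {y : E4} (h : DifferentiableAt ℝ Φ y) :
    LinearMap.toMatrix (EuclideanSpace.basisFun (Fin 4) ℝ).toBasis
      (EuclideanSpace.basisFun (Fin 4) ℝ).toBasis (fderiv ℝ Φ y : E4 →ₗ[ℝ] E4) = jac Φ y := by
  ext m i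
  rw [LinearMap.toMatrix_apply]
  have := fderiv_apply_eq_jac h (stdVec i) m
  simp [stdVec_apply] at this
  simp [← this, stdVec]

lemma det_fderiv_eq_det_jac {Φ : E4 → E4} {y : E4} (h : DifferentiableAt ℝ Φ y) :
    (fderiv ℝ Φ y).det = (jac Φ y).det := by
  rw [← toMatrix_fderiv_eq_jac h, LinearMap.det_toMatrix]

/-! ### Matrix-valued functions -/

/-- The entrywise partial derivative of a matrix-valued function. -/
def dMat (a : Fin 4) (N : E4 → Mat4) (y : E4) : Mat4 :=
  Matrix.of fun i j => partialDeriv a (fun z => N z i j) y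

/-- Entrywise smoothness on a set. -/
def SmoothMat (U : Set E4) (N : E4 → Mat4) : Prop :=
  ∀ i j, ContDiffOn ℝ ∞ (fun y => N y i j) U

/-- Entrywise differentiability at a point. -/
def DiffMat (N : E4 → Mat4) (y : E4) : Prop := ∀ i j, DifferentiableAt ℝ (fun y => N y i j) y

lemma SmoothMat.diffMat {U : Set E4} {N : E4 → Mat4} (h : SmoothMat U N) (hU : IsOpen U) {y : E4}
    (hy : y ∈ U) : DiffMat N y := fun i j => differentiableAt_of_contDiffOn (h i j) hU hy

lemma SmoothMat.congr {U : Set E4} {N P : E4 → Mat4} (h : SmoothMat U N)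
    (hP : ∀ y ∈ U, P y = N y) : SmoothMat U P :=
  fun i j => (h i j).congr fun y hy => by rw [hP y hy]

lemma SmoothMat.add {U : Set E4} {N P : E4 → Mat4} (h : SmoothMat U N) (h' : SmoothMat U P) :
    SmoothMat U (fun y => N y + P y) := fun i j => (h i j).add (h' i j)

lemma SmoothMat.sub {U : Set E4} {N P : E4 → Mat4} (h : SmoothMat U N) (h' : SmoothMat U P) :
    SmoothMat U (fun y => N y - P y) := fun i j => (h i j).sub (h' i j)

lemma SmoothMat.mul {U : Set E4} {N P : E4 → Mat4} (h : SmoothMat U N) (h' : SmoothMat U P) :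
    SmoothMat U (fun y => N y * P y) := fun i j => by
  simp only [mul_apply]
  exact ContDiffOn.sum fun k _ => (h i k).mul (h' k j)

lemma SmoothMat.smul {U : Set E4} {f : E4 → ℝ} {N : E4 → Mat4} (hf : ContDiffOn ℝ ∞ f U)
    (h : SmoothMat U N) : SmoothMat U (fun y => f y • N y) := fun i j => hf.mul (h i j)

lemma SmoothMat.sum {U : Set E4} {ι : Type*} {s : Finset ι} {N : ι → E4 → Mat4}
    (h : ∀ k ∈ s, SmoothMat U (N k)) : SmoothMat U (fun y => ∑ k ∈ s, N k y) := fun i j => by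
  simp only [Matrix.sum_apply]
  exact ContDiffOn.sum fun k hk => h k hk i j

lemma SmoothMat.transpose {U : Set E4} {N : E4 → Mat4} (h : SmoothMat U N) :
    SmoothMat U (fun y => (N y)ᵀ) := fun i j => h j i

lemma SmoothMat.dMat {U : Set E4} {N : E4 → Mat4} (h : SmoothMat U N) (hU : IsOpen U)
    (a : Fin 4) : SmoothMat U (dMat a N) := fun i j => contDiffOn_partialDeriv (h i j) hU a

lemma SmoothMat.det {U : Set E4} {N : E4 → Mat4} (h : SmoothMat U N) :
    ContDiffOn ℝ ∞ (fun y => (N y).det) U := by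
  simp only [Matrix.det_apply]
  exact ContDiffOn.sum fun σ _ => (contDiffOn_prod fun i _ => h _ _).const_smul _

lemma SmoothMat.inv {U : Set E4} {N : E4 → Mat4} (h : SmoothMat U N)
    (hN : ∀ y ∈ U, IsUnit (N y).det) : SmoothMat U (fun y => (N y)⁻¹) := by
  have h1 : SmoothMat U (fun y => ((N y).det)⁻¹ • (N y).adjugate) := by
    refine SmoothMat.smul (h.det.inv fun y hy => (hN y hy).ne_zero) fun i j => ?_
    simp only [Matrix.adjugate_apply]
    refine SmoothMat.det fun k l => ?_
    by_cases hk : k = j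
    · subst hk; simp only [Matrix.updateRow_self]; exact contDiffOn_const
    · simp only [Matrix.updateRow_ne hk]; exact h k l
  exact h1.congr fun y _ => by rw [Matrix.inv_def, Ring.inverse_eq_inv']

lemma SmoothMat.comp {U V : Set E4} {N : E4 → Mat4} {Φ : E4 → E4} (h : SmoothMat V N)
    (hΦ : ContDiffOn ℝ ∞ Φ U) (hm : MapsTo Φ U V) : SmoothMat U (fun y => N (Φ y)) :=
  fun i j => (h i j).comp hΦ hm

lemma SmoothMat.jac {U : Set E4} {Φ : E4 → E4} (hΦ : ContDiffOn ℝ ∞ Φ U) (hU : IsOpen U) :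
    SmoothMat U (jac Φ) := fun i j => contDiffOn_partialDeriv (contDiffOn_apply hΦ i) hU j

lemma dMat_congr {N P : E4 → Mat4} {U : Set E4} (hU : IsOpen U) {y : E4} (hy : y ∈ U)
    (a : Fin 4) (h : ∀ z ∈ U, N z = P z) : dMat a N y = dMat a P y := by
  ext i j
  exact partialDeriv_congr_on hU hy a fun z hz => by rw [h z hz]

lemma dMat_const (a : Fin 4) (A : Mat4) (y : E4) : dMat a (fun _ => A) y = 0 := by
  ext i j; simp [dMat, partialDeriv_const]

lemma dMat_add {N P : E4 → Mat4} {y : E4} (a : Fin 4) (h : DiffMat N y) (h' : DiffMat P y) :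
    dMat a (fun z => N z + P z) y = dMat a N y + dMat a P y := by
  ext i j; exact partialDeriv_add a (h i j) (h' i j)

lemma dMat_sub {N P : E4 → Mat4} {y : E4} (a : Fin 4) (h : DiffMat N y) (h' : DiffMat P y) :
    dMat a (fun z => N z - P z) y = dMat a N y - dMat a P y := by
  ext i j; exact partialDeriv_sub a (h i j) (h' i j)

lemma dMat_mul {N P : E4 → Mat4} {y : E4} (a : Fin 4) (h : DiffMat N y) (h' : DiffMat P y) :
    dMat a (fun z => N z * P z) y = dMat a N y * P y + N y * dMat a P y := by
  ext i j
  simp only [dMat, mul_apply, of_apply, Matrix.add_apply]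
  rw [partialDeriv_sum _ _ fun k _ => (h i k).fun_mul (h' k j), ← sum_add_distrib]
  exact sum_congr rfl fun k _ => partialDeriv_mul a (h i k) (h' k j)

lemma dMat_smul {f : E4 → ℝ} {N : E4 → Mat4} {y : E4} (a : Fin 4) (hf : DifferentiableAt ℝ f y)
    (h : DiffMat N y) :
    dMat a (fun z => f z • N z) y = partialDeriv a f y • N y + f y • dMat a N y := by
  ext i j; exact partialDeriv_mul a hf (h i j)

lemma dMat_sum {ι : Type*} (s : Finset ι) {N : ι → E4 → Mat4} {y : E4} (a : Fin 4)
    (h : ∀ k ∈ s, DiffMat (N k) y) :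
    dMat a (fun z => ∑ k ∈ s, N k z) y = ∑ k ∈ s, dMat a (N k) y := by
  ext i j
  simp only [dMat, Matrix.sum_apply, of_apply]
  exact partialDeriv_sum s a fun k hk => h k hk i j

lemma dMat_transpose {N : E4 → Mat4} {y : E4} (a : Fin 4) :
    dMat a (fun z => (N z)ᵀ) y = (dMat a N y)ᵀ := rfl

lemma dMat_comm {N : E4 → Mat4} {U : Set E4} (h : SmoothMat U N) (hU : IsOpen U) {y : E4}
    (hy : y ∈ U) (a b : Fin 4) : dMat a (dMat b N) y = dMat b (dMat a N) y := by
  ext i j; exact partialDeriv_comm (h i j) hU hy a b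

lemma dMat_comp {N : E4 → Mat4} {Φ : E4 → E4} {y : E4} (h : DiffMat N (Φ y))
    (hΦ : DifferentiableAt ℝ Φ y) (i : Fin 4) :
    dMat i (fun z => N (Φ z)) y = ∑ a, jac Φ y a i • dMat a N (Φ y) := by
  ext j k
  simp only [Matrix.sum_apply, Matrix.smul_apply, smul_eq_mul]
  exact partialDeriv_comp (h j k) hΦ i

lemma DiffMat.mul {N P : E4 → Mat4} {y : E4} (h : DiffMat N y) (h' : DiffMat P y) :
    DiffMat (fun z => N z * P z) y := fun i j => by
  simp only [mul_apply]
  exact DifferentiableAt.fun_sum fun k _ => (h i k).mul (h' k j)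

lemma DiffMat.transpose {N : E4 → Mat4} {y : E4} (h : DiffMat N y) :
    DiffMat (fun z => (N z)ᵀ) y := fun i j => h j i

lemma dMat_inv {N : E4 → Mat4} {U : Set E4} (h : SmoothMat U N) (hU : IsOpen U)
    (hN : ∀ y ∈ U, IsUnit (N y).det) {y : E4} (hy : y ∈ U) (a : Fin 4) :
    dMat a (fun z => (N z)⁻¹) y = - ((N y)⁻¹ * dMat a N y * (N y)⁻¹) := by
  have h1 := (h.inv hN)
  have h2 : dMat a (fun z => N z * (N z)⁻¹) y = 0 := by
    rw [dMat_congr hU hy a (P := fun _ => 1) fun z hz => mul_nonsing_inv _ (hN z hz),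
      dMat_const]
  rw [dMat_mul a (h.diffMat hU hy) (h1.diffMat hU hy)] at h2
  have h3 := congrArg (fun X => (N y)⁻¹ * X) h2
  simp only [mul_add, ← mul_assoc, nonsing_inv_mul _ (hN y hy), one_mul, mul_zero] at h3
  exact eq_neg_of_add_eq_zero_right h3

end

section

/-! ### The Levi-Civita connection in coordinates -/

/-- A smooth Riemannian metric on an open set of `ℝ⁴`. -/
structure MetricOn (U : Set E4) (G : E4 → Mat4) : Prop where
  isOpen : IsOpen U
  smooth : SmoothMat U G
  posDef : ∀ y ∈ U, (G y).PosDef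

section

variable {U : Set E4} {G : E4 → Mat4}

lemma MetricOn.symm (hG : MetricOn U G) {y : E4} (hy : y ∈ U) : (G y)ᵀ = G y := by
  have := (hG.posDef y hy).isHermitian
  simpa [Matrix.IsHermitian, Matrix.conjTranspose_eq_transpose_of_trivial] using this

lemma MetricOn.symm_apply (hG : MetricOn U G) {y : E4} (hy : y ∈ U) (i j : Fin 4) :
    G y i j = G y j i := by
  conv_lhs => rw [← hG.symm hy]
  rfl

lemma MetricOn.isUnit (hG : MetricOn U G) {y : E4} (hy : y ∈ U) : IsUnit (G y).det :=
  (hG.posDef y hy).det_pos.ne'.isUnit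

lemma MetricOn.inv_symm (hG : MetricOn U G) {y : E4} (hy : y ∈ U) :
    ((G y)⁻¹)ᵀ = (G y)⁻¹ := by
  rw [Matrix.transpose_nonsing_inv, hG.symm hy]

lemma MetricOn.mul_inv (hG : MetricOn U G) {y : E4} (hy : y ∈ U) : G y * (G y)⁻¹ = 1 :=
  mul_nonsing_inv _ (hG.isUnit hy)

lemma MetricOn.inv_mul (hG : MetricOn U G) {y : E4} (hy : y ∈ U) : (G y)⁻¹ * G y = 1 :=
  nonsing_inv_mul _ (hG.isUnit hy)

lemma MetricOn.smooth_inv (hG : MetricOn U G) : SmoothMat U (fun y => (G y)⁻¹) :=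
  hG.smooth.inv fun _ hy => hG.isUnit hy

lemma MetricOn.partialDeriv_symm (hG : MetricOn U G) {y : E4} (hy : y ∈ U) (a i j : Fin 4) :
    partialDeriv a (fun z => G z i j) y = partialDeriv a (fun z => G z j i) y :=
  partialDeriv_congr_on hG.isOpen hy a fun _ hz => hG.symm_apply hz i j

/-- The connection matrices `(Γ_a)^l_j = Γ^l_{aj}`. -/
def chr (G : E4 → Mat4) (a : Fin 4) (y : E4) : Mat4 := Matrix.of fun l j => christoffel G l a j y

lemma MetricOn.chr_symm (hG : MetricOn U G) {y : E4} (hy : y ∈ U) (a l j : Fin 4) :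
    chr G a y l j = chr G j y l a := by
  simp only [chr, of_apply, christoffel]
  congr 1
  refine sum_congr rfl fun m _ => ?_
  rw [hG.partialDeriv_symm hy m a j]; ring

lemma MetricOn.mul_chr_apply (hG : MetricOn U G) {y : E4} (hy : y ∈ U) (i l j : Fin 4) :
    (G y * chr G i y) l j = (1 / 2 : ℝ) * (partialDeriv i (fun z => G z j l) y
      + partialDeriv j (fun z => G z i l) y - partialDeriv l (fun z => G z i j) y) := by
  have h : chr G i y = (G y)⁻¹ * Matrix.of fun l j => (1 / 2 : ℝ) *
      (partialDeriv i (fun z => G z j l) y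
      + partialDeriv j (fun z => G z i l) y - partialDeriv l (fun z => G z i j) y) := by
    ext l j
    simp only [chr, christoffel, of_apply, mul_apply, mul_sum]
    exact sum_congr rfl fun _ _ => by ring
  rw [h, ← mul_assoc, hG.mul_inv hy, one_mul]
  rfl

lemma MetricOn.dMat_eq (hG : MetricOn U G) {y : E4} (hy : y ∈ U) (a : Fin 4) :
    dMat a G y = (chr G a y)ᵀ * G y + G y * chr G a y := by
  ext i j
  have h1 : ((chr G a y)ᵀ * G y) i j = (G y * chr G a y) j i := by
    rw [← transpose_apply (G y * chr G a y), transpose_mul, hG.symm hy]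
  rw [Matrix.add_apply, h1, hG.mul_chr_apply hy, hG.mul_chr_apply hy,
    hG.partialDeriv_symm hy a j i]
  simp only [dMat, of_apply]; ring

lemma MetricOn.chr_unique (hG : MetricOn U G) {y : E4} (hy : y ∈ U) (A : Fin 4 → Mat4)
    (hs : ∀ a l j, A a l j = A j l a)
    (hm : ∀ a, dMat a G y = (A a)ᵀ * G y + G y * A a) (a : Fin 4) :
    A a = chr G a y := by
  have h2 : ∀ a i j, (G y * A a) j i + (G y * A a) i j = partialDeriv a (fun z => G z i j) y := by
    intro a i j
    have h1 : ((A a)ᵀ * G y) i j = (G y * A a) j i := by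
      rw [← transpose_apply (G y * A a), transpose_mul, hG.symm hy]
    rw [← h1, ← Matrix.add_apply, ← hm a]; rfl
  have h3 : ∀ a i j, (G y * A a) i j = (G y * A j) i a := by
    intro a i j
    simp only [mul_apply]
    exact sum_congr rfl fun m _ => by rw [hs]
  have h4 : G y * A a = G y * chr G a y := by
    ext l j
    rw [hG.mul_chr_apply hy, ← h2, ← h2, ← h2]
    rw [h3 j a l, h3 j l a, h3 l a j, h3 l j a, h3 a j l]
    have := h3 a l j
    linarith
  have h5 := congrArg (fun X => (G y)⁻¹ * X) h4
  simpa only [← mul_assoc, hG.inv_mul hy, one_mul] using h5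

lemma MetricOn.smooth_chr (hG : MetricOn U G) (a : Fin 4) : SmoothMat U (chr G a) := by
  intro l j
  simp only [chr, of_apply, christoffel]
  refine contDiffOn_const.mul (ContDiffOn.sum fun m _ => (hG.smooth_inv l m).mul ?_)
  exact ((contDiffOn_partialDeriv (hG.smooth _ _) hG.isOpen _).add
    (contDiffOn_partialDeriv (hG.smooth _ _) hG.isOpen _)).sub
    (contDiffOn_partialDeriv (hG.smooth _ _) hG.isOpen _)

lemma MetricOn.dMat_inv_eq (hG : MetricOn U G) {y : E4} (hy : y ∈ U) (a : Fin 4) :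
    dMat a (fun z => (G z)⁻¹) y = -(chr G a y * (G y)⁻¹ + (G y)⁻¹ * (chr G a y)ᵀ) := by
  rw [dMat_inv hG.smooth hG.isOpen (fun _ h => hG.isUnit h) hy, hG.dMat_eq hy, mul_add, add_mul,
    mul_assoc _ _ (G y)⁻¹, mul_assoc _ (G y), hG.mul_inv hy, ← mul_assoc _ (G y), hG.inv_mul hy,
    mul_one, one_mul, add_comm]

/-- The covariant derivative `∇_i H` as a matrix. -/
def cov (G H : E4 → Mat4) (i : Fin 4) (y : E4) : Mat4 := Matrix.of fun j k => covDeriv G H i j k y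

/-- The second covariant derivative `∇²_{a,i} H` as a matrix. -/
def cov2 (G H : E4 → Mat4) (a i : Fin 4) (y : E4) : Mat4 :=
  Matrix.of fun j k => covDeriv2 G H a i j k y

/-- The curvature `R(∂_a, ∂_b)` as a matrix. -/
def curv (G : E4 → Mat4) (a b : Fin 4) (y : E4) : Mat4 :=
  Matrix.of fun l k => riemannUp G a b k l y

lemma cov_eq (G H : E4 → Mat4) (i : Fin 4) (y : E4) :
    cov G H i y = dMat i H y - (chr G i y)ᵀ * H y - H y * chr G i y := by
  ext j k
  simp only [cov, covDeriv, dMat, chr, of_apply, Matrix.sub_apply, mul_apply,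
    transpose_apply]
  congr 1
  exact sum_congr rfl fun _ _ => mul_comm _ _

lemma cov2_eq (G H : E4 → Mat4) (a i : Fin 4) (y : E4) :
    cov2 G H a i y = dMat a (cov G H i) y - (chr G a y)ᵀ * cov G H i y
      - cov G H i y * chr G a y - ∑ l, chr G a y l i • cov G H l y := by
  ext j k
  simp only [cov2, covDeriv2, cov, dMat, chr, of_apply, Matrix.sub_apply, mul_apply,
    transpose_apply, Matrix.sum_apply, Matrix.smul_apply, smul_eq_mul]
  have : ∑ l, christoffel G l a k y * covDeriv G H i j l y
    = ∑ l, covDeriv G H i j l y * christoffel G l a k y :=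
    sum_congr rfl fun _ _ => mul_comm _ _
  rw [this]; ring

lemma curv_eq (G : E4 → Mat4) (a b : Fin 4) (y : E4) :
    curv G a b y = dMat a (chr G b) y - dMat b (chr G a) y + chr G a y * chr G b y
      - chr G b y * chr G a y := by
  ext l k
  simp only [curv, riemannUp, dMat, chr, of_apply, Matrix.sub_apply, mul_apply,
    Matrix.add_apply, sum_sub_distrib]
  rw [add_sub_assoc, sum_congr rfl fun m _ => mul_comm (christoffel G m b k y) _,
    sum_congr rfl fun m _ => mul_comm (christoffel G m a k y) _]

lemma riemann_eq (G : E4 → Mat4) (i j k l : Fin 4) (y : E4) :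
    riemann G i j k l y = ((curv G i j y)ᵀ * G y) k l := by
  simp [riemann, curv, mul_apply]

lemma MetricOn.smooth_cov (hG : MetricOn U G) {H : E4 → Mat4} (hH : SmoothMat U H) (i : Fin 4) :
    SmoothMat U (cov G H i) :=
  (((hH.dMat hG.isOpen i).sub ((hG.smooth_chr i).transpose.mul hH)).sub
    (hH.mul (hG.smooth_chr i))).congr fun y _ => cov_eq G H i y

lemma MetricOn.smooth_curv (hG : MetricOn U G) (a b : Fin 4) : SmoothMat U (curv G a b) :=
  (((((hG.smooth_chr b).dMat hG.isOpen a).sub ((hG.smooth_chr a).dMat hG.isOpen b)).add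
    ((hG.smooth_chr a).mul (hG.smooth_chr b))).sub
    ((hG.smooth_chr b).mul (hG.smooth_chr a))).congr fun y _ => curv_eq G a b y

lemma MetricOn.smooth_riemann (hG : MetricOn U G) (i j k l : Fin 4) :
    ContDiffOn ℝ ∞ (riemann G i j k l) U :=
  ((hG.smooth_curv i j).transpose.mul hG.smooth k l).congr fun y _ => riemann_eq G i j k l y

lemma MetricOn.cov_self (hG : MetricOn U G) {y : E4} (hy : y ∈ U) (i : Fin 4) :
    cov G G i y = 0 := by
  rw [cov_eq, hG.dMat_eq hy]; abel

lemma MetricOn.cov2_self (hG : MetricOn U G) {y : E4} (hy : y ∈ U) (a i : Fin 4) :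
    cov2 G G a i y = 0 := by
  rw [cov2_eq, dMat_congr hG.isOpen hy a (P := fun _ => 0) fun z hz => hG.cov_self hz i,
    dMat_const]
  simp [hG.cov_self hy]

/-- The Ricci identity for 2-tensors. -/
lemma MetricOn.cov2_comm (hG : MetricOn U G) {H : E4 → Mat4} (hH : SmoothMat U H) {y : E4}
    (hy : y ∈ U) (a b : Fin 4) :
    cov2 G H a b y - cov2 G H b a y
      = -((curv G a b y)ᵀ * H y + H y * curv G a b y) := by
  have key : ∀ a b, dMat a (cov G H b) y = dMat a (dMat b H) y
      - (dMat a (chr G b) y)ᵀ * H y - (chr G b y)ᵀ * dMat a H y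
      - dMat a H y * chr G b y - H y * dMat a (chr G b) y := by
    intro a b
    rw [dMat_congr hG.isOpen hy a fun z _ => cov_eq G H b z]
    have d1 := (hH.dMat hG.isOpen b).diffMat hG.isOpen hy
    have d2 := (hG.smooth_chr b).diffMat hG.isOpen hy
    have d3 := hH.diffMat hG.isOpen hy
    rw [dMat_sub a, dMat_sub a d1 (d2.transpose.mul d3), dMat_mul a d2.transpose d3,
      dMat_mul a d3 d2, dMat_transpose]
    · abel
    · exact ((hH.dMat hG.isOpen b).sub ((hG.smooth_chr b).transpose.mul hH)).diffMat hG.isOpen hy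
    · exact d3.mul d2
  have hs : ∑ l, chr G a y l b • cov G H l y = ∑ l, chr G b y l a • cov G H l y :=
    sum_congr rfl fun l _ => by rw [hG.chr_symm hy]
  rw [cov2_eq, cov2_eq, hs, key, key, dMat_comm hH hG.isOpen hy a b, cov_eq, cov_eq, curv_eq]
  simp only [Matrix.transpose_add, Matrix.transpose_sub, transpose_mul]
  noncomm_ring

lemma curv_antisymm (G : E4 → Mat4) (a b : Fin 4) (y : E4) : curv G a b y = - curv G b a y := by
  rw [curv_eq, curv_eq]; noncomm_ring

lemma riemann_antisymm (G : E4 → Mat4) (i j k l : Fin 4) (y : E4) :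
    riemann G i j k l y = - riemann G j i k l y := by
  rw [riemann_eq, riemann_eq, curv_antisymm]; simp

lemma MetricOn.riemann_antisymm' (hG : MetricOn U G) {y : E4} (hy : y ∈ U) (i j k l : Fin 4) :
    riemann G i j k l y = - riemann G i j l k y := by
  have h := hG.cov2_comm hG.smooth hy i j
  rw [hG.cov2_self hy, hG.cov2_self hy, sub_zero, eq_comm, neg_eq_zero] at h
  have h1 := congrFun (congrFun h k) l
  have h2 : (G y * curv G i j y) k l = riemann G i j l k y := by
    rw [riemann_eq, ← transpose_apply (G y * curv G i j y), transpose_mul, hG.symm hy]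
  rw [Matrix.add_apply, h2, ← riemann_eq] at h1
  simp at h1; linarith

lemma MetricOn.riemannUp_bianchi (hG : MetricOn U G) {y : E4} (hy : y ∈ U) (i j k l : Fin 4) :
    riemannUp G i j k l y + riemannUp G j k i l y + riemannUp G k i j l y = 0 := by
  have hs : ∀ a l b, ∀ z ∈ U, christoffel G l a b z = christoffel G l b a z :=
    fun a l b z hz => hG.chr_symm hz a l b
  have hd : ∀ c a l b, partialDeriv c (fun z => christoffel G l a b z) y
      = partialDeriv c (fun z => christoffel G l b a z) y := fun c a l b =>
    partialDeriv_congr_on hG.isOpen hy c fun z hz => hs a l b z hz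
  simp only [riemannUp, sum_sub_distrib]
  rw [hd i k l j, hd j i l k, hd k j l i]
  simp only [hs k _ j y hy, hs i _ k y hy, hs j _ i y hy]
  ring

lemma MetricOn.riemann_bianchi (hG : MetricOn U G) {y : E4} (hy : y ∈ U) (i j k l : Fin 4) :
    riemann G i j k l y + riemann G j k i l y + riemann G k i j l y = 0 := by
  simp only [riemann, ← sum_add_distrib, ← add_mul, hG.riemannUp_bianchi hy]
  simp

lemma MetricOn.riemann_pair_symm (hG : MetricOn U G) {y : E4} (hy : y ∈ U) (i j k l : Fin 4) :
    riemann G i j k l y = riemann G k l i j y := by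
  have b1 := hG.riemann_bianchi hy i j k l
  have b2 := hG.riemann_bianchi hy j k l i
  have b3 := hG.riemann_bianchi hy k l i j
  have b4 := hG.riemann_bianchi hy l i j k
  have a1 := riemann_antisymm G i j k l y
  have := hG.riemann_antisymm' hy i j k l
  have := hG.riemann_antisymm' hy j k i l
  have := hG.riemann_antisymm' hy k i j l
  have := hG.riemann_antisymm' hy k l j i
  have := hG.riemann_antisymm' hy l j k i
  have := hG.riemann_antisymm' hy l i k j
  have := hG.riemann_antisymm' hy i k l j
  have := hG.riemann_antisymm' hy k l i j
  have := hG.riemann_antisymm' hy i j l k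
  have := hG.riemann_antisymm' hy j l i k
  have := riemann_antisymm G l i j k y
  have := riemann_antisymm G j l i k y
  have := riemann_antisymm G k i j l y
  have := riemann_antisymm G l j k i y
  have := riemann_antisymm G i k l j y
  have := riemann_antisymm G k l i j y
  linarith

lemma MetricOn.ricci_eq (hG : MetricOn U G) {y : E4} (hy : y ∈ U) (j k : Fin 4) :
    ricci G y j k = ∑ i, ∑ l, (G y)⁻¹ l i * riemann G i j k l y := by
  have h : ∀ i, (curv G i j y) i k = ((curv G i j y)ᵀ * G y * (G y)⁻¹) k i := by
    intro i; rw [mul_assoc, hG.mul_inv hy, mul_one]; rfl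
  simp only [ricci, of_apply]
  refine sum_congr rfl fun i _ => ?_
  rw [show riemannUp G i j k i y = curv G i j y i k from rfl, h, mul_apply]
  exact sum_congr rfl fun l _ => by rw [riemann_eq, mul_comm]

end

end

section

/-! ### Changes of coordinates -/

/-- The pull-back of a 2-tensor under a map between open sets of `ℝ⁴`. -/
def pull (Φ : E4 → E4) (H : E4 → Mat4) (y : E4) : Mat4 :=
  (jac Φ y)ᵀ * H (Φ y) * jac Φ y

/-- A smooth map from `U` to `V` with invertible differential. -/
structure CoordChange (U V : Set E4) (Φ : E4 → E4) : Prop where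
  isOpen : IsOpen U
  isOpen' : IsOpen V
  smooth : ContDiffOn ℝ ∞ Φ U
  mapsTo : MapsTo Φ U V
  isUnit : ∀ y ∈ U, IsUnit (jac Φ y).det

variable {U V : Set E4} {Φ : E4 → E4} {G G' H H' : E4 → Mat4}

namespace CoordChange

lemma differentiableAt (h : CoordChange U V Φ) {y : E4} (hy : y ∈ U) :
    DifferentiableAt ℝ Φ y :=
  (h.smooth.contDiffAt (h.isOpen.mem_nhds hy)).differentiableAt (by simp)

lemma diffJac (h : CoordChange U V Φ) {y : E4} (hy : y ∈ U) : DiffMat (jac Φ) y :=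
  (SmoothMat.jac h.smooth h.isOpen).diffMat h.isOpen hy

lemma inv_mul (h : CoordChange U V Φ) {y : E4} (hy : y ∈ U) : (jac Φ y)⁻¹ * jac Φ y = 1 :=
  nonsing_inv_mul _ (h.isUnit y hy)

lemma mul_inv (h : CoordChange U V Φ) {y : E4} (hy : y ∈ U) : jac Φ y * (jac Φ y)⁻¹ = 1 :=
  mul_nonsing_inv _ (h.isUnit y hy)

lemma mul_left_cancel (h : CoordChange U V Φ) {y : E4} (hy : y ∈ U) {A B : Mat4}
    (hAB : jac Φ y * A = jac Φ y * B) : A = B := by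
  have := congrArg (fun X => (jac Φ y)⁻¹ * X) hAB
  simpa only [← mul_assoc, h.inv_mul hy, one_mul] using this

lemma smooth_pull (h : CoordChange U V Φ) (hH : SmoothMat V H) : SmoothMat U (pull Φ H) :=
  ((SmoothMat.jac h.smooth h.isOpen).transpose.mul (hH.comp h.smooth h.mapsTo)).mul
    (SmoothMat.jac h.smooth h.isOpen)

lemma metricOn_pull (h : CoordChange U V Φ) (hG : MetricOn V G)
    (hG' : ∀ y ∈ U, G' y = pull Φ G y) : MetricOn U G' where
  isOpen := h.isOpen
  smooth := (h.smooth_pull hG.smooth).congr hG'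
  posDef y hy := by
    rw [hG' y hy, pull]
    have := (hG.posDef _ (h.mapsTo hy)).conjTranspose_mul_mul_same
      (B := jac Φ y) ?_
    · simpa [Matrix.conjTranspose_eq_transpose_of_trivial] using this
    · exact Matrix.mulVec_injective_of_isUnit ((Matrix.isUnit_iff_isUnit_det _).2 (h.isUnit y hy))

lemma jac_mul_inv_mul (h : CoordChange U V Φ)
    (hG' : ∀ y ∈ U, G' y = pull Φ G y) {y : E4} (hy : y ∈ U) :
    jac Φ y * (G' y)⁻¹ * (jac Φ y)ᵀ = (G (Φ y))⁻¹ := by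
  have hJt : IsUnit ((jac Φ y)ᵀ).det := by
    rw [det_transpose]; exact h.isUnit y hy
  rw [hG' y hy, pull, Matrix.mul_inv_rev, Matrix.mul_inv_rev, ← mul_assoc, h.mul_inv hy, one_mul,
    mul_assoc, nonsing_inv_mul _ hJt, mul_one]

/-- The connection matrix of `G` in the direction of the image of `∂_i`. -/
def pullChr (Φ : E4 → E4) (G : E4 → Mat4) (i : Fin 4) (y : E4) : Mat4 :=
  ∑ a, jac Φ y a i • chr G a (Φ y)

lemma dMat_jac_symm (h : CoordChange U V Φ) {y : E4} (hy : y ∈ U) (i j m : Fin 4) :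
    dMat i (jac Φ) y m j = dMat j (jac Φ) y m i := by
  simp only [dMat, jac, of_apply]
  exact partialDeriv_comm (contDiffOn_apply h.smooth m) h.isOpen hy i j

lemma dMat_conj (h : CoordChange U V Φ) {N : E4 → Mat4} {y : E4} (hy : y ∈ U) (hN : DiffMat N y)
    (i : Fin 4) :
    dMat i (fun z => (jac Φ z)ᵀ * N z * jac Φ z) y =
      (dMat i (jac Φ) y)ᵀ * N y * jac Φ y
      + (jac Φ y)ᵀ * dMat i N y * jac Φ y
      + (jac Φ y)ᵀ * N y * dMat i (jac Φ) y := by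
  have hJ := h.diffJac hy
  rw [dMat_mul i (hJ.transpose.mul hN) hJ, dMat_mul i hJ.transpose hN, dMat_transpose, add_mul]

lemma jac_mul_chr (h : CoordChange U V Φ) (hG : MetricOn V G)
    (hG' : ∀ y ∈ U, G' y = pull Φ G y) {y : E4} (hy : y ∈ U) (i : Fin 4) :
    jac Φ y * chr G' i y = dMat i (jac Φ) y + pullChr Φ G i y * jac Φ y := by
  have hM := h.metricOn_pull hG hG'
  set A : Fin 4 → Mat4 := fun i =>
    (jac Φ y)⁻¹ * (dMat i (jac Φ) y + pullChr Φ G i y * jac Φ y) with hA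
  have hJA : ∀ i, jac Φ y * A i = dMat i (jac Φ) y + pullChr Φ G i y * jac Φ y := fun i => by
    simp only [hA, ← mul_assoc, h.mul_inv hy, one_mul]
  have hA' : ∀ i, A i = (jac Φ y)⁻¹ * (dMat i (jac Φ) y + pullChr Φ G i y * jac Φ y) := fun _ => rfl
  clear_value A
  have h1 : A i = chr G' i y := by
    refine hM.chr_unique hy A (fun a l j => ?_) (fun a => ?_) i
    · simp only [hA', mul_apply]
      refine sum_congr rfl fun m _ => ?_
      congr 1
      rw [Matrix.add_apply, Matrix.add_apply, h.dMat_jac_symm hy]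
      congr 1
      simp only [pullChr, mul_apply, Matrix.sum_apply, Matrix.smul_apply, smul_eq_mul,
        sum_mul]
      rw [sum_comm]
      refine sum₂_congr fun b c => ?_
      rw [hG.chr_symm (h.mapsTo hy)]; ring
    · have hd : DiffMat (fun z => G (Φ z)) y :=
        (hG.smooth.comp h.smooth h.mapsTo).diffMat h.isOpen hy
      have h2 : dMat a (fun z => G (Φ z)) y
          = (pullChr Φ G a y)ᵀ * G (Φ y) + G (Φ y) * pullChr Φ G a y := by
        rw [dMat_comp (hG.smooth.diffMat hG.isOpen (h.mapsTo hy)) (h.differentiableAt hy)]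
        simp only [hG.dMat_eq (h.mapsTo hy), pullChr, Matrix.transpose_sum, transpose_smul,
          sum_mul, mul_sum, smul_add, sum_add_distrib, smul_mul_assoc,
          mul_smul_comm]
      rw [dMat_congr h.isOpen hy a hG']
      unfold pull
      rw [h.dMat_conj hy hd, h2, hG' y hy, pull]
      have e1 := hJA a
      have e2 := congrArg Matrix.transpose e1
      rw [transpose_mul, Matrix.transpose_add, transpose_mul] at e2
      calc _ = ((dMat a (jac Φ) y)ᵀ + (jac Φ y)ᵀ * (pullChr Φ G a y)ᵀ)
            * G (Φ y) * jac Φ y + (jac Φ y)ᵀ * G (Φ y) *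
            (dMat a (jac Φ) y + pullChr Φ G a y * jac Φ y) := by noncomm_ring
        _ = _ := by rw [← e1, ← e2]; noncomm_ring
  rw [← h1, hJA]

lemma gauge (h : CoordChange U V Φ) (hG : MetricOn V G)
    (hG' : ∀ y ∈ U, G' y = pull Φ G y) {N : E4 → Mat4} {y : E4} (hy : y ∈ U) (hN : DiffMat N y)
    (i : Fin 4) :
    dMat i (fun z => (jac Φ z)ᵀ * N z * jac Φ z) y
      - (chr G' i y)ᵀ * ((jac Φ y)ᵀ * N y * jac Φ y)
      - (jac Φ y)ᵀ * N y * jac Φ y * chr G' i y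
    = (jac Φ y)ᵀ * (dMat i N y - (pullChr Φ G i y)ᵀ * N y
      - N y * pullChr Φ G i y) * jac Φ y := by
  have e1 := h.jac_mul_chr hG hG' hy i
  have e2 := congrArg Matrix.transpose e1
  rw [transpose_mul, Matrix.transpose_add, transpose_mul] at e2
  rw [h.dMat_conj hy hN]
  calc _ = (dMat i (jac Φ) y)ᵀ * N y * jac Φ y
      + (jac Φ y)ᵀ * dMat i N y * jac Φ y
      + (jac Φ y)ᵀ * N y * dMat i (jac Φ) y
      - ((chr G' i y)ᵀ * (jac Φ y)ᵀ) * N y * jac Φ y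
      - (jac Φ y)ᵀ * N y * (jac Φ y * chr G' i y) := by noncomm_ring
    _ = _ := by rw [e1, e2]; noncomm_ring

lemma sum_smul_conj {ι : Type*} [Fintype ι] (c : ι → ℝ) (X : ι → Mat4) (A B : Mat4) :
    ∑ l, c l • (A * X l * B) = A * (∑ l, c l • X l) * B := by
  simp only [mul_sum, sum_mul, mul_smul_comm, smul_mul_assoc]

lemma cov_pull (h : CoordChange U V Φ) (hG : MetricOn V G)
    (hG' : ∀ y ∈ U, G' y = pull Φ G y) (hH : SmoothMat V H)
    (hH' : ∀ y ∈ U, H' y = pull Φ H y) {y : E4} (hy : y ∈ U) (i : Fin 4) :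
    cov G' H' i y = (jac Φ y)ᵀ * (∑ a, jac Φ y a i • cov G H a (Φ y)) * jac Φ y := by
  have hd : DiffMat (fun z => H (Φ z)) y := (hH.comp h.smooth h.mapsTo).diffMat h.isOpen hy
  rw [cov_eq, dMat_congr h.isOpen hy i hH', hH' y hy]
  have := h.gauge hG hG' hy hd i
  unfold pull
  rw [this]
  congr 2
  rw [dMat_comp (hH.diffMat hG.isOpen (h.mapsTo hy)) (h.differentiableAt hy)]
  simp only [cov_eq, pullChr, Matrix.transpose_sum, transpose_smul,
          sum_mul, mul_sum, smul_sub, sum_sub_distrib, smul_mul_assoc,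
          mul_smul_comm]

lemma cov2_pull (h : CoordChange U V Φ) (hG : MetricOn V G)
    (hG' : ∀ y ∈ U, G' y = pull Φ G y) (hH : SmoothMat V H)
    (hH' : ∀ y ∈ U, H' y = pull Φ H y) {y : E4} (hy : y ∈ U) (a i : Fin 4) :
    cov2 G' H' a i y = (jac Φ y)ᵀ *
      (∑ b, ∑ c, (jac Φ y b a * jac Φ y c i) • cov2 G H b c (Φ y)) * jac Φ y := by
  have hJ := h.diffJac hy
  have hcd : ∀ c, DiffMat (fun z => cov G H c (Φ z)) y := fun c =>
    ((hG.smooth_cov hH c).comp h.smooth h.mapsTo).diffMat h.isOpen hy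
  have hN : DiffMat (fun z => ∑ c, jac Φ z c i • cov G H c (Φ z)) y :=
    (SmoothMat.sum fun c _ => SmoothMat.smul ((SmoothMat.jac h.smooth h.isOpen) c i)
      ((hG.smooth_cov hH c).comp h.smooth h.mapsTo)).diffMat h.isOpen hy
  have h1 : ∑ l, chr G' a y l i • cov G' H' l y = (jac Φ y)ᵀ *
      (∑ c, (dMat a (jac Φ) y + pullChr Φ G a y * jac Φ y) c i • cov G H c (Φ y)) * jac Φ y := by
    simp only [h.cov_pull hG hG' hH hH' hy, ← h.jac_mul_chr hG hG' hy a, mul_apply,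
      sum_smul_conj, smul_sum, Finset.sum_smul, smul_smul]
    congr 2
    rw [sum_comm]
    simp only [mul_comm]
  rw [cov2_eq, dMat_congr h.isOpen hy a fun z hz => h.cov_pull hG hG' hH hH' hz i,
    h.cov_pull hG hG' hH hH' hy i, h1, h.gauge hG hG' hy hN a, ← sub_mul, ← mul_sub]
  congr 2
  rw [dMat_sum _ _ fun c _ => ?_]
  swap
  · exact fun k l => (hJ c i).mul (hcd c k l)
  have h2 : ∀ c, dMat a (fun z => jac Φ z c i • cov G H c (Φ z)) y
      = dMat a (jac Φ) y c i • cov G H c (Φ y)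
        + ∑ b, (jac Φ y b a * jac Φ y c i) • dMat b (cov G H c) (Φ y) := by
    intro c
    rw [dMat_smul a (hJ c i) (hcd c), dMat_comp
      ((hG.smooth_cov hH c).diffMat hG.isOpen (h.mapsTo hy)) (h.differentiableAt hy)]
    simp only [smul_sum, smul_smul]
    congr 1
    exact sum_congr rfl fun b _ => by rw [mul_comm]
  simp only [h2, cov2_eq, pullChr, Matrix.transpose_sum, transpose_smul,
          sum_mul, mul_sum, smul_sub, sum_sub_distrib, smul_mul_assoc,
          mul_smul_comm, sum_add_distrib, Matrix.add_apply, add_smul, smul_smul,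
          smul_sum]
  have e1 : ∑ c, ∑ b, (jac Φ y b a * jac Φ y c i) • dMat b (cov G H c) (Φ y)
      = ∑ b, ∑ c, (jac Φ y b a * jac Φ y c i) • dMat b (cov G H c) (Φ y) := sum_comm
  have e2 : ∑ c, ∑ b, (jac Φ y c i * jac Φ y b a) • ((chr G b (Φ y))ᵀ * cov G H c (Φ y))
      = ∑ b, ∑ c, (jac Φ y b a * jac Φ y c i) • ((chr G b (Φ y))ᵀ * cov G H c (Φ y)) := by
    rw [sum_comm]; simp only [mul_comm]
  have e4 : ∑ c, (∑ b, jac Φ y b a • (chr G b (Φ y) * jac Φ y)) c i • cov G H c (Φ y)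
      = ∑ b, ∑ c, ∑ l, (jac Φ y b a * jac Φ y c i * chr G b (Φ y) l c) • cov G H l (Φ y) := by
    simp only [Matrix.sum_apply, Matrix.smul_apply, mul_apply, smul_eq_mul, Finset.sum_smul,
      mul_sum]
    rw [sum_comm]
    refine sum_congr rfl fun b _ => ?_
    rw [sum_comm]
    refine sum₂_congr fun c l => ?_
    congr 1; ring
  rw [e1, e2, e4]
  abel

end CoordChange

end

section

variable {U V : Set E4} {Φ : E4 → E4} {G G' H H' : E4 → Mat4}

/-- Contraction of two indices transformed by `J`. -/
lemma sum_sum_conj_mul (J A : Mat4) (X : Fin 4 → Fin 4 → ℝ) :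
    ∑ i, ∑ l, (∑ a, ∑ d, J a i * J d l * X a d) * A i l
      = ∑ a, ∑ d, X a d * (J * A * Jᵀ) a d := by
  simp only [mul_apply, transpose_apply, sum_mul, mul_sum]
  calc _ = ∑ i, ∑ a, ∑ l, ∑ d, J a i * J d l * X a d * A i l :=
        sum_congr rfl fun i _ => sum_comm
    _ = ∑ a, ∑ i, ∑ l, ∑ d, J a i * J d l * X a d * A i l := sum_comm
    _ = ∑ a, ∑ i, ∑ d, ∑ l, J a i * J d l * X a d * A i l :=
        sum₂_congr fun a i => sum_comm
    _ = ∑ a, ∑ d, ∑ i, ∑ l, J a i * J d l * X a d * A i l :=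
        sum_congr rfl fun a _ => sum_comm
    _ = ∑ a, ∑ d, ∑ l, ∑ i, J a i * J d l * X a d * A i l :=
        sum₂_congr fun a i => sum_comm
    _ = _ := sum₂_congr fun a d =>
        sum₂_congr fun l i => by ring

lemma sum_sum_smul_conj (J A : Mat4) (M : Fin 4 → Fin 4 → Mat4) :
    ∑ i, ∑ l, A i l • (∑ a, ∑ d, (J a i * J d l) • M a d)
      = ∑ a, ∑ d, (J * A * Jᵀ) a d • M a d := by
  ext j k
  have := sum_sum_conj_mul J A fun a d => M a d j k
  simp only [Matrix.sum_apply, Matrix.smul_apply, smul_eq_mul]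
  simp only [mul_comm (M _ _ _ _)] at this
  simp only [mul_comm ((J * A * Jᵀ) _ _)] at this ⊢
  rw [← this]
  simp only [mul_comm (A _ _)]

namespace CoordChange

lemma jac_mul_curv (h : CoordChange U V Φ) (hG : MetricOn V G)
    (hG' : ∀ y ∈ U, G' y = pull Φ G y) {y : E4} (hy : y ∈ U) (i j : Fin 4) :
    jac Φ y * curv G' i j y
      = (∑ a, ∑ b, (jac Φ y a i * jac Φ y b j) • curv G a b (Φ y)) * jac Φ y := by
  have hM := h.metricOn_pull hG hG'
  have hJ := h.diffJac hy
  have sJ := SmoothMat.jac h.smooth h.isOpen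
  have sC : ∀ j, SmoothMat U (pullChr Φ G j) := fun j =>
    SmoothMat.sum fun a _ => SmoothMat.smul (sJ a j) ((hG.smooth_chr a).comp h.smooth h.mapsTo)
  have key : ∀ i j, dMat i (jac Φ) y * chr G' j y + jac Φ y * dMat i (chr G' j) y
      = dMat i (dMat j (jac Φ)) y + dMat i (pullChr Φ G j) y * jac Φ y
        + pullChr Φ G j y * dMat i (jac Φ) y := by
    intro i j
    rw [← dMat_mul i hJ ((hM.smooth_chr j).diffMat h.isOpen hy),
      dMat_congr h.isOpen hy i fun z hz => h.jac_mul_chr hG hG' hz j,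
      dMat_add i ((sJ.dMat h.isOpen j).diffMat h.isOpen hy)
        (((sC j).mul sJ).diffMat h.isOpen hy), dMat_mul i ((sC j).diffMat h.isOpen hy) hJ, add_assoc]
  have hdC : ∀ i j, dMat i (pullChr Φ G j) y = (∑ a, dMat i (jac Φ) y a j • chr G a (Φ y))
      + ∑ b, ∑ a, (jac Φ y b i * jac Φ y a j) • dMat b (chr G a) (Φ y) := by
    intro i j
    have hcd : ∀ a, DiffMat (fun z => chr G a (Φ z)) y := fun a =>
      ((hG.smooth_chr a).comp h.smooth h.mapsTo).diffMat h.isOpen hy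
    unfold pullChr
    rw [dMat_sum (N := fun a z => jac Φ z a j • chr G a (Φ z)) _ _
      fun a _ => fun k l => (hJ a j).mul (hcd a k l)]
    simp only [dMat_smul _ (hJ _ j) (hcd _), sum_add_distrib]
    congr 1
    rw [sum_comm]
    refine sum_congr rfl fun a _ => ?_
    rw [dMat_comp ((hG.smooth_chr a).diffMat hG.isOpen (h.mapsTo hy)) (h.differentiableAt hy)]
    simp only [smul_sum, smul_smul]
    exact sum_congr rfl fun b _ => by rw [mul_comm]
  have hR : ∑ a, ∑ b, (jac Φ y a i * jac Φ y b j) • curv G a b (Φ y)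
      = dMat i (pullChr Φ G j) y - dMat j (pullChr Φ G i) y
        + pullChr Φ G i y * pullChr Φ G j y - pullChr Φ G j y * pullChr Φ G i y := by
    rw [hdC, hdC]
    simp only [h.dMat_jac_symm hy j i]
    have e1 : ∑ b, ∑ a, (jac Φ y b j * jac Φ y a i) • dMat b (chr G a) (Φ y)
        = ∑ a, ∑ b, (jac Φ y a i * jac Φ y b j) • dMat b (chr G a) (Φ y) := by
      rw [sum_comm]; simp only [mul_comm]
    have e2 : pullChr Φ G i y * pullChr Φ G j y
        = ∑ a, ∑ b, (jac Φ y a i * jac Φ y b j) • (chr G a (Φ y) * chr G b (Φ y)) := by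
      simp only [pullChr, sum_mul, mul_sum, smul_mul_assoc, mul_smul_comm,
        smul_sum, smul_smul]
      rw [sum_comm]
      simp only [mul_comm]
    have e3 : pullChr Φ G j y * pullChr Φ G i y
        = ∑ a, ∑ b, (jac Φ y a i * jac Φ y b j) • (chr G b (Φ y) * chr G a (Φ y)) := by
      simp only [pullChr, sum_mul, mul_sum, smul_mul_assoc, mul_smul_comm,
        smul_sum, smul_smul]
    rw [e1, e2, e3]
    simp only [curv_eq, smul_add, smul_sub, sum_add_distrib, sum_sub_distrib]
    abel
  have k1 := key i j
  have k2 := key j i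
  rw [dMat_comm sJ h.isOpen hy j i] at k2
  have c1 := h.jac_mul_chr hG hG' hy i
  have c2 := h.jac_mul_chr hG hG' hy j
  rw [hR, curv_eq]
  have m1 : jac Φ y * dMat i (chr G' j) y = dMat i (dMat j (jac Φ)) y
      + dMat i (pullChr Φ G j) y * jac Φ y
        + pullChr Φ G j y * dMat i (jac Φ) y - dMat i (jac Φ) y * chr G' j y := by
    rw [← k1]; abel
  have m2 : jac Φ y * dMat j (chr G' i) y = dMat i (dMat j (jac Φ)) y
      + dMat j (pullChr Φ G i) y * jac Φ y
        + pullChr Φ G i y * dMat j (jac Φ) y - dMat j (jac Φ) y * chr G' i y := by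
    rw [← k2]; abel
  calc _ = jac Φ y * dMat i (chr G' j) y - jac Φ y * dMat j (chr G' i) y
        + (jac Φ y * chr G' i y) * chr G' j y - (jac Φ y * chr G' j y) * chr G' i y := by
        noncomm_ring
    _ = (dMat i (pullChr Φ G j) y - dMat j (pullChr Φ G i) y) * jac Φ y
        + pullChr Φ G j y * dMat i (jac Φ) y - pullChr Φ G i y * dMat j (jac Φ) y
        + pullChr Φ G i y * (jac Φ y * chr G' j y) - pullChr Φ G j y * (jac Φ y * chr G' i y) := by
        rw [m1, m2, c1, c2]
        calc _ = (dMat i (pullChr Φ G j) y - dMat j (pullChr Φ G i) y) * jac Φ y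
            + pullChr Φ G j y * dMat i (jac Φ) y - pullChr Φ G i y * dMat j (jac Φ) y
            + pullChr Φ G i y * (jac Φ y * chr G' j y)
            - pullChr Φ G j y * (jac Φ y * chr G' i y) := by noncomm_ring
          _ = _ := by rw [c1, c2]
    _ = _ := by rw [c1, c2]; noncomm_ring

lemma riemann_pull (h : CoordChange U V Φ) (hG : MetricOn V G)
    (hG' : ∀ y ∈ U, G' y = pull Φ G y) {y : E4} (hy : y ∈ U) (i j k l : Fin 4) :
    riemann G' i j k l y = ∑ a, ∑ b, (jac Φ y a i * jac Φ y b j) *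
      ∑ c, ∑ d, jac Φ y c k * jac Φ y d l * riemann G a b c d (Φ y) := by
  have h1 : (curv G' i j y)ᵀ * G' y = ∑ a, ∑ b, (jac Φ y a i * jac Φ y b j) •
      ((jac Φ y)ᵀ * ((curv G a b (Φ y))ᵀ * G (Φ y)) * jac Φ y) := by
    have := congrArg Matrix.transpose (h.jac_mul_curv hG hG' hy i j)
    rw [transpose_mul, transpose_mul] at this
    rw [hG' y hy, pull, ← mul_assoc, ← mul_assoc, this]
    simp only [Matrix.transpose_sum, transpose_smul, sum_mul, mul_sum,
      mul_smul_comm, smul_mul_assoc, mul_assoc]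
  rw [riemann_eq, h1]
  simp only [Matrix.sum_apply, Matrix.smul_apply, smul_eq_mul]
  refine sum₂_congr fun a b => ?_
  congr 1
  rw [mul_apply]
  simp only [mul_apply (M := (jac Φ y)ᵀ), sum_mul, transpose_apply,
    ← riemann_eq]
  rw [sum_comm]
  exact sum₂_congr fun c d => by ring

lemma ricci_pull (h : CoordChange U V Φ) (hG : MetricOn V G)
    (hG' : ∀ y ∈ U, G' y = pull Φ G y) {y : E4} (hy : y ∈ U) :
    ricci G' y = pull Φ (ricci G) y := by
  have hM := h.metricOn_pull hG hG'
  ext j k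
  rw [hM.ricci_eq hy]
  have e : ∀ i l, riemann G' i j k l y = ∑ a, ∑ d, jac Φ y a i * jac Φ y d l *
      ∑ b, ∑ c, jac Φ y b j * jac Φ y c k * riemann G a b c d (Φ y) := by
    intro i l
    rw [h.riemann_pull hG hG' hy]
    refine sum_congr rfl fun a _ => ?_
    simp only [mul_sum]
    calc _ = ∑ b, ∑ d, ∑ c, jac Φ y a i * jac Φ y b j *
          (jac Φ y c k * jac Φ y d l * riemann G a b c d (Φ y)) :=
          sum_congr rfl fun b _ => sum_comm
      _ = _ := by
          rw [sum_comm]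
          exact sum₂_congr fun _ _ =>
            sum_congr rfl fun _ _ => by ring
  have hs : ∀ i l, (G' y)⁻¹ l i = (G' y)⁻¹ i l := fun i l => by
    conv_lhs => rw [← hM.inv_symm hy]
    rfl
  have e2 := sum_sum_conj_mul (jac Φ y) ((G' y)⁻¹)
    (fun a d => ∑ b, ∑ c, jac Φ y b j * jac Φ y c k * riemann G a b c d (Φ y))
  rw [h.jac_mul_inv_mul hG' hy] at e2
  simp only [e, hs]
  simp only [mul_comm ((G' y)⁻¹ _ _)]
  rw [e2, pull, mul_apply]
  have hs2 : ∀ i l, (G (Φ y))⁻¹ l i = (G (Φ y))⁻¹ i l := fun i l => by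
    conv_lhs => rw [← hG.inv_symm (h.mapsTo hy)]
    rfl
  simp only [mul_apply, hG.ricci_eq (h.mapsTo hy), hs2, sum_mul, mul_sum,
    transpose_apply]
  calc _ = ∑ a, ∑ b, ∑ d, ∑ c, jac Φ y b j * jac Φ y c k * riemann G a b c d (Φ y)
        * (G (Φ y))⁻¹ a d := sum_congr rfl fun a _ => sum_comm
    _ = ∑ a, ∑ b, ∑ c, ∑ d, jac Φ y b j * jac Φ y c k * riemann G a b c d (Φ y)
        * (G (Φ y))⁻¹ a d := sum₂_congr fun a b =>
          sum_comm
    _ = ∑ b, ∑ a, ∑ c, ∑ d, jac Φ y b j * jac Φ y c k * riemann G a b c d (Φ y)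
        * (G (Φ y))⁻¹ a d := sum_comm
    _ = ∑ b, ∑ c, ∑ a, ∑ d, jac Φ y b j * jac Φ y c k * riemann G a b c d (Φ y)
        * (G (Φ y))⁻¹ a d := sum_congr rfl fun a _ => sum_comm
    _ = _ := by
        rw [sum_comm]
        exact sum₂_congr fun _ _ =>
            sum₂_congr fun _ _ => by ring

lemma roughLaplacian_pull (h : CoordChange U V Φ) (hG : MetricOn V G)
    (hG' : ∀ y ∈ U, G' y = pull Φ G y) (hH : SmoothMat V H)
    (hH' : ∀ y ∈ U, H' y = pull Φ H y) {y : E4} (hy : y ∈ U) :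
    roughLaplacian G' H' y = pull Φ (roughLaplacian G H) y := by
  have e : ∀ (G H : E4 → Mat4) (y : E4),
      roughLaplacian G H y = ∑ a, ∑ i, (G y)⁻¹ a i • cov2 G H a i y := by
    intro G H y
    ext j k
    simp [roughLaplacian, cov2, Matrix.sum_apply]
  rw [pull, e, e]
  simp only [h.cov2_pull hG hG' hH hH' hy]
  rw [← h.jac_mul_inv_mul hG' hy, ← sum_sum_smul_conj]
  simp only [mul_sum, sum_mul, mul_smul_comm, smul_mul_assoc]

lemma raise_pull (h : CoordChange U V Φ)
    (hG' : ∀ y ∈ U, G' y = pull Φ G y) (A : Mat4) {y : E4} (hy : y ∈ U) :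
    jac Φ y * ((G' y)⁻¹ * ((jac Φ y)ᵀ * A * jac Φ y) * ((G' y)⁻¹)ᵀ)
      * (jac Φ y)ᵀ = (G (Φ y))⁻¹ * A * ((G (Φ y))⁻¹)ᵀ := by
  rw [← h.jac_mul_inv_mul hG' hy]
  simp only [transpose_mul, transpose_transpose, mul_assoc]

lemma curvAction_pull (h : CoordChange U V Φ) (hG : MetricOn V G)
    (hG' : ∀ y ∈ U, G' y = pull Φ G y) {y : E4}
    (hH' : H' y = pull Φ H y) (hy : y ∈ U) :
    curvAction G' H' y = pull Φ (curvAction G H) y := by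
  have e : ∀ (G H : E4 → Mat4) (y : E4) (j k : Fin 4), curvAction G H y j k
      = ∑ i, ∑ l, riemann G i j k l y * ((G y)⁻¹ * H y * ((G y)⁻¹)ᵀ) i l := by
    intro G H y j k
    simp only [curvAction, of_apply, mul_apply, mul_sum, sum_mul,
      transpose_apply]
    refine sum₂_congr fun i l => ?_
    rw [sum_comm]
    exact sum₂_congr fun _ _ => by ring
  ext j k
  rw [e]
  have e1 : ∀ i l, riemann G' i j k l y = ∑ a, ∑ d, jac Φ y a i * jac Φ y d l *
      ∑ b, ∑ c, jac Φ y b j * jac Φ y c k * riemann G a b c d (Φ y) := by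
    intro i l
    rw [h.riemann_pull hG hG' hy]
    refine sum_congr rfl fun a _ => ?_
    simp only [mul_sum]
    calc _ = ∑ b, ∑ d, ∑ c, jac Φ y a i * jac Φ y b j *
          (jac Φ y c k * jac Φ y d l * riemann G a b c d (Φ y)) :=
          sum_congr rfl fun b _ => sum_comm
      _ = _ := by
          rw [sum_comm]
          exact sum₂_congr fun _ _ =>
            sum_congr rfl fun _ _ => by ring
  simp only [e1]
  rw [sum_sum_conj_mul, hH', pull, h.raise_pull hG' (H (Φ y)) hy, pull, mul_apply]
  simp only [mul_apply (M := (jac Φ y)ᵀ), e, sum_mul, mul_sum,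
    transpose_apply]
  calc _ = ∑ a, ∑ b, ∑ d, ∑ c, jac Φ y b j * jac Φ y c k * riemann G a b c d (Φ y)
        * ((G (Φ y))⁻¹ * H (Φ y) * ((G (Φ y))⁻¹)ᵀ) a d :=
          sum_congr rfl fun a _ => sum_comm
    _ = ∑ a, ∑ b, ∑ c, ∑ d, jac Φ y b j * jac Φ y c k * riemann G a b c d (Φ y)
        * ((G (Φ y))⁻¹ * H (Φ y) * ((G (Φ y))⁻¹)ᵀ) a d :=
          sum₂_congr fun a b => sum_comm
    _ = ∑ b, ∑ a, ∑ c, ∑ d, jac Φ y b j * jac Φ y c k * riemann G a b c d (Φ y)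
        * ((G (Φ y))⁻¹ * H (Φ y) * ((G (Φ y))⁻¹)ᵀ) a d := sum_comm
    _ = ∑ b, ∑ c, ∑ a, ∑ d, jac Φ y b j * jac Φ y c k * riemann G a b c d (Φ y)
        * ((G (Φ y))⁻¹ * H (Φ y) * ((G (Φ y))⁻¹)ᵀ) a d :=
          sum_congr rfl fun a _ => sum_comm
    _ = _ := by
        rw [sum_comm]
        exact sum₂_congr fun _ _ =>
            sum₂_congr fun _ _ => by ring

lemma lichnerowicz_pull (h : CoordChange U V Φ) (hG : MetricOn V G)
    (hG' : ∀ y ∈ U, G' y = pull Φ G y) (hH : SmoothMat V H)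
    (hH' : ∀ y ∈ U, H' y = pull Φ H y) {y : E4} (hy : y ∈ U) :
    lichnerowicz G' H' y = pull Φ (lichnerowicz G H) y := by
  rw [lichnerowicz, h.roughLaplacian_pull hG hG' hH hH' hy,
    h.curvAction_pull hG hG' (hH' y hy) hy, h.ricci_pull hG hG' hy, hH' y hy]
  simp only [pull, lichnerowicz, ← h.jac_mul_inv_mul hG' hy, mul_sub, sub_mul, mul_add, add_mul,
    mul_assoc, mul_smul_comm, smul_mul_assoc]

/-! #### Functions and vector fields -/

end CoordChange

/-- The Hessian of a function. -/
def hess (G : E4 → Mat4) (f : E4 → ℝ) (y : E4) : Mat4 :=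
  Matrix.of fun i j => partialDeriv i (partialDeriv j f) y
    - ∑ k, christoffel G k i j y * partialDeriv k f y

/-- The covariant derivative of a vector field, as the matrix `(∇_i V)^l`. -/
def covVec (G : E4 → Mat4) (V : Fin 4 → E4 → ℝ) (y : E4) : Mat4 :=
  Matrix.of fun l i => partialDeriv i (V l) y + ∑ k, chr G i y l k * V k y

/-- The divergence of a vector field. -/
def divergence (G : E4 → Mat4) (V : Fin 4 → E4 → ℝ) (y : E4) : ℝ := (covVec G V y).trace

namespace CoordChange

lemma partialDeriv_comp (h : CoordChange U V Φ) {f : E4 → ℝ} (hf : ContDiffOn ℝ ∞ f V) {y : E4}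
    (hy : y ∈ U) (i : Fin 4) :
    partialDeriv i (fun z => f (Φ z)) y = ∑ a, jac Φ y a i * partialDeriv a f (Φ y) :=
  OrbifoldLiouville.partialDeriv_comp
    (differentiableAt_of_contDiffOn hf h.isOpen' (h.mapsTo hy)) (h.differentiableAt hy) i

lemma hess_pull (h : CoordChange U V Φ) (hG : MetricOn V G)
    (hG' : ∀ y ∈ U, G' y = pull Φ G y) {f f' : E4 → ℝ} (hf : ContDiffOn ℝ ∞ f V)
    (hf' : ∀ y ∈ U, f' y = f (Φ y)) {y : E4} (hy : y ∈ U) :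
    hess G' f' y = pull Φ (hess G f) y := by
  have hJ := h.diffJac hy
  have d1 : ∀ z ∈ U, ∀ j, partialDeriv j f' z = ∑ a, jac Φ z a j * partialDeriv a f (Φ z) := by
    intro z hz j
    rw [partialDeriv_congr_on h.isOpen hz j hf', h.partialDeriv_comp hf hz]
  have hfd : ∀ a, DifferentiableAt ℝ (fun z => partialDeriv a f (Φ z)) y := fun a =>
    differentiableAt_of_contDiffOn ((contDiffOn_partialDeriv hf hG.isOpen a).comp h.smooth h.mapsTo)
      h.isOpen hy
  ext i j
  simp only [hess, of_apply]
  rw [partialDeriv_congr_on h.isOpen hy i fun z hz => d1 z hz j,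
    partialDeriv_sum _ _ fun a _ => (hJ a j).fun_mul (hfd a)]
  have e1 : ∑ k, christoffel G' k i j y * partialDeriv k f' y
      = ∑ a, (dMat i (jac Φ) y + pullChr Φ G i y * jac Φ y) a j * partialDeriv a f (Φ y) := by
    rw [← h.jac_mul_chr hG hG' hy i]
    simp only [d1 y hy, mul_apply, mul_sum, sum_mul]
    rw [sum_comm]
    exact sum₂_congr fun a k => by
      simp only [chr, of_apply]; ring
  have e2 : ∀ a, partialDeriv i (fun z => jac Φ z a j * partialDeriv a f (Φ z)) y
      = dMat i (jac Φ) y a j * partialDeriv a f (Φ y)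
        + ∑ b, jac Φ y b i * jac Φ y a j * partialDeriv b (partialDeriv a f) (Φ y) := by
    intro a
    rw [partialDeriv_mul i (hJ a j) (hfd a),
      h.partialDeriv_comp (contDiffOn_partialDeriv hf hG.isOpen a) hy, mul_sum]
    congr 1
    exact sum_congr rfl fun b _ => by ring
  rw [e1]
  simp only [e2, sum_add_distrib, Matrix.add_apply, add_mul, add_sub_add_left_eq_sub]
  simp only [pull, hess, pullChr, mul_apply, transpose_apply, of_apply,
    Matrix.sum_apply, Matrix.smul_apply, smul_eq_mul, mul_sub, sub_mul, sum_sub_distrib,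
    sum_mul, mul_sum]
  congr 1
  · exact sum₂_congr fun a b => by ring
  · simp only [chr, of_apply, Fin.sum_univ_four]
    ring

lemma divergence_pull (h : CoordChange U V Φ) (hG : MetricOn V G)
    (hG' : ∀ y ∈ U, G' y = pull Φ G y) {X X' : Fin 4 → E4 → ℝ}
    (hX : ∀ m, ContDiffOn ℝ ∞ (X m) V) (hX' : ∀ m, ContDiffOn ℝ ∞ (X' m) U)
    (hXX : ∀ y ∈ U, ∀ m, ∑ i, jac Φ y m i * X' i y = X m (Φ y)) {y : E4} (hy : y ∈ U) :
    divergence G' X' y = divergence G X (Φ y) := by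
  have hJ := h.diffJac hy
  have hX'd : ∀ m, DifferentiableAt ℝ (X' m) y := fun m =>
    differentiableAt_of_contDiffOn (hX' m) h.isOpen hy
  have key : jac Φ y * covVec G' X' y = covVec G X (Φ y) * jac Φ y := by
    ext m i
    have e1 := h.partialDeriv_comp (hX m) hy i
    rw [← partialDeriv_congr_on h.isOpen hy i fun z hz => hXX z hz m,
      partialDeriv_sum _ _ fun l _ => (hJ m l).fun_mul (hX'd l)] at e1
    simp only [partialDeriv_mul i (hJ m _) (hX'd _), sum_add_distrib] at e1
    have e2 := h.jac_mul_chr hG hG' hy i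
    have e3 : ∑ k, (jac Φ y * chr G' i y) m k * X' k y
        = ∑ k, dMat i (jac Φ) y m k * X' k y
          + ∑ a, jac Φ y a i * ∑ c, chr G a (Φ y) m c * X c (Φ y) := by
      rw [e2]
      simp only [Matrix.add_apply, add_mul, sum_add_distrib]
      congr 1
      simp only [← hXX y hy, pullChr, mul_apply, Matrix.sum_apply, Matrix.smul_apply,
        smul_eq_mul, sum_mul, mul_sum]
      simp only [Fin.sum_univ_four]
      ring
    simp only [mul_apply, covVec, of_apply, mul_add, add_mul, sum_add_distrib]
    have e4 : ∑ k, (jac Φ y * chr G' i y) m k * X' k y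
        = ∑ l, jac Φ y m l * ∑ k, chr G' i y l k * X' k y := by
      simp only [mul_apply, sum_mul, mul_sum]
      rw [sum_comm]
      exact sum₂_congr fun _ _ => by ring
    have e5 : ∀ l, dMat i (jac Φ) y m l = partialDeriv i (fun z => jac Φ z m l) y := fun _ => rfl
    rw [← e4, e3]
    simp only [e5]
    have e6 : ∑ x, partialDeriv x (X m) (Φ y) * jac Φ y x i
        = ∑ a, jac Φ y a i * partialDeriv a (X m) (Φ y) :=
      sum_congr rfl fun _ _ => mul_comm _ _
    have e7 : ∑ x, (∑ k, chr G x (Φ y) m k * X k (Φ y)) * jac Φ y x i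
        = ∑ a, jac Φ y a i * ∑ c, chr G a (Φ y) m c * X c (Φ y) :=
      sum_congr rfl fun _ _ => mul_comm _ _
    rw [e6, e7, ← e1]
    ring
  have h2 : covVec G' X' y = (jac Φ y)⁻¹ * (covVec G X (Φ y) * jac Φ y) := by
    rw [← key, ← mul_assoc, h.inv_mul hy, one_mul]
  rw [divergence, divergence, h2, trace_mul_comm, mul_assoc, h.mul_inv hy, mul_one]

end CoordChange

end

section

/-! ### The Levi-Civita symbol -/

lemma sum_fin_four_fun {R : Type*} [AddCommMonoid R] (f : (Fin 4 → Fin 4) → R) :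
    ∑ r, f r = ∑ i, ∑ j, ∑ k, ∑ l, f ![i, j, k, l] := by
  let e : (Fin 4 → Fin 4) ≃ Fin 4 × Fin 4 × Fin 4 × Fin 4 :=
    { toFun := fun r => (r 0, r 1, r 2, r 3)
      invFun := fun p => ![p.1, p.2.1, p.2.2.1, p.2.2.2]
      left_inv := fun r => by ext a; fin_cases a <;> rfl
      right_inv := fun p => rfl }
  rw [← Equiv.sum_comp e.symm f]
  simp only [Fintype.sum_prod_type]
  rfl

lemma sum_leviCivita_mul (J : Mat4) (m n b c : Fin 4) :
    ∑ i, ∑ j, ∑ p, ∑ q, J m i * J n j * J b p * J c q * leviCivita i j p q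
      = J.det * leviCivita m n b c := by
  have h1 : (Matrix.of fun a x => J (![m, n, b, c] a) x).det = leviCivita m n b c * J.det := by
    rw [leviCivita, ← det_mul]
    congr 1
    ext a x
    simp [mul_apply]
  have h2 : (Matrix.of fun a x => J (![m, n, b, c] a) x).det
      = ∑ r : Fin 4 → Fin 4, (∏ a, J (![m, n, b, c] a) (r a)) *
        (Matrix.of fun a x => if r a = x then (1 : ℝ) else 0).det := by
    have := (Matrix.detRowAlternating (R := ℝ) (n := Fin 4)).toMultilinearMap.map_sum
      (fun a k => J (![m, n, b, c] a) k • (fun x => if k = x then (1 : ℝ) else 0))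
    simp only [MultilinearMap.map_smul_univ] at this
    convert this using 1
    · show _ = Matrix.det _
      congr 1
      ext a x
      simp
    · rfl
  rw [mul_comm, ← h1, h2, sum_fin_four_fun]
  refine sum₂_congr fun i j =>
    sum₂_congr fun p q => ?_
  simp only [Fin.prod_univ_four, leviCivita]
  rfl

/-! ### Pointwise algebra -/

lemma tensorInner_eq_sum (G A B : Mat4) :
    tensorInner G A B = ∑ i, ∑ j, A i j * (G⁻¹ * B * (G⁻¹)ᵀ) i j := by
  simp only [tensorInner, mul_apply, transpose_apply, mul_sum, sum_mul]
  refine sum₂_congr fun i j => ?_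
  rw [sum_comm]
  exact sum₂_congr fun _ _ => by ring

lemma sum_mul_eq_trace (A B : Mat4) : ∑ i, ∑ j, A i j * B i j = (Aᵀ * B).trace := by
  simp only [Matrix.trace, Matrix.diag, mul_apply, transpose_apply]
  exact sum_comm

lemma tensorInner_eq_trace (G A B : Mat4) :
    tensorInner G A B = (Aᵀ * (G⁻¹ * B * (G⁻¹)ᵀ)).trace := by
  rw [tensorInner_eq_sum, sum_mul_eq_trace]

lemma tensorInner_add_left (G A A' B : Mat4) :
    tensorInner G (A + A') B = tensorInner G A B + tensorInner G A' B := by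
  simp [tensorInner_eq_trace, add_mul]

lemma tensorInner_smul_left (G A B : Mat4) (c : ℝ) :
    tensorInner G (c • A) B = c * tensorInner G A B := by
  simp [tensorInner_eq_trace]

lemma tensorInner_sub_left (G A A' B : Mat4) :
    tensorInner G (A - A') B = tensorInner G A B - tensorInner G A' B := by
  simp [tensorInner_eq_trace, sub_mul]

lemma tensorInner_sum_left {ι : Type*} (s : Finset ι) (G : Mat4) (A : ι → Mat4) (B : Mat4) :
    tensorInner G (∑ k ∈ s, A k) B = ∑ k ∈ s, tensorInner G (A k) B := by
  simp [tensorInner_eq_trace, Matrix.transpose_sum, sum_mul, Matrix.trace_sum]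

lemma tensorInner_comm {G : Mat4} (hG : Gᵀ = G) (A B : Mat4) :
    tensorInner G A B = tensorInner G B A := by
  rw [tensorInner_eq_trace, tensorInner_eq_trace, ← Matrix.trace_transpose]
  simp only [transpose_mul, transpose_transpose, Matrix.transpose_nonsing_inv, hG]
  rw [← mul_assoc, trace_mul_comm]
  simp only [mul_assoc]
  rw [trace_mul_comm]
  simp only [mul_assoc]
  rw [trace_mul_comm]
  simp only [mul_assoc]

lemma conj_inv {G J : Mat4} (hJ : IsUnit J.det) :
    J * (Jᵀ * G * J)⁻¹ * Jᵀ = G⁻¹ := by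
  have hJt : IsUnit (Jᵀ).det := by rwa [det_transpose]
  rw [Matrix.mul_inv_rev, Matrix.mul_inv_rev, ← mul_assoc, mul_nonsing_inv _ hJ, one_mul,
    mul_assoc, nonsing_inv_mul _ hJt, mul_one]

lemma tensorInner_conj {J : Mat4} (hJ : IsUnit J.det) (G A B : Mat4) :
    tensorInner (Jᵀ * G * J) (Jᵀ * A * J) (Jᵀ * B * J)
      = tensorInner G A B := by
  rw [tensorInner_eq_trace, tensorInner_eq_trace]
  rw [← conj_inv (G := G) hJ]
  simp only [transpose_mul, transpose_transpose, mul_assoc]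
  rw [trace_mul_comm]
  simp only [mul_assoc]

lemma tensorInner_one (A B : Mat4) : tensorInner 1 A B = ∑ i, ∑ j, A i j * B i j := by
  rw [tensorInner_eq_sum]; simp

open scoped MatrixOrder Matrix.Norms.L2Operator in
lemma exists_frame {G : Mat4} (hG : G.PosDef) :
    ∃ A : Mat4, 0 < A.det ∧ Aᵀ * G * A = 1 := by
  obtain ⟨B, hB⟩ := CStarAlgebra.nonneg_iff_eq_star_mul_self.mp hG.posSemidef.nonneg
  rw [Matrix.star_eq_conjTranspose, Matrix.conjTranspose_eq_transpose_of_trivial] at hB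
  have hdet : B.det ≠ 0 := by
    intro h0
    have := hG.det_pos
    rw [hB, det_mul, h0, mul_zero] at this
    exact lt_irrefl _ this
  have hBu : IsUnit B.det := hdet.isUnit
  have key : (B⁻¹)ᵀ * G * B⁻¹ = 1 := by
    rw [hB, ← mul_assoc, ← transpose_mul, mul_nonsing_inv _ hBu, mul_assoc,
      mul_nonsing_inv _ hBu]
    simp
  have hdi : (B⁻¹).det ≠ 0 := by
    rw [Matrix.det_nonsing_inv, Ring.inverse_eq_inv']; exact inv_ne_zero hdet
  rcases hdi.lt_or_gt with h | h
  · set D : Mat4 := Matrix.diagonal ![-1, 1, 1, 1]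
    have hD : Dᵀ * D = 1 := by
      simp only [D, Matrix.diagonal_transpose, Matrix.diagonal_mul_diagonal]
      rw [← Matrix.diagonal_one]
      congr 1
      ext i; fin_cases i <;> simp
    refine ⟨B⁻¹ * D, ?_, ?_⟩
    · rw [det_mul, Matrix.det_diagonal]
      have : ∏ i, (![-1, 1, 1, 1] : Fin 4 → ℝ) i = -1 := by simp [Fin.prod_univ_four]
      rw [this]; linarith
    · rw [transpose_mul]
      calc _ = Dᵀ * ((B⁻¹)ᵀ * G * B⁻¹) * D := by simp only [mul_assoc]
        _ = 1 := by rw [key, mul_one, hD]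
  · exact ⟨B⁻¹, h, key⟩

/-! ### Normal coordinates -/

lemma contDiff_coord (i : Fin 4) : ContDiff ℝ ∞ (fun z : E4 => z i) := by fun_prop

lemma partialDeriv_coord (k i : Fin 4) (y : E4) :
    partialDeriv k (fun z : E4 => z i) y = if i = k then 1 else 0 := by
  have h : (fun z : E4 => z i) = EuclideanSpace.proj (𝕜 := ℝ) i := by ext; simp
  rw [partialDeriv, h, ContinuousLinearMap.fderiv]
  simp [stdVec_apply]

lemma exists_quadratic_map (p : E4) (A : Mat4) (B : Fin 4 → Mat4)
    (hB : ∀ m i j, B m i j = B m j i) :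
    ∃ Φ : E4 → E4, ContDiff ℝ ∞ Φ ∧ Φ 0 = p ∧
      ∀ z m i, jac Φ z m i = A m i + ∑ j, B m i j * z j := by
  let f : Fin 4 → E4 → ℝ := fun m z => p m + ∑ i, A m i * z i
    + (1 / 2 : ℝ) * ∑ i, ∑ j, B m i j * (z i * z j)
  have hf : ∀ m, ContDiff ℝ ∞ (f m) := fun m => by
    simp only [f]; fun_prop
  refine ⟨fun z => WithLp.toLp 2 fun m => f m z, ?_, ?_, ?_⟩
  · exact (PiLp.continuousLinearEquiv 2 ℝ (fun _ : Fin 4 => ℝ)).symm.contDiff.comp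
      (contDiff_pi.2 hf)
  · ext m; simp [f]
  · intro z m k
    have d : ∀ i, DifferentiableAt ℝ (fun z : E4 => z i) z := fun i =>
      (contDiff_coord i).differentiable (by simp) z
    simp only [jac, of_apply, f]
    have d1 : ∀ i, DifferentiableAt ℝ (fun z : E4 => A m i * z i) z := fun i => (d i).const_mul _
    have d2 : ∀ i j, DifferentiableAt ℝ (fun z : E4 => z i * z j) z := fun i j => (d i).mul (d j)
    have d3 : ∀ i j, DifferentiableAt ℝ (fun z : E4 => B m i j * (z i * z j)) z := fun i j =>
      (d2 i j).const_mul _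
    have d4 : ∀ i, DifferentiableAt ℝ (fun z : E4 => ∑ j, B m i j * (z i * z j)) z := fun i =>
      DifferentiableAt.fun_sum fun j _ => d3 i j
    have d5 : DifferentiableAt ℝ (fun z : E4 => ∑ i, ∑ j, B m i j * (z i * z j)) z :=
      DifferentiableAt.fun_sum fun j _ => d4 j
    have d6 : DifferentiableAt ℝ (fun z : E4 => ∑ i, A m i * z i) z :=
      DifferentiableAt.fun_sum fun j _ => d1 j
    rw [partialDeriv_add k ((differentiableAt_const _).fun_add d6) (d5.const_mul _),
      partialDeriv_add k (differentiableAt_const _) d6, partialDeriv_const,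
      partialDeriv_sum _ _ fun i _ => d1 i, partialDeriv_const_mul k _ d5,
      partialDeriv_sum _ _ fun i _ => d4 i]
    simp only [partialDeriv_sum _ _ fun j _ => d3 _ j, partialDeriv_const_mul k _ (d2 _ _),
      partialDeriv_const_mul k _ (d _), partialDeriv_mul k (d _) (d _), partialDeriv_coord]
    simp only [mul_ite, mul_one, mul_zero, Finset.sum_ite_eq', Finset.mem_univ, if_true, zero_add,
      mul_add, sum_add_distrib, ite_mul, one_mul, zero_mul, Finset.sum_ite_irrel,
      Finset.sum_const_zero]
    have : ∑ x, B m x k * z x = ∑ x, B m k x * z x :=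
      sum_congr rfl fun x _ => by rw [hB]
    rw [this]; ring

/-- Existence of normal coordinates at a point, preserving the orientation. -/
lemma MetricOn.exists_normal {V : Set E4} {G : E4 → Mat4} (hG : MetricOn V G) {p : E4}
    (hp : p ∈ V) : ∃ (U : Set E4) (Φ : E4 → E4), CoordChange U V Φ ∧ (0 : E4) ∈ U ∧ Φ 0 = p ∧
      (∀ y ∈ U, 0 < (jac Φ y).det) ∧ pull Φ G 0 = 1 ∧ ∀ a, chr (pull Φ G) a 0 = 0 := by
  obtain ⟨A, hA, hAG⟩ := exists_frame (hG.posDef p hp)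
  let B : Fin 4 → Mat4 := fun m => - (Aᵀ * (Matrix.of fun a b => chr G a p m b) * A)
  have hB : ∀ m i j, B m i j = B m j i := by
    intro m i j
    have : (B m)ᵀ = B m := by
      simp only [B, Matrix.transpose_neg, transpose_mul, transpose_transpose,
        mul_assoc]
      congr 3
      ext a b
      exact (hG.chr_symm hp a m b).symm
    conv_lhs => rw [← this]
    rfl
  obtain ⟨Φ, hΦ, h0, hJ⟩ := exists_quadratic_map p A B hB
  have hJ0 : jac Φ 0 = A := by ext m i; simp [hJ]
  have hdet : Continuous fun z => (jac Φ z).det := by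
    have : SmoothMat univ (jac Φ) := SmoothMat.jac hΦ.contDiffOn isOpen_univ
    exact (contDiffOn_univ.1 this.det).continuous
  let U : Set E4 := {z | Φ z ∈ V ∧ 0 < (jac Φ z).det}
  have hU : IsOpen U := (hG.isOpen.preimage hΦ.continuous).inter (isOpen_lt continuous_const hdet)
  have hc : CoordChange U V Φ :=
    ⟨hU, hG.isOpen, hΦ.contDiffOn, fun z hz => hz.1, fun z hz => hz.2.ne'.isUnit⟩
  have h0U : (0 : E4) ∈ U := ⟨by rw [h0]; exact hp, by rw [hJ0]; exact hA⟩
  refine ⟨U, Φ, hc, h0U, h0, fun z hz => hz.2, by rw [pull, h0, hJ0, hAG], fun a => ?_⟩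
  have h1 := hc.jac_mul_chr hG (G' := pull Φ G) (fun _ _ => rfl) h0U a
  have h2 : dMat a (jac Φ) 0 + CoordChange.pullChr Φ G a 0 * jac Φ 0 = 0 := by
    ext m i
    have d : ∀ i, DifferentiableAt ℝ (fun z : E4 => z i) 0 := fun i =>
      (contDiff_coord i).differentiable (by simp) 0
    have e1 : dMat a (jac Φ) 0 m i = B m i a := by
      simp only [dMat, of_apply, hJ]
      rw [partialDeriv_add a (differentiableAt_const _)
        (DifferentiableAt.fun_sum fun j _ => (d j).const_mul _), partialDeriv_const,
        partialDeriv_sum _ _ fun j _ => (d j).const_mul _]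
      simp [partialDeriv_const_mul _ _ (d _), partialDeriv_coord]
    rw [Matrix.add_apply, e1, hB m i a, CoordChange.pullChr, h0, hJ0]
    simp only [B, Matrix.neg_apply, mul_apply, Matrix.smul_apply,
      smul_eq_mul, transpose_apply, of_apply, Fin.sum_univ_four, Matrix.zero_apply,
      Matrix.add_apply]
    ring
  rw [h2] at h1
  exact hc.mul_left_cancel h0U (by rw [h1, mul_zero])

end

section

/-! ### The volume density -/

/-- Jacobi's formula. -/
lemma partialDeriv_det {N : E4 → Mat4} {y : E4} (h : DiffMat N y) (a : Fin 4) :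
    partialDeriv a (fun z => (N z).det) y = ((N y).adjugate * dMat a N y).trace := by
  have h1 : ∀ σ : Equiv.Perm (Fin 4), DifferentiableAt ℝ (fun z => ∏ i, N z (σ i) i) y :=
    fun σ => (HasFDerivAt.finsetProd fun i _ => (h (σ i) i).hasFDerivAt).differentiableAt
  have h2 : ∀ σ : Equiv.Perm (Fin 4), partialDeriv a (fun z => ∏ i, N z (σ i) i) y
      = ∑ i, (∏ j ∈ Finset.univ.erase i, N y (σ j) j) * dMat a N y (σ i) i := by
    intro σ
    rw [partialDeriv, fderiv_finsetProd (fun i _ => h (σ i) i)]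
    simp [dMat, partialDeriv]
  simp only [Matrix.det_apply, Units.smul_def, zsmul_eq_mul]
  rw [partialDeriv_sum _ _ fun σ _ => (h1 σ).const_mul _]
  simp only [partialDeriv_const_mul a _ (h1 _), h2, mul_sum]
  rw [sum_comm]
  simp only [Matrix.trace, Matrix.diag]
  refine sum_congr rfl fun i _ => ?_
  have h3 : ((N y).adjugate * dMat a N y) i i
      = ((N y).updateCol i (fun k => dMat a N y k i)).det := by
    rw [← Matrix.cramer_apply, Matrix.cramer_eq_adjugate_mulVec]; rfl
  rw [h3, Matrix.det_apply]
  refine sum_congr rfl fun σ _ => ?_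
  rw [Units.smul_def, zsmul_eq_mul, ← Finset.prod_erase_mul _ _ (Finset.mem_univ i)]
  congr 2
  · exact Finset.prod_congr rfl fun j hj => by
      rw [Matrix.updateCol_ne (Finset.ne_of_mem_erase hj)]
  · simp

/-- The volume density `√(det G)`. -/
def volDensity (G : E4 → Mat4) (y : E4) : ℝ := Real.sqrt (G y).det

section

variable {U V : Set E4} {Φ : E4 → E4} {G G' H H' : E4 → Mat4}

lemma MetricOn.volDensity_pos (hG : MetricOn U G) {y : E4} (hy : y ∈ U) : 0 < volDensity G y :=
  Real.sqrt_pos.2 (hG.posDef y hy).det_pos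

lemma MetricOn.smooth_volDensity (hG : MetricOn U G) : ContDiffOn ℝ ∞ (volDensity G) U :=
  hG.smooth.det.sqrt fun _ hy => (hG.posDef _ hy).det_pos.ne'

lemma MetricOn.partialDeriv_volDensity (hG : MetricOn U G) {y : E4} (hy : y ∈ U) (a : Fin 4) :
    partialDeriv a (volDensity G) y = (chr G a y).trace * volDensity G y := by
  have hpos := (hG.posDef y hy).det_pos
  have h1 : partialDeriv a (fun z => (G z).det) y = 2 * (chr G a y).trace * (G y).det := by
    rw [partialDeriv_det (hG.smooth.diffMat hG.isOpen hy), hG.dMat_eq hy, mul_add,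
      Matrix.trace_add, ← mul_assoc, ← mul_assoc, Matrix.adjugate_mul, trace_mul_comm,
      ← mul_assoc, Matrix.mul_adjugate]
    simp; ring
  have h2 : partialDeriv a (volDensity G) y
      = deriv Real.sqrt ((G y).det) * partialDeriv a (fun z => (G z).det) y :=
    partialDeriv_comp_real a (Real.hasDerivAt_sqrt hpos.ne').differentiableAt
      (differentiableAt_of_contDiffOn hG.smooth.det hG.isOpen hy)
  rw [h2, h1, (Real.hasDerivAt_sqrt hpos.ne').deriv, volDensity]
  have := Real.mul_self_sqrt hpos.le
  have hs := Real.sqrt_pos.2 hpos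
  field_simp
  rw [sq, this]; ring

lemma divergence_eq (G : E4 → Mat4) (X : Fin 4 → E4 → ℝ) (y : E4) :
    divergence G X y = ∑ i, partialDeriv i (X i) y + ∑ i, ∑ k, chr G i y i k * X k y := by
  simp [divergence, covVec, Matrix.trace, sum_add_distrib]

lemma MetricOn.divergence_mul_volDensity (hG : MetricOn U G) {X : Fin 4 → E4 → ℝ} {y : E4}
    (hy : y ∈ U) (hX : ∀ i, DifferentiableAt ℝ (X i) y) :
    divergence G X y * volDensity G y
      = ∑ i, partialDeriv i (fun z => X i z * volDensity G z) y := by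
  have hd := differentiableAt_of_contDiffOn hG.smooth_volDensity hG.isOpen hy
  have h1 : ∑ i, ∑ k, chr G i y i k * X k y = ∑ k, (chr G k y).trace * X k y := by
    rw [sum_comm]
    simp only [Matrix.trace, Matrix.diag, sum_mul]
    exact sum₂_congr fun k i => by
      rw [hG.chr_symm hy]
  simp only [partialDeriv_mul _ (hX _) hd, hG.partialDeriv_volDensity hy]
  rw [divergence_eq, h1, add_mul, sum_mul, sum_mul, ← sum_add_distrib]
  exact sum_congr rfl fun i _ => by ring

lemma divergence_mul {f : E4 → ℝ} {X : Fin 4 → E4 → ℝ} {y : E4} (G : E4 → Mat4)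
    (hf : DifferentiableAt ℝ f y) (hX : ∀ i, DifferentiableAt ℝ (X i) y) :
    divergence G (fun i z => f z * X i z) y
      = f y * divergence G X y + ∑ i, X i y * partialDeriv i f y := by
  simp only [divergence_eq, partialDeriv_mul _ hf (hX _), sum_add_distrib, mul_add,
    mul_sum]
  have : ∀ i k, chr G i y i k * (f y * X k y) = f y * (chr G i y i k * X k y) := fun i k => by ring
  simp only [this]
  have : ∑ i, partialDeriv i f y * X i y = ∑ i, X i y * partialDeriv i f y :=
    sum_congr rfl fun _ _ => mul_comm _ _
  rw [this]; ring

/-! ### The momentum vector field -/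

/-- The vector field `X^i = ⟨S^i, h⟩`, with `S = 2 C⁺ + g ⊗ div h`, where `C⁺` is
the selfdual part of the exterior covariant derivative of `h`, at the level of components:
`Gi` is the inverse metric, `d` the volume density and `T a = ∇_a h`. -/
def momentumAt (Gi : Mat4) (d : ℝ) (T : Fin 4 → Mat4) (S : Mat4) (i : Fin 4) : ℝ :=
  (∑ a, Gi i a * ∑ j, ∑ k, T a j k * (Gi * S * Giᵀ) j k)
  - (∑ b, ∑ j, (Gi * (T b * Giᵀ * Sᵀ)) i j * Gi b j)
  + (1 / d) * (∑ j, ∑ p, ∑ q, leviCivita i j p q * (T p * Giᵀ * Sᵀ) q j)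
  + ∑ k, (Gi * S * Giᵀ) i k * ∑ a, ∑ b, T a b k * Gi a b

lemma sum_comm_four_three (f : Fin 4 → Fin 4 → Fin 4 → Fin 4 → Fin 4 → Fin 4 → Fin 4 → ℝ) :
    ∑ i, ∑ j, ∑ p, ∑ q, ∑ n, ∑ c, ∑ b, f i j p q n c b
      = ∑ n, ∑ c, ∑ b, ∑ i, ∑ j, ∑ p, ∑ q, f i j p q n c b := by
  have := sum_comm (s := Finset.univ) (t := Finset.univ)
    (f := fun (x : Fin 4 × Fin 4 × Fin 4 × Fin 4) (y : Fin 4 × Fin 4 × Fin 4) =>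
      f x.1 x.2.1 x.2.2.1 x.2.2.2 y.1 y.2.1 y.2.2)
  simpa only [Fintype.sum_prod_type] using this

lemma conj_apply (J A : Mat4) (q j : Fin 4) :
    (Jᵀ * A * J) q j = ∑ c, ∑ n, J c q * J n j * A c n := by
  simp only [mul_apply, sum_mul, transpose_apply]
  rw [sum_comm]
  exact sum₂_congr fun _ _ => by ring

lemma sum_leviCivita_conj {J : Mat4} {P P' : Fin 4 → Mat4}
    (hP : ∀ p, P' p = Jᵀ * (∑ b, J b p • P b) * J) (m : Fin 4) :
    ∑ i, J m i * ∑ j, ∑ p, ∑ q, leviCivita i j p q * P' p q j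
      = J.det * ∑ n, ∑ b, ∑ c, leviCivita m n b c * P b c n := by
  have e : ∀ p q j, P' p q j = ∑ n, ∑ c, ∑ b, J n j * (J c q * (J b p * P b c n)) := by
    intro p q j
    rw [hP, conj_apply, sum_comm]
    simp only [Matrix.sum_apply, Matrix.smul_apply, smul_eq_mul, mul_sum]
    exact sum₂_congr fun _ _ =>
      sum_congr rfl fun _ _ => by ring
  simp only [e, mul_sum]
  rw [sum_comm_four_three]
  refine sum_congr rfl fun n _ => ?_
  rw [sum_comm]
  refine sum₂_congr fun b c => ?_
  rw [← mul_assoc, ← sum_leviCivita_mul, sum_mul]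
  refine sum_congr rfl fun i _ => ?_
  simp only [sum_mul]
  exact sum₂_congr fun _ _ =>
      sum_congr rfl fun _ _ => by ring

lemma momentumAt_conj {J : Mat4} {Gi Gi' S S' : Mat4} {d d' : ℝ}
    {T T' : Fin 4 → Mat4} (hGi : J * Gi' * Jᵀ = Gi) (hs : Gi'ᵀ = Gi')
    (hdet : J.det ≠ 0) (hd : d' = J.det * d)
    (hT : ∀ i, T' i = Jᵀ * (∑ a, J a i • T a) * J) (hS : S' = Jᵀ * S * J)
    (m : Fin 4) :
    ∑ i, J m i * momentumAt Gi' d' T' S' i = momentumAt Gi d T S m := by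
  have hs' : Giᵀ = Gi := by
    rw [← hGi]; simp only [transpose_mul, transpose_transpose, hs, mul_assoc]
  obtain ⟨P, hPd⟩ : ∃ P : Fin 4 → Mat4, ∀ b, P b = T b * Giᵀ * Sᵀ :=
    ⟨_, fun _ => rfl⟩
  obtain ⟨P', hPd'⟩ : ∃ P : Fin 4 → Mat4, ∀ b, P b = T' b * Gi'ᵀ * S'ᵀ :=
    ⟨_, fun _ => rfl⟩
  obtain ⟨R, hRd⟩ : ∃ R : Mat4, R = Gi * S * Giᵀ := ⟨_, rfl⟩
  obtain ⟨R', hRd'⟩ : ∃ R : Mat4, R = Gi' * S' * Gi'ᵀ := ⟨_, rfl⟩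
  have hP : ∀ b, P' b = Jᵀ * (∑ a, J a b • P a) * J := by
    intro b
    simp only [hPd, hPd', hT, hS]
    rw [hs, hs', ← hGi]
    simp only [transpose_mul, transpose_transpose, sum_mul, mul_sum,
      mul_smul_comm, smul_mul_assoc, mul_assoc]
  have hR : J * R' * Jᵀ = R := by
    rw [hRd', hRd, hS, hs, hs', ← hGi]; simp only [mul_assoc]
  have hTa : ∀ a j k, T' a j k = ∑ c, ∑ n, J c j * J n k * ∑ b, J b a * T b c n := by
    intro a j k
    rw [hT, conj_apply]
    simp only [Matrix.sum_apply, Matrix.smul_apply, smul_eq_mul]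
  have g : ∀ a, Gi m a = (J * Gi' * Jᵀ) m a := by rw [hGi]; exact fun _ => rfl
  have t1 : ∑ i, J m i * ∑ a, Gi' i a * ∑ j, ∑ k, T' a j k * R' j k
      = ∑ a, Gi m a * ∑ j, ∑ k, T a j k * R j k := by
    obtain ⟨v, hv⟩ : ∃ v : Fin 4 → ℝ, ∀ a, v a = ∑ j, ∑ k, T a j k * R j k := ⟨_, fun _ => rfl⟩
    have c1 : ∀ a, ∑ j, ∑ k, T' a j k * R' j k = ∑ b, J b a * v b := by
      intro a
      simp only [hTa, sum_sum_conj_mul, hR, hv]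
      simp only [mul_sum, sum_mul]
      rw [sum_congr rfl fun j _ => sum_comm, sum_comm]
      exact sum₂_congr fun _ _ =>
        sum_congr rfl fun _ _ => by ring
    simp only [c1, ← hv, g]
    simp only [mul_apply, transpose_apply, Fin.sum_univ_four]
    ring
  have t2 : ∑ i, J m i * ∑ b, ∑ j, (Gi' * P' b) i j * Gi' b j
      = ∑ b, ∑ j, (Gi * P b) m j * Gi b j := by
    have := sum_sum_conj_mul J Gi' (fun a n => (Gi * P a) m n)
    rw [hGi] at this
    rw [← this]
    simp only [mul_sum]
    rw [sum_comm]
    refine sum_congr rfl fun b _ => ?_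
    rw [sum_comm]
    refine sum_congr rfl fun j _ => ?_
    simp only [← mul_assoc, ← sum_mul]
    congr 1
    rw [← mul_apply, hP, ← mul_assoc, ← mul_assoc, ← mul_assoc, hGi, mul_sum,
      sum_mul, Matrix.sum_apply]
    refine sum_congr rfl fun a _ => ?_
    rw [mul_smul_comm, smul_mul_assoc, Matrix.smul_apply, mul_apply, smul_eq_mul,
      mul_sum]
    exact sum_congr rfl fun _ _ => by ring
  have t3 : ∑ i, J m i * ((1 / d') * ∑ j, ∑ p, ∑ q, leviCivita i j p q * P' p q j)
      = (1 / d) * ∑ j, ∑ p, ∑ q, leviCivita m j p q * P p q j := by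
    have := sum_leviCivita_conj hP m
    calc _ = (1 / d') * ∑ i, J m i * ∑ j, ∑ p, ∑ q, leviCivita i j p q * P' p q j := by
          rw [mul_sum]
          exact sum_congr rfl fun _ _ => by ring
      _ = _ := by rw [this, hd, ← mul_assoc]; congr 1; field_simp
  have t4 : ∑ i, J m i * ∑ k, R' i k * ∑ a, ∑ b, T' a b k * Gi' a b
      = ∑ k, R m k * ∑ a, ∑ b, T a b k * Gi a b := by
    obtain ⟨v, hv⟩ : ∃ v : Fin 4 → ℝ, ∀ k, v k = ∑ a, ∑ b, T a b k * Gi a b := ⟨_, fun _ => rfl⟩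
    have e : ∀ k, ∑ a, ∑ b, T' a b k * Gi' a b = ∑ l, v l * J l k := by
      intro k
      have := sum_sum_conj_mul J Gi' (fun c n => ∑ l, T c n l * J l k)
      rw [hGi] at this
      have e2 : ∀ a b, T' a b k = ∑ c, ∑ n, J c a * J n b * ∑ l, T c n l * J l k := by
        intro a b
        rw [hT, mul_sum, sum_mul, Matrix.sum_apply]
        refine sum_congr rfl fun c _ => ?_
        rw [mul_smul_comm, smul_mul_assoc, Matrix.smul_apply, mul_assoc, mul_apply,
          smul_eq_mul, mul_sum]
        exact sum_congr rfl fun n _ => by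
          rw [mul_apply, transpose_apply]; ring
      simp only [e2]
      rw [this]
      simp only [hv, sum_mul]
      rw [sum_congr rfl fun a _ => sum_comm, sum_comm]
      exact sum₂_congr fun _ _ =>
        sum_congr rfl fun _ _ => by ring
    simp only [e, ← hR, ← hv]
    simp only [mul_apply, transpose_apply, Fin.sum_univ_four]
    ring
  simp only [momentumAt, ← hPd, ← hPd', ← hRd, ← hRd']
  rw [← t1, ← t2, ← t3, ← t4]
  simp only [mul_add, mul_sub, sum_add_distrib, sum_sub_distrib]

end

end

section

/-! ### Explicit values of the Levi-Civita symbol -/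

lemma leviCivita_swap₁₂ (i j k l : Fin 4) : leviCivita i j k l = - leviCivita j i k l := by
  have := Matrix.det_permute (Equiv.swap (0 : Fin 4) 1)
    (Matrix.of fun a b : Fin 4 => if ![i, j, k, l] a = b then (1 : ℝ) else 0)
  rw [Equiv.Perm.sign_swap (by decide)] at this
  have h2 : leviCivita j i k l = (Matrix.submatrix
    (Matrix.of fun a b : Fin 4 => if ![i, j, k, l] a = b then (1 : ℝ) else 0)
      (Equiv.swap (0 : Fin 4) 1) id).det := by
    rw [leviCivita]; congr 1; ext a b; fin_cases a <;> rfl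
  rw [h2, this, leviCivita]; simp

lemma leviCivita_swap₂₃ (i j k l : Fin 4) : leviCivita i j k l = - leviCivita i k j l := by
  have := Matrix.det_permute (Equiv.swap (1 : Fin 4) 2)
    (Matrix.of fun a b : Fin 4 => if ![i, j, k, l] a = b then (1 : ℝ) else 0)
  rw [Equiv.Perm.sign_swap (by decide)] at this
  have h2 : leviCivita i k j l = (Matrix.submatrix
    (Matrix.of fun a b : Fin 4 => if ![i, j, k, l] a = b then (1 : ℝ) else 0)
      (Equiv.swap (1 : Fin 4) 2) id).det := by
    rw [leviCivita]; congr 1; ext a b; fin_cases a <;> rfl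
  rw [h2, this, leviCivita]; simp

lemma leviCivita_swap₃₄ (i j k l : Fin 4) : leviCivita i j k l = - leviCivita i j l k := by
  have := Matrix.det_permute (Equiv.swap (2 : Fin 4) 3)
    (Matrix.of fun a b : Fin 4 => if ![i, j, k, l] a = b then (1 : ℝ) else 0)
  rw [Equiv.Perm.sign_swap (by decide)] at this
  have h2 : leviCivita i j l k = (Matrix.submatrix
    (Matrix.of fun a b : Fin 4 => if ![i, j, k, l] a = b then (1 : ℝ) else 0)
      (Equiv.swap (2 : Fin 4) 3) id).det := by
    rw [leviCivita]; congr 1; ext a b; fin_cases a <;> rfl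
  rw [h2, this, leviCivita]; simp

lemma leviCivita_one : leviCivita 0 1 2 3 = 1 := by
  rw [leviCivita]
  have : (Matrix.of fun a b : Fin 4 => if ![0, 1, 2, 3] a = b then (1 : ℝ) else 0) = 1 := by
    ext a b; fin_cases a <;> rfl
  rw [this, Matrix.det_one]

lemma leviCivita_self₁₂ (i k l : Fin 4) : leviCivita i i k l = 0 := by
  have := leviCivita_swap₁₂ i i k l; linarith
lemma leviCivita_self₂₃ (i k l : Fin 4) : leviCivita i k k l = 0 := by
  have := leviCivita_swap₂₃ i k k l; linarith
lemma leviCivita_self₃₄ (i j k : Fin 4) : leviCivita i j k k = 0 := by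
  have := leviCivita_swap₃₄ i j k k; linarith
lemma leviCivita_self₁₃ (i j l : Fin 4) : leviCivita i j i l = 0 := by
  rw [leviCivita_swap₂₃, leviCivita_self₁₂, neg_zero]
lemma leviCivita_self₂₄ (i j k : Fin 4) : leviCivita i j k j = 0 := by
  rw [leviCivita_swap₃₄, leviCivita_self₂₃, neg_zero]
lemma leviCivita_self₁₄ (i j k : Fin 4) : leviCivita i j k i = 0 := by
  rw [leviCivita_swap₃₄, leviCivita_self₁₃, neg_zero]

/-- The matrix `∑_{pq} ε_{ijpq} M_{pq}`. -/
def dualMat (M : Mat4) : Mat4 :=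
  !![0, M 2 3 - M 3 2, M 3 1 - M 1 3, M 1 2 - M 2 1;
     M 3 2 - M 2 3, 0, M 0 3 - M 3 0, M 2 0 - M 0 2;
     M 1 3 - M 3 1, M 3 0 - M 0 3, 0, M 0 1 - M 1 0;
     M 2 1 - M 1 2, M 0 2 - M 2 0, M 1 0 - M 0 1, 0]

lemma sum_leviCivita_eq_dualMat (M : Mat4) (i j : Fin 4) :
    ∑ p, ∑ q, leviCivita i j p q * M p q = dualMat M i j := by
  have e0132 : leviCivita 0 1 3 2 = -1 := by rw [leviCivita_swap₃₄, leviCivita_one]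
  have e0213 : leviCivita 0 2 1 3 = -1 := by rw [leviCivita_swap₂₃, leviCivita_one]
  have e0231 : leviCivita 0 2 3 1 = 1 := by rw [leviCivita_swap₃₄, e0213, neg_neg]
  have e0312 : leviCivita 0 3 1 2 = 1 := by rw [leviCivita_swap₂₃, e0132, neg_neg]
  have e0321 : leviCivita 0 3 2 1 = -1 := by rw [leviCivita_swap₃₄, e0312]
  have f : ∀ a b c, leviCivita a 0 b c = - leviCivita 0 a b c := fun a b c => leviCivita_swap₁₂ _ _ _ _
  have f2 : ∀ a b c, leviCivita a b 0 c = leviCivita 0 a b c := fun a b c => by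
    rw [leviCivita_swap₂₃, f, neg_neg]
  have f3 : ∀ a b c, leviCivita a b c 0 = - leviCivita 0 a b c := fun a b c => by
    rw [leviCivita_swap₃₄, f2]
  fin_cases i <;> fin_cases j <;>
    simp [Fin.sum_univ_four, dualMat, leviCivita_self₁₂, leviCivita_self₂₃, leviCivita_self₃₄,
      leviCivita_self₁₃, leviCivita_self₂₄, leviCivita_self₁₄, f, f2, f3, leviCivita_one,
      e0132, e0213, e0231, e0312, e0321] <;> ring

/-! ### Algebra of the momentum in an orthonormal frame -/

/-- The matrices `S_{··k}` of the momentum in an orthonormal frame. -/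
def symbolMat (M : Mat4) : Mat4 := M - Mᵀ + dualMat M + M.trace • 1

lemma sum_sq_symbolMat (M : Mat4) :
    ∑ i, ∑ j, symbolMat M i j ^ 2 = 4 * ∑ i, ∑ j, symbolMat M i j * M i j := by
  simp only [symbolMat, Matrix.add_apply, Matrix.sub_apply, transpose_apply,
    Matrix.smul_apply, Matrix.trace, Matrix.diag, Fin.sum_univ_four, dualMat, of_apply,
    Matrix.cons_val', Matrix.cons_val_zero, Matrix.cons_val_one, Matrix.cons_val, smul_eq_mul,
    Matrix.one_apply]
  simp
  ring

lemma momentumAt_one (T : Fin 4 → Mat4) (S : Mat4) (i : Fin 4) :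
    momentumAt 1 1 T S i
      = ∑ j, ∑ k, symbolMat (Matrix.of fun a b => T a b k) i j * S j k := by
  have h3 : ∑ j, ∑ p, ∑ q, leviCivita i j p q * (T p * Sᵀ) q j
      = ∑ j, ∑ k, dualMat (Matrix.of fun a b => T a b k) i j * S j k := by
    refine sum_congr rfl fun j _ => ?_
    simp only [← sum_leviCivita_eq_dualMat, mul_apply, transpose_apply,
      mul_sum, sum_mul, of_apply]
    rw [sum_congr rfl fun _ _ => sum_comm, sum_comm]
    exact sum₂_congr fun _ _ =>
      sum_congr rfl fun _ _ => by ring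
  simp only [momentumAt, one_mul, mul_one, Matrix.transpose_one, div_one, h3, symbolMat,
    Matrix.add_apply, Matrix.sub_apply, add_mul, sub_mul, sum_add_distrib,
    sum_sub_distrib]
  congr 1
  · congr 2
    · simp [Matrix.one_apply]
    · simp [Matrix.one_apply, mul_apply]
  · simp only [Matrix.smul_apply, Matrix.one_apply, smul_eq_mul, mul_ite, mul_one, mul_zero,
      ite_mul, zero_mul, Matrix.trace, Matrix.diag, of_apply]
    rw [sum_comm]
    simp [mul_comm]

/-- The nonnegative first order quantity `|C⁺|² + |div h|²`. -/
def firstOrder (T : Fin 4 → Mat4) : ℝ := ∑ i, momentumAt 1 1 T (T i) i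

lemma firstOrder_eq (T : Fin 4 → Mat4) : firstOrder T
    = (1 / 4 : ℝ) * ∑ k, ∑ i, ∑ j, symbolMat (Matrix.of fun a b => T a b k) i j ^ 2 := by
  simp only [firstOrder, momentumAt_one, sum_sq_symbolMat, ← mul_sum, of_apply]
  rw [sum_comm (s := Finset.univ) (t := Finset.univ)
    (f := fun k i => ∑ j, symbolMat (Matrix.of fun a b => T a b k) i j * T i j k)]
  rw [← mul_assoc]
  norm_num
  exact sum_congr rfl fun i _ => sum_comm

lemma firstOrder_nonneg (T : Fin 4 → Mat4) : 0 ≤ firstOrder T := by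
  rw [firstOrder_eq]; positivity

lemma sq_momentumAt_le (T : Fin 4 → Mat4) (S : Mat4) (ξ : Fin 4 → ℝ) :
    (∑ i, ξ i * momentumAt 1 1 T S i) ^ 2
      ≤ 4 * firstOrder T * (∑ j, ∑ k, S j k * S j k) * ∑ i, ξ i * ξ i := by
  have h1 : ∑ i, ξ i * momentumAt 1 1 T S i = ∑ x : Fin 4 × Fin 4 × Fin 4,
      symbolMat (Matrix.of fun a b => T a b x.2.2) x.1 x.2.1 * (ξ x.1 * S x.2.1 x.2.2) := by
    simp only [momentumAt_one, Fintype.sum_prod_type, mul_sum]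
    exact sum₂_congr fun _ _ =>
      sum_congr rfl fun _ _ => by ring
  have h2 : ∑ x : Fin 4 × Fin 4 × Fin 4,
      symbolMat (Matrix.of fun a b => T a b x.2.2) x.1 x.2.1 ^ 2 = 4 * firstOrder T := by
    rw [firstOrder_eq, ← mul_assoc]
    norm_num
    simp only [Fintype.sum_prod_type]
    rw [sum_congr rfl fun _ _ => sum_comm, sum_comm]
  have h3 : ∑ x : Fin 4 × Fin 4 × Fin 4, (ξ x.1 * S x.2.1 x.2.2) ^ 2
      = (∑ j, ∑ k, S j k * S j k) * ∑ i, ξ i * ξ i := by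
    rw [mul_comm, sum_mul]
    simp only [Fintype.sum_prod_type, mul_sum]
    exact sum₂_congr fun _ _ =>
      sum_congr rfl fun _ _ => by ring
  rw [h1, mul_assoc, ← h3, ← h2]
  exact Finset.sum_mul_sq_le_sq_mul_sq _ _ _

end

section

/-! ### The divergence of the momentum -/

/-- The momentum vector field of a 2-tensor field `H`. -/
def momentum (G H : E4 → Mat4) (i : Fin 4) (y : E4) : ℝ :=
  momentumAt (G y)⁻¹ (volDensity G y) (fun a => cov G H a y) (H y) i

/-- The quadratic form `∑ ε^{jqip} R_{ipkl} A_j^k A_q^l / 2`. -/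
def starAt (Gi : Mat4) (d : ℝ) (Rm : Fin 4 → Fin 4 → Mat4) (A : Mat4) : ℝ :=
  (1 / d) * ((1 / 2 : ℝ) * ∑ j, ∑ q, ∑ i, ∑ p, leviCivita j q i p *
    (A * Gi * Rm i p * Giᵀ * Aᵀ) j q)

/-- The matrix `R_{ip··}`. -/
def riemMat (G : E4 → Mat4) (i p : Fin 4) (y : E4) : Mat4 :=
  Matrix.of fun k l => riemann G i p k l y

/-- The zeroth order term of the Weitzenböck formula. -/
def zerothForm (G : E4 → Mat4) (Λ : ℝ) (A : Mat4) (y : E4) : ℝ :=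
  - Λ * tensorInner (G y) A A - tensorInner (G y) (curvAction G (fun _ => A) y) A
    + starAt (G y)⁻¹ (volDensity G y) (fun i p => riemMat G i p y) A

variable {U V : Set E4} {Φ : E4 → E4} {G G' H H' : E4 → Mat4}

lemma CoordChange.volDensity_pull (_h : CoordChange U V Φ)
    (hG' : ∀ y ∈ U, G' y = pull Φ G y) {y : E4} (hy : y ∈ U) (hd : 0 < (jac Φ y).det) :
    volDensity G' y = (jac Φ y).det * volDensity G (Φ y) := by
  rw [volDensity, volDensity, hG' y hy, pull, det_mul, det_mul, det_transpose,
    show (jac Φ y).det * (G (Φ y)).det * (jac Φ y).det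
      = (jac Φ y).det ^ 2 * (G (Φ y)).det by ring, Real.sqrt_mul (sq_nonneg _),
    Real.sqrt_sq hd.le]

lemma CoordChange.momentum_pull (h : CoordChange U V Φ) (hG : MetricOn V G)
    (hG' : ∀ y ∈ U, G' y = pull Φ G y) (hH : SmoothMat V H)
    (hH' : ∀ y ∈ U, H' y = pull Φ H y) {y : E4} (hy : y ∈ U) (hd : 0 < (jac Φ y).det)
    (m : Fin 4) :
    ∑ i, jac Φ y m i * momentum G' H' i y = momentum G H m (Φ y) :=
  momentumAt_conj (h.jac_mul_inv_mul hG' hy) ((h.metricOn_pull hG hG').inv_symm hy)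
    hd.ne' (h.volDensity_pull hG' hy hd) (fun i => h.cov_pull hG hG' hH hH' hy i) (hH' y hy) m

lemma starAt_conj {J : Mat4} {Gi Gi' A A' : Mat4} {d d' : ℝ}
    {Rm Rm' : Fin 4 → Fin 4 → Mat4} (hGi : J * Gi' * Jᵀ = Gi)
    (hdet : J.det ≠ 0) (hd : d' = J.det * d)
    (hR : ∀ i p, Rm' i p = Jᵀ * (∑ a, ∑ b, (J a i * J b p) • Rm a b) * J)
    (hA : A' = Jᵀ * A * J) : starAt Gi' d' Rm' A' = starAt Gi d Rm A := by
  obtain ⟨Z, hZ⟩ : ∃ Z : Fin 4 → Fin 4 → Mat4,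
      ∀ i p, Z i p = A * Gi * Rm i p * Giᵀ * Aᵀ := ⟨_, fun _ _ => rfl⟩
  obtain ⟨Z', hZ'⟩ : ∃ Z : Fin 4 → Fin 4 → Mat4,
      ∀ i p, Z i p = A' * Gi' * Rm' i p * Gi'ᵀ * A'ᵀ := ⟨_, fun _ _ => rfl⟩
  have hZZ : ∀ i p, Z' i p = Jᵀ * (∑ a, ∑ b, (J a i * J b p) • Z a b) * J := by
    intro i p
    simp only [hZ, hZ', hA, hR, ← hGi, transpose_mul, transpose_transpose,
      sum_mul, mul_sum, mul_smul_comm, smul_mul_assoc, mul_assoc]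
  have key : ∑ j, ∑ q, ∑ i, ∑ p, leviCivita j q i p * Z' i p j q
      = J.det * ∑ j, ∑ q, ∑ i, ∑ p, leviCivita j q i p * Z i p j q := by
    have e : ∀ i p j q, Z' i p j q
        = ∑ c, ∑ n, ∑ a, ∑ b, J c j * J n q * J a i * J b p * Z a b c n := by
      intro i p j q
      rw [hZZ, conj_apply]
      simp only [Matrix.sum_apply, Matrix.smul_apply, smul_eq_mul, mul_sum]
      exact sum₂_congr fun _ _ =>
        sum₂_congr fun _ _ => by ring
    have hc := sum_comm (s := Finset.univ) (t := Finset.univ)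
      (f := fun (x y : Fin 4 × Fin 4 × Fin 4 × Fin 4) =>
        leviCivita x.1 x.2.1 x.2.2.1 x.2.2.2 *
          (J y.1 x.1 * J y.2.1 x.2.1 * J y.2.2.1 x.2.2.1 * J y.2.2.2 x.2.2.2
            * Z y.2.2.1 y.2.2.2 y.1 y.2.1))
    simp only [Fintype.sum_prod_type] at hc
    simp only [e, mul_sum]
    rw [hc]
    refine sum₂_congr fun c n =>
      sum₂_congr fun a b => ?_
    rw [← mul_assoc, ← sum_leviCivita_mul]
    simp only [sum_mul]
    exact sum₂_congr fun _ _ =>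
        sum₂_congr fun _ _ => by ring
  simp only [starAt, ← hZ, ← hZ']
  rw [key, hd]
  field_simp

lemma CoordChange.riemMat_pull (h : CoordChange U V Φ) (hG : MetricOn V G)
    (hG' : ∀ y ∈ U, G' y = pull Φ G y) {y : E4} (hy : y ∈ U) (i p : Fin 4) :
    riemMat G' i p y = (jac Φ y)ᵀ *
      (∑ a, ∑ b, (jac Φ y a i * jac Φ y b p) • riemMat G a b (Φ y)) * jac Φ y := by
  ext k l
  rw [conj_apply]
  simp only [riemMat, of_apply, h.riemann_pull hG hG' hy, Matrix.sum_apply,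
    Matrix.smul_apply, smul_eq_mul, mul_sum]
  have hc := sum_comm (s := Finset.univ) (t := Finset.univ)
      (f := fun (x y' : Fin 4 × Fin 4) => jac Φ y x.1 i * jac Φ y x.2 p *
        (jac Φ y y'.1 k * jac Φ y y'.2 l * riemann G x.1 x.2 y'.1 y'.2 (Φ y)))
  simp only [Fintype.sum_prod_type] at hc
  rw [hc]
  exact sum₂_congr fun _ _ =>
    sum₂_congr fun _ _ => by ring

lemma CoordChange.zerothForm_pull (h : CoordChange U V Φ) (hG : MetricOn V G)
    (hG' : ∀ y ∈ U, G' y = pull Φ G y) {y : E4} (hy : y ∈ U) (hd : 0 < (jac Φ y).det)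
    (Λ : ℝ) (A : Mat4) :
    zerothForm G' Λ ((jac Φ y)ᵀ * A * jac Φ y) y = zerothForm G Λ A (Φ y) := by
  have hJ := h.isUnit y hy
  have e1 := h.curvAction_pull hG hG' (H := fun _ => A)
    (H' := fun _ => (jac Φ y)ᵀ * A * jac Φ y) (y := y) rfl hy
  rw [zerothForm, zerothForm, e1, pull, hG' y hy, pull, tensorInner_conj hJ, tensorInner_conj hJ]
  congr 1
  rw [← pull, ← hG' y hy]
  exact starAt_conj (h.jac_mul_inv_mul hG' hy) hd.ne' (h.volDensity_pull hG' hy hd)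
    (fun i p => h.riemMat_pull hG hG' hy i p) rfl

lemma MetricOn.smooth_momentum (hG : MetricOn U G) (hH : SmoothMat U H) (i : Fin 4) :
    ContDiffOn ℝ ∞ (momentum G H i) U := by
  have sT := fun a => hG.smooth_cov hH a
  have sI := hG.smooth_inv
  unfold momentum momentumAt
  refine ((ContDiffOn.sub ?_ ?_).add ?_).add ?_
  · exact ContDiffOn.sum fun a _ => (sI i a).mul (ContDiffOn.sum fun j _ =>
      ContDiffOn.sum fun k _ => (sT a j k).mul (((sI.mul hH).mul sI.transpose) j k))
  · exact ContDiffOn.sum fun b _ => ContDiffOn.sum fun j _ =>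
      ((sI.mul (((sT b).mul sI.transpose).mul hH.transpose)) i j).mul (sI b j)
  · refine ContDiffOn.mul (contDiffOn_const.div hG.smooth_volDensity
      fun y hy => (hG.volDensity_pos hy).ne') ?_
    exact ContDiffOn.sum fun j _ => ContDiffOn.sum fun p _ => ContDiffOn.sum fun q _ =>
      contDiffOn_const.mul ((((sT p).mul sI.transpose).mul hH.transpose) q j)
  · exact ContDiffOn.sum fun k _ => (((sI.mul hH).mul sI.transpose) i k).mul
      (ContDiffOn.sum fun a _ => ContDiffOn.sum fun b _ => (sT a b k).mul (sI a b))

lemma partialDeriv_momentumAt {Gi S : E4 → Mat4} {d : E4 → ℝ} {T : Fin 4 → E4 → Mat4} {y : E4}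
    {c : Fin 4} (hGi : DiffMat Gi y) (hd : DifferentiableAt ℝ d y) (hT : ∀ a, DiffMat (T a) y)
    (hS : DiffMat S y) (h1 : Gi y = 1) (h0 : dMat c Gi y = 0) (hd1 : d y = 1)
    (hd0 : partialDeriv c d y = 0) (i : Fin 4) :
    partialDeriv c (fun z => momentumAt (Gi z) (d z) (fun a => T a z) (S z) i) y
      = momentumAt 1 1 (fun a => dMat c (T a) y) (S y) i
        + momentumAt 1 1 (fun a => T a y) (dMat c S y) i := by
  have g0 : ∀ a b, partialDeriv c (fun z => Gi z a b) y = 0 := fun a b => congrFun (congrFun h0 a) b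
  have dR := (hGi.mul hS).mul hGi.transpose
  have dP := fun a => ((hT a).mul hGi.transpose).mul hS.transpose
  have dQ := fun a => hGi.mul (dP a)
  have eR : dMat c (fun z => Gi z * S z * (Gi z)ᵀ) y = dMat c S y := by
    rw [dMat_mul c (hGi.mul hS) hGi.transpose, dMat_mul c hGi hS, dMat_transpose, h0, h1]; simp
  have eP : ∀ a, dMat c (fun z => T a z * (Gi z)ᵀ * (S z)ᵀ) y
      = dMat c (T a) y * (S y)ᵀ + T a y * (dMat c S y)ᵀ := by
    intro a
    rw [dMat_mul c ((hT a).mul hGi.transpose) hS.transpose, dMat_mul c (hT a) hGi.transpose,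
      dMat_transpose, dMat_transpose, h0, h1]; simp
  have eQ : ∀ a, dMat c (fun z => Gi z * (T a z * (Gi z)ᵀ * (S z)ᵀ)) y
      = dMat c (T a) y * (S y)ᵀ + T a y * (dMat c S y)ᵀ := by
    intro a
    rw [dMat_mul c hGi (dP a), eP, h0, h1]; simp
  have eR' := fun j k => congrFun (congrFun eR j) k
  have eP' := fun a j k => congrFun (congrFun (eP a) j) k
  have eQ' := fun a j k => congrFun (congrFun (eQ a) j) k
  simp only [dMat, of_apply] at eR' eP' eQ'
  have t1 : ∀ a j k, DifferentiableAt ℝ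
      (fun z => T a z j k * (Gi z * S z * (Gi z)ᵀ) j k) y :=
    fun a j k => (hT a j k).mul (dR j k)
  have t1' : ∀ a, DifferentiableAt ℝ
      (fun z => ∑ j, ∑ k, T a z j k * (Gi z * S z * (Gi z)ᵀ) j k) y :=
    fun a => DifferentiableAt.fun_sum fun j _ => DifferentiableAt.fun_sum fun k _ => t1 a j k
  have t2 : ∀ b j, DifferentiableAt ℝ
      (fun z => (Gi z * (T b z * (Gi z)ᵀ * (S z)ᵀ)) i j * Gi z b j) y :=
    fun b j => (dQ b i j).mul (hGi b j)
  have t3 : ∀ j p q, DifferentiableAt ℝ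
      (fun z => leviCivita i j p q * (T p z * (Gi z)ᵀ * (S z)ᵀ) q j) y :=
    fun j p q => (dP p q j).const_mul _
  have t3' : DifferentiableAt ℝ (fun z => ∑ j, ∑ p, ∑ q,
      leviCivita i j p q * (T p z * (Gi z)ᵀ * (S z)ᵀ) q j) y :=
    DifferentiableAt.fun_sum fun j _ => DifferentiableAt.fun_sum fun p _ =>
      DifferentiableAt.fun_sum fun q _ => t3 j p q
  have t4 : ∀ a b k, DifferentiableAt ℝ (fun z => T a z b k * Gi z a b) y :=
    fun a b k => (hT a b k).mul (hGi a b)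
  have t4' : ∀ k, DifferentiableAt ℝ (fun z => ∑ a, ∑ b, T a z b k * Gi z a b) y :=
    fun k => DifferentiableAt.fun_sum fun j _ => DifferentiableAt.fun_sum fun p _ => t4 j p k
  have hne : d y ≠ 0 := by rw [hd1]; exact one_ne_zero
  have dd : DifferentiableAt ℝ (fun z => 1 / d z) y :=
    by simpa only [one_div] using hd.fun_inv hne
  have dd0 : partialDeriv c (fun z => 1 / d z) y = 0 := by
    have hφ : DifferentiableAt ℝ (fun x : ℝ => 1 / x) (d y) :=
      (differentiableAt_const (1 : ℝ)).fun_div differentiableAt_id hne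
    have := partialDeriv_comp_real (φ := fun x => 1 / x) c (f := d) (y := y) hφ hd
    rw [this, hd0, mul_zero]
  have s1 : DifferentiableAt ℝ (fun z => ∑ a, Gi z i a * ∑ j, ∑ k, T a z j k *
      (Gi z * S z * (Gi z)ᵀ) j k) y :=
    DifferentiableAt.fun_sum fun a _ => (hGi i a).mul (t1' a)
  have s2 : DifferentiableAt ℝ (fun z => ∑ b, ∑ j,
      (Gi z * (T b z * (Gi z)ᵀ * (S z)ᵀ)) i j * Gi z b j) y :=
    DifferentiableAt.fun_sum fun b _ => DifferentiableAt.fun_sum fun j _ => t2 b j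
  have s4 : DifferentiableAt ℝ (fun z => ∑ k, (Gi z * S z * (Gi z)ᵀ) i k *
      ∑ a, ∑ b, T a z b k * Gi z a b) y :=
    DifferentiableAt.fun_sum fun k _ => (dR i k).mul (t4' k)
  simp only [momentumAt]
  rw [partialDeriv_add c ((s1.fun_sub s2).fun_add (dd.fun_mul t3')) s4,
    partialDeriv_add c (s1.fun_sub s2) (dd.fun_mul t3'), partialDeriv_sub c s1 s2,
    partialDeriv_mul c dd t3', dd0, partialDeriv_sum _ _ fun a _ => (hGi i a).fun_mul (t1' a),
    partialDeriv_sum _ _ fun b _ => DifferentiableAt.fun_sum fun j _ => t2 b j,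
    partialDeriv_sum _ _ fun k _ => (dR i k).fun_mul (t4' k),
    partialDeriv_sum _ _ fun j _ => DifferentiableAt.fun_sum fun p _ =>
      DifferentiableAt.fun_sum fun q _ => t3 j p q]
  simp only [partialDeriv_mul c (hGi i _) (t1' _), partialDeriv_mul c (dR i _) (t4' _),
    partialDeriv_sum _ c fun j _ => t2 _ j, partialDeriv_mul c (dQ _ _ _) (hGi _ _),
    partialDeriv_sum _ c fun p _ => DifferentiableAt.fun_sum fun q _ => t3 _ p q,
    partialDeriv_sum _ c fun q _ => t3 _ _ q, partialDeriv_const_mul c _ (dP _ _ _),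
    partialDeriv_sum _ c fun j _ => DifferentiableAt.fun_sum fun k _ => t1 _ j k,
    partialDeriv_sum _ c fun k _ => t1 _ _ k, partialDeriv_mul c (hT _ _ _) (dR _ _),
    partialDeriv_sum _ c fun j _ => DifferentiableAt.fun_sum fun k _ => t4 j k _,
    partialDeriv_sum _ c fun k _ => t4 _ k _, partialDeriv_mul c (hT _ _ _) (hGi _ _),
    eR', eP', eQ', g0, h1, hd1]
  simp only [dMat, of_apply, zero_mul, zero_add, mul_zero, add_zero, one_mul, mul_one,
    Matrix.transpose_one, div_one, Matrix.add_apply, mul_add, add_mul, sum_add_distrib]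
  ring

end

section

variable {U V : Set E4} {Φ : E4 → E4} {G G' H H' : E4 → Mat4}

lemma sum_fin4_comm₃ (f : Fin 4 → Fin 4 → Fin 4 → ℝ) :
    ∑ i, ∑ j, ∑ k, f i j k = ∑ j, ∑ k, ∑ i, f i j k := by
  rw [sum_comm]
  exact sum_congr rfl fun _ _ => sum_comm

/-- The second order part of the divergence of the momentum, up to commutators. -/
lemma sum_momentumAt_one (D : Fin 4 → Fin 4 → Mat4) (S : Mat4) :
    ∑ i, momentumAt 1 1 (fun a => D i a) S i
      = ∑ j, ∑ k, (∑ i, D i i j k) * S j k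
        - ∑ i, ∑ b, ∑ k, (D i b - D b i) i k * S b k
        + (1 / 2 : ℝ) * ∑ i, ∑ j, ∑ p, ∑ q, leviCivita i j p q *
            ∑ k, (D i p - D p i) q k * S j k := by
  have e1 : ∑ i, ∑ j, ∑ k, D i i j k * S j k = ∑ j, ∑ k, (∑ i, D i i j k) * S j k := by
    rw [sum_fin4_comm₃]
    simp only [sum_mul]
  have e3 : ∑ i, ∑ j, ∑ p, ∑ q, leviCivita i j p q * ∑ k, (D i p - D p i) q k * S j k
      = 2 * ∑ i, ∑ j, ∑ p, ∑ q, leviCivita i j p q * ∑ k, D i p q k * S j k := by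
    have : ∑ i, ∑ j, ∑ p, ∑ q, leviCivita i j p q * ∑ k, D p i q k * S j k
        = - ∑ i, ∑ j, ∑ p, ∑ q, leviCivita i j p q * ∑ k, D i p q k * S j k := by
      have sw : ∀ i j p q, leviCivita i j p q = - leviCivita p j i q := fun i j p q => by
        rw [leviCivita_swap₁₂, leviCivita_swap₂₃, leviCivita_swap₁₂]; ring
      rw [sum_congr rfl fun i _ => sum_comm, sum_comm,
        sum_congr rfl fun i _ => sum_comm]
      simp only [← sum_neg_distrib]
      exact sum₂_congr fun i j =>
        sum₂_congr fun p q => by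
          rw [sw]; ring
    simp only [Matrix.sub_apply, sub_mul, sum_sub_distrib, mul_sub, this]
    ring
  have e2 : ∑ i, ∑ b, ∑ k, (D i b - D b i) i k * S b k
      = ∑ i, ∑ b, ∑ k, D i b i k * S b k - ∑ i, ∑ k, S i k * ∑ a, D i a a k := by
    simp only [Matrix.sub_apply, sub_mul, sum_sub_distrib]
    congr 1
    simp only [mul_sum]
    rw [sum_comm]
    refine sum_congr rfl fun _ _ => ?_
    rw [sum_comm]
    exact sum₂_congr fun _ _ => mul_comm _ _
  rw [e3, e2, ← e1]
  simp only [momentumAt, one_mul, mul_one, Matrix.transpose_one, div_one, sum_add_distrib,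
    sum_sub_distrib]
  simp only [Matrix.one_apply, mul_apply, transpose_apply, ite_mul, mul_ite, one_mul,
    zero_mul, mul_one, mul_zero, Finset.sum_ite_eq, Finset.mem_univ, if_true]
  ring

lemma MetricOn.divergence_momentum_of_normal (hG : MetricOn U G) (hH : SmoothMat U H) {y : E4}
    (hy : y ∈ U) (h1 : G y = 1) (hc : ∀ a, chr G a y = 0) {Λ : ℝ}
    (hE : ricci G y = Λ • G y) :
    divergence G (momentum G H) y
      = tensorInner (G y) (roughLaplacian G H y + (2 : ℝ) • curvAction G H y) (H y)
        + firstOrder (fun a => cov G H a y) + zerothForm G Λ (H y) y := by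
  have hi : (G y)⁻¹ = 1 := by rw [h1, inv_one]
  have hv : volDensity G y = 1 := by simp [volDensity, h1]
  have hv0 : ∀ a, partialDeriv a (volDensity G) y = 0 := fun a => by
    rw [hG.partialDeriv_volDensity hy]; simp [hc]
  have hi0 : ∀ a, dMat a (fun z => (G z)⁻¹) y = 0 := fun a => by rw [hG.dMat_inv_eq hy, hc]; simp
  have c1 : ∀ c a, dMat c (cov G H a) y = cov2 G H c a y := fun c a => by
    rw [cov2_eq]; simp [hc]
  have c0 : ∀ c, dMat c H y = cov G H c y := fun c => by rw [cov_eq]; simp [hc]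
  have hdiv : divergence G (momentum G H) y
      = ∑ i, momentumAt 1 1 (fun a => cov2 G H i a y) (H y) i
        + firstOrder (fun a => cov G H a y) := by
    have : ∀ i, partialDeriv i (momentum G H i) y
        = momentumAt 1 1 (fun a => cov2 G H i a y) (H y) i
          + momentumAt 1 1 (fun a => cov G H a y) (cov G H i y) i := fun i => by
      have := partialDeriv_momentumAt (c := i) (hG.smooth_inv.diffMat hG.isOpen hy)
        (differentiableAt_of_contDiffOn hG.smooth_volDensity hG.isOpen hy)
        (fun a => (hG.smooth_cov hH a).diffMat hG.isOpen hy) (hH.diffMat hG.isOpen hy) hi (hi0 i) hv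
        (hv0 i) i
      simp only [c1, c0] at this
      exact this
    rw [divergence_eq]
    simp only [this, hc, firstOrder, sum_add_distrib, Matrix.zero_apply, zero_mul,
      Finset.sum_const_zero, add_zero]
  have hR : ∀ a b k l, curv G a b y l k = riemann G a b k l y := fun a b k l => by
    rw [riemann_eq, h1, mul_one]; rfl
  have hRic : ∀ j k, ∑ i, riemann G i j k i y = if j = k then Λ else 0 := fun j k => by
    have := congrFun (congrFun hE j) k
    rw [hG.ricci_eq hy, hi] at this
    simpa [Matrix.one_apply, h1] using this
  have T2 : ∑ i, ∑ b, ∑ k, (cov2 G H i b y - cov2 G H b i y) i k * H y b k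
      = Λ * ∑ j, ∑ k, H y j k * H y j k
        - ∑ j, ∑ k, (∑ i, ∑ l, riemann G i j k l y * H y i l) * H y j k := by
    have p1 : ∑ i, ∑ b, ∑ k, (∑ l, riemann G i b i l y * H y l k) * H y b k
        = - (Λ * ∑ j, ∑ k, H y j k * H y j k) := by
      rw [sum_fin4_comm₃]
      simp only [mul_sum, ← sum_neg_distrib]
      refine sum₂_congr fun b k => ?_
      rw [← sum_mul, sum_comm]
      have : ∀ l, ∑ i, riemann G i b i l y * H y l k = - ((if b = l then Λ else 0) * H y l k) := by
        intro l
        rw [← hRic, sum_mul, ← sum_neg_distrib]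
        exact sum_congr rfl fun i _ => by rw [hG.riemann_antisymm' hy i b i l]; ring
      simp only [this, ite_mul, zero_mul, sum_neg_distrib, Finset.sum_ite_eq,
        Finset.mem_univ, if_true]
      ring
    have p2 : ∑ i, ∑ b, ∑ k, (∑ l, H y i l * riemann G i b k l y) * H y b k
        = ∑ j, ∑ k, (∑ i, ∑ l, riemann G i j k l y * H y i l) * H y j k := by
      rw [sum_fin4_comm₃]
      simp only [sum_mul]
      exact sum₂_congr fun _ _ =>
        sum₂_congr fun _ _ => by ring
    simp only [hG.cov2_comm hH hy, Matrix.neg_apply, Matrix.add_apply, mul_apply,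
      transpose_apply, hR, neg_mul, add_mul, sum_neg_distrib, sum_add_distrib,
      p1, p2]
    ring
  have T3 : ∑ i, ∑ j, ∑ p, ∑ q, leviCivita i j p q *
        ∑ k, (cov2 G H i p y - cov2 G H p i y) q k * H y j k
      = ∑ j, ∑ q, ∑ i, ∑ p, leviCivita j q i p *
        ∑ k, ∑ l, H y j k * riemann G i p k l y * H y q l := by
    have p1 : ∑ i, ∑ j, ∑ p, ∑ q, leviCivita i j p q *
        ∑ k, (∑ l, riemann G i p q l y * H y l k) * H y j k = 0 := by
      obtain ⟨Z, hZ⟩ : ∃ Z : Fin 4 → Fin 4 → Fin 4 → Fin 4 → ℝ, ∀ i j p q, Z i j p q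
        = ∑ k, (∑ l, riemann G i p q l y * H y l k) * H y j k := ⟨_, fun _ _ _ _ => rfl⟩
      simp only [← hZ]
      have hB : ∀ i j p q, Z i j p q + Z p j q i + Z q j i p = 0 := by
        intro i j p q
        simp only [hZ, ← sum_add_distrib, ← add_mul, hG.riemann_bianchi hy]
        simp
      have sw : ∀ i j p q, leviCivita i j p q = leviCivita p j q i := fun i j p q => by
        rw [leviCivita_swap₁₂, leviCivita_swap₂₃, leviCivita_swap₁₂, leviCivita_swap₃₄]; ring
      have cyc : ∀ f : Fin 4 → Fin 4 → Fin 4 → Fin 4 → ℝ,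
          ∑ i, ∑ j, ∑ p, ∑ q, f p j q i = ∑ i, ∑ j, ∑ p, ∑ q, f i j p q := fun f => by
        rw [sum_comm, sum_comm (f := fun i j => ∑ p, ∑ q, f i j p q)]
        exact sum_congr rfl fun j _ => sum_fin4_comm₃ (fun i p q => f p j q i)
      have r1 := cyc fun i j p q => leviCivita i j p q * Z i j p q
      have r2 := cyc fun i j p q => leviCivita p j q i * Z p j q i
      have r3 : ∑ i, ∑ j, ∑ p, ∑ q, (leviCivita i j p q * Z i j p q
          + leviCivita p j q i * Z p j q i + leviCivita q j i p * Z q j i p) = 0 :=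
        sum_eq_zero fun i _ => sum_eq_zero fun j _ => sum_eq_zero fun p _ =>
          sum_eq_zero fun q _ => by
            rw [← sw p j q i, ← sw i j p q, ← mul_add, ← mul_add, hB, mul_zero]
      simp only [sum_add_distrib] at r3
      linarith
    have p2 : ∑ i, ∑ j, ∑ p, ∑ q, leviCivita i j p q *
        ∑ k, (∑ l, H y q l * riemann G i p k l y) * H y j k
        = - ∑ j, ∑ q, ∑ i, ∑ p, leviCivita j q i p *
          ∑ k, ∑ l, H y j k * riemann G i p k l y * H y q l := by
      rw [sum_comm, ← sum_neg_distrib]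
      refine sum_congr rfl fun j _ => ?_
      rw [sum_fin4_comm₃ (fun q i p => leviCivita j q i p *
          ∑ k, ∑ l, H y j k * riemann G i p k l y * H y q l)]
      simp only [← sum_neg_distrib]
      refine sum₂_congr fun i p =>
        sum_congr rfl fun q _ => ?_
      rw [leviCivita_swap₁₂ i j, leviCivita_swap₃₄ j i, leviCivita_swap₂₃ j i q, neg_neg, neg_mul]
      congr 2
      simp only [sum_mul]
      exact sum₂_congr fun _ _ => by ring
    simp only [hG.cov2_comm hH hy, Matrix.neg_apply, Matrix.add_apply, mul_apply,
      transpose_apply, hR, neg_mul, add_mul, sum_neg_distrib, sum_add_distrib,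
      mul_add, mul_neg, p1, p2]
    ring
  rw [hdiv, sum_momentumAt_one, T2, T3]
  have hstar : starAt (G y)⁻¹ (volDensity G y) (fun i p => riemMat G i p y) (H y)
      = (1 / 2 : ℝ) * ∑ j, ∑ q, ∑ i, ∑ p, leviCivita j q i p *
        ∑ k, ∑ l, H y j k * riemann G i p k l y * H y q l := by
    simp only [starAt, hi, hv, mul_one, Matrix.transpose_one, div_one, one_mul]
    congr 1
    refine sum₂_congr fun j q =>
      sum₂_congr fun i p => ?_
    simp only [mul_apply, transpose_apply, sum_mul, riemMat, of_apply]
    rw [sum_comm]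
  have hrough : ∀ j k, roughLaplacian G H y j k = ∑ i, cov2 G H i i y j k := fun j k => by
    simp [roughLaplacian, hi, Matrix.one_apply, cov2]
  have hcurv : ∀ F : E4 → Mat4, ∀ j k, curvAction G F y j k
      = ∑ i, ∑ l, riemann G i j k l y * F y i l := fun F j k => by
    simp [curvAction, hi, Matrix.one_apply]
  rw [zerothForm, hstar, h1]
  simp only [tensorInner_one, Matrix.add_apply, Matrix.smul_apply, smul_eq_mul, hrough, hcurv,
    add_mul, sum_add_distrib, mul_assoc (2 : ℝ), ← mul_sum]
  ring

end

section

variable {U V : Set E4} {Φ : E4 → E4} {G G' H H' : E4 → Mat4}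

/-- The squared norm of a covector. -/
def covecSq (G : Mat4) (ξ : Fin 4 → ℝ) : ℝ := ∑ i, ∑ j, G⁻¹ i j * (ξ i * ξ j)

lemma sum_conj_covec (J N : Mat4) (ξ : Fin 4 → ℝ) :
    ∑ i, ∑ j, N i j * ((∑ a, J a i * ξ a) * (∑ b, J b j * ξ b))
      = ∑ a, ∑ b, (J * N * Jᵀ) a b * (ξ a * ξ b) := by
  simp only [mul_apply, transpose_apply, Fin.sum_univ_four]
  ring

lemma CoordChange.covecSq_pull (h : CoordChange U V Φ)
    (hG' : ∀ y ∈ U, G' y = pull Φ G y) {y : E4} (hy : y ∈ U) (ξ : Fin 4 → ℝ) :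
    covecSq (G' y) (fun i => ∑ a, jac Φ y a i * ξ a) = covecSq (G (Φ y)) ξ := by
  rw [covecSq, sum_conj_covec, h.jac_mul_inv_mul hG' hy]; rfl

lemma pull_add (Φ : E4 → E4) (A B : E4 → Mat4) (y : E4) :
    pull Φ A y + pull Φ B y = pull Φ (fun z => A z + B z) y := by
  simp only [pull]; noncomm_ring

lemma pull_smul (Φ : E4 → E4) (c : ℝ) (A : E4 → Mat4) (y : E4) :
    c • pull Φ A y = pull Φ (fun z => c • A z) y := by
  simp only [pull, mul_smul_comm, smul_mul_assoc]

lemma CoordChange.tensorInner_pull (h : CoordChange U V Φ)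
    {y : E4} (hy : y ∈ U) (G A B : E4 → Mat4) :
    tensorInner (pull Φ G y) (pull Φ A y) (pull Φ B y) = tensorInner (G (Φ y)) (A (Φ y)) (B (Φ y)) :=
  tensorInner_conj (h.isUnit y hy) _ _ _

/-- The Weitzenböck formula for the operator whose symbol is `symbolMat`, on an Einstein manifold. -/
lemma MetricOn.exists_divergence_momentum (hG : MetricOn V G) (hH : SmoothMat V H) {y : E4}
    (hy : y ∈ V) {Λ : ℝ} (hE : ricci G y = Λ • G y) :
    ∃ Q : ℝ, 0 ≤ Q ∧
      divergence G (momentum G H) y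
        = tensorInner (G y) (roughLaplacian G H y + (2 : ℝ) • curvAction G H y) (H y)
          + Q + zerothForm G Λ (H y) y ∧
      ∀ ξ : Fin 4 → ℝ, (∑ i, ξ i * momentum G H i y) ^ 2
        ≤ 4 * Q * tensorInner (G y) (H y) (H y) * covecSq (G y) ξ := by
  obtain ⟨U, Φ, h, h0, rfl, hdet, hn, hc⟩ := hG.exists_normal hy
  have hG' : ∀ y ∈ U, pull Φ G y = pull Φ G y := fun _ _ => rfl
  have hH' : ∀ y ∈ U, pull Φ H y = pull Φ H y := fun _ _ => rfl
  have hE' : ricci (pull Φ G) 0 = Λ • pull Φ G 0 := by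
    rw [h.ricci_pull hG hG' h0, pull_smul, pull, hE, pull]
  have hM := h.metricOn_pull hG hG'
  have hS := h.smooth_pull hH
  have key := hM.divergence_momentum_of_normal hS h0 hn hc hE'
  have hinv : (pull Φ G 0)⁻¹ = 1 := by rw [hn, inv_one]
  have hvol : volDensity (pull Φ G) 0 = 1 := by simp [volDensity, hn]
  have hcomp : ∀ y ∈ U, ∀ m, ∑ i, jac Φ y m i * momentum (pull Φ G) (pull Φ H) i y
      = momentum G H m (Φ y) := fun y hy m => h.momentum_pull hG hG' hH hH' hy (hdet y hy) m
  refine ⟨_, firstOrder_nonneg fun a => cov (pull Φ G) (pull Φ H) a 0, ?_, fun ξ => ?_⟩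
  · rw [← h.divergence_pull hG hG' (fun m => hG.smooth_momentum hH m)
      (fun m => hM.smooth_momentum hS m) hcomp h0, key, h.roughLaplacian_pull hG hG' hH hH' h0,
      h.curvAction_pull hG hG' (hH' 0 h0) h0, pull_smul, pull_add, h.tensorInner_pull h0]
    congr 1
    exact h.zerothForm_pull hG hG' h0 (hdet 0 h0) Λ _
  · have := sq_momentumAt_le (fun a => cov (pull Φ G) (pull Φ H) a 0) (pull Φ H 0)
      (fun i => ∑ a, jac Φ 0 a i * ξ a)
    have e1 : ∀ i, momentumAt 1 1 (fun a => cov (pull Φ G) (pull Φ H) a 0) (pull Φ H 0) i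
        = momentum (pull Φ G) (pull Φ H) i 0 := fun i => by rw [momentum, hinv, hvol]
    have e2 : ∑ i, (∑ a, jac Φ 0 a i * ξ a) * momentum (pull Φ G) (pull Φ H) i 0
        = ∑ i, ξ i * momentum G H i (Φ 0) := by
      simp only [← hcomp 0 h0, sum_mul, mul_sum]
      rw [sum_comm]
      exact sum₂_congr fun _ _ => by ring
    have e3 : ∑ i, (∑ a, jac Φ 0 a i * ξ a) * (∑ a, jac Φ 0 a i * ξ a) = covecSq (G (Φ 0)) ξ := by
      rw [← h.covecSq_pull hG' h0, covecSq, hinv]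
      simp [Matrix.one_apply]
    have e4 : tensorInner 1 (pull Φ H 0) (pull Φ H 0) = tensorInner (G (Φ 0)) (H (Φ 0)) (H (Φ 0)) := by
      rw [← hn, h.tensorInner_pull h0]
    rw [← tensorInner_one, e3, e4] at this
    simpa only [e1, e2] using this

lemma CoordChange.hodgeStar_pull (h : CoordChange U V Φ) 
    (hG' : ∀ y ∈ U, G' y = pull Φ G y) {y : E4} (hy : y ∈ U) (hd : 0 < (jac Φ y).det)
    (hGi : ((G (Φ y))⁻¹)ᵀ = (G (Φ y))⁻¹) (hGi' : ((G' y)⁻¹)ᵀ = (G' y)⁻¹) (w : Mat4) :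
    hodgeStar (G' y) ((jac Φ y)ᵀ * w * jac Φ y)
      = (jac Φ y)ᵀ * hodgeStar (G (Φ y)) w * jac Φ y := by
  have e : ∀ N w : Mat4, N⁻¹ᵀ = N⁻¹ → ∀ i j, hodgeStar N w i j = (1 / 2 : ℝ) * Real.sqrt N.det
      * ∑ k, ∑ l, leviCivita i j k l * (N⁻¹ * w * N⁻¹ᵀ) k l := by
    intro N w hN i j
    simp only [hodgeStar, of_apply]
    congr 1
    refine sum₂_congr fun k l => ?_
    simp only [mul_apply, transpose_apply, sum_mul, mul_sum]
    rw [sum_comm]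
    exact sum₂_congr fun _ _ => by ring
  have hv := h.volDensity_pull hG' hy hd
  rw [volDensity, volDensity] at hv
  have hr := h.raise_pull hG' w hy
  set J := jac Φ y with hJ
  obtain ⟨W', hW'⟩ : ∃ W', W' = (G' y)⁻¹ * (Jᵀ * w * J) * (G' y)⁻¹ᵀ := ⟨_, rfl⟩
  ext i j
  rw [e _ _ hGi', conj_apply, hv, ← hW']
  rw [← hW'] at hr
  simp only [e _ _ hGi, ← hr]
  have hL : ∀ p q, J.det * leviCivita i j p q
      = ∑ a, ∑ b, ∑ k, ∑ l, leviCivita a b k l * J a i * J b j * J k p * J l q := by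
    intro p q
    have := sum_leviCivita_mul Jᵀ i j p q
    rw [det_transpose] at this
    rw [← this]
    simp only [transpose_apply]
    exact sum₂_congr fun _ _ =>
      sum₂_congr fun _ _ => by ring
  have hW : ∀ k l, (J * W' * Jᵀ) k l = ∑ p, ∑ q, J k p * J l q * W' p q := fun k l => by
    have := conj_apply Jᵀ W' k l
    simpa only [transpose_transpose, transpose_apply] using this
  have hc := sum_comm (s := Finset.univ) (t := Finset.univ)
    (f := fun (x : Fin 4 × Fin 4) (z : Fin 4 × Fin 4 × Fin 4 × Fin 4) =>
      (leviCivita z.1 z.2.1 z.2.2.1 z.2.2.2 * J z.1 i * J z.2.1 j * J z.2.2.1 x.1 * J z.2.2.2 x.2)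
        * W' x.1 x.2)
  simp only [Fintype.sum_prod_type] at hc
  have e5 : J.det * ∑ k, ∑ l, leviCivita i j k l * W' k l
      = ∑ c, ∑ n, J c i * J n j * ∑ k, ∑ l, leviCivita c n k l * ∑ p, ∑ q, J k p * J l q * W' p q := by
    calc _ = ∑ p, ∑ q, (J.det * leviCivita i j p q) * W' p q := by
          simp only [mul_sum, mul_assoc]
      _ = _ := by
          simp only [hL, sum_mul]
          rw [hc]
          simp only [mul_sum]
          exact sum₂_congr fun _ _ =>
            sum₂_congr fun _ _ =>
            sum₂_congr fun _ _ => by ring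
  calc _ = (1 / 2 : ℝ) * √(G (Φ y)).det * (J.det * ∑ k, ∑ l, leviCivita i j k l * W' k l) := by ring
    _ = _ := by
      rw [e5]
      simp only [hW, mul_sum]
      exact sum₂_congr fun _ _ =>
        sum₂_congr fun _ _ =>
        sum₂_congr fun _ _ => by ring

lemma CoordChange.curvForm_pull (h : CoordChange U V Φ) (hG : MetricOn V G)
    (hG' : ∀ y ∈ U, G' y = pull Φ G y) {y : E4} (hy : y ∈ U) (w : Mat4) :
    curvForm G' y ((jac Φ y)ᵀ * w * jac Φ y) = curvForm G (Φ y) w := by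
  have hr := h.raise_pull hG' w hy
  rw [(h.metricOn_pull hG hG').inv_symm hy, hG.inv_symm (h.mapsTo hy)] at hr
  obtain ⟨W', hW'⟩ : ∃ W', W' = (G' y)⁻¹ * ((jac Φ y)ᵀ * w * jac Φ y) * (G' y)⁻¹ := ⟨_, rfl⟩
  rw [← hW'] at hr
  simp only [curvForm, ← hW', ← hr, h.riemann_pull hG hG' hy]
  obtain ⟨J, hJ⟩ : ∃ J, J = jac Φ y := ⟨_, rfl⟩
  rw [← hJ]
  have hW : ∀ k l, (J * W' * Jᵀ) k l = ∑ p, ∑ q, J k p * J l q * W' p q := fun k l => by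
    have := conj_apply Jᵀ W' k l
    simpa only [transpose_transpose, transpose_apply] using this
  have hc := sum_comm (s := Finset.univ) (t := Finset.univ)
    (f := fun (x z : Fin 4 × Fin 4 × Fin 4 × Fin 4) =>
      (J z.1 x.1 * J z.2.1 x.2.1) * (J z.2.2.1 x.2.2.1 * J z.2.2.2 x.2.2.2
        * riemann G z.1 z.2.1 z.2.2.1 z.2.2.2 (Φ y)) * W' x.1 x.2.1 * W' x.2.2.2 x.2.2.1)
  simp only [Fintype.sum_prod_type] at hc
  congr 1
  simp only [hW, sum_mul, mul_sum]
  rw [hc]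
  refine sum₂_congr fun a b =>
    sum₂_congr fun c d => ?_
  rw [sum₂_congr fun i j => sum_comm]
  have hc2 := sum_comm (s := Finset.univ) (t := Finset.univ)
    (f := fun (x z : Fin 4 × Fin 4) => riemann G a b c d (Φ y) * (J a z.1 * J b z.2 * W' z.1 z.2)
      * (J d x.1 * J c x.2 * W' x.1 x.2))
  simp only [Fintype.sum_prod_type] at hc2
  rw [hc2]
  exact sum₂_congr fun _ _ =>
    sum₂_congr fun _ _ => by ring

lemma CoordChange.rPlusNeg_pull (h : CoordChange U V Φ) (hG : MetricOn V G)
    (hG' : ∀ y ∈ U, G' y = pull Φ G y) {y : E4} (hy : y ∈ U) (hd : 0 < (jac Φ y).det)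
    (hR : RPlusNeg G (Φ y)) : RPlusNeg G' y := by
  intro w' hw hw0
  obtain ⟨w, rfl⟩ : ∃ w, w' = (jac Φ y)ᵀ * w * jac Φ y := by
    refine ⟨((jac Φ y)⁻¹)ᵀ * w' * (jac Φ y)⁻¹, ?_⟩
    simp only [← mul_assoc]
    rw [← transpose_mul, h.inv_mul hy, mul_assoc, h.inv_mul hy]; simp
  have cancel : ∀ A B : Mat4, (jac Φ y)ᵀ * A * jac Φ y = (jac Φ y)ᵀ * B * jac Φ y
      → A = B := by
    intro A B hAB
    have := congrArg (fun X => ((jac Φ y)⁻¹)ᵀ * X * (jac Φ y)⁻¹) hAB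
    simpa only [← mul_assoc, ← transpose_mul, h.mul_inv hy, Matrix.transpose_one, one_mul,
      mul_assoc _ (jac Φ y) (jac Φ y)⁻¹, mul_one] using this
  rw [h.curvForm_pull hG hG' hy]
  refine hR w ⟨cancel _ _ ?_, cancel _ _ ?_⟩ fun h0 => hw0 (by rw [h0]; simp)
  · have := hw.1
    rw [transpose_mul, transpose_mul, transpose_transpose] at this
    rw [mul_assoc, this]; simp
  · rw [← h.hodgeStar_pull hG' hy hd (hG.inv_symm (h.mapsTo hy))
      ((h.metricOn_pull hG hG').inv_symm hy), hw.2]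

end

section

/-- The algebraic symmetries of an Einstein curvature tensor in an orthonormal frame. -/
structure EinsteinTensor (Λ : ℝ) (r : Fin 4 → Fin 4 → Fin 4 → Fin 4 → ℝ) : Prop where
  anti₁₂ : ∀ i j k l, r i j k l = - r j i k l
  anti₃₄ : ∀ i j k l, r i j k l = - r i j l k
  pair : ∀ i j k l, r i j k l = r k l i j
  bianchi : ∀ i j k l, r i j k l + r j k i l + r k i j l = 0
  einstein : ∀ j k, ∑ i, r i j k i = if j = k then Λ else 0

/-- The selfdual 2-form with components `x y z`. -/
def sdMat (x y z : ℝ) : Mat4 := !![0, x, y, z; -x, 0, z, -y; -y, -z, 0, x; -z, y, -x, 0]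

/-- The curvature operator on selfdual forms. -/
def sdForm (r : Fin 4 → Fin 4 → Fin 4 → Fin 4 → ℝ) (x y z : ℝ) : ℝ :=
  -2 * ((r 0 1 0 1 + r 0 1 2 3) * x ^ 2 + (r 0 2 0 2 + r 0 2 3 1) * y ^ 2
    + (r 0 3 0 3 + r 0 3 1 2) * z ^ 2 + 2 * (r 0 1 0 2 + r 0 1 3 1) * x * y
    + 2 * (r 0 1 0 3 + r 0 1 1 2) * x * z + 2 * (r 0 2 0 3 + r 0 2 1 2) * y * z)

variable {Λ : ℝ} {r : Fin 4 → Fin 4 → Fin 4 → Fin 4 → ℝ}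

lemma EinsteinTensor.self₁₂ (h : EinsteinTensor Λ r) (i k l : Fin 4) : r i i k l = 0 := by
  linarith [h.anti₁₂ i i k l]

lemma EinsteinTensor.self₃₄ (h : EinsteinTensor Λ r) (i j k : Fin 4) : r i j k k = 0 := by
  linarith [h.anti₃₄ i j k k]

lemma EinsteinTensor.components (h : EinsteinTensor Λ r) :
    Λ = - (r 0 1 0 1 + r 0 2 0 2 + r 0 3 0 3) ∧ 
    r 2 3 2 3 = r 0 1 0 1 ∧ r 1 3 1 3 = r 0 2 0 2 ∧ r 1 2 1 2 = r 0 3 0 3 ∧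
    r 1 3 2 3 = - r 0 1 0 2 ∧ r 1 2 2 3 = r 0 1 0 3 ∧ r 1 2 1 3 = - r 0 2 0 3 ∧
    r 0 3 1 2 = - r 0 1 2 3 + r 0 2 1 3 ∧ 
    r 0 2 2 3 = - r 0 1 1 3 ∧ r 0 3 2 3 = r 0 1 1 2 ∧ r 0 3 1 3 = - r 0 2 1 2 := by
  have e := h.einstein
  simp only [Fin.sum_univ_four] at e
  have e00 := e 0 0
  have e11 := e 1 1
  have e22 := e 2 2
  have e33 := e 3 3
  have e01 := e 0 1
  have e02 := e 0 2
  have e03 := e 0 3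
  have e12 := e 1 2
  have e13 := e 1 3
  have e23 := e 2 3
  simp only [Fin.reduceEq, if_true, if_false, h.self₁₂, h.self₃₄, h.anti₁₂ 1 0, h.anti₁₂ 2 0, h.anti₁₂ 3 0,
    h.anti₁₂ 2 1, h.anti₁₂ 3 1, h.anti₁₂ 3 2, h.anti₃₄ _ _ 1 0, h.anti₃₄ _ _ 2 0, h.anti₃₄ _ _ 3 0,
    h.anti₃₄ _ _ 2 1, h.anti₃₄ _ _ 3 1, h.anti₃₄ _ _ 3 2] at e00 e11 e22 e33 e01 e02 e03 e12 e13 e23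
  have b := h.bianchi 0 1 2 3
  rw [h.pair 1 2 0 3, h.anti₁₂ 2 0] at b
  have p1 := h.pair 2 3 1 3
  have p2 := h.pair 2 3 1 2
  have p3 := h.pair 1 3 1 2
  refine ⟨?_, ?_, ?_, ?_, ?_, ?_, ?_, ?_, ?_, ?_, ?_⟩ <;> linarith


lemma EinsteinTensor.sum_sdMat (h : EinsteinTensor Λ r) (x y z : ℝ) :
    (1 / 4 : ℝ) * ∑ i, ∑ j, ∑ k, ∑ l, r i j k l * sdMat x y z i j * sdMat x y z l k
      = sdForm r x y z := by
  obtain ⟨e0, e1, e2, e3, e4, e5, e6, e7, e8, e9, e10⟩ := h.components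
  have p1 := h.pair 0 2 0 1
  have p2 := h.pair 0 3 0 1
  have p3 := h.pair 0 3 0 2
  simp only [Fin.sum_univ_four, sdMat, of_apply, Matrix.cons_val', Matrix.cons_val,
    Matrix.cons_val_fin_one, h.self₁₂,
    h.self₃₄, zero_mul, mul_zero, zero_add, add_zero]
  simp only [sdForm, h.anti₁₂ 1 0, h.anti₁₂ 2 0, h.anti₁₂ 3 0,
    h.anti₁₂ 2 1, h.anti₁₂ 3 1, h.anti₁₂ 3 2, h.anti₃₄ _ _ 1 0, h.anti₃₄ _ _ 2 0, h.anti₃₄ _ _ 3 0,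
    h.anti₃₄ _ _ 2 1, h.anti₃₄ _ _ 3 1, h.anti₃₄ _ _ 3 2, h.pair 1 2 0, h.pair 1 3 0, h.pair 2 3 0,
    h.pair 1 3 1 2, h.pair 2 3 1, p1, p2, p3, e1, e2, e3, e4, e5, e6, e7, e8, e9, e10]
  ring

/-- The trace-free part of a symmetric matrix determines three selfdual forms. -/
lemma EinsteinTensor.zeroth_eq (h : EinsteinTensor Λ r) {A : Mat4} (hA : Aᵀ = A) :
    - Λ * (∑ j, ∑ k, A j k * A j k) - ∑ j, ∑ k, (∑ i, ∑ l, r i j k l * A i l) * A j k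
      + (1 / 2 : ℝ) * ∑ j, ∑ q, ∑ i, ∑ p, leviCivita j q i p * ∑ k, ∑ l, A j k * r i p k l * A q l
    = - sdForm r ((A 0 0 + A 1 1 - A 2 2 - A 3 3) / 2) (A 1 2 + A 0 3) (A 1 3 - A 0 2)
      - sdForm r (A 1 2 - A 0 3) ((A 0 0 + A 2 2 - A 1 1 - A 3 3) / 2) (A 0 1 + A 2 3)
      - sdForm r (A 0 2 + A 1 3) (A 2 3 - A 0 1) ((A 0 0 + A 3 3 - A 1 1 - A 2 2) / 2)
      - Λ / 2 * A.trace ^ 2 := by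
  obtain ⟨e0, e1, e2, e3, e4, e5, e6, e7, e8, e9, e10⟩ := h.components
  have p1 := h.pair 0 2 0 1
  have p2 := h.pair 0 3 0 1
  have p3 := h.pair 0 3 0 2
  have hs : ∀ i j, A i j = A j i := fun i j => congrFun (congrFun hA j) i
  have hl : ∀ j q, ∑ i, ∑ p, leviCivita j q i p * ∑ k, ∑ l, A j k * r i p k l * A q l
      = dualMat (Matrix.of fun i p => ∑ k, ∑ l, A j k * r i p k l * A q l) j q := fun j q => by
    rw [← sum_leviCivita_eq_dualMat]; rfl
  simp only [hl]
  simp only [Fin.sum_univ_four, dualMat, of_apply, Matrix.cons_val', Matrix.cons_val,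
    Matrix.cons_val_fin_one, h.self₁₂,
    h.self₃₄, zero_mul, mul_zero, zero_add, add_zero, Matrix.trace, Matrix.diag]
  simp only [sdForm, hs 1 0, hs 2 0, hs 3 0, hs 2 1, hs 3 1, hs 3 2, h.anti₁₂ 1 0, h.anti₁₂ 2 0, h.anti₁₂ 3 0,
    h.anti₁₂ 2 1, h.anti₁₂ 3 1, h.anti₁₂ 3 2, h.anti₃₄ _ _ 1 0, h.anti₃₄ _ _ 2 0, h.anti₃₄ _ _ 3 0,
    h.anti₃₄ _ _ 2 1, h.anti₃₄ _ _ 3 1, h.anti₃₄ _ _ 3 2, h.pair 1 2 0, h.pair 1 3 0, h.pair 2 3 0,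
    h.pair 1 3 1 2, h.pair 2 3 1, p1, p2, p3, e1, e2, e3, e4, e5, e6, e7, e8, e9, e10, e0]
  ring

lemma sdMat_isSelfDual (x y z : ℝ) : IsSelfDual 1 (sdMat x y z) := by
  constructor
  · ext i j; fin_cases i <;> fin_cases j <;> simp [sdMat]
  · ext i j
    have : hodgeStar 1 (sdMat x y z) i j = (1 / 2 : ℝ) * dualMat (sdMat x y z) i j := by
      rw [← sum_leviCivita_eq_dualMat]
      simp [hodgeStar, Matrix.one_apply]
    rw [this]
    fin_cases i <;> fin_cases j <;> simp [sdMat, dualMat] <;> ring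

lemma sdMat_eq_zero {x y z : ℝ} (h : sdMat x y z = 0) : x = 0 ∧ y = 0 ∧ z = 0 := by
  have h1 := congrFun (congrFun h 0) 1
  have h2 := congrFun (congrFun h 0) 2
  have h3 := congrFun (congrFun h 0) 3
  simp [sdMat] at h1 h2 h3
  exact ⟨h1, h2, h3⟩

variable {U V : Set E4} {G : E4 → Mat4}

lemma MetricOn.einsteinTensor (hG : MetricOn U G) {y : E4} (hy : y ∈ U) (h1 : G y = 1)
    (hE : ricci G y = Λ • G y) : EinsteinTensor Λ (fun i j k l => riemann G i j k l y) where
  anti₁₂ i j k l := riemann_antisymm G i j k l y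
  anti₃₄ i j k l := hG.riemann_antisymm' hy i j k l
  pair i j k l := hG.riemann_pair_symm hy i j k l
  bianchi i j k l := hG.riemann_bianchi hy i j k l
  einstein j k := by
    have := congrFun (congrFun hE j) k
    rw [hG.ricci_eq hy, h1, inv_one] at this
    simpa [Matrix.one_apply] using this

lemma MetricOn.zerothForm_pos (hG : MetricOn V G) {y : E4} (hy : y ∈ V) (hΛ : Λ < 0)
    (hE : ricci G y = Λ • G y) (hR : RPlusNeg G y) {A : Mat4} (hA : Aᵀ = A) (hA0 : A ≠ 0) :
    0 < zerothForm G Λ A y := by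
  obtain ⟨U, Φ, h, h0, rfl, hdet, hn, -⟩ := hG.exists_normal hy
  have hG' : ∀ y ∈ U, pull Φ G y = pull Φ G y := fun _ _ => rfl
  have hM := h.metricOn_pull hG hG'
  have hE' : ricci (pull Φ G) 0 = Λ • pull Φ G 0 := by
    rw [h.ricci_pull hG hG' h0, pull_smul, pull, hE, pull]
  have hR' := h.rPlusNeg_pull hG hG' h0 (hdet 0 h0) hR
  have hT := hM.einsteinTensor h0 hn hE'
  rw [← h.zerothForm_pull hG hG' h0 (hdet 0 h0)]
  obtain ⟨B, hB⟩ : ∃ B, B = (jac Φ 0)ᵀ * A * jac Φ 0 := ⟨_, rfl⟩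
  have hBs : Bᵀ = B := by
    rw [hB, transpose_mul, transpose_mul, hA, transpose_transpose, mul_assoc]
  have hB0 : B ≠ 0 := by
    intro hB'
    have := congrArg (fun X => ((jac Φ 0)⁻¹)ᵀ * X * (jac Φ 0)⁻¹) (hB.symm.trans hB')
    simp only [← mul_assoc, ← transpose_mul, h.mul_inv h0, Matrix.transpose_one, one_mul,
      mul_assoc _ (jac Φ 0) (jac Φ 0)⁻¹, mul_one, mul_zero, zero_mul] at this
    exact hA0 this
  rw [← hB]
  have hi : (pull Φ G 0)⁻¹ = 1 := by rw [hn, inv_one]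
  have hsd : ∀ x y z, sdForm (fun i j k l => riemann (pull Φ G) i j k l 0) x y z ≤ 0 ∧
      (sdForm (fun i j k l => riemann (pull Φ G) i j k l 0) x y z = 0 → x = 0 ∧ y = 0 ∧ z = 0) := by
    intro x y z
    have e : curvForm (pull Φ G) 0 (sdMat x y z)
        = sdForm (fun i j k l => riemann (pull Φ G) i j k l 0) x y z := by
      rw [← hT.sum_sdMat, curvForm, hi]; simp
    by_cases hw : sdMat x y z = 0
    · obtain ⟨rfl, rfl, rfl⟩ := sdMat_eq_zero hw
      simp [sdForm]
    · have := hR' _ (by rw [hn]; exact sdMat_isSelfDual x y z) hw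
      rw [e] at this
      exact ⟨this.le, fun h => absurd h this.ne⟩
  have key := hT.zeroth_eq hBs
  have hz : zerothForm (pull Φ G) Λ B 0 = - Λ * (∑ j, ∑ k, B j k * B j k)
      - ∑ j, ∑ k, (∑ i, ∑ l, riemann (pull Φ G) i j k l 0 * B i l) * B j k
      + (1 / 2 : ℝ) * ∑ j, ∑ q, ∑ i, ∑ p, leviCivita j q i p *
        ∑ k, ∑ l, B j k * riemann (pull Φ G) i p k l 0 * B q l := by
    have hv : volDensity (pull Φ G) 0 = 1 := by simp [volDensity, hn]
    have hstar : starAt (pull Φ G 0)⁻¹ (volDensity (pull Φ G) 0) (fun i p => riemMat (pull Φ G) i p 0) B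
        = (1 / 2 : ℝ) * ∑ j, ∑ q, ∑ i, ∑ p, leviCivita j q i p *
          ∑ k, ∑ l, B j k * riemann (pull Φ G) i p k l 0 * B q l := by
      simp only [starAt, hi, hv, mul_one, Matrix.transpose_one, div_one, one_mul]
      congr 1
      refine sum₂_congr fun j q =>
        sum₂_congr fun i p => ?_
      simp only [mul_apply, transpose_apply, sum_mul, riemMat, of_apply]
      rw [sum_comm]
    have hcurv : ∀ j k, curvAction (pull Φ G) (fun _ => B) 0 j k
        = ∑ i, ∑ l, riemann (pull Φ G) i j k l 0 * B i l := fun j k => by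
      simp [curvAction, hi, Matrix.one_apply]
    rw [zerothForm, hstar, hn]
    simp only [tensorInner_one, hcurv]
  rw [hz, key]
  have s1 := hsd ((B 0 0 + B 1 1 - B 2 2 - B 3 3) / 2) (B 1 2 + B 0 3) (B 1 3 - B 0 2)
  have s2 := hsd (B 1 2 - B 0 3) ((B 0 0 + B 2 2 - B 1 1 - B 3 3) / 2) (B 0 1 + B 2 3)
  have s3 := hsd (B 0 2 + B 1 3) (B 2 3 - B 0 1) ((B 0 0 + B 3 3 - B 1 1 - B 2 2) / 2)
  by_contra hneg
  have hsq : 0 ≤ - Λ / 2 * B.trace ^ 2 := mul_nonneg (by linarith) (sq_nonneg _)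
  obtain ⟨a1, a2, a3⟩ := s1.2 (by linarith [s1.1, s2.1, s3.1])
  obtain ⟨b1, b2, b3⟩ := s2.2 (by linarith [s1.1, s2.1, s3.1])
  obtain ⟨c1, c2, c3⟩ := s3.2 (by linarith [s1.1, s2.1, s3.1])
  have ht : B.trace = 0 := by
    have : - Λ / 2 * B.trace ^ 2 = 0 := by linarith [s1.1, s2.1, s3.1]
    rcases mul_eq_zero.1 this with h | h
    · linarith
    · exact pow_eq_zero_iff (two_ne_zero) |>.1 h
  have hs : ∀ i j, B i j = B j i := fun i j => congrFun (congrFun hBs j) i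
  simp only [Matrix.trace, Matrix.diag, Fin.sum_univ_four] at ht
  refine hB0 ?_
  have h10 := hs 1 0
  have h20 := hs 2 0
  have h30 := hs 3 0
  have h21 := hs 2 1
  have h31 := hs 3 1
  have h32 := hs 3 2
  ext i j
  fin_cases i <;> fin_cases j <;> simp <;> linarith

end

section

variable {U V : Set E4} {G H : E4 → Mat4} {Λ : ℝ}

lemma tensorInner_smul_smul (G A B : Mat4) (a : ℝ) :
    tensorInner G (a • A) (a • B) = a ^ 2 * tensorInner G A B := by
  simp only [tensorInner, Matrix.smul_apply, smul_eq_mul, mul_sum]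
  exact sum₂_congr fun _ _ =>
    sum₂_congr fun _ _ => by ring

lemma zerothForm_smul (G : E4 → Mat4) (Λ a : ℝ) (A : Mat4) (y : E4) :
    zerothForm G Λ (a • A) y = a ^ 2 * zerothForm G Λ A y := by
  have h : curvAction G (fun _ => a • A) y = a • curvAction G (fun _ => A) y := by
    ext j k
    simp only [curvAction, of_apply, Matrix.smul_apply, smul_eq_mul, mul_sum]
    exact sum₂_congr fun _ _ =>
      sum₂_congr fun _ _ => by ring
  rw [zerothForm, h, tensorInner_smul_smul, tensorInner_smul_smul, zerothForm, starAt, starAt]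
  simp only [transpose_smul, Matrix.smul_mul, Matrix.mul_smul, Matrix.smul_apply,
    smul_eq_mul]
  have : ∀ f : Fin 4 → Fin 4 → Fin 4 → Fin 4 → ℝ,
      ∑ j, ∑ q, ∑ i, ∑ p, leviCivita j q i p * (a * (a * f j q i p))
        = a ^ 2 * ∑ j, ∑ q, ∑ i, ∑ p, leviCivita j q i p * f j q i p := fun f => by
    simp only [mul_sum]
    exact sum₂_congr fun _ _ =>
      sum₂_congr fun _ _ => by ring
  rw [this fun j q i p => (A * (G y)⁻¹ * riemMat G i p y * ((G y)⁻¹)ᵀ * Aᵀ) j q]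
  ring

lemma MetricOn.tensorInner_pos (hG : MetricOn U G) {y : E4} (hy : y ∈ U) {A : Mat4} (hA : A ≠ 0) :
    0 < tensorInner (G y) A A := by
  obtain ⟨J, hJ, hJ1⟩ := exists_frame (hG.posDef y hy)
  have hJu : IsUnit J.det := hJ.ne'.isUnit
  rw [← tensorInner_conj hJu, hJ1, tensorInner_one]
  have hne : Jᵀ * A * J ≠ 0 := by
    intro h0
    have := congrArg (fun X => (J⁻¹)ᵀ * X * J⁻¹) h0
    simp only [← mul_assoc, ← transpose_mul, mul_nonsing_inv _ hJu,
      Matrix.transpose_one, one_mul, mul_assoc _ J J⁻¹, mul_one, mul_zero, zero_mul] at this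
    exact hA this
  by_contra hle
  have h0 : ∑ i, ∑ j, (Jᵀ * A * J) i j * (Jᵀ * A * J) i j = 0 :=
    le_antisymm (not_lt.1 hle) (sum_nonneg fun _ _ => sum_nonneg fun _ _ =>
      mul_self_nonneg _)
  refine hne (Matrix.ext fun i j => ?_)
  have h1 := (Finset.sum_eq_zero_iff_of_nonneg fun _ _ => sum_nonneg fun _ _ =>
      mul_self_nonneg _).1 h0 i (Finset.mem_univ _)
  have h2 := (Finset.sum_eq_zero_iff_of_nonneg fun _ _ => mul_self_nonneg _).1 h1 j
    (Finset.mem_univ _)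
  exact mul_self_eq_zero.1 h2

lemma MetricOn.tensorInner_nonneg (hG : MetricOn U G) {y : E4} (hy : y ∈ U) (A : Mat4) :
    0 ≤ tensorInner (G y) A A := by
  rcases eq_or_ne A 0 with rfl | hA
  · simp [tensorInner]
  · exact (hG.tensorInner_pos hy hA).le

lemma MetricOn.continuousOn_tensorInner (hG : MetricOn U G) {B B' : E4 × Mat4 → Mat4}
    (hB : ∀ i j, ContinuousOn (fun p => B p i j) (U ×ˢ univ))
    (hB' : ∀ i j, ContinuousOn (fun p => B' p i j) (U ×ˢ univ)) :
    ContinuousOn (fun p : E4 × Mat4 => tensorInner (G p.1) (B p) (B' p)) (U ×ˢ univ) := by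
  have hm : MapsTo Prod.fst (U ×ˢ (univ : Set Mat4)) U := fun p hp => hp.1
  have hI : ∀ i j, ContinuousOn (fun p : E4 × Mat4 => (G p.1)⁻¹ i j) (U ×ˢ univ) :=
    fun i j => (hG.smooth_inv i j).continuousOn.comp continuousOn_fst hm
  exact continuousOn_finsetSum _ fun i _ => continuousOn_finsetSum _ fun j _ =>
    continuousOn_finsetSum _ fun k _ => continuousOn_finsetSum _ fun l _ =>
    (((hI i k).mul (hI j l)).mul (hB i j)).mul (hB' k l)

lemma MetricOn.continuousOn_zerothForm (hG : MetricOn U G) (Λ : ℝ) :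
    ContinuousOn (fun p : E4 × Mat4 => zerothForm G Λ p.2 p.1) (U ×ˢ univ) := by
  have hm : MapsTo Prod.fst (U ×ˢ (univ : Set Mat4)) U := fun p hp => hp.1
  have hR : ∀ i j k l, ContinuousOn (fun p : E4 × Mat4 => riemann G i j k l p.1) (U ×ˢ univ) :=
    fun i j k l => (hG.smooth_riemann i j k l).continuousOn.comp continuousOn_fst hm
  have hI : ∀ i j, ContinuousOn (fun p : E4 × Mat4 => (G p.1)⁻¹ i j) (U ×ˢ univ) :=
    fun i j => (hG.smooth_inv i j).continuousOn.comp continuousOn_fst hm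
  have hV : ContinuousOn (fun p : E4 × Mat4 => 1 / volDensity G p.1) (U ×ˢ univ) :=
    ((continuousOn_const.div hG.smooth_volDensity.continuousOn
      fun y hy => (hG.volDensity_pos hy).ne')).comp continuousOn_fst hm
  have hA : ∀ i j, ContinuousOn (fun p : E4 × Mat4 => p.2 i j) (U ×ˢ univ) :=
    fun i j => (continuous_snd.matrix_elem i j).continuousOn
  have hmul : ∀ {P Q : E4 × Mat4 → Mat4},
      (∀ i j, ContinuousOn (fun p => P p i j) (U ×ˢ univ)) →
      (∀ i j, ContinuousOn (fun p => Q p i j) (U ×ˢ univ)) →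
      ∀ i j, ContinuousOn (fun p => (P p * Q p) i j) (U ×ˢ univ) := by
    intro P Q hP hQ i j
    simp only [mul_apply]
    exact continuousOn_finsetSum _ fun a _ => (hP i a).mul (hQ a j)
  have hC : ∀ i j, ContinuousOn
      (fun p : E4 × Mat4 => curvAction G (fun _ => p.2) p.1 i j) (U ×ˢ univ) := fun i j => by
    simp only [curvAction, of_apply]
    exact continuousOn_finsetSum _ fun a _ => continuousOn_finsetSum _ fun b _ =>
      continuousOn_finsetSum _ fun c _ => continuousOn_finsetSum _ fun d _ =>
      (((hR a i j b).mul (hI a c)).mul (hI b d)).mul (hA c d)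
  refine ((continuousOn_const.mul (hG.continuousOn_tensorInner hA hA)).sub
    (hG.continuousOn_tensorInner hC hA)).add (hV.mul (continuousOn_const.mul ?_))
  exact continuousOn_finsetSum _ fun j _ => continuousOn_finsetSum _ fun q _ =>
    continuousOn_finsetSum _ fun i _ => continuousOn_finsetSum _ fun p _ =>
    continuousOn_const.mul (hmul (hmul (hmul (hmul hA hI) (Q := fun z => riemMat G i p z.1)
      fun a b => hR i p a b) (Q := fun z => ((G z.1)⁻¹)ᵀ) fun a b => hI b a)
      (Q := fun z => z.2ᵀ) (fun a b => hA b a) j q)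

lemma covecSq_nonneg {G : Mat4} (hG : G.PosDef) (ξ : Fin 4 → ℝ) : 0 ≤ covecSq G ξ := by
  obtain ⟨J, hJ, hJ1⟩ := exists_frame hG
  have h1 := conj_inv (G := G) hJ.ne'.isUnit
  rw [hJ1, inv_one] at h1
  rw [covecSq, ← h1, ← sum_conj_covec]
  simp only [Matrix.one_apply, ite_mul, one_mul, zero_mul, Finset.sum_ite_eq, Finset.mem_univ,
    if_true]
  exact sum_nonneg fun _ _ => mul_self_nonneg _

/-- Local uniform positivity of the zeroth order term. -/
lemma MetricOn.exists_zerothForm_ge (hG : MetricOn U G) {y₀ : E4} (hy₀ : y₀ ∈ U)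
    (hpos : ∀ A : Mat4, Aᵀ = A → A ≠ 0 → 0 < zerothForm G Λ A y₀) :
    ∃ c > 0, ∀ᶠ y in 𝓝 y₀, ∀ A : Mat4, Aᵀ = A →
      c * tensorInner (G y) A A ≤ zerothForm G Λ A y := by
  let K : Set Mat4 := {A | Aᵀ = A ∧ ∑ i, ∑ j, A i j * A i j = 1}
  have hK : IsCompact K := by
    have hsub : K ⊆ Set.pi univ fun _ : Fin 4 => Set.pi univ fun _ : Fin 4 => Icc (-1 : ℝ) 1 := by
      rintro A ⟨-, hA⟩ i - j -
      have h1 : A i j * A i j ≤ 1 := by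
        rw [← hA]
        exact (Finset.single_le_sum (f := fun j => A i j * A i j) (fun _ _ => mul_self_nonneg _)
          (Finset.mem_univ j)).trans (Finset.single_le_sum (f := fun i => ∑ j, A i j * A i j)
          (fun _ _ => sum_nonneg fun _ _ => mul_self_nonneg _) (Finset.mem_univ i))
      constructor <;> nlinarith
    refine IsCompact.of_isClosed_subset (isCompact_univ_pi fun _ => isCompact_univ_pi fun _ =>
      isCompact_Icc) ?_ hsub
    refine (isClosed_eq (continuous_id.matrix_transpose) continuous_id).inter
      (isClosed_eq ?_ continuous_const)
    exact continuous_finsetSum _ fun i _ => continuous_finsetSum _ fun j _ =>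
      (continuous_id.matrix_elem i j).mul (continuous_id.matrix_elem i j)
  have hne : ∀ A ∈ K, A ≠ 0 := by
    rintro A ⟨-, hA⟩ rfl
    simp at hA
  have hnhds : ∀ A : Mat4, U ×ˢ (univ : Set Mat4) ∈ 𝓝 (y₀, A) := fun A =>
    (hG.isOpen.prod isOpen_univ).mem_nhds ⟨hy₀, mem_univ _⟩
  have hz := fun A => (hG.continuousOn_zerothForm Λ).continuousAt (hnhds A)
  have hA : ∀ i j, ContinuousOn (fun p : E4 × Mat4 => p.2 i j) (U ×ˢ univ) :=
    fun i j => (continuous_snd.matrix_elem i j).continuousOn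
  have ht := fun A => (hG.continuousOn_tensorInner hA hA).continuousAt (hnhds A)
  have hsec : ∀ A : Mat4, ContinuousAt (fun B : Mat4 => (y₀, B)) A := fun A => by fun_prop
  obtain ⟨c, hc, hcK⟩ : ∃ c > 0, ∀ A ∈ K, 0 < zerothForm G Λ A y₀ - c * tensorInner (G y₀) A A := by
    rcases K.eq_empty_or_nonempty with hKe | hKn
    · exact ⟨1, one_pos, by simp [hKe]⟩
    obtain ⟨A₁, hA₁, hmin⟩ := hK.exists_isMinOn hKn (f := fun A => zerothForm G Λ A y₀)
      fun A _ => ((hz A).comp (hsec A)).continuousWithinAt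
    obtain ⟨A₂, hA₂, hmax⟩ := hK.exists_isMaxOn hKn (f := fun A => tensorInner (G y₀) A A)
      fun A _ => ((ht A).comp (hsec A)).continuousWithinAt
    have hp := hpos A₁ hA₁.1 (hne _ hA₁)
    have hN := hG.tensorInner_nonneg hy₀ A₂
    refine ⟨zerothForm G Λ A₁ y₀ / (tensorInner (G y₀) A₂ A₂ + 1), by positivity, fun A hA => ?_⟩
    have h1 : zerothForm G Λ A₁ y₀ ≤ zerothForm G Λ A y₀ := hmin hA
    have h2 : tensorInner (G y₀) A A ≤ tensorInner (G y₀) A₂ A₂ := hmax hA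
    have h3 : zerothForm G Λ A₁ y₀ / (tensorInner (G y₀) A₂ A₂ + 1) * tensorInner (G y₀) A A
        < zerothForm G Λ A₁ y₀ := by
      rw [div_mul_eq_mul_div, div_lt_iff₀ (by positivity)]
      exact mul_lt_mul_of_pos_left (by linarith) hp
    linarith
  refine ⟨c, hc, ?_⟩
  have hev : ∀ᶠ y in 𝓝 y₀, ∀ A ∈ K, 0 < zerothForm G Λ A y - c * tensorInner (G y) A A := by
    refine hK.eventually_forall_of_forall_eventually fun A hA => ?_
    exact ((hz A).sub (continuousAt_const.mul (ht A))).eventually (lt_mem_nhds (hcK A hA))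
  filter_upwards [hev] with y hy A hA
  rcases eq_or_ne A 0 with rfl | hA0
  · have : zerothForm G Λ 0 y = 0 := by simpa using zerothForm_smul G Λ 0 0 y
    simp [tensorInner, this]
  have hs : 0 < ∑ i, ∑ j, A i j * A i j := by
    rw [← tensorInner_one]
    have h1 : MetricOn univ (fun _ => (1 : Mat4)) :=
      ⟨isOpen_univ, fun i j => contDiffOn_const, fun _ _ => Matrix.PosDef.one⟩
    exact h1.tensorInner_pos (mem_univ (0 : E4)) hA0
  obtain ⟨s, hsd⟩ : ∃ s, s = Real.sqrt (∑ i, ∑ j, A i j * A i j) := ⟨_, rfl⟩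
  have hs0 : 0 < s := hsd ▸ Real.sqrt_pos.2 hs
  have hs2 : s ^ 2 = ∑ i, ∑ j, A i j * A i j := by rw [hsd, Real.sq_sqrt hs.le]
  have hB : s⁻¹ • A ∈ K := by
    refine ⟨by rw [transpose_smul, hA], ?_⟩
    rw [← tensorInner_one, tensorInner_smul_smul, tensorInner_one, ← hs2, inv_pow,
      inv_mul_cancel₀ (by positivity)]
  have := hy _ hB
  rw [zerothForm_smul, tensorInner_smul_smul] at this
  have hinv : 0 < s⁻¹ ^ 2 := by positivity
  have h4 : 0 < s⁻¹ ^ 2 * (zerothForm G Λ A y - c * tensorInner (G y) A A) := by linarith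
  exact (sub_pos.1 ((mul_pos_iff_of_pos_left hinv).1 h4)).le

lemma lichnerowicz_add_of_einstein {y : E4} (hd : IsUnit (G y).det) (hE : ricci G y = Λ • G y) :
    lichnerowicz G H y + (2 * Λ) • H y
      = roughLaplacian G H y + (2 : ℝ) • curvAction G H y := by
  rw [lichnerowicz, hE]
  simp only [Matrix.smul_mul, Matrix.mul_smul, mul_nonsing_inv _ hd, one_mul,
    mul_assoc (H y), nonsing_inv_mul _ hd, mul_one, two_mul, add_smul]
  abel

/-- The basic pointwise estimate. -/
lemma MetricOn.exists_divergence_bound (hG : MetricOn V G) (hH : SmoothMat V H) {y : E4}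
    (hy : y ∈ V) (hE : ricci G y = Λ • G y) (hs : (H y)ᵀ = H y) {c : ℝ}
    (hc : ∀ A : Mat4, Aᵀ = A → c * tensorInner (G y) A A ≤ zerothForm G Λ A y) (a : ℝ)
    (ξ : Fin 4 → ℝ) :
    a ^ 2 * tensorInner (G y) (lichnerowicz G H y + (2 * Λ) • H y) (H y)
      ≤ a ^ 2 * divergence G (momentum G H) y + 2 * a * ∑ i, ξ i * momentum G H i y
        - c * (a ^ 2 * tensorInner (G y) (H y) (H y))
        + 4 * (tensorInner (G y) (H y) (H y) * covecSq (G y) ξ) := by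
  obtain ⟨Q, hQ, hdiv, hξ⟩ := hG.exists_divergence_momentum hH hy hE
  have h1 := hξ ξ
  have h2 := hc _ hs
  rw [lichnerowicz_add_of_einstein (hG.isUnit hy) hE]
  set X := ∑ i, ξ i * momentum G H i y
  set N := tensorInner (G y) (H y) (H y)
  set D := covecSq (G y) ξ
  set L := tensorInner (G y) (roughLaplacian G H y + (2 : ℝ) • curvAction G H y) (H y)
  have h3 : 0 ≤ a ^ 2 * Q + 2 * a * X + 4 * (N * D) := by
    have hND : 0 ≤ 4 * Q * (N * D) := by nlinarith [sq_nonneg X]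
    rcases hQ.eq_or_lt with h0 | h0
    · have hX : X = 0 := by rw [← h0] at h1; exact pow_eq_zero_iff two_ne_zero |>.1 (le_antisymm (by linarith) (sq_nonneg X))
      rw [hX, ← h0]
      have hN : 0 ≤ N := hG.tensorInner_nonneg hy _
      have := mul_nonneg hN (covecSq_nonneg (hG.posDef y hy) ξ)
      linarith
    · have : 0 ≤ Q * (a ^ 2 * Q + 2 * a * X + 4 * (N * D)) := by nlinarith [sq_nonneg (a * Q + X)]
      exact nonneg_of_mul_nonneg_right this h0
  rw [hdiv]
  nlinarith [mul_le_mul_of_nonneg_left h2 (sq_nonneg a)]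

end

section

variable {M : Type*} [TopologicalSpace M] [ChartedSpace E4 M]

/-! ### Parametrizations of a manifold -/

/-- A smooth immersion of an open set of `ℝ⁴` into `M`. -/
structure IsParam (V : Set E4) (Ψ : E4 → M) : Prop where
  isOpen : IsOpen V
  smooth : ContMDiffOn (𝓡 4) (𝓡 4) ∞ Ψ V
  inj : ∀ y ∈ V, Function.Injective (mfderiv (𝓡 4) (𝓡 4) Ψ y)

variable {V : Set E4} {Ψ : E4 → M}

lemma IsParam.contMDiffAt (h : IsParam V Ψ) {y : E4} (hy : y ∈ V) :
    ContMDiffAt (𝓡 4) (𝓡 4) ∞ Ψ y :=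
  h.smooth.contMDiffAt (h.isOpen.mem_nhds hy)

lemma IsParam.mdifferentiableAt (h : IsParam V Ψ) {y : E4} (hy : y ∈ V) :
    MDifferentiableAt (𝓡 4) (𝓡 4) Ψ y :=
  (h.contMDiffAt hy).mdifferentiableAt (by simp)

lemma IsParam.mono (h : IsParam V Ψ) {W : Set E4} (hW : IsOpen W) (hWV : W ⊆ V) :
    IsParam W Ψ :=
  ⟨hW, h.smooth.mono hWV, fun y hy => h.inj y (hWV hy)⟩

lemma IsLocalDiffeomorphOn.isParam (h : IsLocalDiffeomorphOn (𝓡 4) (𝓡 4) ∞ Ψ V)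
    (hV : IsOpen V) : IsParam V Ψ where
  isOpen := hV
  smooth := h.contMDiffOn
  inj y hy := by
    have hn : (∞ : WithTop ℕ∞) ≠ 0 := by simp
    rw [← (h ⟨y, hy⟩).mfderivToContinuousLinearEquiv_coe hn]
    exact ((h ⟨y, hy⟩).mfderivToContinuousLinearEquiv hn).injective

lemma pullback_comp {e : E4 → M} {Φ : E4 → E4} {T : TensorField M} {y : E4}
    (he : MDifferentiableAt (𝓡 4) (𝓡 4) e (Φ y)) (hΦ : DifferentiableAt ℝ Φ y)
    (hΨ : Ψ =ᶠ[𝓝 y] fun z => e (Φ z)) (u v : E4) :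
    pullback Ψ T y u v = pullback e T (Φ y) (fderiv ℝ Φ y u) (fderiv ℝ Φ y v) := by
  have h1 : (mfderiv (𝓡 4) (𝓡 4) Ψ y : E4 →L[ℝ] E4)
      = (mfderiv (𝓡 4) (𝓡 4) e (Φ y) : E4 →L[ℝ] E4).comp (fderiv ℝ Φ y) := by
    have h2 := hΨ.mfderiv_eq (I := 𝓡 4) (I' := 𝓡 4)
    have h3 := mfderiv_comp (I := 𝓡 4) (I' := 𝓡 4) (I'' := 𝓡 4) y he hΦ.mdifferentiableAt
    rw [mfderiv_eq_fderiv] at h3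
    exact h2.trans h3
  have key : ∀ x x' : M, x = x' → ∀ a b : E4, T x a b = T x' a b := by rintro _ _ rfl a b; rfl
  have h4 : ∀ w : E4, (mfderiv (𝓡 4) (𝓡 4) Ψ y : E4 →L[ℝ] E4) w
      = (mfderiv (𝓡 4) (𝓡 4) e (Φ y) : E4 →L[ℝ] E4) (fderiv ℝ Φ y w) := fun w => by rw [h1]; rfl
  unfold pullback
  refine (key _ _ hΨ.self_of_nhds _ _).trans ?_
  congr 1
  · congr 1
    exact h4 u
  · exact h4 v

lemma bilin_sum_stdVec (B : E4 →L[ℝ] E4 →L[ℝ] ℝ) (L : E4 →L[ℝ] E4) (a b : Fin 4 → ℝ) :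
    B (L (∑ m, a m • stdVec m)) (L (∑ n, b n • stdVec n))
      = ∑ m, ∑ n, a m * b n * B (L (stdVec m)) (L (stdVec n)) := by
  simp only [map_sum, map_smul, sum_apply, smul_apply,
    smul_eq_mul, mul_sum]
  rw [sum_comm]
  exact sum₂_congr fun _ _ => by ring

lemma coords_comp {e : E4 → M} {Φ : E4 → E4} (T : TensorField M) {y : E4}
    (he : MDifferentiableAt (𝓡 4) (𝓡 4) e (Φ y)) (hΦ : DifferentiableAt ℝ Φ y)
    (hΨ : Ψ =ᶠ[𝓝 y] fun z => e (Φ z)) : coords Ψ T y = pull Φ (coords e T) y := by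
  ext i j
  rw [pull, conj_apply]
  simp only [coords, of_apply, pullback_comp he hΦ hΨ]
  rw [fderiv_stdVec_eq_sum_jac hΦ, fderiv_stdVec_eq_sum_jac hΦ]
  exact bilin_sum_stdVec (T (e (Φ y))) (mfderiv (𝓡 4) (𝓡 4) e (Φ y)) _ _

variable [IsManifold (𝓡 4) ∞ M]

lemma isParam_symm {e : OpenPartialHomeomorph M E4} (he : e ∈ atlas E4 M) :
    IsParam e.target e.symm where
  isOpen := e.open_target
  smooth := contMDiffOn_symm_of_mem_maximalAtlas (IsManifold.subset_maximalAtlas he)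
  inj y hy := by
    have h1 : MDifferentiableAt (𝓡 4) (𝓡 4) e.symm y :=
      ((contMDiffOn_symm_of_mem_maximalAtlas (n := ∞) (IsManifold.subset_maximalAtlas he)).contMDiffAt
        (e.open_target.mem_nhds hy)).mdifferentiableAt (by simp)
    have h2 : MDifferentiableAt (𝓡 4) (𝓡 4) e (e.symm y) :=
      ((contMDiffOn_of_mem_maximalAtlas (n := ∞) (IsManifold.subset_maximalAtlas he)).contMDiffAt
        (e.open_source.mem_nhds (e.map_target hy))).mdifferentiableAt (by simp)
    have h3 := mfderiv_comp (I := 𝓡 4) (I' := 𝓡 4) (I'' := 𝓡 4) y h2 h1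
    have h4 : (e ∘ e.symm) =ᶠ[𝓝 y] id :=
      Filter.eventually_of_mem (e.open_target.mem_nhds hy) fun z hz => e.right_inv hz
    rw [h4.mfderiv_eq (I := 𝓡 4) (I' := 𝓡 4)] at h3
    intro u v huv
    have h5 : ∀ w : E4, (mfderiv (𝓡 4) (𝓡 4) e (e.symm y) : E4 →L[ℝ] E4)
        ((mfderiv (𝓡 4) (𝓡 4) e.symm y : E4 →L[ℝ] E4) w) = w := fun w => by
      have := DFunLike.congr_fun h3 w
      rw [mfderiv_id] at this
      exact this.symm
    have h6 := congrArg (mfderiv (𝓡 4) (𝓡 4) e (e.symm y) : E4 →L[ℝ] E4) huv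
    exact (h5 u).symm.trans (h6.trans (h5 v))

omit [IsManifold (𝓡 4) ∞ M] in
lemma IsParam.isOpen_preimage (h : IsParam V Ψ) {W : Set M} (hW : IsOpen W) :
    IsOpen (V ∩ Ψ ⁻¹' W) :=
  h.smooth.continuousOn.isOpen_inter_preimage h.isOpen hW

omit [IsManifold (𝓡 4) ∞ M] in
lemma IsParam.eventuallyEq (h : IsParam V Ψ) (e : OpenPartialHomeomorph M E4) {y : E4}
    (hy : y ∈ V ∩ Ψ ⁻¹' e.source) : Ψ =ᶠ[𝓝 y] fun z => e.symm (e (Ψ z)) :=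
  Filter.eventually_of_mem ((h.isOpen_preimage e.open_source).mem_nhds hy)
    fun _ hz => (e.left_inv hz.2).symm

lemma IsParam.contDiffOn_chart (h : IsParam V Ψ) {e : OpenPartialHomeomorph M E4}
    (he : e ∈ atlas E4 M) : ContDiffOn ℝ ∞ (fun z => e (Ψ z)) (V ∩ Ψ ⁻¹' e.source) := by
  rw [← contMDiffOn_iff_contDiffOn]
  exact (contMDiffOn_of_mem_maximalAtlas (n := ∞) (IsManifold.subset_maximalAtlas he)).comp
    (h.smooth.mono inter_subset_left) fun z hz => hz.2

lemma IsParam.coords_eq_pull (h : IsParam V Ψ) {e : OpenPartialHomeomorph M E4}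
    (he : e ∈ atlas E4 M) (T : TensorField M) {y : E4} (hy : y ∈ V ∩ Ψ ⁻¹' e.source) :
    coords Ψ T y = pull (fun z => e (Ψ z)) (coords e.symm T) y :=
  coords_comp T ((isParam_symm he).mdifferentiableAt (e.map_source hy.2))
    (((h.contDiffOn_chart he).contDiffAt
      ((h.isOpen_preimage e.open_source).mem_nhds hy)).differentiableAt (by simp))
    (h.eventuallyEq e hy)

lemma IsParam.coordChange (h : IsParam V Ψ) {e : OpenPartialHomeomorph M E4}
    (he : e ∈ atlas E4 M) :
    CoordChange (V ∩ Ψ ⁻¹' e.source) e.target (fun z => e (Ψ z)) where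
  isOpen := h.isOpen_preimage e.open_source
  isOpen' := e.open_target
  smooth := h.contDiffOn_chart he
  mapsTo z hz := e.map_source hz.2
  isUnit y hy := by
    have hΦ : DifferentiableAt ℝ (fun z => e (Ψ z)) y := ((h.contDiffOn_chart he).contDiffAt
      ((h.isOpen_preimage e.open_source).mem_nhds hy)).differentiableAt (by simp)
    have h3 := mfderiv_comp (I := 𝓡 4) (I' := 𝓡 4) (I'' := 𝓡 4) y
      ((isParam_symm he).mdifferentiableAt (e.map_source hy.2)) hΦ.mdifferentiableAt
    rw [mfderiv_eq_fderiv] at h3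
    have h2 := (h.eventuallyEq e hy).mfderiv_eq (I := 𝓡 4) (I' := 𝓡 4)
    have hinj : Function.Injective (fderiv ℝ (fun z => e (Ψ z)) y) := by
      intro u v huv
      refine h.inj y hy.1 ?_
      have := h2.trans h3
      have h4 : ∀ w : E4, (mfderiv (𝓡 4) (𝓡 4) Ψ y : E4 →L[ℝ] E4) w
        = (mfderiv (𝓡 4) (𝓡 4) e.symm (e (Ψ y)) : E4 →L[ℝ] E4)
          (fderiv ℝ (fun z => e (Ψ z)) y w) := fun w => DFunLike.congr_fun this w
      exact (h4 u).trans ((congrArg _ huv).trans (h4 v).symm)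
    rw [← det_fderiv_eq_det_jac hΦ]
    exact LinearEquiv.isUnit_det' (LinearEquiv.ofInjectiveEndo _ hinj)

lemma IsParam.smooth_coords (h : IsParam V Ψ) (g : RMetric M) :
    SmoothMat V (coords Ψ g.inner) := by
  intro i j
  have hv : ∀ u : E4, ContMDiffOn (𝓡 4) ((𝓡 4).prod 𝓘(ℝ, E4)) ∞
      (fun y => (⟨Ψ y, mfderiv (𝓡 4) (𝓡 4) Ψ y u⟩ : TangentBundle (𝓡 4) M)) V := by
    intro u y hy
    have h1 := h.smooth.contMDiffOn_tangentMapWithin (m := ∞) (by simp)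
      h.isOpen.uniqueMDiffOn
    have h2 : ContMDiffOn (𝓡 4) ((𝓡 4).prod 𝓘(ℝ, E4)) ∞
        (fun y : E4 => (⟨y, u⟩ : TangentBundle (𝓡 4) E4)) V := by
      intro z hz
      exact contMDiffWithinAt_vectorSpace_iff_contDiffWithinAt.2 contDiffWithinAt_const
    have h3 : ∀ z ∈ V, (⟨Ψ z, mfderiv (𝓡 4) (𝓡 4) Ψ z u⟩ : TangentBundle (𝓡 4) M)
        = tangentMapWithin (𝓡 4) (𝓡 4) Ψ V ⟨z, u⟩ := fun z hz => by
      rw [tangentMapWithin, mfderivWithin_of_isOpen h.isOpen hz]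
    exact ((h1.comp h2 fun z hz => hz) y hy).congr h3 (h3 y hy)
  rw [← contMDiffOn_iff_contDiffOn]
  intro y hy
  have : ContMDiffWithinAt (𝓡 4) ((𝓡 4).prod 𝓘(ℝ)) ∞
      (fun m => Bundle.TotalSpace.mk' ℝ (E := Bundle.Trivial M ℝ) (Ψ m)
        (g.inner (Ψ m) (mfderiv (𝓡 4) (𝓡 4) Ψ m (stdVec i)) (mfderiv (𝓡 4) (𝓡 4) Ψ m (stdVec j)))) V y := by
    apply ContMDiffWithinAt.clm_bundle_apply₂ (F₁ := E4) (F₂ := E4)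
    · exact ContMDiffAt.comp_contMDiffWithinAt y g.contMDiff.contMDiffAt (h.smooth y hy)
    · exact hv (stdVec i) y hy
    · exact hv (stdVec j) y hy
  simp only [Bundle.contMDiffWithinAt_totalSpace] at this
  exact this.2

lemma IsParam.metricOn (h : IsParam V Ψ) (g : RMetric M) : MetricOn V (coords Ψ g.inner) where
  isOpen := h.isOpen
  smooth := h.smooth_coords g
  posDef y hy := by
    refine Matrix.PosDef.of_dotProduct_mulVec_pos ?_ fun x hx => ?_
    · ext i j
      exact g.symm _ _ _
    · have h0 : (∑ m, x m • stdVec m : E4) ≠ 0 := by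
        intro h0
        refine hx (funext fun i => ?_)
        have := congrArg (fun z : E4 => z i) h0
        simpa [stdVec_apply] using this
      have h1 : mfderiv (𝓡 4) (𝓡 4) Ψ y (∑ m, x m • stdVec m : E4) ≠ 0 := fun h1 =>
        h0 (h.inj y hy (h1.trans (map_zero _).symm))
      have h2 := g.pos (Ψ y) _ h1
      have h3 := bilin_sum_stdVec (g.inner (Ψ y)) (mfderiv (𝓡 4) (𝓡 4) Ψ y) x x
      refine lt_of_lt_of_eq h2 (h3.trans ?_)
      simp only [dotProduct, Matrix.mulVec, mul_sum, star_trivial, coords, of_apply]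
      refine sum₂_congr fun a b => ?_
      change x a * x b * pullback Ψ g.inner y (stdVec a) (stdVec b) = _
      ring

end

section

/-! ### Measures -/

lemma CoordChange.volDensity_abs {U V : Set E4} {Φ : E4 → E4} {G G' : E4 → Mat4}
    (_h : CoordChange U V Φ) (hG' : ∀ y ∈ U, G' y = pull Φ G y) {y : E4} (hy : y ∈ U) :
    volDensity G' y = |(jac Φ y).det| * volDensity G (Φ y) := by
  rw [volDensity, volDensity, hG' y hy, pull, det_mul, det_mul, det_transpose,
    show (jac Φ y).det * (G (Φ y)).det * (jac Φ y).det
      = (jac Φ y).det ^ 2 * (G (Φ y)).det by ring, Real.sqrt_mul (sq_nonneg _), Real.sqrt_sq_eq_abs]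

lemma CoordChange.exists_injOn {U V : Set E4} {Φ : E4 → E4} (h : CoordChange U V Φ) {y : E4}
    (hy : y ∈ U) : ∃ W, IsOpen W ∧ y ∈ W ∧ InjOn Φ W := by
  have hd := h.differentiableAt hy
  have hu := h.isUnit y hy
  rw [← det_fderiv_eq_det_jac hd] at hu
  have hd' : HasFDerivAt Φ
      ((LinearEquiv.ofIsUnitDet (v := (EuclideanSpace.basisFun (Fin 4) ℝ).toBasis)
        (v' := (EuclideanSpace.basisFun (Fin 4) ℝ).toBasis) (f := (fderiv ℝ Φ y : E4 →ₗ[ℝ] E4))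
        (by rw [toMatrix_fderiv_eq_jac hd]; exact h.isUnit y hy)).toContinuousLinearEquiv :
        E4 →L[ℝ] E4) y := by
    convert hd.hasFDerivAt using 1
    ext v; rfl
  have hc : ContDiffAt ℝ ∞ Φ y := h.smooth.contDiffAt (h.isOpen.mem_nhds hy)
  exact ⟨_, (hc.toOpenPartialHomeomorph Φ hd' (by simp)).open_source,
    hc.mem_toOpenPartialHomeomorph_source hd' (by simp),
    (hc.toOpenPartialHomeomorph Φ hd' (by simp)).injOn⟩

variable {M : Type*} [TopologicalSpace M] [ChartedSpace E4 M]

omit [ChartedSpace E4 M] in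
lemma measurableSet_chart_symm_image [MeasurableSpace M] [BorelSpace M]
    (e : OpenPartialHomeomorph M E4) {B : Set E4} (hB : MeasurableSet B) (hBt : B ⊆ e.target) :
    MeasurableSet (e.symm '' B) := by
  have h1 : e.symm '' B = e.source ∩ e ⁻¹' B := by
    rw [e.symm_image_eq_source_inter_preimage hBt]
  have h2 : Measurable (e.source.domRestrict e) :=
    (continuousOn_iff_continuous_domRestrict.1 e.continuousOn).measurable
  have h3 := (e.open_source.measurableSet.subtype_image (h2 hB))
  rw [h1]
  convert h3 using 1
  ext x
  simp [Set.domRestrict, and_comm]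

omit [ChartedSpace E4 M] in
lemma measurableSet_chart_image [MeasurableSpace M] [BorelSpace M]
    (e : OpenPartialHomeomorph M E4) {B : Set M} (hB : MeasurableSet B) (hBt : B ⊆ e.source) :
    MeasurableSet (e '' B) := by
  have h2 : Measurable (e.target.domRestrict e.symm) :=
    (continuousOn_iff_continuous_domRestrict.1 e.continuousOn_symm).measurable
  have h3 := (e.open_target.measurableSet.subtype_image (h2 hB))
  rw [e.image_eq_target_inter_inv_preimage hBt]
  convert h3 using 1
  ext x
  simp [Set.domRestrict, and_comm]

variable [IsManifold (𝓡 4) ∞ M] {V : Set E4} {Ψ : E4 → M} {g : RMetric M}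

lemma IsParam.lintegral_chart (h : IsParam V Ψ) (g : RMetric M)
    {e : OpenPartialHomeomorph M E4} (he : e ∈ atlas E4 M) {S : Set E4} (hS : MeasurableSet S)
    (hSV : S ⊆ V ∩ Ψ ⁻¹' e.source) (hi : InjOn Ψ S) :
    MeasurableSet ((fun z => e (Ψ z)) '' S) ∧
    ∫⁻ y in (fun z => e (Ψ z)) '' S, ENNReal.ofReal (volDensity (coords e.symm g.inner) y)
      = ∫⁻ y in S, ENNReal.ofReal (volDensity (coords Ψ g.inner) y) := by
  have hc := h.coordChange he
  have hinj : InjOn (fun z => e (Ψ z)) S := fun a ha b hb hab =>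
    hi ha hb (e.injOn (hSV ha).2 (hSV hb).2 hab)
  have hd : ∀ x ∈ S, HasFDerivWithinAt (fun z => e (Ψ z)) (fderiv ℝ (fun z => e (Ψ z)) x) S x :=
    fun x hx => (hc.differentiableAt (hSV hx)).hasFDerivAt.hasFDerivWithinAt
  refine ⟨measurable_image_of_fderivWithin hS hd hinj, ?_⟩
  rw [lintegral_image_eq_lintegral_abs_det_fderiv_mul volume hS hd hinj]
  refine setLIntegral_congr_fun hS fun x hx => ?_
  rw [hc.volDensity_abs (fun y hy => h.coords_eq_pull he g.inner hy) (hSV hx),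
    ENNReal.ofReal_mul (abs_nonneg _), det_fderiv_eq_det_jac (hc.differentiableAt (hSV hx))]

variable [MeasurableSpace M] [BorelSpace M] {μ : Measure M}

/-- A decomposition of the domain of a parametrization into pieces on which the measure is given by
the density. -/
lemma IsParam.exists_pieces (h : IsParam V Ψ) (hμ : IsRiemannianMeasure g μ) :
    ∃ D : ℕ → Set E4, (∀ n, MeasurableSet (D n)) ∧ Pairwise (Function.onFun Disjoint D) ∧
      ⋃ n, D n = V ∧ ∀ n, InjOn Ψ (D n) ∧ ∀ S ⊆ D n, MeasurableSet S →
        MeasurableSet (Ψ '' S) ∧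
        μ (Ψ '' S) = ∫⁻ y in S, ENNReal.ofReal (volDensity (coords Ψ g.inner) y) := by
  rcases V.eq_empty_or_nonempty with rfl | ⟨y₀, hy₀⟩
  · refine ⟨fun _ => ∅, by simp, fun _ _ _ => by simp [Function.onFun], by simp, fun n => ⟨by simp, ?_⟩⟩
    rintro S hS -
    obtain rfl := subset_empty_iff.1 hS
    simp
  have hW : ∀ y : V, ∃ W, IsOpen W ∧ (y : E4) ∈ W ∧
      W ⊆ V ∩ Ψ ⁻¹' (chartAt E4 (Ψ y)).source ∧ InjOn Ψ W := by
    rintro ⟨y, hy⟩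
    have hy' : y ∈ V ∩ Ψ ⁻¹' (chartAt E4 (Ψ y)).source := ⟨hy, mem_chart_source E4 (Ψ y)⟩
    obtain ⟨W, hWo, hyW, hWi⟩ := (h.coordChange (chart_mem_atlas E4 (Ψ y))).exists_injOn hy'
    refine ⟨W ∩ (V ∩ Ψ ⁻¹' (chartAt E4 (Ψ y)).source),
      hWo.inter (h.isOpen_preimage (chartAt E4 (Ψ y)).open_source), ⟨hyW, hy'⟩, inter_subset_right,
      fun a ha b hb hab => hWi ha.1 hb.1 (congrArg _ hab)⟩
  choose W hWo hyW hWV hWi using hW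
  obtain ⟨T, hT, hTU⟩ := TopologicalSpace.isOpen_iUnion_countable W hWo
  have hTV : ⋃ i ∈ T, W i = V := by
    rw [hTU]
    exact Subset.antisymm (iUnion_subset fun i => (hWV i).trans inter_subset_left)
      fun y hy => mem_iUnion.2 ⟨⟨y, hy⟩, hyW ⟨y, hy⟩⟩
  have hTn : T.Nonempty := by
    rw [← hTV] at hy₀
    obtain ⟨i, hi, -⟩ := mem_iUnion₂.1 hy₀
    exact ⟨i, hi⟩
  obtain ⟨f, rfl⟩ := hT.exists_eq_range hTn
  have hTV' : ⋃ n, W (f n) = V := by rw [← hTV, biUnion_range]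
  refine ⟨disjointed fun n => W (f n), fun n => MeasurableSet.disjointed
    (fun n => (hWo (f n)).measurableSet) n, disjoint_disjointed _, by rw [iUnion_disjointed, hTV'],
    fun n => ⟨(hWi (f n)).mono (disjointed_subset _ n), fun S hS hSm => ?_⟩⟩
  have hSW := hS.trans (disjointed_subset _ n)
  have he := chart_mem_atlas E4 (Ψ (f n))
  set e := chartAt E4 (Ψ (f n))
  have hSV : S ⊆ V ∩ Ψ ⁻¹' e.source := hSW.trans (hWV (f n))
  obtain ⟨hm, hl⟩ := h.lintegral_chart g he hSm hSV ((hWi (f n)).mono hSW)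
  have e1 : Ψ '' S = e.symm '' ((fun z => e (Ψ z)) '' S) := by
    rw [← image_comp]
    exact image_congr fun z hz => (e.left_inv (hSV hz).2).symm
  have e2 : e '' (Ψ '' S) = (fun z => e (Ψ z)) '' S := by rw [← image_comp]; rfl
  have hms : MeasurableSet (Ψ '' S) := by
    rw [e1]
    refine measurableSet_chart_symm_image e hm ?_
    rintro _ ⟨z, hz, rfl⟩
    exact e.map_source (hSV hz).2
  refine ⟨hms, ?_⟩
  rw [hμ e he _ hms (by rintro _ ⟨z, hz, rfl⟩; exact (hSV hz).2), e2]
  exact hl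

/-- The measure with density `√det g` on the domain of a parametrization. -/
def paramMeasure (g : RMetric M) (V : Set E4) (Ψ : E4 → M) : Measure E4 :=
  (volume.withDensity fun y => ENNReal.ofReal (volDensity (coords Ψ g.inner) y)).restrict V

lemma IsParam.aemeasurable (h : IsParam V Ψ) : AEMeasurable Ψ (paramMeasure g V Ψ) :=
  h.smooth.continuousOn.aemeasurable h.isOpen.measurableSet

lemma IsParam.map_eq_sum (h : IsParam V Ψ) {A : Set M}
    (hA : MeasurableSet A) {D : ℕ → Set E4} (hm : ∀ n, MeasurableSet (D n))
    (hdis : Pairwise (Function.onFun Disjoint D)) (hD : ⋃ n, D n = V)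
    (hDμ : ∀ n, ∀ S ⊆ D n, MeasurableSet S → μ (Ψ '' S)
      = ∫⁻ y in S, ENNReal.ofReal (volDensity (coords Ψ g.inner) y)) :
    (paramMeasure g V Ψ).map Ψ A = ∑' n, μ (Ψ '' (D n ∩ Ψ ⁻¹' A)) := by
  have hDV : ∀ n, D n ⊆ V := fun n => hD ▸ subset_iUnion D n
  have hmV : MeasurableSet (V ∩ Ψ ⁻¹' A) := by
    have h2 : Measurable (V.domRestrict Ψ) :=
      (continuousOn_iff_continuous_domRestrict.1 h.smooth.continuousOn).measurable
    have h3 := h.isOpen.measurableSet.subtype_image (h2 hA)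
    convert h3 using 1
    ext x
    simp [Set.domRestrict, and_comm]
  have hmn : ∀ n, MeasurableSet (D n ∩ Ψ ⁻¹' A) := fun n => by
    have : D n ∩ Ψ ⁻¹' A = D n ∩ (V ∩ Ψ ⁻¹' A) := by
      rw [← inter_assoc, inter_eq_self_of_subset_left (hDV n)]
    rw [this]
    exact (hm n).inter hmV
  rw [Measure.map_apply_of_aemeasurable h.aemeasurable hA, paramMeasure,
    Measure.restrict_apply' h.isOpen.measurableSet, inter_comm, withDensity_apply _ hmV,
    show V ∩ Ψ ⁻¹' A = ⋃ n, D n ∩ Ψ ⁻¹' A by rw [← hD, iUnion_inter],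
    lintegral_iUnion hmn fun i j hij => (hdis hij).mono inter_subset_left inter_subset_left]
  exact tsum_congr fun n => (hDμ n _ inter_subset_left (hmn n)).symm

lemma IsParam.restrict_le_map (h : IsParam V Ψ) (hμ : IsRiemannianMeasure g μ) :
    μ.restrict (Ψ '' V) ≤ (paramMeasure g V Ψ).map Ψ := by
  obtain ⟨D, hm, hdis, hD, hDμ⟩ := h.exists_pieces hμ
  refine Measure.le_iff.2 fun A hA => ?_
  rw [h.map_eq_sum hA hm hdis hD fun n S hS hSm => ((hDμ n).2 S hS hSm).2,
    Measure.restrict_apply hA]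
  refine (measure_mono ?_).trans (measure_iUnion_le _)
  rintro _ ⟨hxA, y, hy, rfl⟩
  rw [← hD] at hy
  obtain ⟨n, hn⟩ := mem_iUnion.1 hy
  exact mem_iUnion.2 ⟨n, y, ⟨hn, hxA⟩, rfl⟩

lemma IsParam.setLIntegral_image_le (h : IsParam V Ψ) (hμ : IsRiemannianMeasure g μ)
    {f : M → ENNReal} (hf : Measurable f) :
    ∫⁻ x in Ψ '' V, f x ∂μ
      ≤ ∫⁻ y in V, f (Ψ y) * ENNReal.ofReal (volDensity (coords Ψ g.inner) y) := by
  refine (lintegral_mono' (h.restrict_le_map hμ) le_rfl).trans ?_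
  rw [lintegral_map' hf.aemeasurable h.aemeasurable, paramMeasure,
    restrict_withDensity h.isOpen.measurableSet]
  have hd : AEMeasurable (fun y => ENNReal.ofReal (volDensity (coords Ψ g.inner) y))
      (volume.restrict V) :=
    ((h.metricOn g).smooth_volDensity.continuousOn.aemeasurable h.isOpen.measurableSet).ennreal_ofReal
  have hΨ : AEMeasurable Ψ (volume.restrict V) :=
    h.smooth.continuousOn.aemeasurable h.isOpen.measurableSet
  exact le_of_eq ((lintegral_withDensity_eq_lintegral_mul₀ hd (hf.comp_aemeasurable hΨ)).trans
    (lintegral_congr fun y => mul_comm _ _))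

/-- If the fibres of a parametrization of `M` have `N` elements, then the density pushes forward to
`N` times the Riemannian measure. -/
lemma IsParam.map_eq_smul (h : IsParam V Ψ) (hμ : IsRiemannianMeasure g μ) {N : ℕ}
    (hN : ∀ x : M, (V ∩ Ψ ⁻¹' {x}).encard = N) :
    (paramMeasure g V Ψ).map Ψ = (N : ENNReal) • μ := by
  obtain ⟨D, hm, hdis, hD, hDμ⟩ := h.exists_pieces hμ
  refine Measure.ext fun A hA => ?_
  rw [h.map_eq_sum hA hm hdis hD fun n S hS hSm => ((hDμ n).2 S hS hSm).2]
  have hmn : ∀ n, MeasurableSet (Ψ '' D n) := fun n => ((hDμ n).2 _ Subset.rfl (hm n)).1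
  have e1 : ∀ n, μ (Ψ '' (D n ∩ Ψ ⁻¹' A)) = ∫⁻ x in A, (Ψ '' D n).indicator 1 x ∂μ := fun n => by
    rw [lintegral_indicator_one (hmn n), Measure.restrict_apply (hmn n), image_inter_preimage]
  rw [tsum_congr e1, ← lintegral_tsum fun n => (measurable_one.indicator (hmn n)).aemeasurable]
  have e2 : ∀ x, ∑' n, (Ψ '' D n).indicator (1 : M → ENNReal) x = N := fun x => by
    have h1 : ∑' n, (Ψ '' D n).indicator (1 : M → ENNReal) x
        = ∑' n, {n | x ∈ Ψ '' D n}.indicator (1 : ℕ → ENNReal) n :=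
      tsum_congr fun n => by simp [indicator]
    rw [h1, ← tsum_subtype, Pi.one_def, ENNReal.tsum_set_one]
    have h2 : {n | x ∈ Ψ '' D n}.encard = (V ∩ Ψ ⁻¹' {x}).encard := by
      have hex : ∀ n ∈ {n | x ∈ Ψ '' D n}, ∃ y, y ∈ D n ∧ Ψ y = x := fun n hn => hn
      choose! y hyD hyx using hex
      have hinj : InjOn y {n | x ∈ Ψ '' D n} := fun a ha b hb hab => by
        by_contra hne
        exact (Set.disjoint_left.1 (hdis hne)) (hyD a ha) (hab ▸ hyD b hb)
      rw [← hinj.encard_image]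
      congr 1
      ext z
      constructor
      · rintro ⟨n, hn, rfl⟩
        exact ⟨hD ▸ mem_iUnion.2 ⟨n, hyD n hn⟩, hyx n hn⟩
      · rintro ⟨hzV, hzx⟩
        rw [← hD] at hzV
        obtain ⟨n, hn⟩ := mem_iUnion.1 hzV
        have hmem : n ∈ {n | x ∈ Ψ '' D n} := ⟨z, hn, hzx⟩
        exact ⟨n, hmem, (hDμ n).1 (hyD n hmem) hn ((hyx n hmem).trans (mem_singleton_iff.1 hzx).symm)⟩
    rw [h2, hN x]; rfl
  simp [e2]

/-- Existence of the Riemannian measure. -/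
lemma exists_isRiemannianMeasure [SecondCountableTopology M] (g : RMetric M) :
    ∃ μ : Measure M, IsRiemannianMeasure g μ := by
  rcases isEmpty_or_nonempty M with hM | ⟨⟨x₀⟩⟩
  · refine ⟨0, fun e he A hA hAe => ?_⟩
    obtain rfl : A = ∅ := eq_empty_of_isEmpty A
    simp
  obtain ⟨T, hT, hTU⟩ := TopologicalSpace.isOpen_iUnion_countable
    (fun x : M => (chartAt E4 x).source) fun x => (chartAt E4 x).open_source
  have hTuniv : ⋃ i ∈ T, (chartAt E4 i).source = univ := by
    rw [hTU]; exact eq_univ_of_forall fun x => mem_iUnion.2 ⟨x, mem_chart_source E4 x⟩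
  have hTn : T.Nonempty := by
    obtain ⟨i, hi, -⟩ := mem_iUnion₂.1 (hTuniv ▸ mem_univ x₀)
    exact ⟨i, hi⟩
  obtain ⟨f, rfl⟩ := hT.exists_eq_range hTn
  set A := disjointed fun n => (chartAt E4 (f n)).source with hAdef
  have hAs : ∀ n, A n ⊆ (chartAt E4 (f n)).source := fun n => disjointed_subset _ n
  have hAm : ∀ n, MeasurableSet (A n) := MeasurableSet.disjointed
    (fun n => (chartAt E4 (f n)).open_source.measurableSet)
  have hAd : Pairwise (Function.onFun Disjoint A) := disjoint_disjointed _
  have hAu : ⋃ n, A n = univ := by rw [iUnion_disjointed, ← hTuniv, biUnion_range]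
  let ν : ℕ → Measure M := fun n =>
    ((paramMeasure g (chartAt E4 (f n)).target (chartAt E4 (f n)).symm).map
      (chartAt E4 (f n)).symm).restrict (A n)
  refine ⟨Measure.sum ν, fun e he B hB hBe => ?_⟩
  have key : ∀ n, ν n B = ∫⁻ y in e '' (B ∩ A n),
      ENNReal.ofReal (volDensity (coords e.symm g.inner) y) := by
    intro n
    have hp := isParam_symm (chart_mem_atlas E4 (f n))
    set c := chartAt E4 (f n)
    have hBA : MeasurableSet (B ∩ A n) := hB.inter (hAm n)
    have hS : c.target ∩ c.symm ⁻¹' (B ∩ A n) = c '' (B ∩ A n) := by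
      rw [c.image_eq_target_inter_inv_preimage (inter_subset_right.trans (hAs n))]
    have hSm : MeasurableSet (c '' (B ∩ A n)) :=
      measurableSet_chart_image c hBA (inter_subset_right.trans (hAs n))
    rw [Measure.restrict_apply hB, Measure.map_apply_of_aemeasurable hp.aemeasurable hBA,
      paramMeasure, Measure.restrict_apply' hp.isOpen.measurableSet, inter_comm, hS,
      withDensity_apply _ hSm]
    have hSV : c '' (B ∩ A n) ⊆ c.target ∩ c.symm ⁻¹' e.source := by
      rintro _ ⟨x, hx, rfl⟩
      have hxc := hAs n hx.2
      exact ⟨c.map_source hxc, by rw [mem_preimage, c.left_inv hxc]; exact hBe hx.1⟩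
    rw [← (hp.lintegral_chart g he hSm hSV fun a ha b hb hab =>
      c.symm.injOn (hSV ha).1 (hSV hb).1 hab).2]
    congr 2
    rw [← image_comp]
    exact image_congr fun x hx => congrArg e (c.left_inv (hAs n hx.2))
  rw [Measure.sum_apply _ hB, tsum_congr key, ← lintegral_iUnion]
  · have : ⋃ n, e '' (B ∩ A n) = e '' B := by
      rw [← image_iUnion, ← inter_iUnion, hAu, inter_univ]
    rw [this]; rfl
  · exact fun n => measurableSet_chart_image e (hB.inter (hAm n)) (inter_subset_left.trans hBe)
  · intro i j hij
    refine Set.disjoint_left.2 ?_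
    rintro _ ⟨x, hx, rfl⟩ ⟨x', hx', hxx'⟩
    obtain rfl := e.injOn (hBe hx'.1) (hBe hx.1) hxx'
    exact Set.disjoint_left.1 (hAd hij) hx.2 hx'.2

end

section

/-! ### The divergence theorem -/

lemma integral_partialDeriv_eq_zero {f : E4 → ℝ} (hf : ContDiff ℝ 1 f) (hc : HasCompactSupport f)
    (i : Fin 4) : ∫ y, partialDeriv i f y = 0 := by
  have hcd : Continuous fun y => fderiv ℝ f y (stdVec i) :=
    (hf.continuous_fderiv (by simp)).clm_apply continuous_const
  have hcc : HasCompactSupport fun y => fderiv ℝ f y (stdVec i) :=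
    hc.fderiv_apply (𝕜 := ℝ) (stdVec i)
  have := integral_mul_fderiv_eq_neg_fderiv_mul_of_integrable (𝕜 := ℝ) (μ := (volume : Measure E4))
    (f := fun _ => (1 : ℝ)) (g := f) (v := stdVec i) (by simp)
    (by simpa using hcd.integrable_of_hasCompactSupport hcc)
    (by simpa using hf.continuous.integrable_of_hasCompactSupport hc)
    (fun x _ => differentiableAt_const _)
    (fun x _ => (hf.differentiable (by simp)) x)
  simpa [partialDeriv] using this

lemma contDiff_of_contDiffOn_of_support {U K : Set E4} (hU : IsOpen U) (hK : IsCompact K)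
    (hKU : K ⊆ U) {f : E4 → ℝ} {n : WithTop ℕ∞} (hf : ContDiffOn ℝ n f U)
    (h0 : ∀ y, y ∉ K → f y = 0) : ContDiff ℝ n f := by
  rw [contDiff_iff_contDiffAt]
  intro y
  by_cases hy : y ∈ K
  · exact hf.contDiffAt (hU.mem_nhds (hKU hy))
  · exact (contDiffAt_const (c := (0 : ℝ))).congr_of_eventuallyEq
      (Filter.eventually_of_mem (hK.isClosed.isOpen_compl.mem_nhds hy) fun z hz => h0 z hz)

lemma volDensity_nonneg (G : E4 → Mat4) (y : E4) : 0 ≤ volDensity G y := Real.sqrt_nonneg _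

lemma MetricOn.smooth_divergence {U : Set E4} {G : E4 → Mat4} (hG : MetricOn U G)
    {X : Fin 4 → E4 → ℝ} (hX : ∀ i, ContDiffOn ℝ ∞ (X i) U) :
    ContDiffOn ℝ ∞ (divergence G X) U := by
  have : divergence G X = fun y => ∑ i, partialDeriv i (X i) y + ∑ i, ∑ k, chr G i y i k * X k y :=
    funext fun y => divergence_eq G X y
  rw [this]
  exact (ContDiffOn.sum fun i _ => contDiffOn_partialDeriv (hX i) hG.isOpen i).add
    (ContDiffOn.sum fun i _ => ContDiffOn.sum fun k _ => (hG.smooth_chr i i k).mul (hX k))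

/-- The divergence theorem in a coordinate domain. -/
lemma MetricOn.setIntegral_divergence {U K : Set E4} {G : E4 → Mat4} (hG : MetricOn U G)
    {X : Fin 4 → E4 → ℝ} (hX : ∀ i, ContDiffOn ℝ ∞ (X i) U) {f : E4 → ℝ}
    (hf : ContDiffOn ℝ ∞ f U) (hK : IsCompact K) (hKU : K ⊆ U)
    (h0 : ∀ y ∈ U, y ∉ K → ∀ i, f y * X i y = 0) :
    ∫ y in U, (f y * divergence G X y + ∑ i, X i y * partialDeriv i f y) * volDensity G y = 0 := by
  let W : Fin 4 → E4 → ℝ := fun i => U.indicator fun y => (f y * X i y) * volDensity G y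
  have hW0 : ∀ i y, y ∉ K → W i y = 0 := fun i y hy => by
    by_cases hyU : y ∈ U
    · simp [W, hyU, h0 y hyU hy i]
    · simp [W, hyU]
  have hWs : ∀ i, ContDiff ℝ ∞ (W i) := fun i =>
    contDiff_of_contDiffOn_of_support hG.isOpen hK hKU
      (((hf.mul (hX i)).mul hG.smooth_volDensity).congr fun y hy => by simp [W, hy]) (hW0 i)
  have hWc : ∀ i, HasCompactSupport (W i) := fun i => HasCompactSupport.intro hK (hW0 i)
  have hWd : ∀ y ∈ U, ∑ i, partialDeriv i (W i) y
      = (f y * divergence G X y + ∑ i, X i y * partialDeriv i f y) * volDensity G y := by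
    intro y hy
    have hfd := differentiableAt_of_contDiffOn hf hG.isOpen hy
    have hXd := fun i => differentiableAt_of_contDiffOn (hX i) hG.isOpen hy
    rw [← divergence_mul G hfd hXd, hG.divergence_mul_volDensity hy fun i => hfd.fun_mul (hXd i)]
    exact sum_congr rfl fun i _ => partialDeriv_congr_on hG.isOpen hy i fun z hz => by
      simp [W, hz]
  have hWz : ∀ y ∉ U, ∑ i, partialDeriv i (W i) y = 0 := fun y hy =>
    sum_eq_zero fun i _ => by
      have hy' : y ∉ K := fun h => hy (hKU h)
      have : W i =ᶠ[𝓝 y] fun _ => 0 :=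
        Filter.eventually_of_mem (hK.isClosed.isOpen_compl.mem_nhds hy') fun z hz => hW0 i z hz
      rw [partialDeriv, this.fderiv_eq]; simp
  have hint : ∀ i, Integrable (partialDeriv i (W i)) := fun i =>
    Continuous.integrable_of_hasCompactSupport
      (((hWs i).continuous_fderiv (by simp)).clm_apply continuous_const)
      ((hWc i).fderiv_apply (𝕜 := ℝ) (stdVec i))
  calc _ = ∫ y in U, ∑ i, partialDeriv i (W i) y :=
        setIntegral_congr_fun hG.isOpen.measurableSet fun y hy => (hWd y hy).symm
    _ = ∫ y, ∑ i, partialDeriv i (W i) y :=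
        setIntegral_eq_integral_of_forall_compl_eq_zero fun y hy => hWz y hy
    _ = 0 := by
        rw [integral_finsetSum _ fun i _ => hint i]
        exact sum_eq_zero fun i _ =>
          integral_partialDeriv_eq_zero ((hWs i).of_le (by simp)) (hWc i) i

variable {M : Type*} [TopologicalSpace M] [ChartedSpace E4 M]

lemma continuous_of_charts {F : M → ℝ} (Fe : OpenPartialHomeomorph M E4 → E4 → ℝ)
    (h : ∀ e ∈ atlas E4 M, ∀ y ∈ e.target, F (e.symm y) = Fe e y)
    (hc : ∀ e ∈ atlas E4 M, ContinuousOn (Fe e) e.target) : Continuous F := by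
  rw [continuous_iff_continuousAt]
  intro x
  have he := chart_mem_atlas E4 x
  have hx := mem_chart_source E4 x
  set e := chartAt E4 x
  have h1 : ContinuousAt (fun z => Fe e (e z)) x :=
    ((hc e he).continuousAt (e.open_target.mem_nhds (e.map_source hx))).comp
      (e.continuousAt hx)
  refine h1.congr (Filter.eventually_of_mem (e.open_source.mem_nhds hx) fun z hz => ?_)
  simp only
  rw [← h e he _ (e.map_source hz), e.left_inv hz]

variable [IsManifold (𝓡 4) ∞ M] {g : RMetric M}

lemma contDiffOn_comp_symm {φ : M → ℝ} (hφ : ContMDiff (𝓡 4) 𝓘(ℝ, ℝ) ∞ φ)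
    {e : OpenPartialHomeomorph M E4} (he : e ∈ atlas E4 M) :
    ContDiffOn ℝ ∞ (fun y => φ (e.symm y)) e.target := by
  rw [← contMDiffOn_iff_contDiffOn]
  exact hφ.comp_contMDiffOn (isParam_symm he).smooth

/-- A smooth vector field on `M`, given by its components in the charts. -/
structure IsChartField (X : OpenPartialHomeomorph M E4 → Fin 4 → E4 → ℝ) : Prop where
  smooth : ∀ e ∈ atlas E4 M, ∀ i, ContDiffOn ℝ ∞ (X e i) e.target
  compat : ∀ e ∈ atlas E4 M, ∀ e' ∈ atlas E4 M, ∀ y ∈ e.target ∩ e.symm ⁻¹' e'.source, ∀ m,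
    ∑ i, jac (fun z => e' (e.symm z)) y m i * X e i y = X e' m (e' (e.symm y))

/-- The divergence of `φ X`. -/
def chartDiv (g : RMetric M) (X : OpenPartialHomeomorph M E4 → Fin 4 → E4 → ℝ) (φ : M → ℝ)
    (x : M) : ℝ :=
  φ x * divergence (coords (chartAt E4 x).symm g.inner) (X (chartAt E4 x)) (chartAt E4 x x)
    + ∑ i, X (chartAt E4 x) i (chartAt E4 x x)
      * partialDeriv i (fun z => φ ((chartAt E4 x).symm z)) (chartAt E4 x x)

variable {X : OpenPartialHomeomorph M E4 → Fin 4 → E4 → ℝ} {φ : M → ℝ}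

lemma partialDeriv_chart_change (hφ : ContMDiff (𝓡 4) 𝓘(ℝ, ℝ) ∞ φ)
    {e c : OpenPartialHomeomorph M E4} (he : e ∈ atlas E4 M) (hc : c ∈ atlas E4 M) {y : E4}
    (hy : y ∈ e.target ∩ e.symm ⁻¹' c.source) (i : Fin 4) :
    partialDeriv i (fun z => φ (e.symm z)) y
      = ∑ a, jac (fun z => c (e.symm z)) y a i
        * partialDeriv a (fun z => φ (c.symm z)) (c (e.symm y)) := by
  have h := (isParam_symm he).coordChange hc
  rw [← h.partialDeriv_comp (contDiffOn_comp_symm hφ hc) hy]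
  exact partialDeriv_congr_on h.isOpen hy i fun z hz => by simp only [c.left_inv hz.2]

lemma IsChartField.chartDiv_symm (hX : IsChartField X) (hφ : ContMDiff (𝓡 4) 𝓘(ℝ, ℝ) ∞ φ)
    {e : OpenPartialHomeomorph M E4} (he : e ∈ atlas E4 M) {y : E4} (hy : y ∈ e.target) :
    chartDiv g X φ (e.symm y) = φ (e.symm y) * divergence (coords e.symm g.inner) (X e) y
      + ∑ i, X e i y * partialDeriv i (fun z => φ (e.symm z)) y := by
  have hc := chart_mem_atlas E4 (e.symm y)
  have hyc := mem_chart_source E4 (e.symm y)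
  rw [chartDiv]
  set c := chartAt E4 (e.symm y)
  have hy' : y ∈ e.target ∩ e.symm ⁻¹' c.source := ⟨hy, hyc⟩
  have h := (isParam_symm he).coordChange hc
  rw [h.divergence_pull ((isParam_symm hc).metricOn g)
    (fun z hz => (isParam_symm he).coords_eq_pull hc g.inner hz) (hX.smooth c hc)
    (fun m => (hX.smooth e he m).mono inter_subset_left) (hX.compat e he c hc) hy']
  congr 1
  simp only [partialDeriv_chart_change hφ he hc hy', ← hX.compat e he c hc y hy', sum_mul,
    mul_sum]
  rw [sum_comm]
  exact sum₂_congr fun _ _ => by ring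

lemma IsChartField.continuous_chartDiv (hX : IsChartField X)
    (hφ : ContMDiff (𝓡 4) 𝓘(ℝ, ℝ) ∞ φ) : Continuous (chartDiv g X φ) := by
  refine continuous_of_charts (fun e y => φ (e.symm y) * divergence (coords e.symm g.inner) (X e) y
      + ∑ i, X e i y * partialDeriv i (fun z => φ (e.symm z)) y)
    (fun e he y hy => hX.chartDiv_symm hφ he hy) fun e he => ?_
  have hs := contDiffOn_comp_symm hφ he
  exact (hs.continuousOn.mul (((isParam_symm he).metricOn g).smooth_divergence
    (hX.smooth e he)).continuousOn).add (continuousOn_finsetSum _ fun i _ =>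
    (hX.smooth e he i).continuousOn.mul (contDiffOn_partialDeriv hs e.open_target i).continuousOn)

lemma chartDiv_eq_zero {x : M} (hx : x ∉ tsupport φ) : chartDiv g X φ x = 0 := by
  have hxc := mem_chart_source E4 x
  rw [chartDiv]
  set c := chartAt E4 x
  have h1 : φ =ᶠ[𝓝 x] 0 := notMem_tsupport_iff_eventuallyEq.1 hx
  have h2 : (fun z => φ (c.symm z)) =ᶠ[𝓝 (c x)] fun _ => 0 := by
    have := (c.continuousAt_symm (c.map_source hxc)).tendsto
    rw [c.left_inv hxc] at this
    exact this.eventually h1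
  rw [h1.self_of_nhds]
  simp [partialDeriv, h2.fderiv_eq]

lemma chartDiv_sum {ι : Type*} (s : Finset ι) {ψ : ι → M → ℝ}
    (hψ : ∀ i ∈ s, ContMDiff (𝓡 4) 𝓘(ℝ, ℝ) ∞ (ψ i)) (x : M) :
    chartDiv g X (fun x => ∑ i ∈ s, ψ i x) x = ∑ i ∈ s, chartDiv g X (ψ i) x := by
  have hxc := mem_chart_source E4 x
  have hc := chart_mem_atlas E4 x
  simp only [chartDiv]
  set c := chartAt E4 x
  have hd : ∀ i ∈ s, DifferentiableAt ℝ (fun z => ψ i (c.symm z)) (c x) := fun i hi =>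
    differentiableAt_of_contDiffOn (contDiffOn_comp_symm (hψ i hi) hc) c.open_target
      (c.map_source hxc)
  have hk : ∀ k, partialDeriv k (fun z => ∑ i ∈ s, ψ i (c.symm z)) (c x)
      = ∑ i ∈ s, partialDeriv k (fun z => ψ i (c.symm z)) (c x) := fun k =>
    partialDeriv_sum s k hd
  simp only [hk, sum_add_distrib, sum_mul, mul_sum]
  congr 1
  exact sum_comm

variable [MeasurableSpace M] [BorelSpace M] {μ : Measure M}

lemma IsRiemannianMeasure.isLocallyFiniteMeasure (hμ : IsRiemannianMeasure g μ) :
    IsLocallyFiniteMeasure μ := by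
  refine ⟨fun x => ?_⟩
  have he := chart_mem_atlas E4 x
  have hx := mem_chart_source E4 x
  set e := chartAt E4 x
  have hG := (isParam_symm he).metricOn g
  obtain ⟨r, hr, hrt⟩ := Metric.isOpen_iff.1 e.open_target (e x) (e.map_source hx)
  have hsub : Metric.closedBall (e x) (r / 2) ⊆ e.target :=
    (Metric.closedBall_subset_ball (by linarith)).trans hrt
  refine ⟨e.symm '' Metric.ball (e x) (r / 2), ?_, ?_⟩
  · refine (e.symm.isOpen_image_of_subset_source Metric.isOpen_ball
      (Metric.ball_subset_closedBall.trans hsub)).mem_nhds ⟨e x, Metric.mem_ball_self (by linarith), e.left_inv hx⟩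
  · rw [hμ e he _ (measurableSet_chart_symm_image e Metric.isOpen_ball.measurableSet
      (Metric.ball_subset_closedBall.trans hsub))]
    · have : e '' (e.symm '' Metric.ball (e x) (r / 2)) = Metric.ball (e x) (r / 2) := by
        rw [← image_comp]
        refine (image_congr fun z hz => ?_).trans (image_id _)
        exact e.right_inv (hsub (Metric.ball_subset_closedBall hz))
      rw [this]
      have hint : IntegrableOn (volDensity (coords e.symm g.inner)) (Metric.closedBall (e x) (r / 2)) :=
        (hG.smooth_volDensity.continuousOn.mono hsub).integrableOn_compact (isCompact_closedBall _ _)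
      refine lt_of_le_of_lt (lintegral_mono_set Metric.ball_subset_closedBall) ?_
      exact (hasFiniteIntegral_iff_ofReal (Filter.Eventually.of_forall fun y => Real.sqrt_nonneg _)).1 hint.2
    · rintro _ ⟨z, hz, rfl⟩
      exact e.map_target (hsub (Metric.ball_subset_closedBall hz))

lemma IsRiemannianMeasure.integral_eq_chart (hμ : IsRiemannianMeasure g μ)
    {e : OpenPartialHomeomorph M E4} (he : e ∈ atlas E4 M) {F : M → ℝ} (hF : Continuous F)
    (hs : ∀ x, x ∉ e.source → F x = 0) :
    ∫ x, F x ∂μ = ∫ y in e.target, F (e.symm y) * volDensity (coords e.symm g.inner) y := by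
  have hp := isParam_symm he
  have hG := hp.metricOn g
  have h1 : μ.restrict e.source = (paramMeasure g e.target e.symm).map e.symm := by
    have h2 := hp.restrict_le_map hμ
    rw [e.symm_image_target_eq_source] at h2
    refine le_antisymm h2 (Measure.le_iff.2 fun A hA => ?_)
    have hS : e.target ∩ e.symm ⁻¹' (A ∩ e.source) = e '' (A ∩ e.source) := by
      rw [e.image_eq_target_inter_inv_preimage inter_subset_right]
    have hm := hA.inter e.open_source.measurableSet
    have hS' : e.symm ⁻¹' A ∩ e.target = e '' (A ∩ e.source) := by
      rw [← hS]
      ext y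
      constructor
      · rintro ⟨h1, h2⟩; exact ⟨h2, h1, e.map_target h2⟩
      · rintro ⟨h1, h2, -⟩; exact ⟨h2, h1⟩
    rw [Measure.map_apply_of_aemeasurable hp.aemeasurable hA, paramMeasure,
      Measure.restrict_apply' hp.isOpen.measurableSet, hS',
      withDensity_apply _ (measurableSet_chart_image e hm inter_subset_right),
      Measure.restrict_apply hA, hμ e he _ hm inter_subset_right]
    rfl
  rw [← setIntegral_eq_integral_of_forall_compl_eq_zero hs, h1,
    integral_map hp.aemeasurable hF.aestronglyMeasurable, paramMeasure,
    restrict_withDensity hp.isOpen.measurableSet]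
  have hd : AEMeasurable (fun y => Real.toNNReal (volDensity (coords e.symm g.inner) y))
      (volume.restrict e.target) :=
    (hG.smooth_volDensity.continuousOn.aemeasurable hp.isOpen.measurableSet).real_toNNReal
  have := integral_withDensity_eq_integral_smul₀ hd (fun y => F (e.symm y))
  refine this.trans (integral_congr_ae (Filter.Eventually.of_forall fun y => ?_))
  simp only [NNReal.smul_def, smul_eq_mul]
  rw [Real.coe_toNNReal _ (volDensity_nonneg _ _), mul_comm]

lemma IsChartField.integral_chartDiv_of_subset (hX : IsChartField X)
    (hφ : ContMDiff (𝓡 4) 𝓘(ℝ, ℝ) ∞ φ) (hμ : IsRiemannianMeasure g μ) (hc : HasCompactSupport φ)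
    {e : OpenPartialHomeomorph M E4} (he : e ∈ atlas E4 M) (hs : tsupport φ ⊆ e.source) :
    ∫ x, chartDiv g X φ x ∂μ = 0 := by
  rw [hμ.integral_eq_chart he (hX.continuous_chartDiv hφ) fun x hx =>
    chartDiv_eq_zero fun h => hx (hs h)]
  have hG := (isParam_symm he).metricOn g
  rw [← hG.setIntegral_divergence (hX.smooth e he) (contDiffOn_comp_symm hφ he)
    (K := e '' tsupport φ) (hc.isCompact.image_of_continuousOn (e.continuousOn.mono hs))]
  · exact setIntegral_congr_fun e.open_target.measurableSet fun y hy => by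
      simp only [hX.chartDiv_symm hφ he hy]
  · rintro _ ⟨x, hx, rfl⟩
    exact e.map_source (hs hx)
  · intro y hy hyK i
    refine mul_eq_zero_of_left ?_ _
    by_contra h0
    exact hyK ⟨e.symm y, subset_tsupport _ h0, e.right_inv hy⟩

/-- The divergence theorem on a manifold. -/
lemma IsChartField.integral_chartDiv [T2Space M] [SigmaCompactSpace M] (hX : IsChartField X)
    (hφ : ContMDiff (𝓡 4) 𝓘(ℝ, ℝ) ∞ φ) (hμ : IsRiemannianMeasure g μ) (hc : HasCompactSupport φ) :
    ∫ x, chartDiv g X φ x ∂μ = 0 := by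
  have := hμ.isLocallyFiniteMeasure
  obtain ⟨ρ, hρ⟩ := SmoothPartitionOfUnity.exists_isSubordinate_chartAt_source (𝓡 4) M
  have hfin := ρ.locallyFinite.finite_nonempty_inter_compact hc.isCompact
  set s := hfin.toFinset
  have hψ : ∀ i, ContMDiff (𝓡 4) 𝓘(ℝ, ℝ) ∞ fun x => ρ i x * φ x := fun i =>
    (ρ i).contMDiff.mul hφ
  have hsum : φ = fun x => ∑ i ∈ s, ρ i x * φ x := by
    funext x
    rw [← sum_mul]
    by_cases h0 : φ x = 0
    · simp [h0]
    · have h1 : ∑ i ∈ s, ρ i x = 1 := ρ.sum_finsupport' x (mem_univ x) fun i hi =>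
        hfin.mem_toFinset.2 ⟨x, (ρ.mem_finsupport x).1 hi, subset_tsupport _ h0⟩
      rw [h1, one_mul]
  have hcs : ∀ i, HasCompactSupport fun x => ρ i x * φ x := fun i => hc.mul_left
  have e1 : chartDiv g X φ = fun x => ∑ i ∈ s, chartDiv g X (fun x => ρ i x * φ x) x := by
    funext x
    conv_lhs => rw [hsum]
    exact chartDiv_sum s (fun i _ => hψ i) x
  rw [e1, integral_finsetSum _ fun i _ => ?_]
  · refine sum_eq_zero fun i _ => hX.integral_chartDiv_of_subset (hψ i) hμ (hcs i)
      (chart_mem_atlas E4 i) ?_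
    exact (tsupport_mul_subset_left).trans (hρ i)
  · exact (hX.continuous_chartDiv (hψ i)).integrable_of_hasCompactSupport
      (HasCompactSupport.intro (hcs i).isCompact fun x hx => chartDiv_eq_zero hx)

end

section

/-! ### Solutions of the heat equation in coordinates -/

/-- A solution of `∂_t H = (Δ_L + 2Λ) H` in a coordinate domain. -/
structure HeatOn (V : Set E4) (G : E4 → Mat4) (Λ : ℝ) (I : Set ℝ) (H : ℝ → E4 → Mat4) : Prop where
  symm : ∀ t ∈ I, ∀ y ∈ V, (H t y)ᵀ = H t y
  smooth : ∀ i j, ContDiffOn ℝ ∞ (fun p : ℝ × E4 => H p.1 p.2 i j) (I ×ˢ V)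
  equation : ∀ y ∈ V, ∀ t ∈ I, ∀ i j, HasDerivWithinAt (fun s => H s y i j)
    ((lichnerowicz G (H t) y + (2 * Λ) • H t y) i j) I t

variable {V : Set E4} {G : E4 → Mat4} {Λ : ℝ} {I : Set ℝ} {H : ℝ → E4 → Mat4}

lemma HeatOn.smoothMat (h : HeatOn V G Λ I H) {t : ℝ} (ht : t ∈ I) : SmoothMat V (H t) :=
  fun i j => (h.smooth i j).comp (contDiff_const.prodMk contDiff_id).contDiffOn
    fun _ hy => ⟨ht, hy⟩

lemma HeatOn.smooth_tensorInner (h : HeatOn V G Λ I H) (hG : MetricOn V G) :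
    ContDiffOn ℝ ∞ (fun p : ℝ × E4 => tensorInner (G p.2) (H p.1 p.2) (H p.1 p.2)) (I ×ˢ V) := by
  have hI : ∀ i j, ContDiffOn ℝ ∞ (fun p : ℝ × E4 => (G p.2)⁻¹ i j) (I ×ˢ V) := fun i j =>
    (hG.smooth_inv i j).comp contDiff_snd.contDiffOn fun _ hp => hp.2
  unfold tensorInner
  exact ContDiffOn.sum fun i _ => ContDiffOn.sum fun j _ => ContDiffOn.sum fun k _ =>
    ContDiffOn.sum fun l _ => (((hI i k).mul (hI j l)).mul (h.smooth i j)).mul (h.smooth k l)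

lemma HeatOn.hasDerivWithinAt_tensorInner (h : HeatOn V G Λ I H) (hG : MetricOn V G) {y : E4}
    (hy : y ∈ V) {t : ℝ} (ht : t ∈ I) :
    HasDerivWithinAt (fun s => tensorInner (G y) (H s y) (H s y))
      (2 * tensorInner (G y) (lichnerowicz G (H t) y + (2 * Λ) • H t y) (H t y)) I t := by
  have h1 : HasDerivWithinAt (fun s => tensorInner (G y) (H s y) (H s y))
      (tensorInner (G y) (lichnerowicz G (H t) y + (2 * Λ) • H t y) (H t y)
        + tensorInner (G y) (H t y) (lichnerowicz G (H t) y + (2 * Λ) • H t y)) I t := by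
    simp only [tensorInner, ← sum_add_distrib]
    refine HasDerivWithinAt.fun_sum fun i _ => HasDerivWithinAt.fun_sum fun j _ =>
      HasDerivWithinAt.fun_sum fun k _ => HasDerivWithinAt.fun_sum fun l _ => ?_
    exact (((h.equation y hy t ht i j).const_mul _).mul (h.equation y hy t ht k l)).congr_deriv
      (by ring)
  refine h1.congr_deriv ?_
  rw [tensorInner_comm (hG.symm hy) (H t y)]
  ring

lemma HeatOn.hasDerivAt_tensorInner (h : HeatOn V G Λ I H) (hG : MetricOn V G) (hI : IsOpen I)
    {y : E4} (hy : y ∈ V) {t : ℝ} (ht : t ∈ I) :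
    HasDerivAt (fun s => tensorInner (G y) (H s y) (H s y))
      (2 * tensorInner (G y) (lichnerowicz G (H t) y + (2 * Λ) • H t y) (H t y)) t :=
  (h.hasDerivWithinAt_tensorInner hG hy ht).hasDerivAt (hI.mem_nhds ht)

/-- The time derivative of a jointly smooth function is continuous. -/
lemma continuousOn_of_hasDerivAt {f f' : ℝ × E4 → ℝ} (hI : IsOpen I) (hV : IsOpen V)
    (hf : ContDiffOn ℝ ∞ f (I ×ˢ V))
    (hf' : ∀ t ∈ I, ∀ y ∈ V, HasDerivAt (fun s => f (s, y)) (f' (t, y)) t) :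
    ContinuousOn f' (I ×ˢ V) := by
  have h1 := (hf.continuousOn_fderiv_of_isOpen (hI.prod hV) (by simp)).clm_apply
    (continuousOn_const (c := ((1 : ℝ), (0 : E4))))
  refine h1.congr fun p hp => ?_
  have h2 : HasFDerivAt f (fderiv ℝ f p) (p.1, p.2) :=
    ((hf.contDiffAt ((hI.prod hV).mem_nhds hp)).differentiableAt (by simp)).hasFDerivAt
  have h3 := h2.comp_hasDerivAt p.1 ((hasDerivAt_id p.1).prodMk (hasDerivAt_const p.1 p.2))
  exact (hf' p.1 hp.1 p.2 hp.2).unique h3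

lemma HeatOn.continuousOn_equation (h : HeatOn V G Λ I H) (hG : MetricOn V G) (hI : IsOpen I) :
    ContinuousOn (fun p : ℝ × E4 => 2 * tensorInner (G p.2)
      (lichnerowicz G (H p.1) p.2 + (2 * Λ) • H p.1 p.2) (H p.1 p.2)) (I ×ˢ V) :=
  continuousOn_of_hasDerivAt hI hG.isOpen (h.smooth_tensorInner hG)
    fun _ ht _ hy => h.hasDerivAt_tensorInner hG hI hy ht

/-! ### Parameter integrals over compact sets -/

lemma hasDerivAt_setIntegral {X : Type*} [TopologicalSpace X] [MeasurableSpace X]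
    [OpensMeasurableSpace X] {μ : Measure X} [IsFiniteMeasureOnCompacts μ] {K : Set X}
    (hK : IsCompact K) (hKm : MeasurableSet K) (hI : IsOpen I) {F F' : ℝ → X → ℝ}
    (hF : ∀ t ∈ I, ContinuousOn (F t) K)
    (hF' : ContinuousOn (fun p : ℝ × X => F' p.1 p.2) (I ×ˢ K))
    (hd : ∀ x ∈ K, ∀ t ∈ I, HasDerivAt (fun s => F s x) (F' t x) t) {t : ℝ} (ht : t ∈ I) :
    HasDerivAt (fun s => ∫ x in K, F s x ∂μ) (∫ x in K, F' t x ∂μ) t := by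
  obtain ⟨δ, hδ, hδI⟩ := Metric.isOpen_iff.1 hI t ht
  have hs : Metric.closedBall t (δ / 2) ⊆ I :=
    (Metric.closedBall_subset_ball (by linarith)).trans hδI
  obtain ⟨B, hB⟩ := ((isCompact_closedBall t (δ / 2)).prod hK).exists_bound_of_continuousOn
    (hF'.mono (prod_mono hs subset_rfl))
  have hμ : μ K < ⊤ := hK.measure_lt_top
  have hF't : ∀ s ∈ I, ContinuousOn (F' s) K := fun s hs =>
    hF'.comp (by fun_prop : Continuous fun x : X => (s, x)).continuousOn fun x hx => ⟨hs, hx⟩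
  refine (hasDerivAt_integral_of_dominated_loc_of_deriv_le (s := Metric.ball t (δ / 2))
    (bound := fun _ => B) (Metric.ball_mem_nhds t (by linarith)) ?_ ?_ ?_ ?_ ?_ ?_).2
  · filter_upwards [hI.mem_nhds ht] with s hs
    exact (hF s hs).aestronglyMeasurable hKm
  · exact (hF t ht).integrableOn_compact' hK hKm
  · exact (hF't t ht).aestronglyMeasurable hKm
  · refine (ae_restrict_iff' hKm).2 (Eventually.of_forall fun x hx s hs => ?_)
    exact hB (s, x) ⟨Metric.ball_subset_closedBall hs, hx⟩
  · exact (integrableOn_const (hs := hμ.ne))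
  · refine (ae_restrict_iff' hKm).2 (Eventually.of_forall fun x hx s hs' => ?_)
    exact hd x hx s (hs (Metric.ball_subset_closedBall hs'))

/-! ### Ancient solutions of a differential inequality -/

lemma ancient_le {f f' : ℝ → ℝ} {c δ B : ℝ} (hc : 0 < c)
    (hf : ∀ t < 0, HasDerivAt f (f' t) t) (hf' : ∀ t < 0, f' t ≤ -c * f t + δ)
    (hB : ∀ t < 0, f t ≤ B) {t : ℝ} (ht : t < 0) : f t ≤ δ / c := by
  have hd : ∀ s < 0, HasDerivAt (fun s => Real.exp (c * s) * (f s - δ / c))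
      (Real.exp (c * s) * (f' s + c * f s - δ)) s := fun s hs => by
    have h1 := ((hasDerivAt_id s).const_mul c).exp.mul ((hf s hs).sub_const (δ / c))
    refine h1.congr_deriv ?_
    simp only [id]
    field_simp
    ring
  have hanti : AntitoneOn (fun s => Real.exp (c * s) * (f s - δ / c)) (Iio 0) := by
    refine antitoneOn_of_deriv_nonpos (convex_Iio 0)
      (fun s hs => (hd s hs).continuousAt.continuousWithinAt)
      (fun s hs => (hd s (mem_Iio.1 (interior_subset hs))).differentiableAt.differentiableWithinAt)
      fun s hs => ?_
    have hs' : s < 0 := mem_Iio.1 (interior_subset hs)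
    rw [(hd s hs').deriv]
    exact mul_nonpos_of_nonneg_of_nonpos (Real.exp_nonneg _) (by linarith [hf' s hs'])
  have hlim : Tendsto (fun s => Real.exp (c * s) * (B - δ / c)) atBot (𝓝 (0 * (B - δ / c))) :=
    (Real.tendsto_exp_atBot.comp (tendsto_id.const_mul_atBot hc)).mul_const _
  have hle : Real.exp (c * t) * (f t - δ / c) ≤ 0 := by
    rw [zero_mul] at hlim
    refine ge_of_tendsto hlim ?_
    filter_upwards [eventually_lt_atBot t] with s hs
    refine (hanti (hs.trans ht) ht hs.le).trans ?_
    exact mul_le_mul_of_nonneg_left (by linarith [hB s (hs.trans ht)]) (Real.exp_nonneg _)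
  have := nonpos_of_mul_nonpos_right hle (Real.exp_pos _)
  linarith

/-! ### Scalar invariants of tensor fields -/

variable {M : Type*} [TopologicalSpace M] [ChartedSpace E4 M] [IsManifold (𝓡 4) ∞ M]
  {Ψ : E4 → M} {g : RMetric M}

lemma IsParam.atPt_eq (h : IsParam V Ψ) (T : TensorField M) {y : E4} (hy : y ∈ V) :
    coords Ψ T y = (jac (fun z => chartAt E4 (Ψ y) (Ψ z)) y)ᵀ * atPt T (Ψ y)
      * jac (fun z => chartAt E4 (Ψ y) (Ψ z)) y :=
  h.coords_eq_pull (chart_mem_atlas E4 (Ψ y)) T ⟨hy, mem_chart_source E4 (Ψ y)⟩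

lemma IsParam.tensorInner_atPt (h : IsParam V Ψ) (R S T : TensorField M) {y : E4} (hy : y ∈ V) :
    tensorInner (atPt R (Ψ y)) (atPt S (Ψ y)) (atPt T (Ψ y))
      = tensorInner (coords Ψ R y) (coords Ψ S y) (coords Ψ T y) := by
  rw [h.atPt_eq R hy, h.atPt_eq S hy, h.atPt_eq T hy, tensorInner_conj]
  exact (h.coordChange (chart_mem_atlas E4 (Ψ y))).isUnit y ⟨hy, mem_chart_source E4 (Ψ y)⟩

/-- The squared norm of a tensor field. -/
def normSq (g : RMetric M) (T : TensorField M) (x : M) : ℝ :=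
  tensorInner (atPt g.inner x) (atPt T x) (atPt T x)

/-- The squared norm of the differential of a function. -/
def gradSq (g : RMetric M) (η : M → ℝ) (x : M) : ℝ :=
  covecSq (atPt g.inner x)
    (fun i => partialDeriv i (fun z => η ((chartAt E4 x).symm z)) (chartAt E4 x x))

/-- The inner product of `(Δ_L + 2Λ) T` and `T`. -/
def heatInner (g : RMetric M) (Λ : ℝ) (T : TensorField M) (x : M) : ℝ :=
  tensorInner (atPt g.inner x)
    (lichnerowicz (coords (chartAt E4 x).symm g.inner) (coords (chartAt E4 x).symm T)
      (chartAt E4 x x) + (2 * Λ) • atPt T x) (atPt T x)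

lemma posDef_atPt (g : RMetric M) (x : M) : (atPt g.inner x).PosDef :=
  ((isParam_symm (chart_mem_atlas E4 x)).metricOn g).posDef _
    ((chartAt E4 x).map_source (mem_chart_source E4 x))

lemma normSq_nonneg (g : RMetric M) (T : TensorField M) (x : M) : 0 ≤ normSq g T x :=
  ((isParam_symm (chart_mem_atlas E4 x)).metricOn g).tensorInner_nonneg
    ((chartAt E4 x).map_source (mem_chart_source E4 x)) _

lemma normSq_le_of_normAt_le {T : TensorField M} {x : M} {B : ℝ} (h : normAt g T x ≤ B) :
    normSq g T x ≤ B ^ 2 := by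
  have h1 : normAt g T x ^ 2 = normSq g T x := Real.sq_sqrt (normSq_nonneg g T x)
  rw [← h1]
  exact pow_le_pow_left₀ (Real.sqrt_nonneg _) h 2

lemma gradSq_nonneg (g : RMetric M) (η : M → ℝ) (x : M) : 0 ≤ gradSq g η x :=
  covecSq_nonneg (posDef_atPt g x) _

omit [IsManifold (𝓡 4) ∞ M] in
lemma IsParam.contDiffOn_comp (h : IsParam V Ψ) {η : M → ℝ}
    (hη : ContMDiff (𝓡 4) 𝓘(ℝ, ℝ) ∞ η) : ContDiffOn ℝ ∞ (fun y => η (Ψ y)) V := by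
  rw [← contMDiffOn_iff_contDiffOn]
  exact hη.comp_contMDiffOn h.smooth

lemma IsParam.gradSq_eq (h : IsParam V Ψ) {η : M → ℝ} (hη : ContMDiff (𝓡 4) 𝓘(ℝ, ℝ) ∞ η)
    {y : E4} (hy : y ∈ V) :
    gradSq g η (Ψ y) = covecSq (coords Ψ g.inner y)
      (fun i => partialDeriv i (fun z => η (Ψ z)) y) := by
  have he := chart_mem_atlas E4 (Ψ y)
  have hys := mem_chart_source E4 (Ψ y)
  rw [gradSq, atPt]
  set e := chartAt E4 (Ψ y)
  have hc := h.coordChange he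
  have hy' : y ∈ V ∩ Ψ ⁻¹' e.source := ⟨hy, hys⟩
  rw [← hc.covecSq_pull (fun z hz => h.coords_eq_pull he g.inner hz) hy']
  congr 1
  funext i
  rw [← hc.partialDeriv_comp (contDiffOn_comp_symm hη he) hy']
  exact partialDeriv_congr_on hc.isOpen hy' i fun z hz => by simp only [e.left_inv hz.2]

lemma continuous_gradSq {η : M → ℝ} (hη : ContMDiff (𝓡 4) 𝓘(ℝ, ℝ) ∞ η) :
    Continuous (gradSq g η) := by
  refine continuous_of_charts (fun e y => covecSq (coords e.symm g.inner y)
      (fun i => partialDeriv i (fun z => η (e.symm z)) y))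
    (fun e he y hy => (isParam_symm he).gradSq_eq hη hy) fun e he => ?_
  have hp := fun i => (contDiffOn_partialDeriv (contDiffOn_comp_symm hη he) e.open_target
    i).continuousOn
  exact continuousOn_finsetSum _ fun i _ => continuousOn_finsetSum _ fun j _ =>
    ((((isParam_symm he).metricOn g).smooth_inv i j).continuousOn).mul ((hp i).mul (hp j))

lemma IsParam.heatOn (hp : IsParam V Ψ) {h : ℝ → TensorField M} (hh : IsHeatSolution g Λ I h) :
    HeatOn V (coords Ψ g.inner) Λ I (fun t => coords Ψ (h t)) where
  symm t ht y _ := by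
    ext i j
    exact hh.symm t ht _ _ _
  smooth i j := by
    rintro ⟨t, y⟩ ⟨ht, hy⟩
    have he := chart_mem_atlas E4 (Ψ y)
    set e := chartAt E4 (Ψ y)
    have hc := hp.coordChange he
    have hy' : y ∈ V ∩ Ψ ⁻¹' e.source := ⟨hy, mem_chart_source E4 (Ψ y)⟩
    have h1 : ContDiffOn ℝ ∞ (fun p : ℝ × E4 => coords Ψ (h p.1) p.2 i j)
        (I ×ˢ (V ∩ Ψ ⁻¹' e.source)) := by
      have hJ : ∀ i j, ContDiffOn ℝ ∞ (fun p : ℝ × E4 => jac (fun z => e (Ψ z)) p.2 i j)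
          (I ×ˢ (V ∩ Ψ ⁻¹' e.source)) := fun i j =>
        (SmoothMat.jac hc.smooth hc.isOpen i j).comp contDiff_snd.contDiffOn fun _ hp => hp.2
      have hH : ∀ a b, ContDiffOn ℝ ∞ (fun p : ℝ × E4 => coords e.symm (h p.1) (e (Ψ p.2)) a b)
          (I ×ˢ (V ∩ Ψ ⁻¹' e.source)) := fun a b =>
        (hh.smooth e he a b).comp (contDiff_fst.contDiffOn.prodMk
          (hc.smooth.comp contDiff_snd.contDiffOn fun _ hp => hp.2))
          fun p hp => ⟨hp.1, hc.mapsTo hp.2⟩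
      refine ContDiffOn.congr (f := fun p : ℝ × E4 => ∑ a, ∑ b,
        jac (fun z => e (Ψ z)) p.2 a i * jac (fun z => e (Ψ z)) p.2 b j
          * coords e.symm (h p.1) (e (Ψ p.2)) a b) ?_ fun p hp' => ?_
      · exact ContDiffOn.sum fun a _ => ContDiffOn.sum fun b _ =>
          ((hJ a i).mul (hJ b j)).mul (hH a b)
      · rw [hp.coords_eq_pull he (h p.1) hp'.2, pull, conj_apply]
    refine (h1 (t, y) ⟨ht, hy'⟩).mono_of_mem_nhdsWithin ?_
    exact mem_nhdsWithin.2 ⟨univ ×ˢ (V ∩ Ψ ⁻¹' e.source), isOpen_univ.prod hc.isOpen,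
      ⟨mem_univ _, hy'⟩, fun p hp => ⟨hp.2.1, hp.1.2⟩⟩
  equation y hy t ht i j := by
    have he := chart_mem_atlas E4 (Ψ y)
    set e := chartAt E4 (Ψ y)
    have hc := hp.coordChange he
    have hy' : y ∈ V ∩ Ψ ⁻¹' e.source := ⟨hy, mem_chart_source E4 (Ψ y)⟩
    have hT : ∀ s, coords Ψ (h s) y = pull (fun z => e (Ψ z)) (coords e.symm (h s)) y := fun s =>
      hp.coords_eq_pull he (h s) hy'
    have hs : SmoothMat e.target (coords e.symm (h t)) := fun i j =>
      (hh.smooth e he i j).comp (contDiff_const.prodMk contDiff_id).contDiffOn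
        fun _ hy => ⟨ht, hy⟩
    rw [hc.lichnerowicz_pull ((isParam_symm he).metricOn g)
      (fun z hz => hp.coords_eq_pull he g.inner hz) hs
      (fun z hz => hp.coords_eq_pull he (h t) hz) hy']
    simp only [hT]
    rw [pull_smul, pull_add]
    simp only [pull, conj_apply]
    exact HasDerivWithinAt.fun_sum fun a _ => HasDerivWithinAt.fun_sum fun b _ =>
      (hh.equation e he _ (hc.mapsTo hy') t ht a b).const_mul _

lemma hasDerivAt_normSq {h : ℝ → TensorField M} (hh : IsHeatSolution g Λ I h) (hI : IsOpen I)
    {t : ℝ} (ht : t ∈ I) (x : M) :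
    HasDerivAt (fun s => normSq g (h s) x) (2 * heatInner g Λ (h t) x) t := by
  have hp := isParam_symm (chart_mem_atlas E4 x)
  exact (hp.heatOn hh).hasDerivAt_tensorInner (hp.metricOn g) hI
    ((chartAt E4 x).map_source (mem_chart_source E4 x)) ht

omit [IsManifold (𝓡 4) ∞ M] in
lemma continuousOn_of_charts {F : ℝ × M → ℝ}
    (Fe : OpenPartialHomeomorph M E4 → ℝ × E4 → ℝ)
    (h : ∀ e ∈ atlas E4 M, ∀ t ∈ I, ∀ y ∈ e.target, F (t, e.symm y) = Fe e (t, y))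
    (hc : ∀ e ∈ atlas E4 M, ContinuousOn (Fe e) (I ×ˢ e.target)) :
    ContinuousOn F (I ×ˢ univ) := by
  rintro ⟨t, x⟩ ⟨ht, -⟩
  have he := chart_mem_atlas E4 x
  have hx := mem_chart_source E4 x
  set e := chartAt E4 x
  have h1 : ContinuousOn (fun p : ℝ × M => Fe e (p.1, e p.2)) (I ×ˢ e.source) :=
    (hc e he).comp (continuousOn_fst.prodMk (e.continuousOn.comp continuousOn_snd fun _ hp => hp.2))
      fun p hp => ⟨hp.1, e.map_source hp.2⟩
  have h2 : ContinuousOn F (I ×ˢ e.source) := h1.congr fun p hp => by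
    change F (p.1, p.2) = Fe e (p.1, e p.2)
    rw [← h e he p.1 hp.1 _ (e.map_source hp.2), e.left_inv hp.2]
  refine (h2 (t, x) ⟨ht, hx⟩).mono_of_mem_nhdsWithin ?_
  exact mem_nhdsWithin.2 ⟨univ ×ˢ e.source, isOpen_univ.prod e.open_source,
      ⟨mem_univ _, hx⟩, fun p hp => ⟨hp.2.1, hp.1.2⟩⟩

lemma continuousOn_normSq {h : ℝ → TensorField M} (hh : IsHeatSolution g Λ I h) :
    ContinuousOn (fun p : ℝ × M => normSq g (h p.1) p.2) (I ×ˢ univ) :=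
  continuousOn_of_charts (fun e p => tensorInner (coords e.symm g.inner p.2)
    (coords e.symm (h p.1) p.2) (coords e.symm (h p.1) p.2))
    (fun _ he _ _ _ hy => (isParam_symm he).tensorInner_atPt _ _ _ hy)
    fun _ he => (((isParam_symm he).heatOn hh).smooth_tensorInner
      ((isParam_symm he).metricOn g)).continuousOn

lemma continuousOn_heatInner {h : ℝ → TensorField M} (hh : IsHeatSolution g Λ I h)
    (hI : IsOpen I) :
    ContinuousOn (fun p : ℝ × M => 2 * heatInner g Λ (h p.1) p.2) (I ×ˢ univ) :=
  continuousOn_of_charts (fun e p => 2 * tensorInner (coords e.symm g.inner p.2)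
    (lichnerowicz (coords e.symm g.inner) (coords e.symm (h p.1)) p.2
      + (2 * Λ) • coords e.symm (h p.1) p.2) (coords e.symm (h p.1) p.2))
    (fun e he t ht y hy => by
      have h1 := hasDerivAt_normSq hh hI ht (e.symm y)
      have h2 := ((isParam_symm he).heatOn hh).hasDerivAt_tensorInner
        ((isParam_symm he).metricOn g) hI hy ht
      refine h1.unique (h2.congr_of_eventuallyEq (Eventually.of_forall fun s => ?_))
      exact (isParam_symm he).tensorInner_atPt _ _ _ hy)
    fun _ he => ((isParam_symm he).heatOn hh).continuousOn_equation
      ((isParam_symm he).metricOn g) hI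

/-! ### The momentum field -/

lemma isChartField_momentum
    (ho : ∀ e ∈ atlas E4 M, ∀ e' ∈ atlas E4 M, ∀ y ∈ e.target, e.symm y ∈ e'.source →
      0 < (fderiv ℝ (fun z => e' (e.symm z)) y).det) {T : TensorField M}
    (hT : ∀ e ∈ atlas E4 M, SmoothMat e.target (coords e.symm T)) :
    IsChartField fun (e : OpenPartialHomeomorph M E4) i y =>
      momentum (coords e.symm g.inner) (coords e.symm T) i y where
  smooth e he i := ((isParam_symm he).metricOn g).smooth_momentum (hT e he) i
  compat e he e' he' y hy m := by
    have hc := (isParam_symm he).coordChange he'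
    refine hc.momentum_pull ((isParam_symm he').metricOn g)
      (fun z hz => (isParam_symm he).coords_eq_pull he' g.inner hz) (hT e' he')
      (fun z hz => (isParam_symm he).coords_eq_pull he' T hz) hy ?_ m
    rw [← det_fderiv_eq_det_jac (hc.differentiableAt hy)]
    exact ho e he e' he' y hy.1 hy.2

lemma heatInner_le (hE : IsEinstein g Λ) {T : TensorField M}
    (hT : ∀ e ∈ atlas E4 M, SmoothMat e.target (coords e.symm T))
    (hs : ∀ (x : M) (u v : TangentSpace (𝓡 4) x), T x u v = T x v u) {c : ℝ}
    (hc : ∀ e ∈ atlas E4 M, ∀ y ∈ e.target, ∀ A : Mat4, Aᵀ = A →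
      c * tensorInner (coords e.symm g.inner y) A A ≤ zerothForm (coords e.symm g.inner) Λ A y)
    {η : M → ℝ} (hη : ContMDiff (𝓡 4) 𝓘(ℝ, ℝ) ∞ η) (x : M) :
    η x ^ 2 * heatInner g Λ T x
      ≤ chartDiv g (fun e i y => momentum (coords e.symm g.inner) (coords e.symm T) i y)
          (fun x => η x ^ 2) x
        - c * (η x ^ 2 * normSq g T x) + 4 * (normSq g T x * gradSq g η x) := by
  have he := chart_mem_atlas E4 x
  have hx := mem_chart_source E4 x
  rw [heatInner, chartDiv, normSq, gradSq, atPt, atPt]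
  set e := chartAt E4 x
  have hy := e.map_source hx
  have h1 := ((isParam_symm he).metricOn g).exists_divergence_bound (hT e he) hy (hE e he _ hy)
    (by ext i j; exact hs _ _ _) (hc e he _ hy) (η x)
    (fun i => partialDeriv i (fun z => η (e.symm z)) (e x))
  have h2 : ∀ i, partialDeriv i (fun z => η (e.symm z) ^ 2) (e x)
      = 2 * η x * partialDeriv i (fun z => η (e.symm z)) (e x) := fun i => by
    rw [partialDeriv_comp_real (φ := fun s => s ^ 2) i (by fun_prop)
      (differentiableAt_of_contDiffOn (contDiffOn_comp_symm hη he) e.open_target hy),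
      e.left_inv hx]
    simp
  refine h1.trans (le_of_eq ?_)
  simp only [h2, mul_sum]
  congr 3
  exact sum_congr rfl fun i _ => by ring

end

section

/-! ### The energy estimate -/

variable {M : Type*} [TopologicalSpace M] [ChartedSpace E4 M] [IsManifold (𝓡 4) ∞ M]
  {g : RMetric M} {Λ : ℝ} {I : Set ℝ} {h : ℝ → TensorField M}

lemma IsHeatSolution.mono (hh : IsHeatSolution g Λ I h) {J : Set ℝ} (hJ : J ⊆ I) :
    IsHeatSolution g Λ J h where
  symm t ht := hh.symm t (hJ ht)
  smooth e he i j := (hh.smooth e he i j).mono (prod_mono hJ subset_rfl)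
  equation e he y hy t ht i j := (hh.equation e he y hy t (hJ ht) i j).mono hJ

lemma normSq_eq_zero {T : TensorField M} {x : M} (h : normSq g T x = 0) : T x = 0 := by
  have hp := isParam_symm (chart_mem_atlas E4 x)
  have hx := mem_chart_source E4 x
  have hA : atPt T x = 0 := by
    by_contra hA
    exact ((hp.metricOn g).tensorInner_pos ((chartAt E4 x).map_source hx) hA).ne' h
  rw [atPt] at hA
  set e := chartAt E4 x
  have hy := e.map_source hx
  set L : E4 →L[ℝ] E4 := mfderiv (𝓡 4) (𝓡 4) e.symm (e x)
  have hL : Function.Surjective L :=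
    (LinearMap.injective_iff_surjective (V := E4) (f := L.toLinearMap)).1 (hp.inj _ hy)
  have key : ∀ x x' : M, x = x' → ∀ a b : E4, T x a b = T x' a b := by rintro _ _ rfl a b; rfl
  ext u v
  obtain ⟨u', rfl⟩ := hL u
  obtain ⟨v', rfl⟩ := hL v
  refine (key x (e.symm (e x)) (e.left_inv hx).symm _ _).trans ?_
  rw [eq_sum_stdVec u', eq_sum_stdVec v']
  refine (bilin_sum_stdVec (T (e.symm (e x))) L _ _).trans ?_
  refine sum_eq_zero fun i _ => sum_eq_zero fun j _ => ?_
  have h1 : T (e.symm (e x)) (L (stdVec i)) (L (stdVec j)) = 0 := congrFun (congrFun hA i) j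
  exact mul_eq_zero_of_right _ h1

lemma gradSq_comp {r : M → ℝ} (hr : ContMDiff (𝓡 4) 𝓘(ℝ, ℝ) ∞ r) {φ : ℝ → ℝ}
    (hφ : Differentiable ℝ φ) (x : M) :
    gradSq g (fun x => φ (r x)) x = deriv φ (r x) ^ 2 * gradSq g r x := by
  have he := chart_mem_atlas E4 x
  have hx := mem_chart_source E4 x
  have h1 : ∀ i, partialDeriv i (fun z => φ (r ((chartAt E4 x).symm z))) (chartAt E4 x x)
      = deriv φ (r x) * partialDeriv i (fun z => r ((chartAt E4 x).symm z)) (chartAt E4 x x) :=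
    fun i => by
      rw [partialDeriv_comp_real i hφ.differentiableAt (differentiableAt_of_contDiffOn
        (contDiffOn_comp_symm hr he) (chartAt E4 x).open_target ((chartAt E4 x).map_source hx)),
        (chartAt E4 x).left_inv hx]
  simp only [gradSq, covecSq, h1, mul_sum]
  exact sum₂_congr fun i j => by ring

lemma IsHeatSolution.smoothMat (hh : IsHeatSolution g Λ I h) {t : ℝ} (ht : t ∈ I)
    {e : OpenPartialHomeomorph M E4} (he : e ∈ atlas E4 M) :
    SmoothMat e.target (coords e.symm (h t)) :=
  ((isParam_symm he).heatOn hh).smoothMat ht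

lemma continuous_normSq (hh : IsHeatSolution g Λ I h) {t : ℝ} (ht : t ∈ I) :
    Continuous (normSq g (h t)) := by
  rw [← continuousOn_univ]
  exact (continuousOn_normSq hh).comp (f := fun x => (t, x))
    (by fun_prop : Continuous fun x : M => (t, x)).continuousOn fun x _ => ⟨ht, mem_univ _⟩

variable [MeasurableSpace M] [BorelSpace M] {μ : Measure M}

lemma IsRiemannianMeasure.isOpenPosMeasure (hμ : IsRiemannianMeasure g μ) :
    μ.IsOpenPosMeasure := by
  refine ⟨fun U hU hne h0 => ?_⟩
  obtain ⟨x, hx⟩ := hne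
  have he := chart_mem_atlas E4 x
  have hxs := mem_chart_source E4 x
  set e := chartAt E4 x
  have hA : IsOpen (U ∩ e.source) := hU.inter e.open_source
  have hO : IsOpen (e '' (U ∩ e.source)) :=
    e.isOpen_image_of_subset_source hA inter_subset_right
  have h1 := hμ e he _ hA.measurableSet inter_subset_right
  rw [measure_mono_null inter_subset_left h0, eq_comm] at h1
  change ∫⁻ y in _, ENNReal.ofReal (volDensity (coords e.symm g.inner) y) = 0 at h1
  have hG := (isParam_symm he).metricOn g
  have hsub : e '' (U ∩ e.source) ⊆ e.target := by
    rintro _ ⟨z, hz, rfl⟩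
    exact e.map_source hz.2
  have hcont : ContinuousOn (volDensity (coords e.symm g.inner)) (e '' (U ∩ e.source)) :=
    hG.smooth_volDensity.continuousOn.mono hsub
  have hm : AEMeasurable (fun y => ENNReal.ofReal (volDensity (coords e.symm g.inner) y))
      (volume.restrict (e '' (U ∩ e.source))) :=
    (hcont.aemeasurable hO.measurableSet).ennreal_ofReal
  rw [lintegral_eq_zero_iff' hm, Filter.EventuallyEq, ae_restrict_iff' hO.measurableSet] at h1
  have h2 : volume (e '' (U ∩ e.source)) = 0 := by
    refine measure_mono_null (fun y hy => ?_) (ae_iff.1 h1)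
    intro h3
    have := h3 hy
    rw [Pi.zero_apply, ENNReal.ofReal_eq_zero] at this
    exact absurd this (not_le.2 (hG.volDensity_pos (hsub hy)))
  exact (hO.measure_pos volume ⟨e x, mem_image_of_mem e ⟨hx, hxs⟩⟩).ne' h2

lemma IsHeatSolution.energy_le [T2Space M] [SigmaCompactSpace M]
    (hh : IsHeatSolution g Λ (Iio 0) h) (hμ : IsRiemannianMeasure g μ)
    (ho : ∀ e ∈ atlas E4 M, ∀ e' ∈ atlas E4 M, ∀ y ∈ e.target, e.symm y ∈ e'.source →
      0 < (fderiv ℝ (fun z => e' (e.symm z)) y).det) (hE : IsEinstein g Λ) {c : ℝ} (hc0 : 0 < c)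
    (hc : ∀ e ∈ atlas E4 M, ∀ y ∈ e.target, ∀ A : Mat4, Aᵀ = A →
      c * tensorInner (coords e.symm g.inner y) A A ≤ zerothForm (coords e.symm g.inner) Λ A y)
    {η : M → ℝ} (hη : ContMDiff (𝓡 4) 𝓘(ℝ, ℝ) ∞ η) (hcs : HasCompactSupport η) {B δ : ℝ}
    (hB : ∀ t < 0, ∀ x ∈ tsupport η, η x ^ 2 * normSq g (h t) x ≤ B)
    (hδ : ∀ t < 0, ∫ x in tsupport η, normSq g (h t) x * gradSq g η x ∂μ ≤ δ) {t : ℝ}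
    (ht : t < 0) :
    ∫ x in tsupport η, η x ^ 2 * normSq g (h t) x ∂μ ≤ 4 * δ / c := by
  have := hμ.isLocallyFiniteMeasure
  set K := tsupport η
  have hK : IsCompact K := hcs.isCompact
  have hKm : MeasurableSet K := hK.isClosed.measurableSet
  have hI : IsOpen (Iio (0 : ℝ)) := isOpen_Iio
  have hcn : ∀ t < 0, Continuous (normSq g (h t)) := fun t ht => continuous_normSq hh ht
  have hηc : Continuous η := hη.continuous
  have hd : ∀ t < 0, HasDerivAt (fun s => ∫ x in K, η x ^ 2 * normSq g (h s) x ∂μ)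
      (∫ x in K, η x ^ 2 * (2 * heatInner g Λ (h t) x) ∂μ) t := by
    intro t ht
    refine hasDerivAt_setIntegral (F' := fun s x => η x ^ 2 * (2 * heatInner g Λ (h s) x)) hK hKm hI
      (fun s hs => (((hηc.pow 2).mul (hcn s hs)).continuousOn)) ?_ ?_ ht
    · exact (hηc.comp continuous_snd).continuousOn.pow 2 |>.mul
        ((continuousOn_heatInner hh hI).mono (prod_mono subset_rfl (subset_univ _)))
    · intro x _ s hs
      exact (hasDerivAt_normSq hh hI hs x).const_mul _
  have hle : ∀ t < 0, ∫ x in K, η x ^ 2 * (2 * heatInner g Λ (h t) x) ∂μ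
      ≤ -(2 * c) * ∫ x in K, η x ^ 2 * normSq g (h t) x ∂μ + 8 * δ := by
    intro t ht
    have hX := isChartField_momentum (g := g) ho (fun e he => hh.smoothMat ht he)
    set X := fun (e : OpenPartialHomeomorph M E4) i y =>
      momentum (coords e.symm g.inner) (coords e.symm (h t)) i y
    have hη2 : ContMDiff (𝓡 4) 𝓘(ℝ, ℝ) ∞ fun x => η x ^ 2 := hη.pow 2
    have hcs2 : HasCompactSupport fun x => η x ^ 2 :=
      hcs.comp_left (g := fun s : ℝ => s ^ 2) (by simp)
    have hsub : tsupport (fun x => η x ^ 2) ⊆ K := closure_mono fun x hx => by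
      rw [Function.mem_support] at hx ⊢
      exact fun h0 => hx (by rw [h0]; simp)
    have h0 : ∫ x in K, chartDiv g X (fun x => η x ^ 2) x ∂μ = 0 := by
      rw [setIntegral_eq_integral_of_forall_compl_eq_zero fun x hx =>
        chartDiv_eq_zero fun hx' => hx (hsub hx')]
      exact hX.integral_chartDiv hη2 hμ hcs2
    have hi1 : IntegrableOn (chartDiv g X fun x => η x ^ 2) K μ :=
      (hX.continuous_chartDiv hη2).continuousOn.integrableOn_compact hK
    have hi2 : IntegrableOn (fun x => η x ^ 2 * normSq g (h t) x) K μ :=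
      ((hηc.pow 2).mul (hcn t ht)).continuousOn.integrableOn_compact hK
    have hi3 : IntegrableOn (fun x => normSq g (h t) x * gradSq g η x) K μ :=
      ((hcn t ht).mul (continuous_gradSq hη)).continuousOn.integrableOn_compact hK
    have hheat : Continuous fun x => 2 * heatInner g Λ (h t) x := by
      rw [← continuousOn_univ]
      exact (continuousOn_heatInner hh hI).comp (f := fun x => (t, x))
        (by fun_prop : Continuous fun x : M => (t, x)).continuousOn fun x _ => ⟨ht, mem_univ _⟩
    have hi4 : IntegrableOn (fun x => η x ^ 2 * (2 * heatInner g Λ (h t) x)) K μ :=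
      ((hηc.pow 2).mul hheat).continuousOn.integrableOn_compact hK
    calc ∫ x in K, η x ^ 2 * (2 * heatInner g Λ (h t) x) ∂μ
        ≤ ∫ x in K, (2 * chartDiv g X (fun x => η x ^ 2) x
            + (-(2 * c)) * (η x ^ 2 * normSq g (h t) x)
            + 8 * (normSq g (h t) x * gradSq g η x)) ∂μ := by
          refine integral_mono hi4 (((hi1.const_mul 2).add (hi2.const_mul _)).add
            (hi3.const_mul 8)) fun x => ?_
          have := heatInner_le hE (fun e he => hh.smoothMat ht he) (hh.symm t ht) hc hη x
          change η x ^ 2 * (2 * heatInner g Λ (h t) x) ≤ 2 * chartDiv g X (fun x => η x ^ 2) x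
            + (-(2 * c)) * (η x ^ 2 * normSq g (h t) x) + 8 * (normSq g (h t) x * gradSq g η x)
          linarith
      _ = 2 * 0 + (-(2 * c)) * (∫ x in K, η x ^ 2 * normSq g (h t) x ∂μ)
            + 8 * ∫ x in K, normSq g (h t) x * gradSq g η x ∂μ := by
          rw [integral_add (f := fun x => 2 * chartDiv g X (fun x => η x ^ 2) x
              + (-(2 * c)) * (η x ^ 2 * normSq g (h t) x))
            ((hi1.const_mul 2).add (hi2.const_mul _)) (hi3.const_mul 8),
            integral_add (hi1.const_mul 2) (hi2.const_mul _), integral_const_mul,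
            integral_const_mul, integral_const_mul, h0]
      _ ≤ _ := by linarith [hδ t ht]
  have hbd : ∀ t < 0, ∫ x in K, η x ^ 2 * normSq g (h t) x ∂μ ≤ ∫ _ in K, B ∂μ := fun t ht =>
    setIntegral_mono_on (((hηc.pow 2).mul (hcn t ht)).continuousOn.integrableOn_compact hK)
      (integrableOn_const (hs := hK.measure_lt_top.ne)) hKm fun x hx => hB t ht x hx
  have := ancient_le (by linarith : 0 < 2 * c) hd hle hbd ht
  refine this.trans (le_of_eq ?_)
  field_simp
  ring

/-- A smooth cutoff function on the line: `0` on `(-∞, ε]` and `1` on `[2ε, ∞)`. -/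
def cutoff (ε s : ℝ) : ℝ := Real.smoothTransition (s / ε - 1)

lemma contDiff_cutoff (ε : ℝ) : ContDiff ℝ ∞ (cutoff ε) :=
  Real.smoothTransition.contDiff.comp (by fun_prop)

lemma cutoff_nonneg (ε s : ℝ) : 0 ≤ cutoff ε s := Real.smoothTransition.nonneg _

lemma cutoff_le_one (ε s : ℝ) : cutoff ε s ≤ 1 := Real.smoothTransition.le_one _

lemma cutoff_eq_zero {ε s : ℝ} (hε : 0 < ε) (h : s ≤ ε) : cutoff ε s = 0 :=
  Real.smoothTransition.zero_of_nonpos (by rw [sub_nonpos, div_le_one hε]; exact h)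

lemma cutoff_eq_one {ε s : ℝ} (hε : 0 < ε) (h : 2 * ε ≤ s) : cutoff ε s = 1 :=
  Real.smoothTransition.one_of_one_le (by rw [le_sub_iff_add_le, le_div_iff₀ hε]; linarith)

lemma deriv_cutoff (ε s : ℝ) :
    deriv (cutoff ε) s = deriv Real.smoothTransition (s / ε - 1) / ε := by
  have h1 : HasDerivAt (fun s : ℝ => s / ε - 1) (1 / ε) s :=
    ((hasDerivAt_id s).div_const ε).sub_const 1
  have h2 := ((Real.smoothTransition.contDiff (n := 1)).differentiable
    (by simp) (s / ε - 1)).hasDerivAt.comp s h1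
  rw [show cutoff ε = Real.smoothTransition ∘ fun s : ℝ => s / ε - 1 from rfl, h2.deriv]
  ring

lemma deriv_cutoff_eq_zero {ε s : ℝ} (hε : 0 < ε) (h : 2 * ε ≤ s) : deriv (cutoff ε) s = 0 :=
  IsLocalMax.deriv_eq_zero (Eventually.of_forall fun s' => by
    rw [cutoff_eq_one hε h]; exact cutoff_le_one _ _)

lemma hasCompactSupport_deriv_smoothTransition :
    HasCompactSupport (deriv Real.smoothTransition) :=
  HasCompactSupport.intro (isCompact_Icc (a := (0 : ℝ)) (b := 1)) fun x hx => by
    rcases not_and_or.1 hx with h | h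
    · exact IsLocalMin.deriv_eq_zero (Eventually.of_forall fun s' => by
        rw [Real.smoothTransition.zero_of_nonpos (not_le.1 h).le]
        exact Real.smoothTransition.nonneg _)
    · exact IsLocalMax.deriv_eq_zero (Eventually.of_forall fun s' => by
        rw [Real.smoothTransition.one_of_one_le (not_le.1 h).le]
        exact Real.smoothTransition.le_one _)

lemma exists_deriv_cutoff_bound :
    ∃ L, ∀ ε > 0, ∀ s, |deriv (cutoff ε) s| ≤ L / ε := by
  obtain ⟨L, hL⟩ := hasCompactSupport_deriv_smoothTransition.exists_bound_of_continuous
    ((Real.smoothTransition.contDiff (n := 1)).continuous_deriv (by simp))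
  refine ⟨L, fun ε hε s => ?_⟩
  rw [deriv_cutoff, abs_div, abs_of_pos hε]
  exact div_le_div_of_nonneg_right (hL _) hε.le

end

section

/-! ### Geometry of orbifold charts -/

lemma isOpen_puncturedBall (δ : ℝ) : IsOpen (puncturedBall δ) :=
  (isOpen_lt continuous_const continuous_norm).inter (isOpen_lt continuous_norm continuous_const)

lemma mem_puncturedBall {δ : ℝ} {y : E4} :
    y ∈ puncturedBall δ ↔ y ≠ 0 ∧ y ∈ Metric.ball (0 : E4) δ := by
  rw [puncturedBall, mem_ofPred_eq, norm_pos_iff, mem_ball_zero_iff]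

lemma CoordChange.zerothForm_ge {U V : Set E4} {Φ : E4 → E4} {G G' : E4 → Mat4}
    (h : CoordChange U V Φ) (hG : MetricOn V G) (hG' : ∀ y ∈ U, G' y = pull Φ G y) {y : E4}
    (hy : y ∈ U) (hd : 0 < (jac Φ y).det) {Λ c : ℝ}
    (hc : ∀ A : Mat4, Aᵀ = A → c * tensorInner (G' y) A A ≤ zerothForm G' Λ A y)
    {A : Mat4} (hA : Aᵀ = A) :
    c * tensorInner (G (Φ y)) A A ≤ zerothForm G Λ A (Φ y) := by
  have h1 := hc ((jac Φ y)ᵀ * A * jac Φ y) (by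
    rw [transpose_mul, transpose_mul, transpose_transpose, hA, mul_assoc])
  rwa [h.zerothForm_pull hG hG' hy hd, hG' y hy, pull, tensorInner_conj (h.isUnit y hy)] at h1

variable {M : Type*} [TopologicalSpace M] [ChartedSpace E4 M] [IsManifold (𝓡 4) ∞ M]
  {g : RMetric M} {Λ : ℝ} {X : Type*} [TopologicalSpace X]

namespace OrbifoldChart

variable {incl : M → X} {p : X}

lemma isParam (C : OrbifoldChart incl g p) : IsParam (puncturedBall C.δ) C.par :=
  IsLocalDiffeomorphOn.isParam C.localDiffeo (isOpen_puncturedBall _)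

lemma metricOn_lift (C : OrbifoldChart incl g p) : MetricOn (Metric.ball 0 C.δ) C.lift where
  isOpen := Metric.isOpen_ball
  smooth := C.lift_smooth
  posDef y hy := by
    by_cases h0 : y = 0
    · rw [h0]
      exact C.lift_posDef
    · have h1 := mem_puncturedBall.2 ⟨h0, hy⟩
      rw [C.lift_eq y h1]
      exact (C.isParam.metricOn g).posDef y h1

lemma lift_eq_pull (C : OrbifoldChart incl g p) {e : OpenPartialHomeomorph M E4}
    (he : e ∈ atlas E4 M) {y : E4} (hy : y ∈ puncturedBall C.δ ∩ C.par ⁻¹' e.source) :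
    C.lift y = pull (fun z => e (C.par z)) (coords e.symm g.inner) y := by
  rw [C.lift_eq y hy.1, C.isParam.coords_eq_pull he g.inner hy]

lemma ricci_lift_zero (C : OrbifoldChart incl g p) (hE : IsEinstein g Λ) :
    ricci C.lift 0 = Λ • C.lift 0 := by
  have hG := C.metricOn_lift
  have h0 : (0 : E4) ∈ Metric.ball (0 : E4) C.δ := Metric.mem_ball_self C.δ_pos
  have hnb := Metric.isOpen_ball.mem_nhds h0
  ext j k
  have h1 : ContinuousOn (fun y => ricci C.lift y j k) (Metric.ball 0 C.δ) := by
    refine ContinuousOn.congr (f := fun y => ∑ i, ∑ l, (C.lift y)⁻¹ l i * riemann C.lift i j k l y)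
      ?_ fun y hy => hG.ricci_eq hy j k
    exact continuousOn_finsetSum _ fun i _ => continuousOn_finsetSum _ fun l _ =>
      (hG.smooth_inv l i).continuousOn.mul (hG.smooth_riemann i j k l).continuousOn
  have h2 : ContinuousOn (fun y => (Λ • C.lift y) j k) (Metric.ball 0 C.δ) :=
    (C.lift_smooth j k).continuousOn.const_smul Λ
  have h3 : ∀ᶠ y in 𝓝[≠] (0 : E4), ricci C.lift y j k = (Λ • C.lift y) j k := by
    filter_upwards [self_mem_nhdsWithin, mem_nhdsWithin_of_mem_nhds hnb] with y hy0 hy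
    have hyp := mem_puncturedBall.2 ⟨hy0, hy⟩
    have he := chart_mem_atlas E4 (C.par y)
    have hy' : y ∈ puncturedBall C.δ ∩ C.par ⁻¹' (chartAt E4 (C.par y)).source :=
      ⟨hyp, mem_chart_source E4 (C.par y)⟩
    have hc := C.isParam.coordChange he
    have h4 := hc.ricci_pull ((isParam_symm he).metricOn g) (fun z hz => C.lift_eq_pull he hz) hy'
    rw [h4, C.lift_eq_pull he hy', pull, hE _ he _ (hc.mapsTo hy'), pull_smul]
    rfl
  have := Module.punctured_nhds_neBot ℝ E4 (0 : E4)
  exact tendsto_nhds_unique ((h1.continuousAt hnb).tendsto.mono_left nhdsWithin_le_nhds)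
    (((h2.continuousAt hnb).tendsto.mono_left nhdsWithin_le_nhds).congr'
      (h3.mono fun _ h => h.symm))

/-- The image of a ball in an orbifold chart. -/
def nbhd (C : OrbifoldChart incl g p) (s : ℝ) : Set X :=
  (fun x => open Classical in if x = 0 then p else incl (C.par x)) '' Metric.ball (0 : E4) s

lemma isOpen_nbhd (C : OrbifoldChart incl g p) {s : ℝ} (hs : s ≤ C.δ) : IsOpen (C.nbhd s) :=
  C.isOpen_image _ (Metric.ball_subset_ball hs) Metric.isOpen_ball

lemma mem_nbhd (C : OrbifoldChart incl g p) {s : ℝ} (hs : 0 < s) : p ∈ C.nbhd s :=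
  ⟨0, Metric.mem_ball_self hs, by simp⟩

lemma exists_of_mem_nbhd (C : OrbifoldChart incl g p) (hp : p ∉ range incl)
    (hi : Function.Injective incl) {s : ℝ} {x : M} (hx : incl x ∈ C.nbhd s) :
    ∃ z ∈ puncturedBall s, C.par z = x := by
  obtain ⟨z, hz, hzx⟩ := hx
  by_cases h0 : z = 0
  · simp only [h0, if_true] at hzx
    exact absurd ⟨x, hzx.symm⟩ hp
  · simp only [h0, if_false] at hzx
    exact ⟨z, mem_puncturedBall.2 ⟨h0, hz⟩, hi hzx⟩

end OrbifoldChart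

namespace RiemannianOrbifold

variable {O : RiemannianOrbifold g X}

lemma exists_zerothForm_ge_regular (hΛ : Λ < 0) (hE : IsEinstein g Λ) (ho : O.IsOriented)
    (hR : O.RPlusNegative) (x₀ : M) : ∃ c > 0, ∀ᶠ x in 𝓝 x₀, ∀ e ∈ atlas E4 M, x ∈ e.source →
      ∀ A : Mat4, Aᵀ = A → c * tensorInner (coords e.symm g.inner (e x)) A A
        ≤ zerothForm (coords e.symm g.inner) Λ A (e x) := by
  have he₀ := chart_mem_atlas E4 x₀
  have hx₀ := mem_chart_source E4 x₀
  set e₀ := chartAt E4 x₀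
  have hp := isParam_symm he₀
  have hG := hp.metricOn g
  have hy₀ := e₀.map_source hx₀
  obtain ⟨c, hc, h⟩ := hG.exists_zerothForm_ge hy₀ fun A hA hA0 =>
    hG.zerothForm_pos hy₀ hΛ (hE e₀ he₀ _ hy₀) (hR.regular e₀ he₀ _ hy₀) hA hA0
  refine ⟨c, hc, ?_⟩
  filter_upwards [(e₀.continuousAt hx₀).eventually h, e₀.open_source.mem_nhds hx₀]
    with x hx hxs e he hxe A hA
  have hy : e₀ x ∈ e₀.target ∩ e₀.symm ⁻¹' e.source :=
    ⟨e₀.map_source hxs, by rw [mem_preimage, e₀.left_inv hxs]; exact hxe⟩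
  have hch := hp.coordChange he
  have := hch.zerothForm_ge ((isParam_symm he).metricOn g)
    (fun z hz => hp.coords_eq_pull he g.inner hz) hy (by
      rw [← det_fderiv_eq_det_jac (hch.differentiableAt hy)]
      exact ho.atlas_pos e₀ he₀ e he _ hy.1 hy.2) hx hA
  rwa [e₀.left_inv hxs] at this

lemma exists_zerothForm_ge_singular (hΛ : Λ < 0) (hE : IsEinstein g Λ) (ho : O.IsOriented)
    (hR : O.RPlusNegative) (p : X) (hp : p ∈ O.sing) :
    ∃ c > 0, ∃ W ∈ 𝓝 p, ∀ x, O.incl x ∈ W → ∀ e ∈ atlas E4 M, x ∈ e.source →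
      ∀ A : Mat4, Aᵀ = A → c * tensorInner (coords e.symm g.inner (e x)) A A
        ≤ zerothForm (coords e.symm g.inner) Λ A (e x) := by
  set C := O.chart p hp with hCdef
  have hG := C.metricOn_lift
  have h0 : (0 : E4) ∈ Metric.ball (0 : E4) C.δ := Metric.mem_ball_self C.δ_pos
  obtain ⟨c, hc, h⟩ := hG.exists_zerothForm_ge h0 fun A hA hA0 =>
    hG.zerothForm_pos h0 hΛ (C.ricci_lift_zero hE) (hR.singular p hp) hA hA0
  obtain ⟨s, hs, hball⟩ := Metric.mem_nhds_iff.1 (h.and (Metric.isOpen_ball.mem_nhds h0))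
  have hs' : 0 < min s C.δ := lt_min hs C.δ_pos
  refine ⟨c, hc, C.nbhd (min s C.δ), (C.isOpen_nbhd (min_le_right _ _)).mem_nhds (C.mem_nbhd hs'),
    fun x hx e he hxe A hA => ?_⟩
  obtain ⟨z, hz, rfl⟩ := C.exists_of_mem_nbhd ((O.mem_sing p).1 hp) O.isOpenEmbedding.injective hx
  have hz1 : z ∈ Metric.ball (0 : E4) s :=
    Metric.ball_subset_ball (min_le_left _ _) (mem_puncturedBall.1 hz).2
  have hz2 : z ∈ puncturedBall C.δ := mem_puncturedBall.2 ⟨(mem_puncturedBall.1 hz).1,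
    Metric.ball_subset_ball (min_le_right _ _) (mem_puncturedBall.1 hz).2⟩
  have hch := C.isParam.coordChange he
  exact hch.zerothForm_ge ((isParam_symm he).metricOn g)
    (fun z hz => C.lift_eq_pull he hz) (y := z) ⟨hz2, hxe⟩ (by
      rw [← det_fderiv_eq_det_jac (hch.differentiableAt ⟨hz2, hxe⟩)]
      exact ho.chart_pos p hp e he _ hz2 hxe) (hball hz1).1 hA

lemma exists_zerothForm_ge [CompactSpace X] (hΛ : Λ < 0) (hE : IsEinstein g Λ)
    (ho : O.IsOriented) (hR : O.RPlusNegative) :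
    ∃ c > 0, ∀ e ∈ atlas E4 M, ∀ y ∈ e.target, ∀ A : Mat4, Aᵀ = A →
      c * tensorInner (coords e.symm g.inner y) A A ≤ zerothForm (coords e.symm g.inner) Λ A y := by
  have key : ∃ c > 0, ∀ x, O.incl x ∈ (univ : Set X) → ∀ e ∈ atlas E4 M, x ∈ e.source →
      ∀ A : Mat4, Aᵀ = A → c * tensorInner (coords e.symm g.inner (e x)) A A
        ≤ zerothForm (coords e.symm g.inner) Λ A (e x) := by
    refine isCompact_univ.induction_on (p := fun S : Set X => ∃ c > 0, ∀ x, O.incl x ∈ S →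
      ∀ e ∈ atlas E4 M, x ∈ e.source → ∀ A : Mat4, Aᵀ = A →
      c * tensorInner (coords e.symm g.inner (e x)) A A
        ≤ zerothForm (coords e.symm g.inner) Λ A (e x)) ⟨1, one_pos, by simp⟩ ?_ ?_ ?_
    · rintro S T hST ⟨c, hc, h⟩
      exact ⟨c, hc, fun x hx => h x (hST hx)⟩
    · rintro S T ⟨c, hc, h⟩ ⟨c', hc', h'⟩
      refine ⟨min c c', lt_min hc hc', fun x hx e he hxe A hA => ?_⟩
      have h0 := ((isParam_symm he).metricOn g).tensorInner_nonneg (e.map_source hxe) A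
      rcases hx with hx | hx
      · exact (mul_le_mul_of_nonneg_right (min_le_left _ _) h0).trans (h x hx e he hxe A hA)
      · exact (mul_le_mul_of_nonneg_right (min_le_right _ _) h0).trans (h' x hx e he hxe A hA)
    · intro p _
      by_cases hp : p ∈ O.sing
      · obtain ⟨c, hc, W, hW, h⟩ := exists_zerothForm_ge_singular hΛ hE ho hR p hp
        exact ⟨W, mem_nhdsWithin_of_mem_nhds hW, c, hc, h⟩
      · obtain ⟨x₀, rfl⟩ := not_not.1 (mt (O.mem_sing p).2 hp)
        obtain ⟨c, hc, h⟩ := exists_zerothForm_ge_regular hΛ hE ho hR x₀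
        refine ⟨O.incl '' {x | ∀ e ∈ atlas E4 M, x ∈ e.source → ∀ A : Mat4, Aᵀ = A →
          c * tensorInner (coords e.symm g.inner (e x)) A A
            ≤ zerothForm (coords e.symm g.inner) Λ A (e x)},
          mem_nhdsWithin_of_mem_nhds (O.isOpenEmbedding.isOpenMap.image_mem_nhds h), c, hc, ?_⟩
        rintro x ⟨x', hx', hxx⟩
        rw [← O.isOpenEmbedding.injective hxx]
        exact hx'
  obtain ⟨c, hc, h⟩ := key
  refine ⟨c, hc, fun e he y hy A hA => ?_⟩
  have := h (e.symm y) (mem_univ _) e he (e.map_target hy) A hA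
  rwa [e.right_inv hy] at this

end RiemannianOrbifold

end

section

/-! ### The Liouville theorem on negative Einstein orbifolds -/

variable {M : Type*} [TopologicalSpace M] [ChartedSpace E4 M] [IsManifold (𝓡 4) ∞ M]
  {g : RMetric M} {Λ : ℝ} {X : Type*} [TopologicalSpace X]

lemma exists_covecSq_bound {G : E4 → Mat4} {δ s : ℝ} (hG : MetricOn (Metric.ball 0 δ) G)
    (hs : s < δ) : ∃ K, ∀ y ∈ Metric.closedBall (0 : E4) s, ∀ ξ : Fin 4 → ℝ,
      (∀ i, |ξ i| ≤ 1) → covecSq (G y) ξ ≤ K := by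
  have hc : ContinuousOn (fun p : E4 × (Fin 4 → ℝ) => covecSq (G p.1) p.2)
      (Metric.closedBall 0 s ×ˢ Metric.closedBall 0 1) := by
    refine continuousOn_finsetSum _ fun i _ => continuousOn_finsetSum _ fun j _ => ?_
    exact ((hG.smooth_inv i j).continuousOn.comp continuousOn_fst fun p hp =>
      Metric.closedBall_subset_ball hs hp.1).mul (by fun_prop)
  obtain ⟨K, hK⟩ := ((isCompact_closedBall (0 : E4) s).prod
    (isCompact_closedBall (0 : Fin 4 → ℝ) 1)).exists_bound_of_continuousOn hc
  refine ⟨K, fun y hy ξ hξ => (le_abs_self _).trans (hK (y, ξ) ⟨hy, ?_⟩)⟩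
  rw [mem_closedBall_zero_iff, pi_norm_le_iff_of_nonneg zero_le_one]
  exact hξ

lemma abs_partialDeriv_norm_le {y : E4} (hy : y ≠ 0) (i : Fin 4) :
    |partialDeriv i (fun z : E4 => ‖z‖) y| ≤ 1 := by
  have h1 : DifferentiableAt ℝ (fun z : E4 => ‖z‖) y := differentiableAt_id.norm ℝ hy
  have h2 := (fderiv ℝ (fun z : E4 => ‖z‖) y).le_opNorm (stdVec i)
  rw [norm_fderiv_norm h1, one_mul] at h2
  exact h2.trans (by simp [stdVec])

lemma OrbifoldChart.exists_collar {incl : M → X} {p : X} (C : OrbifoldChart incl g p)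
    {r : M → ℝ} (hr : ContMDiff (𝓡 4) 𝓘(ℝ, ℝ) ∞ r)
    (hn : ∃ ε > 0, ∀ x ∈ puncturedBall C.δ, ‖x‖ < ε → r (C.par x) = ‖x‖) :
    ∃ s > 0, s ≤ C.δ ∧ ∃ K, 0 ≤ K ∧ ∀ z ∈ puncturedBall s, r (C.par z) = ‖z‖ ∧
      volDensity (coords C.par g.inner) z ≤ K ∧ gradSq g r (C.par z) ≤ K := by
  obtain ⟨ε, hε, hn⟩ := hn
  have hG := C.metricOn_lift
  set s := min ε (C.δ / 2)
  have hδ := C.δ_pos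
  have hs : 0 < s := lt_min hε (by linarith)
  have hsδ : s < C.δ := (min_le_right _ _).trans_lt (by linarith)
  obtain ⟨K₁, hK₁⟩ := exists_covecSq_bound hG hsδ
  obtain ⟨K₂, hK₂⟩ := (isCompact_closedBall (0 : E4) s).exists_bound_of_continuousOn
    (hG.smooth_volDensity.continuousOn.mono (Metric.closedBall_subset_ball hsδ))
  refine ⟨s, hs, hsδ.le, max 0 (max K₁ K₂), le_max_left _ _, fun z hz => ?_⟩
  have hsub : puncturedBall s ⊆ puncturedBall C.δ := fun w hw => ⟨hw.1, hw.2.trans hsδ⟩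
  have hrz : ∀ w ∈ puncturedBall s, r (C.par w) = ‖w‖ := fun w hw =>
    hn w (hsub hw) (hw.2.trans_le (min_le_left _ _))
  have hzc : z ∈ Metric.closedBall (0 : E4) s := by
    rw [mem_closedBall_zero_iff]
    exact hz.2.le
  refine ⟨hrz z hz, ?_, ?_⟩
  · refine le_trans ?_ ((le_max_right K₁ K₂).trans (le_max_right _ _))
    refine le_trans (le_of_eq ?_) ((le_abs_self _).trans (hK₂ z hzc))
    rw [volDensity, volDensity, C.lift_eq z (hsub hz)]
  · refine le_trans ?_ ((le_max_left K₁ K₂).trans (le_max_right _ _))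
    rw [C.isParam.gradSq_eq hr (hsub hz), ← C.lift_eq z (hsub hz)]
    refine hK₁ z hzc _ fun i => ?_
    rw [partialDeriv_congr_on (isOpen_puncturedBall s) hz i hrz]
    exact abs_partialDeriv_norm_le (norm_pos_iff.1 hz.1) i

namespace RiemannianOrbifold

variable {O : RiemannianOrbifold g X} {r : M → ℝ} [CompactSpace X]

/-- A compact set of regular points and the cone-like neighbourhoods of the singular points. -/
lemma isCompact_compl_nbhd {s : ∀ p ∈ O.sing, ℝ} (hs : ∀ p hp, 0 < s p hp)
    (hs' : ∀ p hp, s p hp ≤ (O.chart p hp).δ) :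
    IsCompact {x | ∀ p hp, O.incl x ∉ (O.chart p hp).nbhd (s p hp)} := by
  have hW : IsOpen (⋃ p : X, ⋃ hp : p ∈ O.sing, (O.chart p hp).nbhd (s p hp)) :=
    isOpen_iUnion fun p => isOpen_iUnion fun hp => (O.chart p hp).isOpen_nbhd (hs' p hp)
  have h1 := hW.isClosed_compl.isCompact
  have h2 := O.isOpenEmbedding.isInducing.isCompact_preimage_iff
    (K := (⋃ p : X, ⋃ hp : p ∈ O.sing, (O.chart p hp).nbhd (s p hp))ᶜ) (fun q hq => by
      by_contra hq'
      have hp := (O.mem_sing q).2 hq'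
      exact hq (mem_iUnion₂.2 ⟨q, hp, (O.chart q hp).mem_nbhd (hs q hp)⟩))
  convert h2.2 h1 using 1
  ext x
  simp

lemma isCompact_superlevel (hr : O.IsRadius r) {ε : ℝ} (hε : 0 < ε) :
    IsCompact {x | ε ≤ r x} := by
  have h := fun p hp => (O.chart p hp).exists_collar hr.smooth (hr.near p hp)
  choose s hs hs' K hK0 hK using h
  have hc := isCompact_compl_nbhd (O := O) (s := fun p hp => min (s p hp) ε)
    (fun p hp => lt_min (hs p hp) hε) (fun p hp => (min_le_left _ _).trans (hs' p hp))
  refine hc.of_isClosed_subset (isClosed_le continuous_const hr.smooth.continuous)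
    fun x hx p hp hxp => ?_
  obtain ⟨z, hz, rfl⟩ := (O.chart p hp).exists_of_mem_nbhd ((O.mem_sing p).1 hp)
    O.isOpenEmbedding.injective hxp
  have h1 := (hK p hp z ⟨hz.1, hz.2.trans_le (min_le_left _ _)⟩).1
  have h2 : ‖z‖ < ε := hz.2.trans_le (min_le_right _ _)
  rw [mem_ofPred_eq, h1] at hx
  exact absurd hx (not_le.2 h2)

lemma sigmaCompactSpace (hr : O.IsRadius r) : SigmaCompactSpace M := by
  refine ⟨fun n => {x | 1 / ((n : ℝ) + 1) ≤ r x},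
    fun n => isCompact_superlevel hr (by positivity), ?_⟩
  refine eq_univ_of_forall fun x => mem_iUnion.2 ?_
  obtain ⟨n, hn⟩ := exists_nat_one_div_lt (hr.pos x)
  exact ⟨n, hn.le⟩

variable [MeasurableSpace M] [BorelSpace M] {μ : Measure M}

lemma exists_collar (hr : O.IsRadius r) (hμ : IsRiemannianMeasure g μ) :
    ∃ ρ > 0, ∃ K, 0 ≤ K ∧ (∀ x, r x < ρ → gradSq g r x ≤ K) ∧
      ∀ t, 0 < t → t ≤ ρ → μ {x | r x < t} ≤ ENNReal.ofReal (K * t ^ 4) := by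
  have h := fun p hp => (O.chart p hp).exists_collar hr.smooth (hr.near p hp)
  choose s hs hs' K hK0 hK using h
  have hc := isCompact_compl_nbhd (O := O) hs hs'
  obtain ⟨ρ, hρ, hρr⟩ : ∃ ρ > 0, ∀ x, r x < ρ →
      ∃ p, ∃ hp : p ∈ O.sing, ∃ z ∈ puncturedBall (s p hp), (O.chart p hp).par z = x := by
    have key : ∃ ρ > 0, ∀ x ∈ {x | ∀ p hp, O.incl x ∉ (O.chart p hp).nbhd (s p hp)}, ρ ≤ r x := by
      rcases eq_empty_or_nonempty {x | ∀ p hp, O.incl x ∉ (O.chart p hp).nbhd (s p hp)} with h | h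
      · exact ⟨1, one_pos, by simp [h]⟩
      · obtain ⟨x, -, hx⟩ := hc.exists_isMinOn h hr.smooth.continuous.continuousOn
        exact ⟨r x, hr.pos x, fun y hy => hx hy⟩
    obtain ⟨ρ, hρ, h⟩ := key
    refine ⟨ρ, hρ, fun x hx => ?_⟩
    have h1 := mt (h x) (not_le.2 hx)
    rw [mem_ofPred_eq] at h1
    push Not at h1
    obtain ⟨p, hp, hxp⟩ := h1
    obtain ⟨z, hz, hzx⟩ := (O.chart p hp).exists_of_mem_nbhd ((O.mem_sing p).1 hp)
      O.isOpenEmbedding.injective hxp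
    exact ⟨p, hp, z, hz, hzx⟩
  have hvb : volume (Metric.ball (0 : E4) 1) ≠ ⊤ := measure_ball_lt_top.ne
  set v := (volume (Metric.ball (0 : E4) 1)).toReal
  set K' := ∑ p ∈ O.sing.attach, K p.1 p.2
  have hKle : ∀ p hp, K p hp ≤ K' := fun p hp =>
    Finset.single_le_sum (f := fun p : {x // x ∈ O.sing} => K p.1 p.2) (fun q _ => hK0 q.1 q.2)
      (Finset.mem_attach _ ⟨p, hp⟩)
  have hK' : 0 ≤ K' := sum_nonneg fun q _ => hK0 q.1 q.2
  refine ⟨ρ, hρ, max K' (K' * v), hK'.trans (le_max_left _ _), fun x hx => ?_, fun t ht htρ => ?_⟩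
  · obtain ⟨p, hp, z, hz, rfl⟩ := hρr x hx
    exact ((hK p hp z hz).2.2.trans (hKle p hp)).trans (le_max_left _ _)
  · have hsub : {x | r x < t} ⊆ ⋃ p ∈ O.sing.attach, (O.chart p.1 p.2).par ''
        puncturedBall (min t (s p.1 p.2)) := by
      intro x hx
      obtain ⟨p, hp, z, hz, rfl⟩ := hρr x (lt_of_lt_of_le hx htρ)
      have hzt : ‖z‖ < t := by rw [← (hK p hp z hz).1]; exact hx
      exact mem_iUnion₂.2 ⟨⟨p, hp⟩, Finset.mem_attach _ _, z, ⟨hz.1, lt_min hzt hz.2⟩, rfl⟩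
    have hone : ∀ p : {x // x ∈ O.sing}, μ ((O.chart p.1 p.2).par ''
        puncturedBall (min t (s p.1 p.2))) ≤ ENNReal.ofReal (K p.1 p.2 * v * t ^ 4) := by
      rintro ⟨p, hp⟩
      set C := O.chart p hp
      have hsubC : puncturedBall (min t (s p hp)) ⊆ puncturedBall C.δ := fun w hw =>
        ⟨hw.1, (hw.2.trans_le (min_le_right _ _)).trans_le (hs' p hp)⟩
      have hP := C.isParam.mono (isOpen_puncturedBall _) hsubC
      have h1 := hP.setLIntegral_image_le hμ (f := fun _ => 1) measurable_const
      rw [setLIntegral_one] at h1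
      refine h1.trans ?_
      calc ∫⁻ y in puncturedBall (min t (s p hp)),
            1 * ENNReal.ofReal (volDensity (coords C.par g.inner) y)
          ≤ ∫⁻ _ in puncturedBall (min t (s p hp)), ENNReal.ofReal (K p hp) := by
            refine setLIntegral_mono' (isOpen_puncturedBall _).measurableSet fun y hy => ?_
            rw [one_mul]
            exact ENNReal.ofReal_le_ofReal
              (hK p hp y ⟨hy.1, hy.2.trans_le (min_le_right _ _)⟩).2.1
        _ = ENNReal.ofReal (K p hp) * volume (puncturedBall (min t (s p hp))) :=
            setLIntegral_const _ _
        _ ≤ ENNReal.ofReal (K p hp) * volume (Metric.ball (0 : E4) t) := by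
            gcongr
            intro y hy
            rw [mem_ball_zero_iff]
            exact hy.2.trans_le (min_le_left _ _)
        _ = ENNReal.ofReal (K p hp * v * t ^ 4) := by
            rw [Measure.addHaar_ball volume (0 : E4) ht.le, ← ENNReal.ofReal_toReal hvb,
              finrank_euclideanSpace_fin, ← ENNReal.ofReal_mul (by positivity),
              ← ENNReal.ofReal_mul (hK0 p hp)]
            congr 1
            ring
    refine ((measure_mono hsub).trans (measure_biUnion_finset_le _ _)).trans ?_
    refine (Finset.sum_le_sum fun p _ => hone p).trans ?_
    rw [← ENNReal.ofReal_sum_of_nonneg fun p _ => by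
      have := hK0 p.1 p.2
      positivity]
    refine ENNReal.ofReal_le_ofReal ?_
    rw [← sum_mul, ← sum_mul]
    exact mul_le_mul_of_nonneg_right (le_max_right _ _) (by positivity)

end RiemannianOrbifold

end

section

variable {M : Type*} [TopologicalSpace M] [ChartedSpace E4 M] [IsManifold (𝓡 4) ∞ M]
  {g : RMetric M} {Λ : ℝ} {X : Type*} [TopologicalSpace X] {h : ℝ → TensorField M}

lemma normSq_le {T : TensorField M} {x : M} {C σ ε r : ℝ} (hσ : 0 ≤ σ) (hε : 0 < ε)
    (hr : ε ≤ r) (h : normAt g T x ≤ C * r ^ (-σ)) : normSq g T x ≤ (C * ε ^ (-σ)) ^ 2 := by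
  have h0 : 0 ≤ C := by
    have h1 : 0 ≤ normAt g T x := Real.sqrt_nonneg _
    exact nonneg_of_mul_nonneg_left (h1.trans h) (Real.rpow_pos_of_pos (hε.trans_le hr) _)
  refine normSq_le_of_normAt_le (h.trans ?_)
  exact mul_le_mul_of_nonneg_left
    (Real.rpow_le_rpow_of_nonpos hε hr (neg_nonpos.2 hσ)) h0

namespace RiemannianOrbifold

variable {O : RiemannianOrbifold g X} {r : M → ℝ}

lemma normSq_eq_zero [CompactSpace X] [T2Space X] (hΛ : Λ < 0) (hE : IsEinstein g Λ)
    (ho : O.IsOriented) (hR : O.RPlusNegative) (hr : O.IsRadius r) {C σ : ℝ} (hσ0 : 0 < σ)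
    (hσ1 : σ < 1) (hh : IsHeatSolution g Λ (Iio 0) h)
    (hb : ∀ t < 0, ∀ x, normAt g (h t) x ≤ C * r x ^ (-σ)) {t : ℝ} (ht : t < 0) (x₀ : M) :
    normSq g (h t) x₀ = 0 := by
  let _ : MeasurableSpace M := borel M
  have : BorelSpace M := ⟨rfl⟩
  have : T2Space M := O.isOpenEmbedding.isEmbedding.t2Space
  have : SigmaCompactSpace M := sigmaCompactSpace hr
  have : SecondCountableTopology M := ChartedSpace.secondCountable_of_sigmaCompact E4 M
  obtain ⟨μ, hμ⟩ := exists_isRiemannianMeasure g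
  have := hμ.isLocallyFiniteMeasure
  have := hμ.isOpenPosMeasure
  obtain ⟨c, hc0, hc⟩ := exists_zerothForm_ge hΛ hE ho hR
  obtain ⟨ρ, hρ, K, hK0, hK, hKμ⟩ := exists_collar hr hμ
  obtain ⟨L, hL⟩ := exists_deriv_cutoff_bound
  set K₁ := {x | r x₀ / 2 ≤ r x}
  have hK₁ : IsCompact K₁ := isCompact_superlevel hr (by linarith [hr.pos x₀])
  have hK₁m : MeasurableSet K₁ := hK₁.isClosed.measurableSet
  have hcn := fun s (hs : s < 0) => continuous_normSq hh (t := s) hs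
  have hrc := hr.smooth.continuous
  have key : ∀ ε, 0 < ε → 2 * ε ≤ ρ → 2 * ε ≤ r x₀ / 2 →
      ∫ x in K₁, normSq g (h t) x ∂μ
        ≤ 4 * (16 * (C * L * K) ^ 2 * (ε ^ (1 - σ)) ^ 2) / c := by
    intro ε hε hερ hεr
    set η : M → ℝ := fun x => cutoff ε (r x)
    have hη : ContMDiff (𝓡 4) 𝓘(ℝ, ℝ) ∞ η := (contDiff_cutoff ε).contMDiff.comp hr.smooth
    have hηc := hη.continuous
    have hsub : tsupport η ⊆ {x | ε ≤ r x} := by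
      refine closure_minimal (fun x hx => ?_) (isClosed_le continuous_const hrc)
      by_contra hx'
      exact hx (cutoff_eq_zero hε (not_le.1 hx').le)
    have hcs : HasCompactSupport η :=
      (isCompact_superlevel hr hε).of_isClosed_subset (isClosed_tsupport _) hsub
    have hKη : MeasurableSet (tsupport η) := (isClosed_tsupport η).measurableSet
    have hD : ∀ s < 0, ∀ x ∈ tsupport η, normSq g (h s) x ≤ (C * ε ^ (-σ)) ^ 2 :=
      fun s hs x hx => normSq_le hσ0.le hε (hsub hx) (hb s hs x)
    have hgrad : ∀ x, gradSq g η x ≤ {x | r x < 2 * ε}.indicator (fun _ => (L / ε) ^ 2 * K) x := by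
      intro x
      have h1 : gradSq g η x = deriv (cutoff ε) (r x) ^ 2 * gradSq g r x :=
        gradSq_comp hr.smooth ((contDiff_cutoff ε).differentiable (by simp)) x
      rw [h1]
      by_cases hx : r x < 2 * ε
      · rw [indicator_of_mem (by exact hx)]
        refine mul_le_mul ?_ (hK x (hx.trans_le hερ)) (gradSq_nonneg _ _ _) (sq_nonneg _)
        rw [← sq_abs]
        exact pow_le_pow_left₀ (abs_nonneg _) (hL ε hε (r x)) 2
      · rw [indicator_of_notMem (by exact hx), deriv_cutoff_eq_zero hε (not_lt.1 hx)]
        simp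
    have hlow : MeasurableSet {x | r x < 2 * ε} := (isOpen_lt hrc continuous_const).measurableSet
    have hμlow : μ.real {x | r x < 2 * ε} ≤ K * (2 * ε) ^ 4 :=
      ENNReal.toReal_le_of_le_ofReal (by positivity) (hKμ _ (by linarith) hερ)
    have hδ : ∀ s < 0, ∫ x in tsupport η, normSq g (h s) x * gradSq g η x ∂μ
        ≤ 16 * (C * L * K) ^ 2 * (ε ^ (1 - σ)) ^ 2 := by
      intro s hs
      have hfin : μ (tsupport η) ≠ ⊤ := hcs.isCompact.measure_lt_top.ne
      calc ∫ x in tsupport η, normSq g (h s) x * gradSq g η x ∂μ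
          ≤ ∫ x in tsupport η, {x | r x < 2 * ε}.indicator
              (fun _ => (C * ε ^ (-σ)) ^ 2 * ((L / ε) ^ 2 * K)) x ∂μ := by
            refine setIntegral_mono_on
              (((hcn s hs).mul (continuous_gradSq hη)).continuousOn.integrableOn_compact
                hcs.isCompact)
              ((integrableOn_const (hs := hfin)).indicator hlow) hKη fun x hx => ?_
            refine (mul_le_mul (hD s hs x hx) (hgrad x) (gradSq_nonneg _ _ _)
              (sq_nonneg _)).trans (le_of_eq ?_)
            by_cases hx : x ∈ {x | r x < 2 * ε} <;> simp [hx]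
        _ = μ.real ({x | r x < 2 * ε} ∩ tsupport η)
              * ((C * ε ^ (-σ)) ^ 2 * ((L / ε) ^ 2 * K)) := by
            rw [integral_indicator hlow, Measure.restrict_restrict hlow, setIntegral_const,
              smul_eq_mul]
        _ ≤ K * (2 * ε) ^ 4 * ((C * ε ^ (-σ)) ^ 2 * ((L / ε) ^ 2 * K)) := by
            refine mul_le_mul_of_nonneg_right ?_ (by positivity)
            refine le_trans (measureReal_mono inter_subset_left ?_) hμlow
            exact ((hKμ _ (by linarith) hερ).trans_lt ENNReal.ofReal_lt_top).ne
        _ = 16 * (C * L * K) ^ 2 * (ε ^ (1 - σ)) ^ 2 := by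
            rw [Real.rpow_sub hε, Real.rpow_neg hε.le, Real.rpow_one]
            field_simp
            ring
    have h1 := hh.energy_le hμ ho.atlas_pos hE hc0 hc hη hcs (B := (C * ε ^ (-σ)) ^ 2)
      (fun s hs x hx => ?_) hδ ht
    · refine le_trans ?_ h1
      have hone : ∀ x ∈ K₁, η x = 1 := fun x hx => cutoff_eq_one hε (hεr.trans hx)
      have hsubK : K₁ ⊆ tsupport η := fun x hx =>
        subset_tsupport _ (by rw [Function.mem_support, hone x hx]; exact one_ne_zero)
      rw [setIntegral_congr_fun (g := fun x => η x ^ 2 * normSq g (h t) x) hK₁m fun x hx => by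
        simp only [hone x hx, one_pow, one_mul]]
      exact setIntegral_mono_set (((hηc.pow 2).mul (hcn t ht)).continuousOn.integrableOn_compact
        hcs.isCompact) (Eventually.of_forall fun x => mul_nonneg (sq_nonneg _)
          (normSq_nonneg _ _ _)) hsubK.eventuallyLE
    · have hη1 : η x ^ 2 ≤ 1 := pow_le_one₀ (cutoff_nonneg _ _) (cutoff_le_one _ _)
      calc η x ^ 2 * normSq g (h s) x ≤ 1 * normSq g (h s) x :=
            mul_le_mul_of_nonneg_right hη1 (normSq_nonneg _ _ _)
        _ ≤ _ := by rw [one_mul]; exact hD s hs x hx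
  have hlim : Tendsto (fun ε : ℝ => 4 * (16 * (C * L * K) ^ 2 * (ε ^ (1 - σ)) ^ 2) / c)
      (𝓝[>] 0) (𝓝 0) := by
    have h1 : Tendsto (fun ε : ℝ => ε ^ (1 - σ)) (𝓝 0) (𝓝 0) := by
      have := (Real.continuousAt_rpow_const (0 : ℝ) (1 - σ) (Or.inr (by linarith))).tendsto
      rwa [Real.zero_rpow (by linarith)] at this
    have h2 := ((((h1.mono_left (nhdsWithin_le_nhds (s := Ioi 0))).pow 2).const_mul
      (16 * (C * L * K) ^ 2)).const_mul 4).div_const c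
    simpa using h2
  have hle : ∫ x in K₁, normSq g (h t) x ∂μ ≤ 0 := by
    refine ge_of_tendsto hlim ?_
    have hr0 := hr.pos x₀
    filter_upwards [self_mem_nhdsWithin, mem_nhdsWithin_of_mem_nhds
      (Iio_mem_nhds (show (0 : ℝ) < min (ρ / 2) (r x₀ / 4) from lt_min (by linarith)
        (by linarith)))] with ε hε hε'
    rw [mem_Iio, lt_min_iff] at hε'
    exact key ε hε (by linarith [hε'.1]) (by linarith [hε'.2])
  have h0 : ∫ x in K₁, normSq g (h t) x ∂μ = 0 :=
    le_antisymm hle (integral_nonneg fun x => normSq_nonneg _ _ _)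
  rw [setIntegral_eq_zero_iff_of_nonneg_ae (Eventually.of_forall fun x => normSq_nonneg _ _ _)
    ((hcn t ht).continuousOn.integrableOn_compact hK₁)] at h0
  have hU : IsOpen {x | r x₀ / 2 < r x} := isOpen_lt continuous_const hrc
  have h1 := Measure.eqOn_open_of_ae_eq (μ := μ) (U := {x | r x₀ / 2 < r x})
    (ae_restrict_of_ae_restrict_of_subset (t := K₁) (fun x (hx : r x₀ / 2 < r x) => hx.le) h0) hU
    (hcn t ht).continuousOn continuousOn_const
  exact h1 (show r x₀ / 2 < r x₀ by linarith [hr.pos x₀])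

lemma eq_zero [CompactSpace X] [T2Space X] (hΛ : Λ < 0) (hE : IsEinstein g Λ)
    (ho : O.IsOriented) (hR : O.RPlusNegative) (hr : O.IsRadius r) {C σ : ℝ} (hσ0 : 0 < σ)
    (hσ1 : σ < 1) (hh : IsHeatSolution g Λ (Iic 0) h)
    (hb : ∀ t ≤ 0, ∀ x, normAt g (h t) x ≤ C * r x ^ (-σ)) {t : ℝ} (ht : t ≤ 0) (x : M) :
    h t x = 0 := by
  have h0 : ∀ s < 0, normSq g (h s) x = 0 := fun s hs =>
    normSq_eq_zero hΛ hE ho hR hr hσ0 hσ1 (hh.mono Iio_subset_Iic_self)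
      (fun s hs => hb s hs.le) hs x
  refine OrbifoldLiouville.normSq_eq_zero (g := g) ?_
  rcases ht.lt_or_eq with ht | rfl
  · exact h0 t ht
  have h1 : ContinuousOn (fun s => normSq g (h s) x) (Iic 0) :=
    (continuousOn_normSq hh).comp (f := fun s : ℝ => (s, x))
      (by fun_prop : Continuous fun s : ℝ => (s, x)).continuousOn fun s hs => ⟨hs, mem_univ _⟩
  have h2 : Tendsto (fun s => normSq g (h s) x) (𝓝[<] 0) (𝓝 (normSq g (h 0) x)) :=
    (h1 0 (mem_Iic.2 le_rfl)).mono_left (nhdsWithin_mono _ Iio_subset_Iic_self)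
  exact tendsto_nhds_unique h2 (tendsto_const_nhds.congr'
    (eventually_of_mem self_mem_nhdsWithin fun s hs => (h0 s hs).symm))

end RiemannianOrbifold

end

section

/-! ### The Laplacian on functions -/

/-- `⟨df, dk⟩`. -/
def gradInner (G : E4 → Mat4) (f k : E4 → ℝ) (y : E4) : ℝ :=
  ∑ i, ∑ j, (G y)⁻¹ i j * (partialDeriv i f y * partialDeriv j k y)

/-- The Laplacian of a function. -/
def lap (G : E4 → Mat4) (f : E4 → ℝ) (y : E4) : ℝ := ∑ i, ∑ j, (G y)⁻¹ i j * hess G f y i j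

variable {U K : Set E4} {G : E4 → Mat4} {f k : E4 → ℝ} {y : E4}

lemma hess_apply (G : E4 → Mat4) (f : E4 → ℝ) (y : E4) (i j : Fin 4) :
    hess G f y i j = partialDeriv i (partialDeriv j f) y
      - ∑ l, christoffel G l i j y * partialDeriv l f y := rfl

lemma MetricOn.inv_comm (hG : MetricOn U G) (hy : y ∈ U) (i j : Fin 4) :
    (G y)⁻¹ i j = (G y)⁻¹ j i := congrFun (congrFun (hG.inv_symm hy) j) i

lemma MetricOn.gradInner_comm (hG : MetricOn U G) (hy : y ∈ U) (f k : E4 → ℝ) :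
    gradInner G f k y = gradInner G k f y := by
  rw [gradInner, gradInner, sum_comm]
  exact sum₂_congr fun i j => by
    rw [hG.inv_comm hy]; ring

lemma MetricOn.smooth_lap (hG : MetricOn U G) (hf : ContDiffOn ℝ ∞ f U) :
    ContDiffOn ℝ ∞ (lap G f) U := by
  have hp := fun i => contDiffOn_partialDeriv hf hG.isOpen i
  exact ContDiffOn.sum fun i _ => ContDiffOn.sum fun j _ => (hG.smooth_inv i j).mul
    ((contDiffOn_partialDeriv (hp j) hG.isOpen i).sub
      (ContDiffOn.sum fun l _ => (hG.smooth_chr i l j).mul (hp l)))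

lemma lap_congr (hU : IsOpen U) (hy : y ∈ U) (h : ∀ z ∈ U, f z = k z) :
    lap G f y = lap G k y := by
  have h1 := fun z (hz : z ∈ U) i => partialDeriv_congr_on hU hz i h
  simp only [lap, hess_apply, h1 y hy, fun i j => partialDeriv_congr_on hU hy i fun z hz => h1 z hz j]

lemma MetricOn.lap_mul (hG : MetricOn U G) (hy : y ∈ U) (hf : ContDiffOn ℝ ∞ f U)
    (hk : ContDiffOn ℝ ∞ k U) : lap G (fun z => f z * k z) y
      = f y * lap G k y + k y * lap G f y + 2 * gradInner G f k y := by
  have hd := fun z (hz : z ∈ U) => differentiableAt_of_contDiffOn hf hG.isOpen hz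
  have hd' := fun z (hz : z ∈ U) => differentiableAt_of_contDiffOn hk hG.isOpen hz
  have hp := fun i => differentiableAt_of_contDiffOn
    (contDiffOn_partialDeriv hf hG.isOpen i) hG.isOpen hy
  have hp' := fun i => differentiableAt_of_contDiffOn
    (contDiffOn_partialDeriv hk hG.isOpen i) hG.isOpen hy
  have h1 : ∀ z ∈ U, ∀ i, partialDeriv i (fun z => f z * k z) z
      = partialDeriv i f z * k z + f z * partialDeriv i k z := fun z hz i =>
    partialDeriv_mul i (hd z hz) (hd' z hz)
  have h2 : ∀ i j, hess G (fun z => f z * k z) y i j = f y * hess G k y i j + k y * hess G f y i j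
      + (partialDeriv i f y * partialDeriv j k y + partialDeriv j f y * partialDeriv i k y) := by
    intro i j
    rw [hess_apply, partialDeriv_congr_on hG.isOpen hy i fun z hz => h1 z hz j,
      partialDeriv_add i ((hp j).fun_mul (hd' y hy)) ((hd y hy).fun_mul (hp' j)),
      partialDeriv_mul i (hp j) (hd' y hy), partialDeriv_mul i (hd y hy) (hp' j)]
    simp only [hess_apply, h1 y hy, Fin.sum_univ_four]
    ring
  have h3 : gradInner G f k y
      = ∑ i, ∑ j, (G y)⁻¹ i j * (partialDeriv j f y * partialDeriv i k y) := by
    rw [hG.gradInner_comm hy, gradInner]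
    exact sum₂_congr fun i j => by ring
  rw [two_mul]
  nth_rw 2 [h3]
  simp only [lap, gradInner, h2, mul_sum, ← sum_add_distrib]
  exact sum₂_congr fun i j => by ring

lemma MetricOn.lap_comp (hG : MetricOn U G) (hy : y ∈ U) (hf : ContDiffOn ℝ ∞ f U) {φ : ℝ → ℝ}
    (hφ : ContDiff ℝ ∞ φ) : lap G (fun z => φ (f z)) y
      = deriv φ (f y) * lap G f y + deriv (deriv φ) (f y) * gradInner G f f y := by
  have hd := fun z (hz : z ∈ U) => differentiableAt_of_contDiffOn hf hG.isOpen hz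
  have hp := fun i => differentiableAt_of_contDiffOn
    (contDiffOn_partialDeriv hf hG.isOpen i) hG.isOpen hy
  have hφ1 : Differentiable ℝ φ := hφ.differentiable (by simp)
  have hφ2 : Differentiable ℝ (deriv φ) :=
    ((contDiff_infty_iff_deriv.1 hφ).2).differentiable (by simp)
  have h1 : ∀ z ∈ U, ∀ i, partialDeriv i (fun z => φ (f z)) z
      = deriv φ (f z) * partialDeriv i f z := fun z hz i =>
    partialDeriv_comp_real i hφ1.differentiableAt (hd z hz)
  have h2 : ∀ i j, hess G (fun z => φ (f z)) y i j = deriv φ (f y) * hess G f y i j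
      + deriv (deriv φ) (f y) * (partialDeriv i f y * partialDeriv j f y) := by
    intro i j
    rw [hess_apply, partialDeriv_congr_on hG.isOpen hy i fun z hz => h1 z hz j,
      partialDeriv_mul (f := fun z => deriv φ (f z)) i (hφ2.differentiableAt.comp y (hd y hy)) (hp j),
      partialDeriv_comp_real i hφ2.differentiableAt (hd y hy)]
    simp only [hess_apply, h1 y hy, Fin.sum_univ_four]
    ring
  simp only [lap, gradInner, h2, mul_sum, ← sum_add_distrib]
  exact sum₂_congr fun i j => by ring

lemma MetricOn.gradInner_comp (hG : MetricOn U G) (hy : y ∈ U) (hf : ContDiffOn ℝ ∞ f U)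
    {φ : ℝ → ℝ} (hφ : ContDiff ℝ ∞ φ) (k : E4 → ℝ) :
    gradInner G (fun z => φ (f z)) k y = deriv φ (f y) * gradInner G f k y := by
  simp only [gradInner, mul_sum, partialDeriv_comp_real (y := y) _
    (hφ.differentiable (by simp)).differentiableAt
    (differentiableAt_of_contDiffOn hf hG.isOpen hy)]
  exact sum₂_congr fun i j => by ring

lemma MetricOn.divergence_gradient (hG : MetricOn U G) (hy : y ∈ U) (hf : ContDiffOn ℝ ∞ f U) :
    divergence G (gradient G f) y = lap G f y := by
  have hp := fun i => differentiableAt_of_contDiffOn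
    (contDiffOn_partialDeriv hf hG.isOpen i) hG.isOpen hy
  have hI := hG.smooth_inv.diffMat hG.isOpen hy
  have h1 : ∀ i, partialDeriv i (gradient G f i) y = ∑ l, (dMat i (fun z => (G z)⁻¹) y i l
      * partialDeriv l f y + (G y)⁻¹ i l * partialDeriv i (partialDeriv l f) y) := fun i => by
    unfold gradient
    rw [partialDeriv_sum _ _ fun l _ => (hI i l).fun_mul (hp l)]
    exact sum_congr rfl fun l _ => partialDeriv_mul i (hI i l) (hp l)
  rw [divergence_eq]
  simp only [h1, hG.dMat_inv_eq hy, gradient, lap, hess_apply]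
  have h2 : ∀ i l j, christoffel G l i j y = chr G i y l j := fun _ _ _ => rfl
  simp only [h2, Matrix.neg_apply, Matrix.add_apply, mul_apply, transpose_apply,
    mul_sum, sum_mul, neg_add, mul_sub, add_mul, neg_mul, sum_add_distrib,
    sum_sub_distrib, sum_neg_distrib]
  have e1 : ∑ i, ∑ l, ∑ m, chr G i y i m * (G y)⁻¹ m l * partialDeriv l f y
      = ∑ i, ∑ k, ∑ l, chr G i y i k * ((G y)⁻¹ k l * partialDeriv l f y) :=
    sum_congr rfl fun i _ => sum_comm.trans (sum₂_congr fun k l => by ring)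
  have e2 : ∑ i, ∑ l, ∑ m, (G y)⁻¹ i m * chr G i y l m * partialDeriv l f y
      = ∑ i, ∑ j, ∑ l, (G y)⁻¹ i j * (chr G i y l j * partialDeriv l f y) :=
    sum_congr rfl fun i _ => sum_comm.trans (sum₂_congr fun k l => by ring)
  rw [e1, e2]
  ring

/-- Green's second identity. -/
lemma MetricOn.setIntegral_green (hG : MetricOn U G) (hf : ContDiffOn ℝ ∞ f U)
    (hk : ContDiffOn ℝ ∞ k U) (hK : IsCompact K) (hKU : K ⊆ U)
    (h0 : ∀ y ∈ U, y ∉ K → k y = 0) :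
    ∫ y in U, (k y * lap G f y - f y * lap G k y) * volDensity G y = 0 := by
  have hgr : ∀ {p : E4 → ℝ}, ContDiffOn ℝ ∞ p U → ∀ i, ContDiffOn ℝ ∞ (gradient G p i) U :=
    fun hp i => ContDiffOn.sum fun l _ => (hG.smooth_inv i l).mul
      (contDiffOn_partialDeriv hp hG.isOpen l)
  have h0' : ∀ y ∈ U, y ∉ K → ∀ i, gradient G k i y = 0 := fun y hy hyK i => by
    refine sum_eq_zero fun l _ => ?_
    rw [partialDeriv_congr_on (hG.isOpen.inter hK.isClosed.isOpen_compl) ⟨hy, hyK⟩ l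
      (fun z hz => h0 z hz.1 hz.2), partialDeriv_const, mul_zero]
  have hX : ∀ i, ContDiffOn ℝ ∞ (fun y => k y * gradient G f i y + (-f y) * gradient G k i y) U :=
    fun i => (hk.mul (hgr hf i)).add (hf.neg.mul (hgr hk i))
  rw [← hG.setIntegral_divergence hX (contDiffOn_const (c := (1 : ℝ))) hK hKU
    fun y hy hyK i => by rw [h0 y hy hyK, h0' y hy hyK]; ring]
  refine setIntegral_congr_fun hG.isOpen.measurableSet fun y hy => ?_
  have hfd := differentiableAt_of_contDiffOn hf hG.isOpen hy
  have hkd := differentiableAt_of_contDiffOn hk hG.isOpen hy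
  have hgd := fun i => differentiableAt_of_contDiffOn (hgr hf i) hG.isOpen hy
  have hgd' := fun i => differentiableAt_of_contDiffOn (hgr hk i) hG.isOpen hy
  have h1 : divergence G (fun i y => k y * gradient G f i y + (-f y) * gradient G k i y) y
      = divergence G (fun i y => k y * gradient G f i y) y
        + divergence G (fun i y => (-f y) * gradient G k i y) y := by
    simp only [divergence_eq]
    simp only [partialDeriv_add _ (hkd.fun_mul (hgd _)) (hfd.fun_neg.fun_mul (hgd' _)), mul_add,
      sum_add_distrib]
    ring
  simp only [h1, divergence_mul G hkd hgd, divergence_mul G hfd.fun_neg hgd',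
    hG.divergence_gradient hy hf, hG.divergence_gradient hy hk, partialDeriv_const,
    partialDeriv_neg]
  have h2 : ∑ i, gradient G f i y * partialDeriv i k y
      = ∑ i, gradient G k i y * partialDeriv i f y := by
    have := hG.gradInner_comm hy k f
    simp only [gradInner, gradient, sum_mul] at this ⊢
    refine Eq.trans ?_ (this.trans ?_) <;>
    exact sum₂_congr fun i j => by ring
  simp only [h2, mul_neg, sum_neg_distrib, mul_zero, Finset.sum_const_zero]
  ring

/-! ### The Bochner formula for the inner product of tensors -/

variable {A B : E4 → Mat4}

lemma MetricOn.partialDeriv_tensorInner (hG : MetricOn U G) (hy : y ∈ U) (hA : DiffMat A y)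
    (hB : DiffMat B y) (a : Fin 4) :
    partialDeriv a (fun z => tensorInner (G z) (A z) (B z)) y
      = tensorInner (G y) (cov G A a y) (B y) + tensorInner (G y) (A y) (cov G B a y) := by
  have hI : DiffMat (fun z => (G z)⁻¹) y := hG.smooth_inv.diffMat hG.isOpen hy
  have hIT : ((G y)⁻¹)ᵀ = (G y)⁻¹ := hG.inv_symm hy
  have hIT' : DiffMat (fun z => ((G z)⁻¹)ᵀ) y := fun i j => hI j i
  have hAT : DiffMat (fun z => (A z)ᵀ) y := fun i j => hA j i
  have hN : DiffMat (fun z => (A z)ᵀ * ((G z)⁻¹ * B z * ((G z)⁻¹)ᵀ)) y :=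
    hAT.mul ((hI.mul hB).mul hIT')
  have h1 : partialDeriv a (fun z => tensorInner (G z) (A z) (B z)) y
      = (dMat a (fun z => (A z)ᵀ * ((G z)⁻¹ * B z * ((G z)⁻¹)ᵀ)) y).trace := by
    simp only [tensorInner_eq_trace, Matrix.trace, Matrix.diag]
    exact partialDeriv_sum _ _ fun i _ => hN i i
  rw [h1, dMat_mul a hAT ((hI.mul hB).mul hIT'), dMat_mul a (hI.mul hB) hIT',
    dMat_mul a hI hB, dMat_transpose, dMat_transpose, hG.dMat_inv_eq hy, tensorInner_eq_trace,
    tensorInner_eq_trace, cov_eq, cov_eq, hIT]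
  simp only [Matrix.transpose_neg, Matrix.transpose_add, transpose_mul,
    transpose_transpose, Matrix.transpose_sub, hIT]
  have h2 : ((A y)ᵀ * ((G y)⁻¹ * (B y * ((G y)⁻¹ * (chr G a y)ᵀ)))).trace
      = ((chr G a y)ᵀ * ((A y)ᵀ * ((G y)⁻¹ * (B y * (G y)⁻¹)))).trace := by
    rw [trace_mul_comm (chr G a y)ᵀ]
    simp only [mul_assoc]
  simp only [mul_add, add_mul, mul_sub, sub_mul, mul_neg, neg_mul, Matrix.trace_add,
    Matrix.trace_sub, Matrix.trace_neg, mul_assoc]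
  rw [h2]
  ring

lemma MetricOn.lap_tensorInner (hG : MetricOn U G) (hy : y ∈ U) (hA : SmoothMat U A)
    (hB : SmoothMat U B) :
    lap G (fun z => tensorInner (G z) (A z) (B z)) y
      = tensorInner (G y) (roughLaplacian G A y) (B y)
        + tensorInner (G y) (A y) (roughLaplacian G B y)
        + 2 * ∑ a, ∑ i, (G y)⁻¹ a i * tensorInner (G y) (cov G A a y) (cov G B i y) := by
  have hr : ∀ C : Mat4, tensorInner (G y) C = fun D => tensorInner (G y) D C := fun C =>
    funext fun D => tensorInner_comm (hG.symm hy) C D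
  have h1 : ∀ z ∈ U, ∀ i, partialDeriv i (fun z => tensorInner (G z) (A z) (B z)) z
      = tensorInner (G z) (cov G A i z) (B z) + tensorInner (G z) (A z) (cov G B i z) :=
    fun z hz i => hG.partialDeriv_tensorInner hz (hA.diffMat hG.isOpen hz)
      (hB.diffMat hG.isOpen hz) i
  have hA1 := fun i => hG.smooth_cov hA i
  have hB1 := fun i => hG.smooth_cov hB i
  have hsm : ∀ {C D : E4 → Mat4}, SmoothMat U C → SmoothMat U D →
      DifferentiableAt ℝ (fun z => tensorInner (G z) (C z) (D z)) y := fun hC hD => by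
    refine differentiableAt_of_contDiffOn ?_ hG.isOpen hy
    exact ContDiffOn.sum fun i _ => ContDiffOn.sum fun j _ => ContDiffOn.sum fun k _ =>
      ContDiffOn.sum fun l _ => (((hG.smooth_inv i k).mul (hG.smooth_inv j l)).mul (hC i j)).mul
        (hD k l)
  have hc2 : ∀ {C : E4 → Mat4} (a i : Fin 4), cov G (cov G C i) a y
      = cov2 G C a i y + ∑ l, chr G a y l i • cov G C l y := fun a i => by
    rw [cov2_eq, cov_eq]
    abel
  have h2 : ∀ a i, hess G (fun z => tensorInner (G z) (A z) (B z)) y a i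
      = tensorInner (G y) (cov2 G A a i y) (B y) + tensorInner (G y) (A y) (cov2 G B a i y)
        + (tensorInner (G y) (cov G A i y) (cov G B a y)
          + tensorInner (G y) (cov G A a y) (cov G B i y)) := by
    intro a i
    rw [hess_apply, partialDeriv_congr_on hG.isOpen hy a fun z hz => h1 z hz i,
      partialDeriv_add a (hsm (hA1 i) hB) (hsm hA (hB1 i)),
      hG.partialDeriv_tensorInner hy ((hA1 i).diffMat hG.isOpen hy) (hB.diffMat hG.isOpen hy),
      hG.partialDeriv_tensorInner hy (hA.diffMat hG.isOpen hy) ((hB1 i).diffMat hG.isOpen hy),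
      hc2, hc2]
    have h3 : ∀ l, christoffel G l a i y = chr G a y l i := fun _ => rfl
    simp only [h1 y hy, h3]
    rw [hr (A y)]
    simp only [tensorInner_add_left, tensorInner_sum_left, tensorInner_smul_left, mul_add,
      sum_add_distrib]
    ring
  have h4 : ∑ a, ∑ i, (G y)⁻¹ a i * tensorInner (G y) (cov G A i y) (cov G B a y)
      = ∑ a, ∑ i, (G y)⁻¹ a i * tensorInner (G y) (cov G A a y) (cov G B i y) := by
    rw [sum_comm]
    exact sum₂_congr fun i j => by
      rw [hG.inv_comm hy]
  have h5 : ∀ C : E4 → Mat4, roughLaplacian G C y = ∑ a, ∑ i, (G y)⁻¹ a i • cov2 G C a i y :=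
    fun C => by
      ext j k
      simp only [roughLaplacian, of_apply, Matrix.sum_apply, Matrix.smul_apply, smul_eq_mul]
      rfl
  simp only [lap, h2, mul_add, sum_add_distrib, h4]
  rw [hr (A y), h5, h5]
  simp only [tensorInner_sum_left, tensorInner_smul_left]
  ring

lemma MetricOn.sum_tensorInner_nonneg (hG : MetricOn U G) (hy : y ∈ U) (T : Fin 4 → Mat4) :
    0 ≤ ∑ a, ∑ i, (G y)⁻¹ a i * tensorInner (G y) (T a) (T i) := by
  obtain ⟨J, hJ, hJ1⟩ := exists_frame (hG.posDef y hy)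
  have h1 := conj_inv (G := G y) hJ.ne'.isUnit
  rw [hJ1, inv_one, mul_one] at h1
  have hr : ∀ C D : Mat4, tensorInner (G y) C D = tensorInner (G y) D C := fun C D =>
    tensorInner_comm (hG.symm hy) C D
  have h2 : ∑ a, ∑ i, (G y)⁻¹ a i * tensorInner (G y) (T a) (T i)
      = ∑ b, tensorInner (G y) (∑ a, J a b • T a) (∑ i, J i b • T i) := by
    simp only [← h1, mul_apply, transpose_apply, tensorInner_sum_left,
      tensorInner_smul_left, sum_mul]
    have : ∀ a b, tensorInner (G y) (T a) (∑ i, J i b • T i)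
        = ∑ i, J i b * tensorInner (G y) (T a) (T i) := fun a b => by
      rw [hr, tensorInner_sum_left]
      exact sum_congr rfl fun i _ => by rw [tensorInner_smul_left, hr]
    simp only [this, mul_sum, mul_assoc]
    rw [← sum_fin4_comm₃ fun b a i => J a b * (J i b * tensorInner (G y) (T a) (T i))]
  rw [h2]
  exact sum_nonneg fun b _ => hG.tensorInner_nonneg hy _

end

section

/-! ### Hypersurfaces isometric to the unit sphere -/

/-- The components of an isometric immersion of `(U, G)` into the unit sphere of `ℝ⁵`. -/
structure SphereMap (U : Set E4) (G : E4 → Mat4) (F : Unit ⊕ Fin 4 → E4 → ℝ) : Prop where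
  smooth : ∀ A, ContDiffOn ℝ ∞ (F A) U
  sq : ∀ y ∈ U, ∑ A, F A y * F A y = 1
  metric : ∀ y ∈ U, ∀ i j, G y i j = ∑ A, partialDeriv i (F A) y * partialDeriv j (F A) y

/-- The linear function `y ↦ ⟨a, F y⟩`. -/
def linComb (F : Unit ⊕ Fin 4 → E4 → ℝ) (a : Unit ⊕ Fin 4 → ℝ) (y : E4) : ℝ := ∑ A, a A * F A y

variable {U : Set E4} {G : E4 → Mat4} {F : Unit ⊕ Fin 4 → E4 → ℝ} {y : E4}

lemma sum_rearrange {ι : Type*} [Fintype ι] (f : ι → ι → ι → ι → ℝ) :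
    ∑ i, ∑ l, ∑ p, ∑ q, f i l p q = ∑ p, ∑ q, ∑ i, ∑ l, f i l p q := by
  calc ∑ i, ∑ l, ∑ p, ∑ q, f i l p q = ∑ x : ι × ι, ∑ z : ι × ι, f x.1 x.2 z.1 z.2 := by
        simp only [Fintype.sum_prod_type]
    _ = ∑ z : ι × ι, ∑ x : ι × ι, f x.1 x.2 z.1 z.2 := sum_comm
    _ = _ := by simp only [Fintype.sum_prod_type]

namespace SphereMap

lemma diff (h : SphereMap U G F) (hG : MetricOn U G) (hy : y ∈ U) (A : Unit ⊕ Fin 4) :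
    DifferentiableAt ℝ (F A) y :=
  differentiableAt_of_contDiffOn (h.smooth A) hG.isOpen hy

lemma diff₁ (h : SphereMap U G F) (hG : MetricOn U G) (hy : y ∈ U) (A : Unit ⊕ Fin 4)
    (i : Fin 4) : DifferentiableAt ℝ (partialDeriv i (F A)) y :=
  differentiableAt_of_contDiffOn (contDiffOn_partialDeriv (h.smooth A) hG.isOpen i) hG.isOpen hy

lemma sum_mul_deriv (h : SphereMap U G F) (hG : MetricOn U G) (hy : y ∈ U) (l : Fin 4) :
    ∑ A, F A y * partialDeriv l (F A) y = 0 := by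
  have h1 : partialDeriv l (fun z => ∑ A, F A z * F A z) y = 0 := by
    rw [partialDeriv_congr_on hG.isOpen hy l h.sq, partialDeriv_const]
  rw [partialDeriv_sum _ _ fun A _ => (h.diff hG hy A).fun_mul (h.diff hG hy A)] at h1
  simp only [fun A => partialDeriv_mul l (h.diff hG hy A) (h.diff hG hy A), mul_comm
    (partialDeriv l _ y), ← two_mul, ← mul_sum] at h1
  linarith

lemma sum_mul_deriv₂ (h : SphereMap U G F) (hG : MetricOn U G) (hy : y ∈ U) (i j : Fin 4) :
    ∑ A, F A y * partialDeriv i (partialDeriv j (F A)) y = - G y i j := by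
  have h1 : partialDeriv i (fun z => ∑ A, F A z * partialDeriv j (F A) z) y = 0 := by
    rw [partialDeriv_congr_on hG.isOpen hy i fun z hz => h.sum_mul_deriv hG hz j,
      partialDeriv_const]
  rw [partialDeriv_sum _ _ fun A _ => (h.diff hG hy A).fun_mul (h.diff₁ hG hy A j)] at h1
  simp only [fun A => partialDeriv_mul i (h.diff hG hy A) (h.diff₁ hG hy A j),
    sum_add_distrib, ← h.metric y hy] at h1
  linarith

lemma sum_deriv₂_mul (h : SphereMap U G F) (hG : MetricOn U G) (hy : y ∈ U) (i j l : Fin 4) :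
    ∑ A, partialDeriv i (partialDeriv j (F A)) y * partialDeriv l (F A) y
      = ∑ m, chr G i y m j * G y m l := by
  have h1 : ∀ a b c, partialDeriv a (fun z => G z b c) y
      = ∑ A, (partialDeriv a (partialDeriv b (F A)) y * partialDeriv c (F A) y
        + partialDeriv b (F A) y * partialDeriv a (partialDeriv c (F A)) y) := fun a b c => by
    rw [partialDeriv_congr_on hG.isOpen hy a fun z hz => h.metric z hz b c,
      partialDeriv_sum _ _ fun A _ => (h.diff₁ hG hy A b).fun_mul (h.diff₁ hG hy A c)]
    exact sum_congr rfl fun A _ => partialDeriv_mul a (h.diff₁ hG hy A b) (h.diff₁ hG hy A c)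
  have h2 := hG.mul_chr_apply hy i l j
  have h3 : ∑ m, chr G i y m j * G y m l = (G y * chr G i y) l j := by
    rw [mul_apply]
    exact sum_congr rfl fun m _ => by rw [hG.symm_apply hy m l, mul_comm]
  have hc : ∀ A a b, partialDeriv a (partialDeriv b (F A)) y
      = partialDeriv b (partialDeriv a (F A)) y := fun A a b =>
    partialDeriv_comm (h.smooth A) hG.isOpen hy a b
  rw [h3, h2, h1, h1, h1, ← sum_add_distrib, ← sum_sub_distrib, mul_sum]
  refine sum_congr rfl fun A _ => ?_
  rw [hc A j i, hc A i l, hc A j l]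
  ring

/-- Gauss' equation: the curvature is that of the unit sphere. -/
lemma riemann_eq (h : SphereMap U G F) (hG : MetricOn U G) (hy : y ∈ U) (i j k l : Fin 4)
    (hess : ∀ z ∈ U, ∀ A i j, partialDeriv i (partialDeriv j (F A)) z
      = ∑ m, chr G i z m j * partialDeriv m (F A) z - F A z * G z i j) :
    riemann G i j k l y = G y i l * G y j k - G y i k * G y j l := by
  have hcd := fun a m c => (hG.smooth_chr a).diffMat hG.isOpen hy m c
  have hGd := fun b c => hG.smooth.diffMat hG.isOpen hy b c
  have h1 : ∀ a b A, partialDeriv a (partialDeriv b (partialDeriv k (F A))) y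
      = ∑ m, (dMat a (chr G b) y m k * partialDeriv m (F A) y
          + chr G b y m k * partialDeriv a (partialDeriv m (F A)) y)
        - (partialDeriv a (F A) y * G y b k + F A y * dMat a G y b k) := fun a b A => by
    rw [partialDeriv_congr_on hG.isOpen hy a fun z hz => hess z hz A b k, partialDeriv_sub a
      (DifferentiableAt.fun_sum fun m _ => (hcd b m k).fun_mul (h.diff₁ hG hy A m))
      ((h.diff hG hy A).fun_mul (hGd b k)),
      partialDeriv_sum _ _ fun m _ => (hcd b m k).fun_mul (h.diff₁ hG hy A m),
      partialDeriv_mul a (h.diff hG hy A) (hGd b k)]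
    congr 1
    exact sum_congr rfl fun m _ => partialDeriv_mul a (hcd b m k) (h.diff₁ hG hy A m)
  have h2 : ∀ a b, ∑ A, partialDeriv a (partialDeriv b (partialDeriv k (F A))) y
        * partialDeriv l (F A) y
      = ∑ m, (dMat a (chr G b) y m k * G y m l + chr G b y m k * ∑ p, chr G a y p m * G y p l)
        - G y a l * G y b k := fun a b => by
    have e : ∀ A, partialDeriv a (partialDeriv b (partialDeriv k (F A))) y * partialDeriv l (F A) y
        = ∑ m, (dMat a (chr G b) y m k * (partialDeriv m (F A) y * partialDeriv l (F A) y)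
          + chr G b y m k * (partialDeriv a (partialDeriv m (F A)) y * partialDeriv l (F A) y))
        - (partialDeriv a (F A) y * partialDeriv l (F A) y * G y b k
          + dMat a G y b k * (F A y * partialDeriv l (F A) y)) := fun A => by
      rw [h1, sub_mul, sum_mul]
      congr 1
      · exact sum_congr rfl fun m _ => by ring
      · ring
    simp only [e, sum_sub_distrib, sum_add_distrib, ← sum_mul,
      ← mul_sum, h.sum_mul_deriv hG hy l, mul_zero, add_zero, ← h.metric y hy]
    rw [sum_comm, sum_comm (s := Finset.univ (α := Unit ⊕ Fin 4))]
    simp only [← mul_sum, ← h.metric y hy, h.sum_deriv₂_mul hG hy]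
  have h3 := h2 i j
  have h4 := h2 j i
  have h5 : ∑ A, partialDeriv i (partialDeriv j (partialDeriv k (F A))) y * partialDeriv l (F A) y
      = ∑ A, partialDeriv j (partialDeriv i (partialDeriv k (F A))) y * partialDeriv l (F A) y :=
    sum_congr rfl fun A _ => by
      rw [partialDeriv_comm (contDiffOn_partialDeriv (h.smooth A) hG.isOpen k) hG.isOpen hy i j]
  have h6 : riemann G i j k l y
      = ∑ m, (dMat i (chr G j) y m k * G y m l + chr G j y m k * ∑ p, chr G i y p m * G y p l)
        - ∑ m, (dMat j (chr G i) y m k * G y m l + chr G i y m k * ∑ p, chr G j y p m * G y p l) := by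
    have h7 : ∀ m, riemannUp G i j k m y = dMat i (chr G j) y m k - dMat j (chr G i) y m k
        + ∑ p, (chr G j y p k * chr G i y m p - chr G i y p k * chr G j y m p) := fun m => rfl
    simp only [riemann, h7, Fin.sum_univ_four]
    ring
  rw [h6]
  linarith

/-- The matrix with rows `F` and the derivatives of `F`. -/
def frame (F : Unit ⊕ Fin 4 → E4 → ℝ) (y : E4) : Matrix (Unit ⊕ Fin 4) (Unit ⊕ Fin 4) ℝ :=
  Matrix.of (Sum.elim (fun _ A => F A y) fun l A => partialDeriv l (F A) y)

lemma frame_inv (h : SphereMap U G F) (hG : MetricOn U G) (hy : y ∈ U) :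
    (frame F y)ᵀ * Matrix.fromBlocks 1 0 0 (G y)⁻¹ * frame F y = 1 := by
  have h1 : frame F y * (frame F y)ᵀ = Matrix.fromBlocks 1 0 0 (G y) := by
    ext r s
    rw [mul_apply]
    rcases r with r | r <;> rcases s with s | s <;>
      simp only [frame, transpose_apply, of_apply, Sum.elim_inl, Sum.elim_inr,
        Matrix.fromBlocks_apply₁₁, Matrix.fromBlocks_apply₁₂, Matrix.fromBlocks_apply₂₁,
        Matrix.fromBlocks_apply₂₂]
    · rw [h.sq y hy, Matrix.one_apply_eq]
    · exact h.sum_mul_deriv hG hy s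
    · exact (sum_congr rfl fun A _ => mul_comm _ _).trans (h.sum_mul_deriv hG hy r)
    · exact (h.metric y hy r s).symm
  rw [mul_assoc, mul_eq_one_comm, mul_assoc, h1, Matrix.fromBlocks_multiply]
  simp [hG.inv_mul hy]

lemma eq_zero_of_orthogonal (h : SphereMap U G F) (hG : MetricOn U G) (hy : y ∈ U)
    {n : Unit ⊕ Fin 4 → ℝ} (h0 : ∑ A, F A y * n A = 0)
    (h1 : ∀ l, ∑ A, partialDeriv l (F A) y * n A = 0) : n = 0 := by
  have h2 : (frame F y).mulVec n = 0 := by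
    ext r
    rcases r with r | r
    · exact h0
    · exact h1 r
  rw [← Matrix.one_mulVec n, ← h.frame_inv hG hy, ← Matrix.mulVec_mulVec, h2, Matrix.mulVec_zero]

lemma hess_eq (h : SphereMap U G F) (hG : MetricOn U G) (hy : y ∈ U) (A : Unit ⊕ Fin 4) :
    hess G (F A) y = (- F A y) • G y := by
  ext i j
  have h1 := h.eq_zero_of_orthogonal hG hy (n := fun A => hess G (F A) y i j + F A y * G y i j)
    (by
      have e : ∀ A, F A y * (hess G (F A) y i j + F A y * G y i j)
          = F A y * partialDeriv i (partialDeriv j (F A)) y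
            - ∑ l, christoffel G l i j y * (F A y * partialDeriv l (F A) y)
            + F A y * F A y * G y i j := fun A => by
        rw [hess_apply, mul_add, mul_sub, mul_sum, mul_assoc]
        congr 2
        exact sum_congr rfl fun l _ => by ring
      simp only [e, sum_add_distrib, sum_sub_distrib, ← sum_mul, h.sq y hy,
        h.sum_mul_deriv₂ hG hy]
      rw [sum_comm]
      simp [← mul_sum, h.sum_mul_deriv hG hy])
    (fun l => by
      have e : ∀ A, partialDeriv l (F A) y * (hess G (F A) y i j + F A y * G y i j)
          = partialDeriv i (partialDeriv j (F A)) y * partialDeriv l (F A) y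
            - ∑ m, chr G i y m j * (partialDeriv m (F A) y * partialDeriv l (F A) y)
            + F A y * partialDeriv l (F A) y * G y i j := fun A => by
        rw [hess_apply, mul_add, mul_sub, mul_sum]
        congr 1
        · rw [mul_comm]
          congr 1
          refine sum_congr rfl fun m _ => ?_
          change partialDeriv l (F A) y * (chr G i y m j * partialDeriv m (F A) y) = _
          ring
        · ring
      simp only [e, sum_add_distrib, sum_sub_distrib, ← sum_mul,
        h.sum_mul_deriv hG hy, h.sum_deriv₂_mul hG hy]
      rw [sum_comm (s := Finset.univ (α := Unit ⊕ Fin 4))]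
      simp [← mul_sum, ← h.metric y hy])
  have h2 := congrFun h1 A
  simp only [Pi.zero_apply] at h2
  simp only [Matrix.smul_apply, smul_eq_mul]
  linarith

lemma curvAction_eq (h : SphereMap U G F) (hG : MetricOn U G) (hy : y ∈ U) {H : E4 → Mat4}
    (hs : (H y)ᵀ = H y) :
    curvAction G H y = tensorInner (G y) (H y) (G y) • G y - H y := by
  have hR := fun i j k l => h.riemann_eq hG hy i j k l fun z hz A i j => by
    have := congrFun (congrFun (h.hess_eq hG hz A) i) j
    rw [hess_apply, Matrix.smul_apply, smul_eq_mul] at this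
    have e : ∑ m, christoffel G m i j z * partialDeriv m (F A) z
      = ∑ m, chr G i z m j * partialDeriv m (F A) z := rfl
    linarith
  have h1 : tensorInner (G y) (H y) (G y) = ∑ p, ∑ q, H y p q * (G y)⁻¹ p q := by
    rw [tensorInner_eq_sum, hG.inv_symm hy, hG.inv_mul hy, one_mul]
  have h3 : (G y * (G y)⁻¹) = 1 := hG.mul_inv hy
  have h4 : ∀ p q, ∑ i, ∑ l, G y i l * (G y)⁻¹ i p * (G y)⁻¹ l q = (G y)⁻¹ p q := fun p q => by
    have : ∀ i, ∑ l, G y i l * (G y)⁻¹ i p * (G y)⁻¹ l q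
        = (G y)⁻¹ i p * (G y * (G y)⁻¹) i q := fun i => by
      rw [mul_apply, mul_sum]
      exact sum_congr rfl fun _ _ => by ring
    simp only [this, h3, Matrix.one_apply, mul_ite, mul_one, mul_zero, Finset.sum_ite_eq',
      Finset.mem_univ, if_true]
    exact hG.inv_comm hy q p
  ext j k
  have h5 : curvAction G H y j k = G y j k * ∑ p, ∑ q, H y p q * (G y)⁻¹ p q
      - ∑ p, ∑ q, (∑ i, ∑ l, G y k i * (G y)⁻¹ i p * (G y j l * (G y)⁻¹ l q)) * H y p q := by
    have e : ∑ p, ∑ q, H y p q * (G y)⁻¹ p q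
        = ∑ p, ∑ q, (∑ i, ∑ l, G y i l * (G y)⁻¹ i p * (G y)⁻¹ l q) * H y p q := by
      simp only [h4, mul_comm (H y _ _)]
    simp only [curvAction, of_apply, hR, e, sum_mul, mul_sum]
    conv_lhs => rw [sum_rearrange]
    rw [← sum_sub_distrib]
    refine sum_congr rfl fun p _ => ?_
    rw [← sum_sub_distrib]
    refine sum_congr rfl fun q _ => ?_
    rw [← sum_sub_distrib]
    refine sum_congr rfl fun i _ => ?_
    rw [← sum_sub_distrib]
    refine sum_congr rfl fun l _ => ?_
    rw [hG.symm_apply hy k i]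
    ring
  have h6 : ∀ k p, ∑ i, G y k i * (G y)⁻¹ i p = if k = p then 1 else 0 := fun k p => by
    rw [← mul_apply, h3, Matrix.one_apply]
  rw [h5, h1, Matrix.sub_apply, Matrix.smul_apply, smul_eq_mul, mul_comm]
  congr 1
  simp only [← Finset.sum_mul_sum, h6]
  simpa using congrFun (congrFun hs j) k

lemma gradInner_eq (h : SphereMap U G F) (hG : MetricOn U G) (hy : y ∈ U)
    (a b : Unit ⊕ Fin 4 → ℝ) : gradInner G (linComb F a) (linComb F b) y
      = ∑ A, a A * b A - linComb F a y * linComb F b y := by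
  have h1 : ∀ (a : Unit ⊕ Fin 4 → ℝ) i, partialDeriv i (linComb F a) y
      = ∑ A, a A * partialDeriv i (F A) y := fun a i => by
    unfold linComb
    rw [partialDeriv_sum _ _ fun A _ => (h.diff hG hy A).const_mul (a A)]
    exact sum_congr rfl fun A _ => partialDeriv_const_mul i _ (h.diff hG hy A)
  have h2 := h.frame_inv hG hy
  have h3 : ∑ A, a A * b A = ∑ A, ∑ B, a A *
      ((frame F y)ᵀ * Matrix.fromBlocks 1 0 0 (G y)⁻¹ * frame F y :
        Matrix (Unit ⊕ Fin 4) (Unit ⊕ Fin 4) ℝ) A B * b B := by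
    simp [h2, Matrix.one_apply]
  have h4 : ∀ A B, ((frame F y)ᵀ * Matrix.fromBlocks 1 0 0 (G y)⁻¹ * frame F y :
      Matrix (Unit ⊕ Fin 4) (Unit ⊕ Fin 4) ℝ) A B
      = F A y * F B y + ∑ i, ∑ j, (G y)⁻¹ i j * (partialDeriv i (F A) y * partialDeriv j (F B) y) :=
    fun A B => by
      simp only [mul_apply, Fintype.sum_sum_type, frame, transpose_apply,
        of_apply, Sum.elim_inl, Sum.elim_inr, Matrix.fromBlocks_apply₁₁,
        Matrix.fromBlocks_apply₁₂, Matrix.fromBlocks_apply₂₁, Matrix.fromBlocks_apply₂₂,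
        Finset.univ_unique, Finset.sum_singleton, Matrix.one_apply_eq, Matrix.zero_apply, mul_one,
        mul_zero, Finset.sum_const_zero, add_zero, zero_add, sum_mul]
      rw [sum_comm]
      congr 1
      exact sum₂_congr fun i j => by ring
  rw [h3]
  simp only [h4, gradInner, h1, linComb, sum_mul, mul_sum, mul_add, add_mul,
    sum_add_distrib]
  rw [add_comm, add_sub_assoc]
  have e1 : ∑ A, ∑ B, a A * (F A y * F B y) * b B = ∑ A, ∑ B, a A * F A y * (b B * F B y) :=
    sum₂_congr fun _ _ => by ring
  have e2 : ∑ A, ∑ B, a A * F A y * (b B * F B y) = ∑ A, ∑ B, a B * F B y * (b A * F A y) :=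
    sum_comm
  rw [e1, e2, sub_self, add_zero]
  simp only [Fin.sum_univ_four, Fintype.sum_sum_type, Finset.univ_unique, Finset.sum_singleton]
  ring

lemma smooth_linComb (h : SphereMap U G F) (a : Unit ⊕ Fin 4 → ℝ) :
    ContDiffOn ℝ ∞ (linComb F a) U :=
  ContDiffOn.sum fun A _ => contDiffOn_const.mul (h.smooth A)

lemma lap_linComb (h : SphereMap U G F) (hG : MetricOn U G) (hy : y ∈ U)
    (a : Unit ⊕ Fin 4 → ℝ) : lap G (linComb F a) y = -4 * linComb F a y := by
  have h1 : ∀ z ∈ U, ∀ i, partialDeriv i (linComb F a) z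
      = ∑ A, a A * partialDeriv i (F A) z := fun z hz i => by
    unfold linComb
    rw [partialDeriv_sum _ _ fun A _ => (h.diff hG hz A).const_mul (a A)]
    exact sum_congr rfl fun A _ => partialDeriv_const_mul i _ (h.diff hG hz A)
  have h2 : ∀ i j, hess G (linComb F a) y i j = - linComb F a y * G y i j := fun i j => by
    have e : hess G (linComb F a) y i j = ∑ A, a A * hess G (F A) y i j := by
      rw [hess_apply, partialDeriv_congr_on hG.isOpen hy i fun z hz => h1 z hz j,
        partialDeriv_sum _ _ fun A _ => (h.diff₁ hG hy A j).const_mul (a A)]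
      simp only [partialDeriv_const_mul i _ (h.diff₁ hG hy _ j), h1 y hy, hess_apply,
        Fin.sum_univ_four, Fintype.sum_sum_type, Finset.univ_unique, Finset.sum_singleton]
      ring
    rw [e]
    simp only [h.hess_eq hG hy, Matrix.smul_apply, smul_eq_mul, linComb, sum_mul, neg_mul,
      mul_neg, sum_neg_distrib, mul_assoc]
  have h3 : ∑ i, ∑ j, (G y)⁻¹ i j * G y i j = 4 := by
    have := congrArg Matrix.trace (hG.inv_mul hy)
    simp only [Matrix.trace, Matrix.diag, mul_apply, Matrix.one_apply_eq] at this
    rw [Finset.sum_const, Finset.card_univ, Fintype.card_fin, nsmul_eq_mul, mul_one] at this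
    rw [show (4 : ℝ) = ((4 : ℕ) : ℝ) by norm_num, ← this]
    exact sum₂_congr fun i j => by
      rw [hG.symm_apply hy]
  have h4 : lap G (linComb F a) y
      = - linComb F a y * ∑ i, ∑ j, (G y)⁻¹ i j * G y i j := by
    simp only [lap, h2, mul_sum]
    exact sum₂_congr fun i j => by ring
  rw [h4, h3]
  ring

end SphereMap

end

section

/-! ### A maximum principle for ancient subsolutions on the sphere minus its poles -/

lemma exists_cutoff_bound : ∃ L, 0 ≤ L ∧ ∀ ε > 0, ∀ s > 0, |deriv (cutoff ε) s| * s ≤ L ∧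
    |deriv (deriv (cutoff ε)) s| * s ^ 2 ≤ L := by
  have hS : ContDiff ℝ 2 Real.smoothTransition := Real.smoothTransition.contDiff
  have hS1 : ContDiff ℝ 1 (deriv Real.smoothTransition) := hS.deriv' (n := 1)
  have hc := hasCompactSupport_deriv_smoothTransition
  obtain ⟨L₁, h₁⟩ := (hc.mul_right (f' := fun x => x + 1)).exists_bound_of_continuous
    (hS1.continuous.mul (by fun_prop))
  obtain ⟨L₂, h₂⟩ := (hc.deriv.mul_right (f' := fun x => (x + 1) ^ 2)).exists_bound_of_continuous
    ((hS1.continuous_deriv le_rfl).mul (by fun_prop))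
  have hL₁ : 0 ≤ L₁ := (norm_nonneg _).trans (h₁ 0)
  have hL₂ : 0 ≤ L₂ := (norm_nonneg _).trans (h₂ 0)
  refine ⟨L₁ + L₂, by positivity, fun ε hε s hs => ?_⟩
  have hd : deriv (deriv (cutoff ε)) s
      = deriv (deriv Real.smoothTransition) (s / ε - 1) / ε / ε := by
    rw [show deriv (cutoff ε) = fun s => deriv Real.smoothTransition (s / ε - 1) / ε from
      funext (deriv_cutoff ε)]
    have h1 : HasDerivAt (fun s : ℝ => s / ε - 1) (1 / ε) s :=
      ((hasDerivAt_id s).div_const ε).sub_const 1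
    have h2 := ((hS1.differentiable (by simp) (s / ε - 1)).hasDerivAt.comp s h1).div_const ε
    rw [show (fun s => deriv Real.smoothTransition (s / ε - 1) / ε)
      = fun s => (deriv Real.smoothTransition ∘ fun s : ℝ => s / ε - 1) s / ε from rfl, h2.deriv]
    ring
  constructor
  · have := h₁ (s / ε - 1)
    rw [Pi.mul_apply, norm_mul, Real.norm_eq_abs, Real.norm_eq_abs, sub_add_cancel,
      abs_of_pos (div_pos hs hε)] at this
    rw [deriv_cutoff, abs_div, abs_of_pos hε]
    calc _ = |deriv Real.smoothTransition (s / ε - 1)| * (s / ε) := by ring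
      _ ≤ _ := by linarith
  · have := h₂ (s / ε - 1)
    rw [Pi.mul_apply, norm_mul, Real.norm_eq_abs, Real.norm_eq_abs, sub_add_cancel,
      abs_of_pos (pow_pos (div_pos hs hε) 2)] at this
    rw [hd, abs_div, abs_div, abs_of_pos hε]
    calc _ = |deriv (deriv Real.smoothTransition) (s / ε - 1)| * (s / ε) ^ 2 := by
          field_simp
      _ ≤ _ := by linarith

lemma deriv_deriv_cutoff_eq_zero {ε s : ℝ} (hε : 0 < ε) (h : 2 * ε < s) :
    deriv (deriv (cutoff ε)) s = 0 := by
  have : deriv (cutoff ε) =ᶠ[𝓝 s] fun _ => (0 : ℝ) :=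
    (eventually_gt_nhds h).mono fun z hz => deriv_cutoff_eq_zero hε hz.le
  rw [this.deriv_eq, deriv_const]

variable {U : Set E4} {G : E4 → Mat4} {F : Unit ⊕ Fin 4 → E4 → ℝ} {y : E4}
  {a : Unit ⊕ Fin 4 → ℝ}

lemma linComb_single (F : Unit ⊕ Fin 4 → E4 → ℝ) (A : Unit ⊕ Fin 4) :
    linComb F (Pi.single A 1) = F A := by
  ext y
  simp [linComb, Pi.single_apply]

lemma SphereMap.abs_linComb_le (h : SphereMap U G F) (hy : y ∈ U) (ha : ∑ A, a A * a A = 1) :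
    |linComb F a y| ≤ 1 := by
  have h1 := Finset.sum_mul_sq_le_sq_mul_sq Finset.univ a fun A => F A y
  have h2 := h.sq y hy
  simp only [← pow_two] at h2 ha
  rw [ha, h2, one_mul] at h1
  exact abs_le_one_iff_mul_self_le_one.2 (by rw [← pow_two]; exact h1)

/-- The squared distance `sin²` from the axis through the poles. -/
def sinSq (F : Unit ⊕ Fin 4 → E4 → ℝ) (y : E4) : ℝ := 1 - F (Sum.inl ()) y ^ 2

/-- The weights `(1 + ⟨a, F⟩)ⁿ`. -/
def weight (F : Unit ⊕ Fin 4 → E4 → ℝ) (a : Unit ⊕ Fin 4 → ℝ) (n : ℕ) (y : E4) : ℝ :=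
  (1 + linComb F a y) ^ n

/-- The cutoff functions near the poles. -/
def poleCutoff (F : Unit ⊕ Fin 4 → E4 → ℝ) (ε : ℝ) (y : E4) : ℝ := cutoff ε (sinSq F y)

lemma lap_weight (h : SphereMap U G F) (hG : MetricOn U G) (hy : y ∈ U)
    (ha : ∑ A, a A * a A = 1) (n : ℕ) :
    lap G (weight F a n) y = -(n * (n + 3)) * weight F a n y
      + 2 * n * (n + 1) * weight F a (n - 1) y := by
  have hd : ∀ m : ℕ, deriv (fun z : ℝ => (1 + z) ^ m) = fun z => (m : ℝ) * (1 + z) ^ (m - 1) :=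
    fun m => by
      ext z
      have := ((hasDerivAt_id z).const_add 1).fun_pow m
      simpa using this.deriv
  have h1 := hG.lap_comp hy (h.smooth_linComb a) (φ := fun z => (1 + z) ^ n) (by fun_prop)
  rw [h.lap_linComb hG hy, h.gradInner_eq hG hy, ha, hd] at h1
  have hdd : deriv (fun z : ℝ => n * (1 + z) ^ (n - 1)) (linComb F a y)
      = n * (((n - 1 : ℕ) : ℝ) * (1 + linComb F a y) ^ (n - 1 - 1)) := by
    rw [deriv_const_mul _ (by fun_prop), congrFun (hd (n - 1))]
  rw [hdd] at h1
  unfold weight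
  rw [h1]
  rcases n with _ | _ | n
  · simp
  · simp
    ring
  · simp only [Nat.add_sub_cancel]
    push_cast
    ring

lemma deriv_sq_comp {φ : ℝ → ℝ} (hφ : ContDiff ℝ ∞ φ) (v : ℝ) :
    deriv (fun v => φ (1 - v ^ 2)) v = -2 * v * deriv φ (1 - v ^ 2) := by
  have h1 : HasDerivAt (fun v : ℝ => 1 - v ^ 2) (-(2 * v)) v := by
    simpa using ((hasDerivAt_id v).pow 2).const_sub 1
  have h2 := (hφ.differentiable (by simp) (1 - v ^ 2)).hasDerivAt.comp v h1
  rw [show (fun v => φ (1 - v ^ 2)) = φ ∘ fun v => 1 - v ^ 2 from rfl, h2.deriv]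
  ring

lemma deriv_deriv_sq_comp {φ : ℝ → ℝ} (hφ : ContDiff ℝ ∞ φ) (v : ℝ) :
    deriv (deriv fun v => φ (1 - v ^ 2)) v
      = -2 * deriv φ (1 - v ^ 2) + 4 * v ^ 2 * deriv (deriv φ) (1 - v ^ 2) := by
  have hφ' : ContDiff ℝ ∞ (deriv φ) := (contDiff_infty_iff_deriv.1 hφ).2
  rw [show (deriv fun v => φ (1 - v ^ 2)) = fun v => -2 * v * deriv φ (1 - v ^ 2) from
    funext (deriv_sq_comp hφ)]
  have h1 : HasDerivAt (fun v : ℝ => 1 - v ^ 2) (-(2 * v)) v := by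
    simpa using ((hasDerivAt_id v).pow 2).const_sub 1
  have h2 := (hφ'.differentiable (by simp) (1 - v ^ 2)).hasDerivAt.comp v h1
  have h3 := ((hasDerivAt_id v).const_mul (-2)).mul h2
  refine h3.deriv.trans ?_
  simp only [Function.comp, id]
  ring

lemma SphereMap.smooth_weight (h : SphereMap U G F) (n : ℕ) :
    ContDiffOn ℝ ∞ (weight F a n) U :=
  (contDiffOn_const.add (h.smooth_linComb a)).pow n

lemma SphereMap.smooth_poleCutoff (h : SphereMap U G F) (ε : ℝ) :
    ContDiffOn ℝ ∞ (poleCutoff F ε) U :=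
  (contDiff_cutoff ε).comp_contDiffOn (contDiffOn_const.sub ((h.smooth _).pow 2))

lemma SphereMap.weight_mem (h : SphereMap U G F) (hy : y ∈ U) (ha : ∑ A, a A * a A = 1)
    (n : ℕ) : 0 ≤ weight F a n y ∧ weight F a n y ≤ 2 ^ n := by
  have := abs_le.1 (h.abs_linComb_le hy ha)
  exact ⟨pow_nonneg (by linarith) n, pow_le_pow_left₀ (by linarith) (by linarith) n⟩

lemma abs_sq_comp_le {v s c1 c2 L : ℝ} (hs : 0 < s) (hs1 : s ≤ 1) (hv : v ^ 2 ≤ 1)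
    (b1 : |c1| * s ≤ L) (b2 : |c2| * s ^ 2 ≤ L) :
    |-2 * v * c1 * (-4 * v) + (-2 * c1 + 4 * v ^ 2 * c2) * s| * s ≤ 14 * L := by
  have c1n : 0 ≤ |c1| * s := by positivity
  have c2n : 0 ≤ |c2| * s ^ 2 := by positivity
  have t1 : |-2 * v * c1 * (-4 * v) + (-2 * c1 + 4 * v ^ 2 * c2) * s|
      ≤ 8 * v ^ 2 * |c1| + (2 * |c1| + 4 * v ^ 2 * |c2|) * s := by
    refine (abs_add_le _ _).trans (add_le_add ?_ ?_)
    · rw [show -2 * v * c1 * (-4 * v) = 8 * v ^ 2 * c1 by ring, abs_mul,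
        abs_of_nonneg (by positivity : 0 ≤ 8 * v ^ 2)]
    · rw [abs_mul, abs_of_pos hs]
      refine mul_le_mul_of_nonneg_right ((abs_add_le _ _).trans (add_le_add ?_ ?_)) hs.le
      · rw [abs_mul, abs_neg, abs_two]
      · rw [abs_mul, abs_of_nonneg (by positivity : 0 ≤ 4 * v ^ 2)]
  have t2 : (|c1| * s) * s ≤ L := (mul_le_of_le_one_right c1n hs1).trans b1
  have t3 : v ^ 2 * (|c1| * s) ≤ L := (mul_le_of_le_one_left c1n hv).trans b1
  have t4 : v ^ 2 * (|c2| * s ^ 2) ≤ L := (mul_le_of_le_one_left c2n hv).trans b2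
  calc _ ≤ (8 * v ^ 2 * |c1| + (2 * |c1| + 4 * v ^ 2 * |c2|) * s) * s :=
        mul_le_mul_of_nonneg_right t1 hs.le
    _ = 8 * (v ^ 2 * (|c1| * s)) + 2 * (|c1| * s * s) + 4 * (v ^ 2 * (|c2| * s ^ 2)) := by ring
    _ ≤ _ := by linarith

lemma SphereMap.lap_poleCutoff (h : SphereMap U G F) (hG : MetricOn U G) (hy : y ∈ U) (ε : ℝ) :
    lap G (poleCutoff F ε) y = -2 * F (Sum.inl ()) y * deriv (cutoff ε) (sinSq F y)
        * (-4 * F (Sum.inl ()) y) + (-2 * deriv (cutoff ε) (sinSq F y)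
          + 4 * F (Sum.inl ()) y ^ 2 * deriv (deriv (cutoff ε)) (sinSq F y)) * sinSq F y := by
  have hφ : ContDiff ℝ ∞ fun v : ℝ => cutoff ε (1 - v ^ 2) :=
    (contDiff_cutoff ε).comp (by fun_prop)
  have h2 := hG.lap_comp hy (h.smooth (Sum.inl ())) hφ
  have h7 := h.gradInner_eq hG hy (Pi.single (Sum.inl ()) 1) (Pi.single (Sum.inl ()) 1)
  have h8 := h.lap_linComb hG hy (Pi.single (Sum.inl ()) 1)
  rw [linComb_single] at h7 h8
  rw [deriv_sq_comp (contDiff_cutoff ε), deriv_deriv_sq_comp (contDiff_cutoff ε), h7, h8] at h2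
  simp only [Pi.single_apply, mul_ite, mul_one, mul_zero, Finset.sum_ite_eq', Finset.mem_univ,
    if_true, ← pow_two (F _ y)] at h2
  exact h2

lemma SphereMap.gradInner_poleCutoff (h : SphereMap U G F) (hG : MetricOn U G) (hy : y ∈ U)
    (ε : ℝ) (n : ℕ) : gradInner G (poleCutoff F ε) (weight F a n) y
      = -2 * F (Sum.inl ()) y * deriv (cutoff ε) (sinSq F y)
        * (n * weight F a (n - 1) y * (a (Sum.inl ()) - linComb F a y * F (Sum.inl ()) y)) := by
  have hφ : ContDiff ℝ ∞ fun v : ℝ => cutoff ε (1 - v ^ 2) :=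
    (contDiff_cutoff ε).comp (by fun_prop)
  have h3 := hG.gradInner_comp hy (h.smooth (Sum.inl ())) hφ (weight F a n)
  have h4 := hG.gradInner_comp hy (h.smooth_linComb a) (φ := fun z => (1 + z) ^ n) (by fun_prop)
      (F (Sum.inl ()))
  have h5 : deriv (fun z : ℝ => (1 + z) ^ n) (linComb F a y) = n * (1 + linComb F a y) ^ (n - 1) := by
    have := ((hasDerivAt_id (linComb F a y)).const_add 1).fun_pow n
    simpa using this.deriv
  have h6 := h.gradInner_eq hG hy a (Pi.single (Sum.inl ()) 1)
  rw [linComb_single] at h6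
  rw [h5, h6] at h4
  rw [deriv_sq_comp (contDiff_cutoff ε), hG.gradInner_comm hy (F (Sum.inl ()))] at h3
  refine h3.trans ?_
  congr 1
  refine h4.trans ?_
  simp [Pi.single_apply, weight]

/-- Cutting off near the poles changes the Laplacian of the weights by at most a multiple of
`1 / sin²`. -/
lemma SphereMap.exists_lap_bound (h : SphereMap U G F) (hG : MetricOn U G)
    (ha : ∑ A, a A * a A = 1) (hs : ∀ y ∈ U, 0 < sinSq F y) (n : ℕ) :
    ∃ K, 0 ≤ K ∧ ∀ ε > 0, ∀ y ∈ U,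
      |lap G (fun z => poleCutoff F ε z * weight F a n z) y
          - poleCutoff F ε y * lap G (weight F a n) y|
        ≤ {z | sinSq F z ≤ 2 * ε}.indicator (fun z => K * (sinSq F z)⁻¹) y := by
  obtain ⟨L, hL0, hL⟩ := exists_cutoff_bound
  refine ⟨2 ^ n * (14 * L) + 8 * L * (n * 2 ^ (n - 1)), by positivity, fun ε hε y hy => ?_⟩
  have h1 := hG.lap_mul hy (h.smooth_poleCutoff ε) (h.smooth_weight (a := a) n)
  have h2 := h.lap_poleCutoff hG hy ε
  have h3 := h.gradInner_poleCutoff hG hy ε n (a := a)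
  have hsy := hs y hy
  by_cases hi : y ∈ {z | sinSq F z ≤ 2 * ε}
  · rw [indicator_of_mem hi]
    obtain ⟨b1, b2⟩ := hL ε hε _ hsy
    have hss : 1 - F (Sum.inl ()) y ^ 2 = sinSq F y := rfl
    have hw := h.weight_mem hy ha n
    have hw' := h.weight_mem hy ha (n - 1)
    have hz1 := h.abs_linComb_le hy ha
    have hv1 : |F (Sum.inl ()) y| ≤ 1 := by
      rw [← linComb_single F]
      exact h.abs_linComb_le hy (by simp [Pi.single_apply])
    have e2 : |a (Sum.inl ())| ≤ 1 := by
      refine abs_le_one_iff_mul_self_le_one.2 (ha ▸ ?_)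
      exact Finset.single_le_sum (f := fun A => a A * a A) (fun A _ => mul_self_nonneg _)
        (Finset.mem_univ _)
    have e3 : |a (Sum.inl ()) - linComb F a y * F (Sum.inl ()) y| ≤ 2 := by
      have : |linComb F a y * F (Sum.inl ()) y| ≤ 1 := by
        rw [abs_mul]; exact mul_le_one₀ hz1 (abs_nonneg _) hv1
      linarith [abs_sub (a (Sum.inl ())) (linComb F a y * F (Sum.inl ()) y)]
    have hs1 : sinSq F y ≤ 1 := by rw [← hss]; linarith [sq_nonneg (F (Sum.inl ()) y)]
    have k1 : |lap G (poleCutoff F ε) y| * sinSq F y ≤ 14 * L := by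
      rw [h2]
      exact abs_sq_comp_le hsy hs1 (by rw [← sq_abs]; exact pow_le_one₀ (abs_nonneg _) hv1) b1 b2
    have k2 : |gradInner G (poleCutoff F ε) (weight F a n) y| * sinSq F y
        ≤ 4 * L * (n * 2 ^ (n - 1)) := by
      rw [h3, abs_mul, abs_mul, abs_mul, abs_mul, abs_mul, Nat.abs_cast, abs_of_nonneg hw'.1,
        abs_neg, abs_two]
      calc _ = 2 * (|F (Sum.inl ()) y| * (|deriv (cutoff ε) (sinSq F y)| * sinSq F y)
            * (n * weight F a (n - 1) y
            * |a (Sum.inl ()) - linComb F a y * F (Sum.inl ()) y|)) := by ring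
        _ ≤ 2 * (1 * L * (n * 2 ^ (n - 1) * 2)) := by
          refine mul_le_mul_of_nonneg_left (mul_le_mul (mul_le_mul hv1 b1 (by positivity)
            zero_le_one) (mul_le_mul (mul_le_mul_of_nonneg_left hw'.2 (by positivity)) e3
            (abs_nonneg _) (by positivity)) ?_ (by positivity)) zero_le_two
          exact mul_nonneg (mul_nonneg (by positivity) hw'.1) (abs_nonneg _)
        _ = _ := by ring
    have k3 : |weight F a n y * lap G (poleCutoff F ε) y| * sinSq F y ≤ 2 ^ n * (14 * L) := by
      rw [abs_mul, abs_of_nonneg hw.1, mul_assoc]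
      exact mul_le_mul hw.2 k1 (mul_nonneg (abs_nonneg _) hsy.le) (by positivity)
    rw [h1, ← div_eq_mul_inv, le_div_iff₀ hsy]
    calc _ ≤ (|weight F a n y * lap G (poleCutoff F ε) y|
          + 2 * |gradInner G (poleCutoff F ε) (weight F a n) y|) * sinSq F y := by
          refine mul_le_mul_of_nonneg_right ?_ hsy.le
          rw [show ∀ p q r : ℝ, p + q + r - p = q + r by intros; ring]
          refine (abs_add_le _ _).trans (add_le_add le_rfl ?_)
          rw [abs_mul, abs_two]
      _ ≤ _ := by linarith
  · rw [indicator_of_notMem hi]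
    rw [mem_ofPred_eq] at hi
    rw [deriv_cutoff_eq_zero hε (not_le.1 hi).le] at h2 h3
    rw [deriv_deriv_cutoff_eq_zero hε (not_le.1 hi)] at h2
    rw [h1, h2, h3]
    simp

end

section

/-- A coordinate domain of the unit sphere that exhausts the complement of the two poles, where
the first component of the position vector is `±1`. -/
structure SphereDomain (U : Set E4) (G : E4 → Mat4) (F : Unit ⊕ Fin 4 → E4 → ℝ) : Prop
    extends SphereMap U G F where
  metricOn : MetricOn U G
  continuous : ∀ A, Continuous (F A)
  sinSq_pos : ∀ y ∈ U, 0 < sinSq F y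
  isCompact : ∀ ε > 0, IsCompact {y | y ∈ U ∧ ε ≤ sinSq F y}

/-- A smooth solution, for negative times, of `∂_t f ≤ Δ f + m f`. -/
structure IsSubsolution (U : Set E4) (G : E4 → Mat4) (m : ℝ) (f f' : ℝ → E4 → ℝ) : Prop where
  smooth : ContDiffOn ℝ ∞ (fun p : ℝ × E4 => f p.1 p.2) (Iio 0 ×ˢ U)
  hasDerivAt : ∀ t < 0, ∀ y ∈ U, HasDerivAt (fun s => f s y) (f' t y) t
  le : ∀ t < 0, ∀ y ∈ U, f' t y ≤ lap G (f t) y + m * f t y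

lemma integrableOn_of_eq_zero {U K : Set E4} (hU : IsOpen U) (hK : IsCompact K) (hKU : K ⊆ U)
    {g : E4 → ℝ} (hg : ContinuousOn g U) (h0 : ∀ y ∈ U, y ∉ K → g y = 0) : IntegrableOn g U :=
  ((hg.mono hKU).integrableOn_compact hK).of_forall_sdiff_eq_zero hU.measurableSet
    fun y hy => h0 y hy.1 hy.2

/-- The integral of `(sin²)^{-(1+β)}` near the poles. -/
def tail (U : Set E4) (G : E4 → Mat4) (F : Unit ⊕ Fin 4 → E4 → ℝ) (β ε : ℝ) : ℝ :=
  ∫ y in U, {z | sinSq F z ≤ 2 * ε}.indicator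
    (fun z => sinSq F z ^ (-(1 + β)) * volDensity G z) y

variable {U : Set E4} {G : E4 → Mat4} {F : Unit ⊕ Fin 4 → E4 → ℝ} {y : E4}
  {a : Unit ⊕ Fin 4 → ℝ} {m D β ε t : ℝ} {f f' : ℝ → E4 → ℝ} {n : ℕ}

namespace SphereDomain

lemma continuous_sinSq (h : SphereDomain U G F) : Continuous (sinSq F) :=
  continuous_const.sub ((h.continuous _).pow 2)

lemma measurableSet_le (h : SphereDomain U G F) (ε : ℝ) :
    MeasurableSet {z | sinSq F z ≤ ε} :=
  (isClosed_le h.continuous_sinSq continuous_const).measurableSet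

lemma sinSq_le_one : sinSq F y ≤ 1 := sub_le_self _ (sq_nonneg _)

lemma rpow_le (h : SphereDomain U G F) (hy : y ∈ U) :
    sinSq F y ^ (-β) ≤ sinSq F y ^ (-(1 + β)) :=
  Real.rpow_le_rpow_of_exponent_ge (h.sinSq_pos y hy) sinSq_le_one (by linarith)

lemma tendsto_tail (h : SphereDomain U G F)
    (hw : IntegrableOn (fun y => sinSq F y ^ (-(1 + β)) * volDensity G y) U) :
    Tendsto (tail U G F β) (𝓝[>] 0) (𝓝 0) := by
  have h1 : Tendsto (tail U G F β) (𝓝[>] 0) (𝓝 (∫ _ in U, (0 : ℝ))) := by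
    refine tendsto_integral_filter_of_dominated_convergence _
      (Eventually.of_forall fun ε => hw.aestronglyMeasurable.indicator (h.measurableSet_le _))
      (Eventually.of_forall fun ε => ?_) hw.norm ?_
    · exact Eventually.of_forall fun y => norm_indicator_le_norm_self _ _
    · refine (ae_restrict_mem h.metricOn.isOpen.measurableSet).mono fun y hy => ?_
      have h2 : ∀ᶠ ε in 𝓝[>] (0 : ℝ), 2 * ε < sinSq F y :=
        nhdsWithin_le_nhds ((by fun_prop : Continuous fun ε : ℝ => 2 * ε).tendsto 0
          |>.eventually (gt_mem_nhds (by simpa using h.sinSq_pos y hy)))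
      refine tendsto_const_nhds.congr' (h2.mono fun ε hε => ?_)
      exact (indicator_of_notMem (s := {z | sinSq F z ≤ 2 * ε}) (not_le.2 hε) _).symm
  simpa using h1

lemma tail_nonneg (h : SphereDomain U G F) : 0 ≤ tail U G F β ε :=
  setIntegral_nonneg h.metricOn.isOpen.measurableSet fun y hy => indicator_apply_nonneg fun _ =>
    mul_nonneg (Real.rpow_nonneg (h.sinSq_pos y hy).le _) (h.metricOn.volDensity_pos hy).le

lemma integrable_tail (h : SphereDomain U G F)
    (hw : IntegrableOn (fun y => sinSq F y ^ (-(1 + β)) * volDensity G y) U) :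
    IntegrableOn ({z | sinSq F z ≤ 2 * ε}.indicator
      (fun z => sinSq F z ^ (-(1 + β)) * volDensity G z)) U :=
  Integrable.indicator hw (h.measurableSet_le _)

lemma poleCutoff_eq_zero (hε : 0 < ε) (hy : y ∈ U) (hy' : y ∉ {y | y ∈ U ∧ ε ≤ sinSq F y}) :
    poleCutoff F ε y = 0 :=
  cutoff_eq_zero hε (by
    rw [mem_ofPred_eq] at hy'
    exact (not_le.1 fun h => hy' ⟨hy, h⟩).le)

lemma subset : {y | y ∈ U ∧ ε ≤ sinSq F y} ⊆ U := fun _ hy => hy.1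

end SphereDomain

namespace IsSubsolution

lemma contDiffOn (hf : IsSubsolution U G m f f') (ht : t < 0) : ContDiffOn ℝ ∞ (f t) U :=
  hf.smooth.comp (contDiffOn_const.prodMk contDiffOn_id) fun _ hy => ⟨ht, hy⟩

lemma continuousOn_deriv (hf : IsSubsolution U G m f f') (hU : IsOpen U) :
    ContinuousOn (fun p : ℝ × E4 => f' p.1 p.2) (Iio 0 ×ˢ U) :=
  continuousOn_of_hasDerivAt isOpen_Iio hU hf.smooth hf.hasDerivAt

end IsSubsolution

lemma MetricOn.continuousOn_volDensity (hG : MetricOn U G) : ContinuousOn (volDensity G) U :=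
  hG.smooth_volDensity.continuousOn

namespace SphereDomain

lemma hasDerivAt_moment (h : SphereDomain U G F) (hf : IsSubsolution U G m f f') (hε : 0 < ε)
    (ht : t < 0) (n : ℕ) :
    HasDerivAt (fun s => ∫ y in U, f s y * (poleCutoff F ε y * weight F a n y) * volDensity G y)
      (∫ y in U, f' t y * (poleCutoff F ε y * weight F a n y) * volDensity G y) t := by
  have hk : ContinuousOn (fun y => poleCutoff F ε y * weight F a n y) U :=
    ((h.smooth_poleCutoff ε).mul (h.smooth_weight n)).continuousOn
  have hK := h.isCompact ε hε
  have e : ∀ k : E4 → ℝ, ∫ y in U, k y * (poleCutoff F ε y * weight F a n y) * volDensity G y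
      = ∫ y in {y | y ∈ U ∧ ε ≤ sinSq F y},
        k y * (poleCutoff F ε y * weight F a n y) * volDensity G y := fun k =>
    setIntegral_eq_of_subset_of_forall_sdiff_eq_zero h.metricOn.isOpen.measurableSet subset
      fun y hy => by rw [poleCutoff_eq_zero hε hy.1 hy.2]; ring
  simp only [e]
  refine hasDerivAt_setIntegral (I := Iio 0) hK hK.measurableSet isOpen_Iio
    (F := fun s y => f s y * (poleCutoff F ε y * weight F a n y) * volDensity G y)
    (F' := fun s y => f' s y * (poleCutoff F ε y * weight F a n y) * volDensity G y)
    (fun s hs => ?_) ?_ (fun y hy s hs => ?_) ht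
  · exact (((hf.contDiffOn hs).continuousOn.mul hk).mul
      h.metricOn.continuousOn_volDensity).mono subset
  · have hs : ∀ p ∈ (Iio (0 : ℝ)) ×ˢ {y | y ∈ U ∧ ε ≤ sinSq F y}, p.2 ∈ U := fun p hp => hp.2.1
    exact (((hf.continuousOn_deriv h.metricOn.isOpen).mono (prod_mono_right subset)).mul
      (hk.comp continuousOn_snd hs)).mul
      (h.metricOn.continuousOn_volDensity.comp continuousOn_snd hs)
  · exact ((hf.hasDerivAt s hs y hy.1).mul_const _).mul_const _

lemma moment_deriv_le (h : SphereDomain U G F) (hf : IsSubsolution U G m f f')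
    (ha : ∑ A, a A * a A = 1)
    (hw : IntegrableOn (fun y => sinSq F y ^ (-(1 + β)) * volDensity G y) U) (hD : 0 ≤ D)
    (hb : ∀ t < 0, ∀ y ∈ U, |f t y| ≤ D * sinSq F y ^ (-β)) (n : ℕ) :
    ∃ K, 0 ≤ K ∧ ∀ ε > 0, ∀ t < 0,
      ∫ y in U, f' t y * (poleCutoff F ε y * weight F a n y) * volDensity G y
        ≤ (m - n * (n + 3))
            * (∫ y in U, f t y * (poleCutoff F ε y * weight F a n y) * volDensity G y)
          + 2 * n * (n + 1)
            * (∫ y in U, f t y * (poleCutoff F ε y * weight F a (n - 1) y) * volDensity G y)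
          + K * tail U G F β ε := by
  obtain ⟨K, hK0, hK⟩ := h.exists_lap_bound h.metricOn ha h.sinSq_pos n
  refine ⟨D * K, mul_nonneg hD hK0, fun ε hε t ht => ?_⟩
  have hU := h.metricOn.isOpen
  have hv := h.metricOn.continuousOn_volDensity
  have hfs := hf.contDiffOn ht
  have hk : ∀ n, ContDiffOn ℝ ∞ (fun y => poleCutoff F ε y * weight F a n y) U := fun n =>
    (h.smooth_poleCutoff ε).mul (h.smooth_weight n)
  have hC := h.isCompact ε hε
  have h0 : ∀ n, ∀ y ∈ U, y ∉ {y | y ∈ U ∧ ε ≤ sinSq F y} →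
      poleCutoff F ε y * weight F a n y = 0 := fun n y hy hy' => by
    rw [poleCutoff_eq_zero hε hy hy', zero_mul]
  have hl0 : ∀ y ∈ U, y ∉ {y | y ∈ U ∧ ε ≤ sinSq F y} →
      lap G (fun y => poleCutoff F ε y * weight F a n y) y = 0 := fun y hy hy' => by
    have hV : IsOpen (U ∩ {z | sinSq F z < ε}) :=
      hU.inter (isOpen_lt h.continuous_sinSq continuous_const)
    have hyV : y ∈ U ∩ {z | sinSq F z < ε} := by
      rw [mem_ofPred_eq] at hy'
      exact ⟨hy, not_le.1 fun h => hy' ⟨hy, h⟩⟩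
    rw [lap_congr (k := fun _ => 0) hV hyV fun z hz => by
      rw [poleCutoff, cutoff_eq_zero hε (le_of_lt hz.2), zero_mul]]
    have e : ∀ i, partialDeriv i (fun _ => (0 : ℝ)) = fun _ => 0 := fun i =>
      funext fun z => partialDeriv_const i 0 z
    simp [lap, hess_apply, e]
  have hgreen := h.metricOn.setIntegral_green hfs (hk n) hC subset (h0 n)
  have i1 : ∀ n, IntegrableOn
      (fun y => f t y * (poleCutoff F ε y * weight F a n y) * volDensity G y) U := fun n =>
    integrableOn_of_eq_zero hU hC subset ((hfs.continuousOn.mul (hk n).continuousOn).mul hv)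
      fun y hy hy' => by rw [h0 n y hy hy']; ring
  have i2 : IntegrableOn (fun y => (poleCutoff F ε y * weight F a n y * lap G (f t) y
      - f t y * lap G (fun y => poleCutoff F ε y * weight F a n y) y) * volDensity G y) U :=
    integrableOn_of_eq_zero hU hC subset ((((hk n).continuousOn.mul
      (h.metricOn.smooth_lap hfs).continuousOn).sub (hfs.continuousOn.mul
      (h.metricOn.smooth_lap (hk n)).continuousOn)).mul hv)
      fun y hy hy' => by rw [h0 n y hy hy', hl0 y hy hy']; ring
  have i3 : IntegrableOn
      (fun y => f' t y * (poleCutoff F ε y * weight F a n y) * volDensity G y) U :=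
    integrableOn_of_eq_zero hU hC subset ((((hf.continuousOn_deriv hU).comp
      (by fun_prop : Continuous fun y : E4 => (t, y)).continuousOn fun y hy => ⟨ht, hy⟩).mul
      (hk n).continuousOn).mul hv) fun y hy hy' => by rw [h0 n y hy hy']; ring
  have i4 := h.integrable_tail (ε := ε) hw
  have hle : ∀ y ∈ U, f' t y * (poleCutoff F ε y * weight F a n y) * volDensity G y
      ≤ ((poleCutoff F ε y * weight F a n y * lap G (f t) y
          - f t y * lap G (fun y => poleCutoff F ε y * weight F a n y) y) * volDensity G y
        + (m - n * (n + 3)) * (f t y * (poleCutoff F ε y * weight F a n y) * volDensity G y)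
        + 2 * n * (n + 1) * (f t y * (poleCutoff F ε y * weight F a (n - 1) y) * volDensity G y)
        + D * K * {z | sinSq F z ≤ 2 * ε}.indicator
          (fun z => sinSq F z ^ (-(1 + β)) * volDensity G z) y) := fun y hy => by
    have hk0 : 0 ≤ poleCutoff F ε y * weight F a n y :=
      mul_nonneg (cutoff_nonneg _ _) (h.weight_mem hy ha n).1
    have hv0 := (h.metricOn.volDensity_pos hy).le
    have hs := h.sinSq_pos y hy
    have e1 := mul_le_mul_of_nonneg_right (mul_le_mul_of_nonneg_right (hf.le t ht y hy) hk0) hv0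
    have e2 : f t y * (lap G (fun z => poleCutoff F ε z * weight F a n z) y
          - poleCutoff F ε y * lap G (weight F a n) y) * volDensity G y
        ≤ D * K * {z | sinSq F z ≤ 2 * ε}.indicator
          (fun z => sinSq F z ^ (-(1 + β)) * volDensity G z) y := by
      have e3 := (le_abs_self _).trans ((abs_mul _ _).le.trans (mul_le_mul (hb t ht y hy)
        (hK ε hε y hy) (abs_nonneg _) (mul_nonneg hD (Real.rpow_nonneg hs.le _))))
      refine (mul_le_mul_of_nonneg_right e3 hv0).trans (le_of_eq ?_)
      by_cases hi : y ∈ {z | sinSq F z ≤ 2 * ε}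
      · rw [indicator_of_mem hi, indicator_of_mem hi, neg_add, Real.rpow_add hs,
          Real.rpow_neg_one]
        ring
      · rw [indicator_of_notMem hi, indicator_of_notMem hi]
        ring
    rw [lap_weight h.toSphereMap h.metricOn hy ha] at e2
    linarith
  refine (setIntegral_mono_on i3 (((i2.add ((i1 n).const_mul _)).add
    ((i1 (n - 1)).const_mul _)).add (i4.const_mul _)) hU.measurableSet hle).trans (le_of_eq ?_)
  rw [integral_add', integral_add', integral_add', hgreen, integral_const_mul, integral_const_mul,
    integral_const_mul, zero_add]
  · rfl
  · exact i2
  · exact (i1 n).const_mul _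
  · exact i2.add ((i1 n).const_mul _)
  · exact (i1 (n - 1)).const_mul _
  · exact (i2.add ((i1 n).const_mul _)).add ((i1 (n - 1)).const_mul _)
  · exact i4.const_mul _

lemma integrableOn_mul (h : SphereDomain U G F) {k : E4 → ℝ} (hk : ContinuousOn k U) {B : ℝ}
    (hw : IntegrableOn (fun y => sinSq F y ^ (-(1 + β)) * volDensity G y) U)
    (hb : ∀ y ∈ U, |k y| ≤ B * sinSq F y ^ (-(1 + β))) :
    IntegrableOn (fun y => k y * volDensity G y) U := by
  have hU := h.metricOn.isOpen.measurableSet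
  refine Integrable.mono' (hw.const_mul B)
    ((hk.mul h.metricOn.continuousOn_volDensity).aestronglyMeasurable hU)
    ((ae_restrict_mem hU).mono fun y hy => ?_)
  rw [norm_mul, Real.norm_eq_abs, Real.norm_eq_abs, abs_of_pos (h.metricOn.volDensity_pos hy),
    ← mul_assoc]
  exact mul_le_mul_of_nonneg_right (hb y hy) (h.metricOn.volDensity_pos hy).le

lemma abs_mul_weight_le (h : SphereDomain U G F) (ha : ∑ A, a A * a A = 1) (hD : 0 ≤ D)
    {k : E4 → ℝ} (hb : ∀ y ∈ U, |k y| ≤ D * sinSq F y ^ (-β)) (n : ℕ) (hy : y ∈ U) :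
    |k y * weight F a n y| ≤ 2 ^ n * D * sinSq F y ^ (-(1 + β)) := by
  have hw := h.weight_mem hy ha n
  rw [abs_mul, abs_of_nonneg hw.1]
  calc _ ≤ D * sinSq F y ^ (-(1 + β)) * 2 ^ n :=
        mul_le_mul ((hb y hy).trans (mul_le_mul_of_nonneg_left (h.rpow_le hy) hD)) hw.2 hw.1
          (mul_nonneg hD (Real.rpow_nonneg (h.sinSq_pos y hy).le _))
    _ = _ := by ring

lemma abs_moment_sub_le (h : SphereDomain U G F) (ha : ∑ A, a A * a A = 1)
    (hw : IntegrableOn (fun y => sinSq F y ^ (-(1 + β)) * volDensity G y) U) (hD : 0 ≤ D)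
    {k : E4 → ℝ} (hk : ContinuousOn k U) (hb : ∀ y ∈ U, |k y| ≤ D * sinSq F y ^ (-β)) (n : ℕ)
    (hε : 0 < ε) :
    |(∫ y in U, k y * weight F a n y * volDensity G y)
        - ∫ y in U, k y * (poleCutoff F ε y * weight F a n y) * volDensity G y|
      ≤ 2 ^ n * D * tail U G F β ε := by
  have hU := h.metricOn.isOpen.measurableSet
  have i1 : IntegrableOn (fun y => k y * weight F a n y * volDensity G y) U :=
    h.integrableOn_mul (hk.mul (h.smooth_weight (a := a) n).continuousOn) hw
    fun y hy => h.abs_mul_weight_le ha hD hb n hy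
  have i2 : IntegrableOn (fun y => k y * (poleCutoff F ε y * weight F a n y) * volDensity G y) U :=
    integrableOn_of_eq_zero h.metricOn.isOpen (h.isCompact ε hε) subset
      ((hk.mul ((h.smooth_poleCutoff ε).mul (h.smooth_weight n)).continuousOn).mul
        h.metricOn.continuousOn_volDensity)
      fun y hy hy' => by rw [poleCutoff_eq_zero hε hy hy']; ring
  rw [← integral_sub i1 i2, ← Real.norm_eq_abs, tail, ← integral_const_mul]
  refine norm_integral_le_of_norm_le ((h.integrable_tail hw).const_mul _)
    ((ae_restrict_mem hU).mono fun y hy => ?_)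
  have hv0 := (h.metricOn.volDensity_pos hy).le
  have hc : poleCutoff F ε y ≤ 1 := cutoff_le_one _ _
  rw [show k y * weight F a n y * volDensity G y
      - k y * (poleCutoff F ε y * weight F a n y) * volDensity G y
    = (1 - poleCutoff F ε y) * ((k y * weight F a n y) * volDensity G y) by ring, norm_mul,
    norm_mul, Real.norm_eq_abs, Real.norm_eq_abs, Real.norm_eq_abs, abs_of_nonneg hv0,
    abs_of_nonneg (sub_nonneg.2 hc)]
  have h1 := mul_le_mul_of_nonneg_right (h.abs_mul_weight_le ha hD hb n hy) hv0
  by_cases hi : y ∈ {z | sinSq F z ≤ 2 * ε}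
  · rw [indicator_of_mem hi, ← mul_assoc]
    refine (le_of_eq (mul_assoc _ _ _)).trans ((mul_le_of_le_one_left (mul_nonneg (abs_nonneg _)
      hv0) (sub_le_self _ (cutoff_nonneg ε (sinSq F y)))).trans (h1.trans (le_of_eq ?_)))
    ring
  · rw [indicator_of_notMem hi]
    rw [mem_ofPred_eq] at hi
    rw [poleCutoff, cutoff_eq_one hε (not_le.1 hi).le]
    simp

/-- The moments of an ancient subsolution are nonpositive, provided that those finitely many which
may grow backwards in time are. -/
lemma moment_nonpos (h : SphereDomain U G F) (hf : IsSubsolution U G m f f')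
    (ha : ∑ A, a A * a A = 1)
    (hw : IntegrableOn (fun y => sinSq F y ^ (-(1 + β)) * volDensity G y) U) (hD : 0 ≤ D)
    (hb : ∀ t < 0, ∀ y ∈ U, |f t y| ≤ D * sinSq F y ^ (-β))
    (hbase : ∀ n : ℕ, (n * (n + 3) : ℝ) ≤ m → ∀ t < 0,
      ∫ y in U, f t y * weight F a n y * volDensity G y ≤ 0) (n : ℕ) {t : ℝ} (ht : t < 0) :
    ∫ y in U, f t y * weight F a n y * volDensity G y ≤ 0 := by
  have hsub : ∀ (n : ℕ) (ε : ℝ) (_ : 0 < ε) (t : ℝ) (_ : t < 0), _ := fun n ε hε t ht => abs_le.1 (h.abs_moment_sub_le ha hw hD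
    (hf.contDiffOn ht).continuousOn (hb t ht) n hε (ε := ε))
  have hT : ∀ ε, 0 ≤ tail U G F β ε := fun ε => h.tail_nonneg
  have key : ∀ n, ∃ K, 0 ≤ K ∧ ∀ ε > 0, ∀ t < 0,
      ∫ y in U, f t y * (poleCutoff F ε y * weight F a n y) * volDensity G y
        ≤ K * tail U G F β ε := by
    intro n
    induction n using Nat.strong_induction_on with
    | _ n ih =>
      by_cases hn : (n * (n + 3) : ℝ) ≤ m
      · exact ⟨2 ^ n * D, by positivity, fun ε hε t ht => by
          linarith [(hsub n ε hε t ht).1, (hsub n ε hε t ht).2, hbase n hn t ht]⟩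
      · have hc : 0 < n * (n + 3) - m := by linarith [not_le.1 hn]
        obtain ⟨K₁, hK₁, h₁⟩ := h.moment_deriv_le hf ha hw hD hb n
        obtain ⟨K₂, hK₂, h₂⟩ : ∃ K, 0 ≤ K ∧ ∀ ε > 0, ∀ t < 0, 2 * n * (n + 1)
            * ∫ y in U, f t y * (poleCutoff F ε y * weight F a (n - 1) y) * volDensity G y
            ≤ K * tail U G F β ε := by
          rcases Nat.eq_zero_or_pos n with rfl | hn0
          · exact ⟨0, le_rfl, fun ε hε t ht => by simp⟩
          · obtain ⟨K, hK, hK'⟩ := ih (n - 1) (by omega)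
            refine ⟨2 * n * (n + 1) * K, by positivity, fun ε hε t ht => ?_⟩
            rw [mul_assoc _ K]
            exact mul_le_mul_of_nonneg_left (hK' ε hε t ht) (by positivity)
        refine ⟨(K₁ + K₂) / (n * (n + 3) - m), by positivity, fun ε hε t ht => ?_⟩
        have hB : ∀ t < 0, ∫ y in U, f t y * (poleCutoff F ε y * weight F a n y) * volDensity G y
            ≤ 2 ^ n * D * (∫ y in U, sinSq F y ^ (-(1 + β)) * volDensity G y)
              + 2 ^ n * D * tail U G F β ε := fun t ht => by
          have e1 : ∫ y in U, f t y * weight F a n y * volDensity G y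
              ≤ ∫ y in U, 2 ^ n * D * (sinSq F y ^ (-(1 + β)) * volDensity G y) := by
            refine setIntegral_mono_on (h.integrableOn_mul ((hf.contDiffOn ht).continuousOn.mul
              (h.smooth_weight (a := a) n).continuousOn) hw
              fun y hy => h.abs_mul_weight_le ha hD (hb t ht) n hy) (hw.const_mul _)
              h.metricOn.isOpen.measurableSet fun y hy => ?_
            rw [← mul_assoc (2 ^ n * D)]
            exact mul_le_mul_of_nonneg_right ((le_abs_self _).trans
              (h.abs_mul_weight_le ha hD (hb t ht) n hy)) (h.metricOn.volDensity_pos hy).le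
          rw [integral_const_mul] at e1
          linarith [(hsub n ε hε t ht).1]
        have := ancient_le hc (fun t ht => h.hasDerivAt_moment (a := a) hf hε ht n)
          (δ := (K₁ + K₂) * tail U G F β ε) (fun t ht => by
            linarith [h₁ ε hε t ht, h₂ ε hε t ht]) hB ht
        rwa [mul_div_right_comm] at this
  obtain ⟨K, hK, hle⟩ := key n
  have hlim : Tendsto (fun ε => (K + 2 ^ n * D) * tail U G F β ε) (𝓝[>] 0) (𝓝 0) := by
    simpa using (h.tendsto_tail hw).const_mul (K + 2 ^ n * D)
  refine ge_of_tendsto hlim (eventually_mem_nhdsWithin.mono fun ε hε => ?_)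
  linarith [hle ε hε t ht, (hsub n ε hε t ht).2]

end SphereDomain

/-- An ancient subsolution whose low moments are nonpositive is nonpositive. -/
lemma SphereDomain.nonpos (h : SphereDomain U G F) {S : Set E4} (hS : IsCompact S) (hUS : U ⊆ S)
    (hinj : ∀ x ∈ U, ∀ y ∈ S, (∀ A, F A y = F A x) → y = x)
    (hFS : ∀ y ∈ S, ∑ A, F A y * F A y = 1)
    (hf : IsSubsolution U G m f f')
    (hw : IntegrableOn (fun y => sinSq F y ^ (-(1 + β)) * volDensity G y) U) (hD : 0 ≤ D)
    (hb : ∀ t < 0, ∀ y ∈ U, |f t y| ≤ D * sinSq F y ^ (-β))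
    (hbase : ∀ (a : Unit ⊕ Fin 4 → ℝ) (n : ℕ), (n * (n + 3) : ℝ) ≤ m → ∀ t < 0,
      ∫ y in U, f t y * weight F a n y * volDensity G y ≤ 0) (ht : t < 0) {x : E4} (hx : x ∈ U) :
    f t x ≤ 0 := by
  set a : Unit ⊕ Fin 4 → ℝ := fun A => F A x with ha'
  have ha : ∑ A, a A * a A = 1 := h.sq x hx
  have hU := h.metricOn.isOpen
  have hax : linComb F a x = 1 := ha
  have hdist : ∀ y ∈ S, ∑ A, (F A y - F A x) * (F A y - F A x) = 2 - 2 * linComb F a y :=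
    fun y hy => by
      have e : ∀ A, (F A y - F A x) * (F A y - F A x)
          = F A y * F A y + F A x * F A x - 2 * (a A * F A y) := fun A => by simp only [ha']; ring
      simp only [e, sum_sub_distrib, sum_add_distrib, hFS y hy, h.sq x hx,
        ← mul_sum, linComb]
      norm_num
  have hsum : ∀ y ∈ S, ∑ A, (F A y + F A x) * (F A y + F A x) = 2 + 2 * linComb F a y :=
    fun y hy => by
      have e : ∀ A, (F A y + F A x) * (F A y + F A x)
          = F A y * F A y + F A x * F A x + 2 * (a A * F A y) := fun A => by simp only [ha']; ring
      simp only [e, sum_add_distrib, hFS y hy, h.sq x hx, ← mul_sum, linComb]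
      norm_num
  have hc : Continuous fun y => 1 + linComb F a y :=
    continuous_const.add (continuous_finsetSum _ fun A _ => continuous_const.mul (h.continuous A))
  have hg : IntegrableOn (fun y => f t y * volDensity G y) U :=
    h.integrableOn_mul (hf.contDiffOn ht).continuousOn hw fun y hy =>
      (hb t ht y hy).trans (mul_le_mul_of_nonneg_left (h.rpow_le hy) hD)
  have hpeak := tendsto_setIntegral_pow_smul_of_unique_maximum_of_isCompact_of_integrableOn
    (μ := volume) (s := S) (x₀ := x) (g := U.indicator fun y => f t y * volDensity G y) hS
    (c := fun y => 1 + linComb F a y) hc.continuousOn (fun y hy hyx => ?_) (fun y hy => ?_)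
    (by rw [hax]; norm_num) ?_ ?_ ?_
  · rw [indicator_of_mem hx] at hpeak
    have hle : f t x * volDensity G x ≤ 0 := by
      refine le_of_tendsto hpeak (Eventually.of_forall fun n => ?_)
      refine mul_nonpos_of_nonneg_of_nonpos (inv_nonneg.2 (setIntegral_nonneg hS.measurableSet
        fun y hy => pow_nonneg ?_ n)) ?_
      · have := hsum y hy
        have h0 : 0 ≤ ∑ A, (F A y + F A x) * (F A y + F A x) :=
          sum_nonneg fun A _ => mul_self_nonneg _
        linarith
      · have e : ∀ y, (1 + linComb F a y) ^ n • U.indicator (fun y => f t y * volDensity G y) y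
            = U.indicator (fun y => f t y * weight F a n y * volDensity G y) y := fun y => by
          by_cases hy : y ∈ U
          · rw [indicator_of_mem hy, indicator_of_mem hy, smul_eq_mul, weight]; ring
          · rw [indicator_of_notMem hy, indicator_of_notMem hy, smul_zero]
        simp only [e]
        rw [setIntegral_indicator hU.measurableSet, inter_eq_self_of_subset_right hUS]
        exact h.moment_nonpos hf ha hw hD hb (hbase a) n ht
    exact nonpos_of_mul_nonpos_left hle (h.metricOn.volDensity_pos hx)
  · by_contra hle
    refine hyx (hinj x hx y hy fun A => ?_)
    have h1 := hdist y hy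
    have h2 : ∑ A, (F A y - F A x) * (F A y - F A x) = 0 :=
      le_antisymm (by linarith [not_lt.1 hle]) (sum_nonneg fun A _ => mul_self_nonneg _)
    have h3 := (Finset.sum_eq_zero_iff_of_nonneg fun A _ => mul_self_nonneg _).1 h2 A
      (Finset.mem_univ A)
    exact sub_eq_zero.1 (mul_self_eq_zero.1 h3)
  · have := hsum y hy
    have h0 : 0 ≤ ∑ A, (F A y + F A x) * (F A y + F A x) :=
      sum_nonneg fun A _ => mul_self_nonneg _
    linarith
  · exact subset_closure (interior_mono hUS (hU.interior_eq.symm ▸ hx))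
  · exact ((integrable_indicator_iff hU.measurableSet).2 hg).integrableOn
  · have h1 : ContinuousAt (fun y => f t y * volDensity G y) x :=
      (((hf.contDiffOn ht).continuousOn.mul h.metricOn.continuousOn_volDensity).continuousAt
        (hU.mem_nhds hx))
    exact (h1.congr ((hU.eventually_mem hx).mono fun y hy =>
      (indicator_of_mem hy fun y => f t y * volDensity G y).symm)).continuousWithinAt

end

section

/-! ### The double cover of the suspension: the unit sphere in exponential coordinates -/

/-- The exponential map of the unit sphere of `ℝ⁵` at a pole. -/
def sphereExp : Unit ⊕ Fin 4 → E4 → ℝ :=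
  Sum.elim (fun _ y => Real.cos ‖y‖) fun i y => Real.sinc ‖y‖ * y i

lemma sinc_mul_self (θ : ℝ) : Real.sinc θ * θ = Real.sin θ := by
  rcases eq_or_ne θ 0 with rfl | h
  · simp
  · rw [Real.sinc_of_ne_zero h, div_mul_cancel₀ _ h]

lemma sum_sq_eq_norm_sq (y : E4) : ∑ i, y i * y i = ‖y‖ ^ 2 := by
  rw [EuclideanSpace.real_norm_sq_eq]
  exact sum_congr rfl fun i _ => (sq _).symm

lemma sum_sphereExp_sq (y : E4) : ∑ A, sphereExp A y * sphereExp A y = 1 := by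
  have e : ∑ i, Real.sinc ‖y‖ * y i * (Real.sinc ‖y‖ * y i) = Real.sin ‖y‖ ^ 2 := by
    rw [← sinc_mul_self, mul_pow, ← sum_sq_eq_norm_sq, mul_sum]
    exact sum_congr rfl fun i _ => by ring
  simp only [Fintype.sum_sum_type, sphereExp, Sum.elim_inl, Sum.elim_inr, Finset.univ_unique,
    Finset.sum_singleton, e]
  rw [← sq, Real.cos_sq_add_sin_sq]

lemma sinSq_sphereExp (y : E4) : sinSq sphereExp y = Real.sin ‖y‖ ^ 2 := by
  rw [sinSq, Real.sin_sq]
  rfl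

lemma continuous_sphereExp (A : Unit ⊕ Fin 4) : Continuous (sphereExp A) := by
  rcases A with _ | i
  · exact Real.continuous_cos.comp continuous_norm
  · exact (Real.continuous_sinc.comp continuous_norm).mul (by fun_prop)

lemma partialDeriv_norm {y : E4} (hy : y ≠ 0) (i : Fin 4) :
    partialDeriv i (fun z => ‖z‖) y = y i / ‖y‖ := by
  have h1 : HasFDerivAt (fun z : E4 => ‖z‖ ^ 2) _ y := (hasStrictFDerivAt_norm_sq y).hasFDerivAt
  have h2 := h1.sqrt (by positivity)
  have e : (fun z : E4 => √(‖z‖ ^ 2)) = fun z => ‖z‖ :=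
    funext fun z => Real.sqrt_sq (norm_nonneg z)
  rw [e] at h2
  rw [partialDeriv, h2.fderiv, Real.sqrt_sq (norm_nonneg y)]
  have h3 : inner ℝ y (stdVec i) = y i := by
    rw [stdVec, EuclideanSpace.inner_single_right]; simp
  simp [h3]
  field_simp

lemma differentiableAt_norm {y : E4} (hy : y ≠ 0) : DifferentiableAt ℝ (fun z : E4 => ‖z‖) y :=
  (contDiffAt_norm (n := 1) ℝ hy).differentiableAt (by simp)

lemma sphereExp_inr_eq {y : E4} (hy : y ≠ 0) (i : Fin 4) :
    sphereExp (Sum.inr i) y = Real.sin ‖y‖ / ‖y‖ * y i := by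
  simp only [sphereExp, Sum.elim_inr, Real.sinc_of_ne_zero (norm_ne_zero_iff.2 hy)]

lemma partialDeriv_sphereExp_inl {y : E4} (hy : y ≠ 0) (i : Fin 4) :
    partialDeriv i (sphereExp (Sum.inl ())) y = - Real.sin ‖y‖ * (y i / ‖y‖) := by
  have := partialDeriv_comp_real i (Real.differentiable_cos _) (differentiableAt_norm hy)
  rwa [Real.deriv_cos, partialDeriv_norm hy] at this

lemma partialDeriv_apply (y : E4) (i k : Fin 4) :
    partialDeriv i (fun z : E4 => z k) y = if k = i then 1 else 0 := by
  rw [partialDeriv, show (fun z : E4 => z k) = EuclideanSpace.proj (𝕜 := ℝ) k from rfl,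
    ContinuousLinearMap.fderiv]
  exact stdVec_apply i k

lemma partialDeriv_sphereExp_inr {y : E4} (hy : y ≠ 0) (i k : Fin 4) :
    partialDeriv i (sphereExp (Sum.inr k)) y
      = (Real.cos ‖y‖ * ‖y‖ - Real.sin ‖y‖) / ‖y‖ ^ 2 * (y i / ‖y‖) * y k
        + Real.sin ‖y‖ / ‖y‖ * if k = i then 1 else 0 := by
  have hn := norm_ne_zero_iff.2 hy
  have hd : HasDerivAt (fun θ => Real.sin θ / θ)
      ((Real.cos ‖y‖ * ‖y‖ - Real.sin ‖y‖) / ‖y‖ ^ 2) ‖y‖ := by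
    simpa using (Real.hasDerivAt_sin ‖y‖).fun_div (hasDerivAt_id ‖y‖) hn
  have h1 := partialDeriv_comp_real i hd.differentiableAt (differentiableAt_norm hy)
  rw [hd.deriv, partialDeriv_norm hy] at h1
  have h2 : DifferentiableAt ℝ (fun z : E4 => Real.sin ‖z‖ / ‖z‖) y :=
    hd.differentiableAt.comp y (differentiableAt_norm hy)
  rw [partialDeriv_congr_on isOpen_compl_singleton hy i fun z hz => sphereExp_inr_eq hz k,
    partialDeriv_mul i h2 (by fun_prop), partialDeriv_apply, h1]

lemma smooth_sphereExp (δ : ℝ) (A : Unit ⊕ Fin 4) :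
    ContDiffOn ℝ ∞ (sphereExp A) (puncturedBall δ) := by
  have h1 : ContDiffOn ℝ ∞ (fun z : E4 => ‖z‖) (puncturedBall δ) := fun y hy =>
    (contDiffAt_norm ℝ (norm_pos_iff.1 hy.1)).contDiffWithinAt
  rcases A with _ | i
  · exact Real.contDiff_cos.comp_contDiffOn h1
  · refine ContDiffOn.congr (f := fun y => Real.sin ‖y‖ / ‖y‖ * y i) ?_
      fun y hy => sphereExp_inr_eq (norm_pos_iff.1 hy.1) i
    exact ((Real.contDiff_sin.comp_contDiffOn h1).div h1 fun y hy => hy.1.ne').mul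
      (by fun_prop)

/-- `G` is the metric `dθ² + sin²θ g_{𝕊³}`. -/
def IsRound (G : E4 → Mat4) : Prop := ∀ y ∈ puncturedBall π, ∀ i j,
  G y i j = y i * y j / ‖y‖ ^ 2
    + Real.sin ‖y‖ ^ 2 * (((if i = j then 1 else 0) - y i * y j / ‖y‖ ^ 2) / ‖y‖ ^ 2)

variable {G : E4 → Mat4} {y : E4}

lemma sin_norm_pos (hy : y ∈ puncturedBall π) : 0 < Real.sin ‖y‖ :=
  Real.sin_pos_of_pos_of_lt_pi hy.1 hy.2

lemma IsRound.metric_eq (hR : IsRound G) (hy : y ∈ puncturedBall π) (i j : Fin 4) :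
    G y i j = ∑ A, partialDeriv i (sphereExp A) y * partialDeriv j (sphereExp A) y := by
  have h0 : y ≠ 0 := norm_pos_iff.1 hy.1
  have hn : ‖y‖ ≠ 0 := hy.1.ne'
  have h1 := sum_sq_eq_norm_sq y
  simp only [Fintype.sum_sum_type, Finset.univ_unique, Finset.sum_singleton]
  rw [show (default : Unit) = () from rfl, partialDeriv_sphereExp_inl h0,
    partialDeriv_sphereExp_inl h0]
  simp only [partialDeriv_sphereExp_inr h0]
  have e : ∀ p q : ℝ, ∑ k, (p * (y i / ‖y‖) * y k + q * if k = i then 1 else 0)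
      * (p * (y j / ‖y‖) * y k + q * if k = j then 1 else 0)
      = p ^ 2 * (y i * y j) + 2 * p * q * (y i * y j / ‖y‖) + q ^ 2 * if i = j then 1 else 0 := by
    intro p q
    have e1 : ∀ k, (p * (y i / ‖y‖) * y k + q * if k = i then (1 : ℝ) else 0)
        * (p * (y j / ‖y‖) * y k + q * if k = j then (1 : ℝ) else 0)
        = p ^ 2 * (y i * y j) / ‖y‖ ^ 2 * (y k * y k)
          + (if k = j then p * q * (y i / ‖y‖) * y k else 0)
          + (if k = i then p * q * (y j / ‖y‖) * y k else 0)
          + (if k = i then (if k = j then q ^ 2 else 0) else 0) := fun k => by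
      split_ifs <;> ring
    rw [sum_congr rfl fun k _ => e1 k]
    simp only [sum_add_distrib, ← mul_sum, h1, Finset.sum_ite_eq',
      Finset.mem_univ, if_true, mul_ite, mul_one, mul_zero]
    field_simp
    ring
  rw [e, hR y hy]
  have hcs := Real.cos_sq' ‖y‖
  field_simp
  linear_combination (- y i * y j * ‖y‖ ^ 2) * hcs

lemma IsRound.sphereDomain (hR : IsRound G) (hG : MetricOn (puncturedBall π) G) :
    SphereDomain (puncturedBall π) G sphereExp where
  smooth := smooth_sphereExp _
  sq y _ := sum_sphereExp_sq y
  metric y hy := hR.metric_eq hy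
  metricOn := hG
  continuous := continuous_sphereExp
  sinSq_pos y hy := by
    rw [sinSq_sphereExp]
    exact pow_pos (sin_norm_pos hy) 2
  isCompact ε hε := by
    have e : {y | y ∈ puncturedBall π ∧ ε ≤ sinSq sphereExp y}
        = Metric.closedBall 0 π ∩ {y | ε ≤ Real.sin ‖y‖ ^ 2} := by
      ext y
      simp only [sinSq_sphereExp]
      constructor
      · rintro ⟨h1, h2⟩
        exact ⟨mem_closedBall_zero_iff.2 h1.2.le, h2⟩
      · rintro ⟨h1, h2⟩
        rw [mem_closedBall_zero_iff] at h1
        have h3 : Real.sin ‖y‖ ≠ 0 := fun h => by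
          rw [mem_ofPred_eq, h] at h2
          linarith
        refine ⟨⟨(norm_nonneg y).lt_of_ne fun h => h3 (by rw [← h, Real.sin_zero]),
          h1.lt_of_ne fun h => h3 (by rw [h, Real.sin_pi])⟩, h2⟩
    rw [e]
    exact (isCompact_closedBall _ _).inter_right (isClosed_le continuous_const
      ((Real.continuous_sin.comp continuous_norm).pow 2))

lemma sphereExp_injective {x y : E4} (hx : x ∈ puncturedBall π)
    (hy : y ∈ Metric.closedBall (0 : E4) π) (h : ∀ A, sphereExp A y = sphereExp A x) :
    y = x := by
  have h1 : ‖y‖ = ‖x‖ := Real.injOn_cos ⟨norm_nonneg y, mem_closedBall_zero_iff.1 hy⟩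
    ⟨hx.1.le, hx.2.le⟩ (h (Sum.inl ()))
  have h2 : Real.sinc ‖x‖ ≠ 0 := fun h => by
    have := sinc_mul_self ‖x‖
    rw [h, zero_mul] at this
    exact (sin_norm_pos hx).ne this
  ext i
  have h3 := h (Sum.inr i)
  simp only [sphereExp, Sum.elim_inr, h1] at h3
  exact mul_left_cancel₀ h2 h3

lemma IsRound.volDensity_eq (hR : IsRound G) (hy : y ∈ puncturedBall π) :
    volDensity G y = (Real.sin ‖y‖ / ‖y‖) ^ 3 := by
  have hn : ‖y‖ ≠ 0 := hy.1.ne'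
  have hs := sin_norm_pos hy
  set q := Real.sin ‖y‖ / ‖y‖ with hq
  have hq0 : 0 < q := div_pos hs hy.1
  have h1 : G y = q ^ 2 • (1 + Matrix.replicateCol Unit (fun i => (1 - q ^ 2) / (q ^ 2 * ‖y‖ ^ 2)
      * y i) * Matrix.replicateRow Unit fun i => y i) := by
    ext i j
    rw [hR y hy]
    simp only [Matrix.smul_apply, Matrix.add_apply, Matrix.one_apply, mul_apply,
      Matrix.replicateCol_apply, Matrix.replicateRow_apply, Finset.univ_unique,
      Finset.sum_singleton, smul_eq_mul]
    rw [hq]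
    field_simp
    ring
  have h2 : (G y).det = (q ^ 3) ^ 2 := by
    rw [h1, Matrix.det_smul, Matrix.det_one_add_replicateCol_mul_replicateRow]
    have e : (fun i => y i) ⬝ᵥ (fun i => (1 - q ^ 2) / (q ^ 2 * ‖y‖ ^ 2) * y i)
        = (1 - q ^ 2) / q ^ 2 := by
      have : ∀ i, y i * ((1 - q ^ 2) / (q ^ 2 * ‖y‖ ^ 2) * y i)
          = (1 - q ^ 2) / (q ^ 2 * ‖y‖ ^ 2) * (y i * y i) := fun i => by ring
      simp only [dotProduct, this, ← mul_sum, sum_sq_eq_norm_sq]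
      field_simp
    rw [e, Fintype.card_fin]
    field_simp
    ring
  rw [volDensity, h2, Real.sqrt_sq (by positivity)]

lemma min_le_sin {θ : ℝ} (h0 : 0 < θ) (hπ : θ < π) :
    2 / π * min θ (π - θ) ≤ Real.sin θ := by
  rcases le_total θ (π / 2) with h | h
  · exact (mul_le_mul_of_nonneg_left (min_le_left _ _) (by positivity)).trans
      (Real.mul_le_sin h0.le h)
  · rw [← Real.sin_pi_sub]
    exact (mul_le_mul_of_nonneg_left (min_le_right _ _) (by positivity)).trans
      (Real.mul_le_sin (by linarith) (by linarith))

lemma integrableOn_sin_rpow {σ : ℝ} (h0 : 0 < σ) (h1 : σ < 1) :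
    IntegrableOn (fun θ => Real.sin θ ^ (-σ)) (Ioo 0 π) := by
  have i1 : IntegrableOn (fun θ : ℝ => θ ^ (-σ)) (Ioo 0 π) := by
    have := intervalIntegral.intervalIntegrable_rpow' (a := 0) (b := π) (r := -σ) (by linarith)
    rw [intervalIntegrable_iff_integrableOn_Ioo_of_le Real.pi_pos.le] at this
    exact this
  have i2 : IntegrableOn (fun θ : ℝ => (π - θ) ^ (-σ)) (Ioo 0 π) := by
    have := (intervalIntegral.intervalIntegrable_rpow' (a := 0) (b := π) (r := -σ)
      (by linarith)).comp_sub_left π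
    rw [sub_zero, sub_self] at this
    have := this.symm
    rw [intervalIntegrable_iff_integrableOn_Ioo_of_le Real.pi_pos.le] at this
    exact this
  refine Integrable.mono' ((i1.add i2).const_mul ((2 / π) ^ (-σ)))
    (ContinuousOn.aestronglyMeasurable (Real.continuous_sin.continuousOn.rpow_const fun θ hθ =>
      Or.inl (Real.sin_pos_of_pos_of_lt_pi hθ.1 hθ.2).ne') measurableSet_Ioo)
    ((ae_restrict_mem measurableSet_Ioo).mono fun θ hθ => ?_)
  have hs := Real.sin_pos_of_pos_of_lt_pi hθ.1 hθ.2
  have hm : 0 < min θ (π - θ) := lt_min hθ.1 (sub_pos.2 hθ.2)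
  rw [Real.norm_eq_abs, abs_of_pos (Real.rpow_pos_of_pos hs _)]
  refine (Real.rpow_le_rpow_of_nonpos (by positivity) (min_le_sin hθ.1 hθ.2) (by linarith)).trans ?_
  rw [Real.mul_rpow (by positivity) hm.le]
  refine mul_le_mul_of_nonneg_left ?_ (by positivity)
  have p1 := Real.rpow_nonneg hθ.1.le (-σ)
  have p2 := Real.rpow_nonneg (sub_pos.2 hθ.2).le (-σ)
  simp only [Pi.add_apply]
  rcases min_choice θ (π - θ) with h | h <;> rw [h] <;> linarith

lemma IsRound.integrableOn (hR : IsRound G) {σ : ℝ} (h0 : 0 < σ) (h1 : σ < 1) :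
    IntegrableOn (fun y => sinSq sphereExp y ^ (-(1 + (1 + σ) / 2)) * volDensity G y)
      (puncturedBall π) := by
  have hi : IntegrableOn (fun y : E4 => (fun θ => Real.sin θ ^ (-σ) / θ ^ 3) ‖y‖)
      (Metric.ball 0 π) := by
    refine (integrableOn_fun_norm_addHaar (E := E4) volume
      (f := fun θ => Real.sin θ ^ (-σ) / θ ^ 3)).2 ?_
    refine (integrableOn_sin_rpow h0 h1).congr_fun (fun θ hθ => ?_) measurableSet_Ioo
    simp only [finrank_euclideanSpace, Fintype.card_fin, smul_eq_mul]
    have := hθ.1.ne'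
    field_simp
  refine (hi.mono_set fun y hy => mem_ball_zero_iff.2 hy.2).congr_fun (fun y hy => ?_)
    (isOpen_puncturedBall _).measurableSet
  have hs := sin_norm_pos hy
  simp only [sinSq_sphereExp, hR.volDensity_eq hy]
  rw [← Real.rpow_natCast (Real.sin ‖y‖) 2, ← Real.rpow_mul hs.le, div_pow, ← mul_div_assoc,
    ← Real.rpow_natCast (Real.sin ‖y‖) 3, ← Real.rpow_add hs]
  congr 2
  push_cast
  ring

end

section

/-! ### The heat equation for tensors on the sphere -/

variable {U : Set E4} {G : E4 → Mat4} {F : Unit ⊕ Fin 4 → E4 → ℝ} {y : E4} {Λ D σ t : ℝ}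
  {H : ℝ → E4 → Mat4} {A : E4 → Mat4}

lemma MetricOn.tensorInner_self (hG : MetricOn U G) (hy : y ∈ U) :
    tensorInner (G y) (G y) (G y) = 4 := by
  rw [tensorInner_eq_trace, hG.symm hy, hG.inv_mul hy, one_mul, hG.inv_symm hy, hG.mul_inv hy,
    Matrix.trace_one, Fintype.card_fin]
  norm_num

lemma MetricOn.lap_trace (hG : MetricOn U G) (hy : y ∈ U) (hA : SmoothMat U A) :
    lap G (fun z => tensorInner (G z) (A z) (G z)) y
      = tensorInner (G y) (roughLaplacian G A y) (G y) := by
  have h0 : roughLaplacian G G y = 0 := by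
    ext j k
    have h2 : ∀ a i, covDeriv2 G G a i j k y = 0 := fun a i =>
      congrFun (congrFun (hG.cov2_self hy a i) j) k
    simp [roughLaplacian, h2]
  rw [hG.lap_tensorInner hy hA hG.smooth, h0]
  simp [hG.cov_self hy, tensorInner]

lemma MetricOn.smooth_trace (hG : MetricOn U G) (hA : SmoothMat U A) :
    ContDiffOn ℝ ∞ (fun y => tensorInner (G y) (A y) (G y)) U := by
  unfold tensorInner
  exact ContDiffOn.sum fun i _ => ContDiffOn.sum fun j _ => ContDiffOn.sum fun k _ =>
    ContDiffOn.sum fun l _ => (((hG.smooth_inv i k).mul (hG.smooth_inv j l)).mul (hA i j)).mul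
      (hG.smooth k l)

lemma MetricOn.lap_const_mul (hG : MetricOn U G) (hy : y ∈ U) {f : E4 → ℝ}
    (hf : ContDiffOn ℝ ∞ f U) (c : ℝ) : lap G (fun z => c * f z) y = c * lap G f y := by
  have hd : deriv (fun z : ℝ => c * z) = fun _ => c := funext fun z => by simp
  rw [hG.lap_comp hy hf (φ := fun z => c * z) (by fun_prop), hd]
  simp

lemma MetricOn.trace_sq_le (hG : MetricOn U G) (hy : y ∈ U) (T : Mat4) :
    tensorInner (G y) T (G y) ^ 2 ≤ 4 * tensorInner (G y) T T := by
  set u := tensorInner (G y) T (G y) with hu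
  have h := hG.tensorInner_nonneg hy (T - (u / 4) • G y)
  rw [tensorInner_sub_left, tensorInner_smul_left, tensorInner_comm (hG.symm hy) T,
    tensorInner_comm (hG.symm hy) (G y) (T - _), tensorInner_sub_left, tensorInner_sub_left,
    tensorInner_smul_left, tensorInner_smul_left, hG.tensorInner_self hy,
    tensorInner_comm (hG.symm hy) (G y) T, ← hu] at h
  linarith

lemma HeatOn.hasDerivAt_trace (h : HeatOn U G Λ (Iio 0) H) (hy : y ∈ U) (ht : t < 0) :
    HasDerivAt (fun s => tensorInner (G y) (H s y) (G y))
      (tensorInner (G y) (lichnerowicz G (H t) y + (2 * Λ) • H t y) (G y)) t := by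
  simp only [tensorInner]
  refine HasDerivAt.fun_sum fun i _ => HasDerivAt.fun_sum fun j _ =>
      HasDerivAt.fun_sum fun k _ => HasDerivAt.fun_sum fun l _ => ?_
  exact ((((h.equation y hy t ht i j).hasDerivAt (Iio_mem_nhds ht)).const_mul _).mul_const _)

lemma HeatOn.smooth_trace (h : HeatOn U G Λ (Iio 0) H) (hG : MetricOn U G) :
    ContDiffOn ℝ ∞ (fun p : ℝ × E4 => tensorInner (G p.2) (H p.1 p.2) (G p.2)) (Iio 0 ×ˢ U) := by
  have hs : MapsTo Prod.snd (Iio (0 : ℝ) ×ˢ U) U := fun _ hp => hp.2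
  have hI : ∀ i j, ContDiffOn ℝ ∞ (fun p : ℝ × E4 => (G p.2)⁻¹ i j) (Iio 0 ×ˢ U) := fun i j =>
    (hG.smooth_inv i j).comp contDiff_snd.contDiffOn hs
  unfold tensorInner
  exact ContDiffOn.sum fun i _ => ContDiffOn.sum fun j _ => ContDiffOn.sum fun k _ =>
    ContDiffOn.sum fun l _ => (((hI i k).mul (hI j l)).mul (h.smooth i j)).mul
      ((hG.smooth k l).comp contDiff_snd.contDiffOn hs)

lemma SphereMap.lichnerowicz_eq (hS : SphereMap U G F) (hG : MetricOn U G)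
    (h : HeatOn U G Λ (Iio 0) H) (hE : ∀ y ∈ U, ricci G y = Λ • G y) (hy : y ∈ U) (ht : t < 0) :
    lichnerowicz G (H t) y + (2 * Λ) • H t y = roughLaplacian G (H t) y
      + (2 : ℝ) • (tensorInner (G y) (H t y) (G y) • G y - H t y) := by
  rw [lichnerowicz_add_of_einstein (hG.isUnit hy) (hE y hy),
    hS.curvAction_eq (H := H t) hG hy (h.symm t ht y hy)]

lemma SphereMap.isSubsolution_trace (hS : SphereMap U G F) (hG : MetricOn U G)
    (h : HeatOn U G Λ (Iio 0) H) (hE : ∀ y ∈ U, ricci G y = Λ • G y) (c : ℝ) :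
    IsSubsolution U G 6 (fun t y => c * tensorInner (G y) (H t y) (G y)) fun t y =>
      c * tensorInner (G y) (lichnerowicz G (H t) y + (2 * Λ) • H t y) (G y) where
  smooth := contDiffOn_const.mul (h.smooth_trace hG)
  hasDerivAt t ht y hy := (h.hasDerivAt_trace hy ht).const_mul c
  le t ht y hy := by
    have hs := hG.smooth_trace (h.smoothMat ht)
    have h1 := hS.lichnerowicz_eq hG h hE hy ht
    have h2 := hG.lap_const_mul hy hs c
    have h3 := hG.lap_trace hy (h.smoothMat ht)
    rw [h1, h2, h3, tensorInner_add_left, tensorInner_smul_left, tensorInner_sub_left,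
      tensorInner_smul_left, hG.tensorInner_self hy]
    apply le_of_eq
    ring

lemma SphereMap.isSubsolution_energy (hS : SphereMap U G F) (hG : MetricOn U G)
    (h : HeatOn U G Λ (Iio 0) H) (hE : ∀ y ∈ U, ricci G y = Λ • G y)
    (h0 : ∀ t < 0, ∀ y ∈ U, tensorInner (G y) (H t y) (G y) = 0) :
    IsSubsolution U G (-4) (fun t y => tensorInner (G y) (H t y) (H t y)) fun t y =>
      2 * tensorInner (G y) (lichnerowicz G (H t) y + (2 * Λ) • H t y) (H t y) where
  smooth := h.smooth_tensorInner hG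
  hasDerivAt t ht y hy := h.hasDerivAt_tensorInner hG isOpen_Iio hy ht
  le t ht y hy := by
    have hn := hG.sum_tensorInner_nonneg hy fun a => cov G (H t) a y
    rw [hS.lichnerowicz_eq hG h hE hy ht, hG.lap_tensorInner hy (h.smoothMat ht) (h.smoothMat ht),
      tensorInner_add_left, tensorInner_smul_left, tensorInner_sub_left, tensorInner_smul_left,
      h0 t ht y hy, tensorInner_comm (hG.symm hy) (H t y) (roughLaplacian G (H t) y)]
    linarith

/-- On the unit sphere, an ancient solution with mild singularities at the poles vanishes if its
trace is orthogonal to the affine functions of the position vector. -/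
lemma IsRound.eq_zero (hR : IsRound G) (hG : MetricOn (puncturedBall π) G)
    (h : HeatOn (puncturedBall π) G Λ (Iio 0) H)
    (hE : ∀ y ∈ puncturedBall π, ricci G y = Λ • G y) (hσ0 : 0 < σ) (hσ1 : σ < 1)
    (hD : 0 ≤ D) (hb : ∀ t < 0, ∀ y ∈ puncturedBall π,
      tensorInner (G y) (H t y) (H t y) ≤ D * sinSq sphereExp y ^ (-σ))
    (hI : ∀ t < 0, ∫ y in puncturedBall π,
      tensorInner (G y) (H t y) (G y) * volDensity G y = 0)
    (hI' : ∀ t < 0, (∀ A, IntegrableOn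
        (fun y => tensorInner (G y) (H t y) (G y) * sphereExp A y * volDensity G y)
        (puncturedBall π)) →
      ∀ A, ∫ y in puncturedBall π,
        tensorInner (G y) (H t y) (G y) * sphereExp A y * volDensity G y = 0)
    (ht : t < 0) (hy : y ∈ puncturedBall π) : H t y = 0 := by
  have hS := hR.sphereDomain hG
  have hw := hR.integrableOn hσ0 hσ1
  have hBS : puncturedBall π ⊆ Metric.closedBall 0 π := fun y hy =>
    mem_closedBall_zero_iff.2 hy.2.le
  have hpow : ∀ y ∈ puncturedBall π, sinSq sphereExp y ^ (-σ)
      ≤ sinSq sphereExp y ^ (-((1 + σ) / 2)) := fun y hy =>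
    Real.rpow_le_rpow_of_exponent_ge (hS.sinSq_pos y hy) SphereDomain.sinSq_le_one (by linarith)
  have hone : ∀ y ∈ puncturedBall π, 1 ≤ sinSq sphereExp y ^ (-((1 + σ) / 2)) :=
    fun y hy => Real.one_le_rpow_of_pos_of_le_one_of_nonpos (hS.sinSq_pos y hy)
      SphereDomain.sinSq_le_one (by linarith)
  have hbH : ∀ t < 0, ∀ y ∈ puncturedBall π, |tensorInner (G y) (H t y) (H t y)|
      ≤ (1 + D) * sinSq sphereExp y ^ (-((1 + σ) / 2)) := fun t ht y hy => by
    rw [abs_of_nonneg (hG.tensorInner_nonneg hy _)]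
    linarith [hb t ht y hy, mul_le_mul_of_nonneg_left (hpow y hy) hD, hone y hy]
  have hbu : ∀ t < 0, ∀ y ∈ puncturedBall π, |tensorInner (G y) (H t y) (G y)|
      ≤ (1 + D) * sinSq sphereExp y ^ (-((1 + σ) / 2)) := fun t ht y hy => by
    have h1 := hG.trace_sq_le hy (H t y)
    have h2 : |tensorInner (G y) (H t y) (G y)| ≤ 1 + tensorInner (G y) (H t y) (G y) ^ 2 / 4 := by
      rw [← sq_abs]
      nlinarith [sq_nonneg (|tensorInner (G y) (H t y) (G y)| - 2)]
    linarith [hb t ht y hy, mul_le_mul_of_nonneg_left (hpow y hy) hD, hone y hy]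
  have hsign : ∀ c : ℝ, |c| = 1 → ∀ t < 0, ∀ y ∈ puncturedBall π,
      c * tensorInner (G y) (H t y) (G y) ≤ 0 := fun c hc t ht y hy => by
    refine hS.nonpos (isCompact_closedBall 0 π) hBS (fun x hx y hy => sphereExp_injective hx hy)
      (fun y _ => sum_sphereExp_sq y) (hS.isSubsolution_trace hG h hE c) hw
      (by linarith : 0 ≤ 1 + D) (fun t ht y hy => by
        rw [abs_mul, hc, one_mul]; exact hbu t ht y hy) (fun a n hn t ht => ?_) ht hy
    have hs : ContinuousOn (fun y => tensorInner (G y) (H t y) (G y)) (puncturedBall π) :=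
      (hG.smooth_trace (h.smoothMat ht)).continuousOn
    have i0 : IntegrableOn (fun y => tensorInner (G y) (H t y) (G y) * volDensity G y)
        (puncturedBall π) := hS.integrableOn_mul hs hw fun y hy =>
      (hbu t ht y hy).trans (mul_le_mul_of_nonneg_left (hS.rpow_le hy) (by linarith))
    have iA : ∀ A, IntegrableOn
        (fun y => tensorInner (G y) (H t y) (G y) * sphereExp A y * volDensity G y)
        (puncturedBall π) := fun A => hS.integrableOn_mul
      (hs.mul (continuous_sphereExp A).continuousOn) hw fun y hy => by
        have : |sphereExp A y| ≤ 1 := by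
          rw [← linComb_single sphereExp]
          exact hS.abs_linComb_le hy (by simp [Pi.single_apply])
        rw [abs_mul]
        exact (mul_le_of_le_one_right (abs_nonneg _) this).trans
          ((hbu t ht y hy).trans (mul_le_mul_of_nonneg_left (hS.rpow_le hy) (by linarith)))
    have hn2 : n < 2 := by
      by_contra hn2
      have : (2 : ℝ) ≤ n := by exact_mod_cast not_lt.1 hn2
      nlinarith
    interval_cases n
    · have e : ∀ y, c * tensorInner (G y) (H t y) (G y) * weight sphereExp a 0 y * volDensity G y
          = c * (tensorInner (G y) (H t y) (G y) * volDensity G y) := fun y => by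
        rw [weight]; ring
      simp only [e]
      rw [integral_const_mul, hI t ht, mul_zero]
    · have e : ∀ y, c * tensorInner (G y) (H t y) (G y) * weight sphereExp a 1 y * volDensity G y
          = c * (tensorInner (G y) (H t y) (G y) * volDensity G y) + ∑ A, c * a A
            * (tensorInner (G y) (H t y) (G y) * sphereExp A y * volDensity G y) := fun y => by
        rw [weight, pow_one, linComb, mul_add, add_mul, mul_sum, sum_mul]
        congr 1
        · ring
        · exact sum_congr rfl fun A _ => by ring
      simp only [e]
      rw [integral_add (i0.const_mul c) (integrable_finsetSum _ fun A _ => (iA A).const_mul _),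
        integral_const_mul, hI t ht, integral_finsetSum _ fun A _ => (iA A).const_mul _]
      simp only [integral_const_mul, hI' t ht iA, mul_zero, Finset.sum_const_zero, add_zero, le_refl]
  have hu : ∀ t < 0, ∀ y ∈ puncturedBall π, tensorInner (G y) (H t y) (G y) = 0 :=
    fun t ht y hy => by
      linarith [hsign 1 (by simp) t ht y hy, hsign (-1) (by simp) t ht y hy]
  have hle := hS.nonpos (isCompact_closedBall 0 π) hBS
    (fun x hx y hy => sphereExp_injective hx hy) (fun y _ => sum_sphereExp_sq y)
    (hS.isSubsolution_energy hG h hE hu) hw (by linarith : 0 ≤ 1 + D) hbH (fun a n hn => by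
      have : (0 : ℝ) ≤ n * (n + 3) := by positivity
      linarith) ht hy
  by_contra hne
  exact hle.not_gt (hG.tensorInner_pos hy hne)

end

section

/-! ### Spherical suspensions -/

section Gradient

variable {U : Set E4} {G : E4 → Mat4} {y : E4} {f : E4 → ℝ}

/-- The Lie derivative of the metric along a gradient is twice the Hessian. -/
lemma MetricOn.lieDeriv_gradient (hG : MetricOn U G) (hf : ContDiffOn ℝ ∞ f U) (hy : y ∈ U) :
    lieDeriv (gradient G f) G y = (2 : ℝ) • hess G f y := by
  have hX : ∀ k, DifferentiableAt ℝ (gradient G f k) y := fun k =>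
    differentiableAt_of_contDiffOn (ContDiffOn.sum fun l _ =>
      (hG.smooth_inv k l).mul (contDiffOn_partialDeriv hf hG.isOpen l)) hG.isOpen hy
  have hGd := fun b c => hG.smooth.diffMat hG.isOpen hy b c
  have h1 : ∀ z ∈ U, ∀ j, ∑ k, G z j k * gradient G f k z = partialDeriv j f z := fun z hz j => by
    have e : ∑ k, G z j k * gradient G f k z
        = ((G z * (G z)⁻¹).mulVec fun l => partialDeriv l f z) j := by
      rw [← Matrix.mulVec_mulVec]
      rfl
    rw [e, hG.mul_inv hz, Matrix.one_mulVec]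
  have h2 : ∀ i j, partialDeriv i (partialDeriv j f) y
      = ∑ k, (partialDeriv i (fun z => G z j k) y * gradient G f k y
        + G y j k * partialDeriv i (gradient G f k) y) := fun i j => by
    rw [← partialDeriv_congr_on hG.isOpen hy i fun z hz => h1 z hz j,
      partialDeriv_sum _ _ fun k _ => (hGd j k).fun_mul (hX k)]
    exact sum_congr rfl fun k _ => partialDeriv_mul i (hGd j k) (hX k)
  ext i j
  have h3 : ∑ m, christoffel G m i j y * partialDeriv m f y
      = ∑ k, (G y * chr G i y) k j * gradient G f k y := by
    simp only [← h1 y hy, mul_apply, mul_sum, sum_mul]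
    rw [sum_comm]
    refine sum₂_congr fun k m => ?_
    change christoffel G m i j y * _ = G y k m * christoffel G m i j y * _
    rw [hG.symm_apply hy k m]
    ring
  have h4 : (2 : ℝ) * (partialDeriv i (partialDeriv j f) y
        - ∑ k, (G y * chr G i y) k j * gradient G f k y)
      = partialDeriv i (partialDeriv j f) y + partialDeriv j (partialDeriv i f) y
        - ∑ k, 2 * ((G y * chr G i y) k j * gradient G f k y) := by
    rw [partialDeriv_comm hf hG.isOpen hy j i, ← mul_sum]
    ring
  rw [Matrix.smul_apply, smul_eq_mul, hess_apply, h3, h4, h2, h2, ← sum_add_distrib,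
    ← sum_sub_distrib]
  rw [lieDeriv, of_apply]
  refine sum_congr rfl fun k _ => ?_
  rw [hG.mul_chr_apply hy, hG.symm_apply hy k j]
  ring

end Gradient

/-- The moments of first order of a function invariant under a nontrivial spherical group vanish. -/
lemma IsSphericalGroup.integral_mul_coord {Γ : Subgroup (E4 ≃ₗᵢ[ℝ] E4)} (hΓ : IsSphericalGroup Γ)
    (hΓ1 : Γ ≠ ⊥) {δ : ℝ} {k : E4 → ℝ} (hk : ∀ γ ∈ Γ, ∀ y ∈ puncturedBall δ, k (γ y) = k y)
    (hi : ∀ i, IntegrableOn (fun y => k y * y i) (puncturedBall δ)) (i : Fin 4) :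
    ∫ y in puncturedBall δ, k y * y i = 0 := by
  have hm := (isOpen_puncturedBall δ).measurableSet
  obtain ⟨⟨γ, hγ⟩, hγ1⟩ := Subgroup.ne_bot_iff_exists_ne_one.1 hΓ1
  have hV : ∫ y in puncturedBall δ, k y • y
      = ∑ i, (∫ y in puncturedBall δ, k y * y i) • stdVec i := by
    have e : ∀ y : E4, k y • y = ∑ i, (k y * y i) • stdVec i := fun y => by
      refine (congrArg (k y • ·) (eq_sum_stdVec y)).trans ?_
      simp only [smul_sum, smul_smul]
    simp only [e]
    rw [integral_finsetSum _ fun i _ => (hi i).smul_const _]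
    simp only [integral_smul_const]
  have hfix : γ (∫ y in puncturedBall δ, k y • y) = ∫ y in puncturedBall δ, k y • y := by
    have hpre : γ ⁻¹' puncturedBall δ = puncturedBall δ := by
      ext y
      simp only [puncturedBall, mem_preimage, mem_ofPred_eq, γ.norm_map]
    have h1 := γ.measurePreserving.setIntegral_preimage_emb
      γ.toHomeomorph.measurableEmbedding (fun y => k y • y) (puncturedBall δ)
    rw [hpre] at h1
    refine (γ.toContinuousLinearEquiv.integral_comp_comm (μ := volume.restrict (puncturedBall δ))
      fun y => k y • y).symm.trans (Eq.trans (setIntegral_congr_fun hm fun y hy => ?_) h1)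
    change γ (k y • y) = k (γ y) • γ y
    rw [map_smul, hk γ hγ y hy]
  have h0 : ∫ y in puncturedBall δ, k y • y = 0 := by
    by_contra hne
    refine hΓ.free γ hγ (fun h => hγ1 (Subtype.ext h)) (‖∫ y in puncturedBall δ, k y • y‖⁻¹ • ∫ y in puncturedBall δ, k y • y)
      (norm_smul_inv_norm (𝕜 := ℝ) hne) ?_
    rw [map_smul, hfix]
  have h2 := congrArg (fun v : E4 => v i) (hV.symm.trans h0)
  simpa [stdVec_apply, Finset.sum_apply] using h2

section Suspension

variable {M : Type*} [TopologicalSpace M] [ChartedSpace E4 M] [IsManifold (𝓡 4) ∞ M]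
  {g : RMetric M} {Γ : Subgroup (E4 ≃ₗᵢ[ℝ] E4)} {v r : M → ℝ}

namespace SphericalSuspension

lemma isParam (S : SphericalSuspension Γ g) : IsParam (puncturedBall π) S.par :=
  IsLocalDiffeomorphOn.isParam S.localDiffeo (isOpen_puncturedBall _)

lemma isRound (S : SphericalSuspension Γ g) : IsRound (coords S.par g.inner) := by
  intro y hy i j
  have h1 : ∀ (z : E4) i, inner ℝ z (stdVec i) = z i := fun z i => by
    rw [stdVec, EuclideanSpace.inner_single_right]; simp
  rw [coords, of_apply, S.metric y hy, h1, h1, h1, stdVec_apply]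
  simp only [eq_comm]

lemma ricci_eq (S : SphericalSuspension Γ g) {Λ : ℝ} (hE : IsEinstein g Λ) {y : E4}
    (hy : y ∈ puncturedBall π) :
    ricci (coords S.par g.inner) y = Λ • coords S.par g.inner y := by
  have he := chart_mem_atlas E4 (S.par y)
  have hy' : y ∈ puncturedBall π ∩ S.par ⁻¹' (chartAt E4 (S.par y)).source :=
    ⟨hy, mem_chart_source E4 (S.par y)⟩
  have hc := S.isParam.coordChange he
  rw [hc.ricci_pull ((isParam_symm he).metricOn g)
    (fun z hz => S.isParam.coords_eq_pull he g.inner hz) hy',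
    S.isParam.coords_eq_pull he g.inner hy', pull, hE _ he _ (hc.mapsTo hy'), pull_smul]
  rfl

lemma exists_mem (S : SphericalSuspension Γ g) (x : M) :
    ∃ y ∈ puncturedBall π, S.par y = x := by
  have : x ∈ S.par '' puncturedBall π := S.surj ▸ mem_univ x
  exact this

lemma encard_fibre (S : SphericalSuspension Γ g) (hΓ : IsSphericalGroup Γ) (x : M) :
    (puncturedBall π ∩ S.par ⁻¹' {x}).encard = Nat.card Γ := by
  have := hΓ.finite
  obtain ⟨y, hy, rfl⟩ := S.exists_mem x
  have h1 : puncturedBall π ∩ S.par ⁻¹' {S.par y}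
      = range fun γ : Γ => (γ : E4 ≃ₗᵢ[ℝ] E4) y := by
    ext z
    constructor
    · rintro ⟨hz, hzy⟩
      obtain ⟨γ, hγ, h⟩ := (S.fibre y hy z hz).1 (Eq.symm hzy)
      exact ⟨⟨γ, hγ⟩, h⟩
    · rintro ⟨γ, rfl⟩
      have hz : (γ : E4 ≃ₗᵢ[ℝ] E4) y ∈ puncturedBall π := by
        simpa only [puncturedBall, mem_ofPred_eq, LinearIsometryEquiv.norm_map] using hy
      exact ⟨hz, ((S.fibre y hy _ hz).2 ⟨γ, γ.2, rfl⟩).symm⟩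
  have hinj : Function.Injective fun γ : Γ => (γ : E4 ≃ₗᵢ[ℝ] E4) y := fun γ₁ γ₂ h => by
    by_contra hne
    have h2 : (γ₁⁻¹ * γ₂ : Γ) ≠ 1 := fun h => hne (inv_mul_eq_one.1 h)
    refine hΓ.free _ (γ₁⁻¹ * γ₂).2 (fun h => h2 (Subtype.ext h)) (‖y‖⁻¹ • y)
      (norm_smul_inv_norm (𝕜 := ℝ) (norm_pos_iff.1 hy.1)) ?_
    rw [map_smul]
    congr 1
    change (γ₁ : E4 ≃ₗᵢ[ℝ] E4).symm ((γ₂ : E4 ≃ₗᵢ[ℝ] E4) y) = y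
    rw [LinearIsometryEquiv.symm_apply_eq]
    exact h.symm
  rw [h1, ← image_univ, hinj.encard_image, encard_univ, ENat.card_eq_coe_natCard]

lemma setIntegral_comp [MeasurableSpace M] [BorelSpace M] {μ : Measure M}
    (S : SphericalSuspension Γ g) (hΓ : IsSphericalGroup Γ) (hμ : IsRiemannianMeasure g μ)
    {φ : M → ℝ} (hφ : Continuous φ) :
    ∫ y in puncturedBall π, φ (S.par y) * volDensity (coords S.par g.inner) y
      = Nat.card Γ * ∫ x, φ x ∂μ := by
  have hv := (S.isParam.metricOn g).continuousOn_volDensity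
  have hU := S.isParam.isOpen.measurableSet
  have h1 := integral_map (S.isParam.aemeasurable (g := g)) hφ.aestronglyMeasurable
  rw [S.isParam.map_eq_smul hμ (S.encard_fibre hΓ), integral_smul_measure, paramMeasure,
    restrict_withDensity hU, integral_withDensity_eq_integral_toReal_smul₀
      (hv.aemeasurable hU).ennreal_ofReal (Eventually.of_forall fun _ => ENNReal.ofReal_lt_top)] at h1
  simp only [ENNReal.toReal_natCast, smul_eq_mul] at h1
  rw [h1]
  refine setIntegral_congr_fun hU fun y hy => ?_
  rw [ENNReal.toReal_ofReal ((S.isParam.metricOn g).volDensity_pos hy).le, mul_comm]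

lemma contMDiff (S : SphericalSuspension Γ g)
    (hv : ∀ x ∈ puncturedBall π, v (S.par x) = Real.cos ‖x‖) :
    ContMDiff (𝓡 4) 𝓘(ℝ, ℝ) ∞ v := by
  intro x
  obtain ⟨y, hy, rfl⟩ := S.exists_mem x
  have hd := S.localDiffeo ⟨y, hy⟩
  have h1 : ContMDiffAt (𝓡 4) (𝓡 4) ∞ hd.localInverse (S.par y) :=
    hd.contmdiffOn_localInverse.contMDiffAt
      (hd.localInverse_open_source.mem_nhds hd.localInverse_mem_source)
  have h2 : hd.localInverse (S.par y) = y := hd.localInverse_left_inv hd.localInverse_mem_target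
  have h3 : ContMDiffAt (𝓡 4) 𝓘(ℝ, ℝ) ∞ (fun z : E4 => Real.cos ‖z‖)
      (hd.localInverse (S.par y)) := by
    rw [h2]
    exact (Real.contDiff_cos.contDiffAt.comp y (contDiffAt_norm ℝ
      (norm_pos_iff.1 hy.1))).contMDiffAt
  refine (h3.comp (S.par y) h1).congr_of_eventuallyEq ?_
  have h4 : ∀ᶠ z in 𝓝 (S.par y), hd.localInverse z ∈ puncturedBall π :=
    h1.continuousAt.eventually ((isOpen_puncturedBall _).mem_nhds (h2.symm ▸ hy))
  filter_upwards [h4, hd.localInverse_eventuallyEq_right] with z hz hz'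
  rw [Function.comp_apply, ← hv _ hz]
  exact congrArg v hz'.symm

lemma lieGrad_eq (S : SphericalSuspension Γ g)
    (hv : ∀ x ∈ puncturedBall π, v (S.par x) = Real.cos ‖x‖) (x : M) :
    lieGrad g v x = (-2 * v x) • atPt g.inner x := by
  have hvs := S.contMDiff hv
  obtain ⟨y, hy, rfl⟩ := S.exists_mem x
  have he := chart_mem_atlas E4 (S.par y)
  have hc := S.isParam.coordChange he
  have hy' : y ∈ puncturedBall π ∩ S.par ⁻¹' (chartAt E4 (S.par y)).source :=
    ⟨hy, mem_chart_source E4 (S.par y)⟩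
  have hG := (isParam_symm he).metricOn g
  have hf := contDiffOn_comp_symm hvs he
  have h1 := hc.hess_pull hG (fun z hz => S.isParam.coords_eq_pull he g.inner hz) hf
    (f' := fun z => v (S.par z)) (fun z hz => by rw [(chartAt E4 (S.par y)).left_inv hz.2]) hy'
  have h2 : hess (coords S.par g.inner) (fun z => v (S.par z)) y
      = (- v (S.par y)) • coords S.par g.inner y := by
    have hD := S.isRound.sphereDomain (S.isParam.metricOn g)
    rw [hv y hy]
    refine Eq.trans ?_ (hD.hess_eq hD.metricOn hy (Sum.inl ()))
    ext i j
    rw [hess_apply, hess_apply]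
    have e : ∀ z ∈ puncturedBall π, ∀ j, partialDeriv j (fun z => v (S.par z)) z
        = partialDeriv j (sphereExp (Sum.inl ())) z := fun z hz j =>
      partialDeriv_congr_on (isOpen_puncturedBall _) hz j hv
    rw [partialDeriv_congr_on (isOpen_puncturedBall _) hy i fun z hz => e z hz j]
    simp only [e y hy]
  rw [h2, S.isParam.coords_eq_pull he g.inner hy', pull_smul] at h1
  have h3 : hess (coords (chartAt E4 (S.par y)).symm g.inner)
      (fun z => v ((chartAt E4 (S.par y)).symm z)) (chartAt E4 (S.par y) (S.par y))
      = (- v (S.par y)) • coords (chartAt E4 (S.par y)).symm g.inner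
        (chartAt E4 (S.par y) (S.par y)) := by
    have hu := hc.isUnit y hy'
    have hu' := Matrix.isUnit_det_transpose _ hu
    have h4 := congrArg (fun X => (jac (fun z => chartAt E4 (S.par y) (S.par z)) y)ᵀ⁻¹
      * X * (jac (fun z => chartAt E4 (S.par y) (S.par z)) y)⁻¹) h1.symm
    simp only [pull, mul_assoc, mul_nonsing_inv _ hu, mul_one] at h4
    simpa only [← mul_assoc, nonsing_inv_mul _ hu', one_mul] using h4
  rw [lieGrad, hG.lieDeriv_gradient hf (hc.mapsTo hy'), h3, smul_smul, atPt]
  congr 1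
  ring

lemma exists_mul_sin_le (S : SphericalSuspension Γ g) (hr : S.IsRadius r) :
    ∃ c > 0, ∀ y ∈ puncturedBall π, c * Real.sin ‖y‖ ≤ r (S.par y) := by
  obtain ⟨ε, hε, hn⟩ := hr.near
  have hK : IsCompact {y : E4 | ε ≤ ‖y‖ ∧ ‖y‖ ≤ π - ε} := by
    refine (isCompact_closedBall (0 : E4) (π - ε)).of_isClosed_subset
      ((isClosed_le continuous_const continuous_norm).inter
        (isClosed_le continuous_norm continuous_const)) fun y hy => mem_closedBall_zero_iff.2 hy.2
  have hsub : {y : E4 | ε ≤ ‖y‖ ∧ ‖y‖ ≤ π - ε} ⊆ puncturedBall π := fun y hy =>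
    ⟨hε.trans_le hy.1, hy.2.trans_lt (by linarith)⟩
  obtain ⟨m, hm, hle⟩ := hK.exists_forall_le' (f := fun y => r (S.par y)) (a := 0)
    ((S.isParam.contDiffOn_comp hr.smooth).continuousOn.mono hsub) fun y _ => hr.pos _
  refine ⟨min 1 m, lt_min one_pos hm, fun y hy => ?_⟩
  have hs := sin_norm_pos hy
  by_cases h1 : ‖y‖ < ε
  · rw [(hn y hy).1 h1]
    calc min 1 m * Real.sin ‖y‖ ≤ 1 * Real.sin ‖y‖ :=
          mul_le_mul_of_nonneg_right (min_le_left _ _) hs.le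
      _ ≤ ‖y‖ := by rw [one_mul]; exact Real.sin_le (norm_nonneg y)
  by_cases h2 : π - ‖y‖ < ε
  · rw [(hn y hy).2 h2]
    calc min 1 m * Real.sin ‖y‖ ≤ 1 * Real.sin ‖y‖ :=
          mul_le_mul_of_nonneg_right (min_le_left _ _) hs.le
      _ ≤ π - ‖y‖ := by
          rw [one_mul, ← Real.sin_pi_sub]; exact Real.sin_le (sub_pos.2 hy.2).le
  · calc min 1 m * Real.sin ‖y‖ ≤ m * 1 :=
          mul_le_mul (min_le_right _ _) (Real.sin_le_one _) hs.le hm.le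
      _ ≤ r (S.par y) := by
          rw [mul_one]; exact hle y ⟨not_lt.1 h1, by linarith [not_lt.1 h2]⟩

lemma eq_zero [MeasurableSpace M] [BorelSpace M] {μ : Measure M} {Λ C σ : ℝ}
    {h : ℝ → TensorField M} (S : SphericalSuspension Γ g) (hE : IsEinstein g Λ)
    (hΓ : IsSphericalGroup Γ) (hΓ1 : Γ ≠ ⊥) (hσ0 : 0 < σ) (hσ1 : σ < 1)
    (hv : ∀ x ∈ puncturedBall π, v (S.par x) = Real.cos ‖x‖) (hr : S.IsRadius r)
    (hμ : IsRiemannianMeasure g μ) (hh : IsHeatSolution g Λ (Iio 0) h)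
    (hb : ∀ t < 0, ∀ x, normAt g (h t) x ≤ C * r x ^ (-σ))
    (h0 : ∀ t < 0, ∫ x, tensorInner (atPt g.inner x) (atPt (h t) x) (atPt g.inner x) ∂μ = 0)
    (h1 : ∀ t < 0, ∫ x, tensorInner (atPt g.inner x) (atPt (h t) x) (lieGrad g v x) ∂μ = 0)
    {t : ℝ} (ht : t < 0) (x : M) : h t x = 0 := by
  have hp := S.isParam
  have hG := hp.metricOn g
  have hR := S.isRound
  obtain ⟨c, hc, hcr⟩ := S.exists_mul_sin_le hr
  have hH := hp.heatOn hh
  have hU := hp.isOpen.measurableSet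
  have hcont : ∀ t < 0, Continuous fun x =>
      tensorInner (atPt g.inner x) (atPt (h t) x) (atPt g.inner x) := fun t ht =>
    continuous_of_charts (fun e y => tensorInner (coords e.symm g.inner y) (coords e.symm (h t) y)
      (coords e.symm g.inner y)) (fun e he y hy => (isParam_symm he).tensorInner_atPt _ _ _ hy)
      fun e he => (((isParam_symm he).metricOn g).smooth_trace
        (hh.smoothMat ht he)).continuousOn
  have hφ : ∀ t, ∀ y ∈ puncturedBall π,
      tensorInner (atPt g.inner (S.par y)) (atPt (h t) (S.par y)) (atPt g.inner (S.par y))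
        = tensorInner (coords S.par g.inner y) (coords S.par (h t) y) (coords S.par g.inner y) :=
    fun t y hy => hp.tensorInner_atPt _ _ _ hy
  have hlie : ∀ t x, tensorInner (atPt g.inner x) (atPt (h t) x) (lieGrad g v x) = -2 * v x
      * tensorInner (atPt g.inner x) (atPt (h t) x) (atPt g.inner x) := fun t x => by
    have hs : (atPt g.inner x).IsSymm := by simpa using (posDef_atPt g x).isHermitian
    rw [S.lieGrad_eq hv, tensorInner_comm hs, tensorInner_smul_left, tensorInner_comm hs]
  have hI : ∀ t < 0, ∫ y in puncturedBall π, tensorInner (coords S.par g.inner y)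
      (coords S.par (h t) y) (coords S.par g.inner y) * volDensity (coords S.par g.inner) y = 0 :=
    fun t ht => by
      have := S.setIntegral_comp hΓ hμ (hcont t ht)
      rw [h0 t ht, mul_zero] at this
      rw [← this]
      exact setIntegral_congr_fun hU fun y hy => by simp only [hφ t y hy]
  obtain ⟨y, hy, rfl⟩ := S.exists_mem x
  have hz := hR.eq_zero hG hH (fun y hy => S.ricci_eq hE hy) hσ0 hσ1
    (D := C ^ 2 * (c ^ (-σ)) ^ 2) (by positivity) (fun t ht y hy => ?_) hI
    (fun t ht hint A => ?_) ht hy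
  · refine normSq_eq_zero (g := g) ?_
    rw [normSq, hp.tensorInner_atPt _ _ _ hy, hz]
    simp [tensorInner]
  · have hs := sin_norm_pos hy
    have := normSq_le hσ0.le (mul_pos hc hs) (hcr y hy) (hb t ht (S.par y))
    rw [normSq, hp.tensorInner_atPt _ _ _ hy] at this
    refine this.trans (le_of_eq ?_)
    rw [sinSq_sphereExp, Real.mul_rpow hc.le hs.le, ← Real.rpow_pow_comm hs.le]
    ring
  · rcases A with u | i
    · have := S.setIntegral_comp hΓ hμ (φ := fun x =>
        tensorInner (atPt g.inner x) (atPt (h t) x) (lieGrad g v x)) (by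
          simp only [hlie]
          exact (continuous_const.mul (S.contMDiff hv).continuous).mul (hcont t ht))
      rw [h1 t ht, mul_zero] at this
      have e : ∫ y in puncturedBall π, tensorInner (atPt g.inner (S.par y))
          (atPt (h t) (S.par y)) (lieGrad g v (S.par y)) * volDensity (coords S.par g.inner) y
          = ∫ y in puncturedBall π, -2 * (tensorInner (coords S.par g.inner y)
            (coords S.par (h t) y) (coords S.par g.inner y) * sphereExp (Sum.inl u) y
              * volDensity (coords S.par g.inner) y) :=
        setIntegral_congr_fun hU fun y hy => by
          simp only [hlie, hφ t y hy, hv y hy, sphereExp, Sum.elim_inl]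
          ring
      rw [e, integral_const_mul] at this
      linarith
    · have e : ∀ y : E4, tensorInner (coords S.par g.inner y) (coords S.par (h t) y)
          (coords S.par g.inner y) * sphereExp (Sum.inr i) y * volDensity (coords S.par g.inner) y
          = (tensorInner (coords S.par g.inner y) (coords S.par (h t) y)
            (coords S.par g.inner y) * Real.sinc ‖y‖ * volDensity (coords S.par g.inner) y)
            * y i := fun y => by
        simp only [sphereExp, Sum.elim_inr]; ring
      simp only [e]
      refine hΓ.integral_mul_coord hΓ1 (k := fun y => tensorInner (coords S.par g.inner y)
        (coords S.par (h t) y) (coords S.par g.inner y) * Real.sinc ‖y‖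
          * volDensity (coords S.par g.inner) y) (fun γ hγ y hy => ?_) (fun i => ?_) i
      · have hy' : γ y ∈ puncturedBall π := by
          simpa only [puncturedBall, mem_ofPred_eq, γ.norm_map] using hy
        have hpar : S.par y = S.par (γ y) := (S.fibre y hy _ hy').2 ⟨γ, hγ, rfl⟩
        simp only [← hφ t _ hy, ← hφ t _ hy', hR.volDensity_eq hy, hR.volDensity_eq hy',
          γ.norm_map, hpar]
      · refine (hint (Sum.inr i)).congr_fun (fun y _ => ?_) hU
        simp only [sphereExp, Sum.elim_inr]; ring

end SphericalSuspension

end Suspension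

end

end OrbifoldLiouville

end

open OrbifoldLiouville in
theorem proposition5 {M : Type*} [TopologicalSpace M] [ChartedSpace E4 M]
    [IsManifold (𝓡 4) ∞ M] (g : RMetric M) (Λ : ℝ) (hΛ : IsEinstein g Λ)
    (h : ℝ → TensorField M) (C σ : ℝ) (hσ0 : 0 < σ) (hσ1 : σ < 1) :
    -- spherical suspensions
    (∀ (Γ : Subgroup (E4 ≃ₗᵢ[ℝ] E4)), IsSphericalGroup Γ → Γ ≠ ⊥ →
      ∀ (S : SphericalSuspension Γ g) (v r : M → ℝ),
        (∀ x ∈ puncturedBall Real.pi, v (S.par x) = Real.cos ‖x‖) →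
        S.IsRadius r →
        ∀ [MeasurableSpace M] [BorelSpace M] (μ : Measure M), IsRiemannianMeasure g μ →
          IsHeatSolution g Λ (Iio 0) h →
          (∀ t < 0, ∀ x, normAt g (h t) x ≤ C * r x ^ (-σ)) →
          (∀ t < 0,
            ∫ x, tensorInner (atPt g.inner x) (atPt (h t) x) (atPt g.inner x) ∂μ = 0) →
          (∀ t < 0,
            ∫ x, tensorInner (atPt g.inner x) (atPt (h t) x) (lieGrad g v x) ∂μ = 0) →
          ∀ t < 0, ∀ x, h t x = 0) ∧
    -- negative Einstein orbifolds
    (∀ (X : Type*) [TopologicalSpace X] [T2Space X] [CompactSpace X]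
      (O : RiemannianOrbifold g X) (r : M → ℝ),
        O.IsOriented → Λ < 0 → O.RPlusNegative → O.IsRadius r →
          IsHeatSolution g Λ (Iic 0) h →
          (∀ t ≤ 0, ∀ x, normAt g (h t) x ≤ C * r x ^ (-σ)) →
          ∀ t ≤ 0, ∀ x, h t x = 0) := by
  refine ⟨fun Γ hΓ hΓ1 S v r hv hr _ _ μ hμ hh hb h0 h1 t ht x =>
    S.eq_zero hΛ hΓ hΓ1 hσ0 hσ1 hv hr hμ hh hb h0 h1 ht x,
    fun X _ _ _ O r ho hΛ0 hR hr hh hb t ht x =>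
    RiemannianOrbifold.eq_zero hΛ0 hΛ ho hR hr hσ0 hσ1 hh hb ht x⟩
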